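/- **Theorem (Compactification of the sectional Poincaré flow).** Let $M$ be a compact smooth Riemannian manifold of dimension $3$ without boundary, let $r\ge 2$ be an integer, and let $(\varphi_t)_{t\in\mathbb R}$ be a $C^r$ flow on $M$, i.e. $(t,x)\mapsto\varphi_t(x)$ is of class $C^r$, generated by the vector field $X(x)=\frac{d}{dt}\varphi_t(x)|_{t=0}$. Let $K\subset M$ be a compact invariant set such that every singularity $\sigma\in K$ (that is, $X(\sigma)=0$) is hyperbolic: $DX(\sigma)$ has no complex eigenvalue with zero real part. *Notation.* For a regular point $x$ ($X(x)\neq 0$) let $\mathcal N_x=X(x)^{\perp}\subset T_xM$, and let $\mathcal N=\{(x,v): x\in K,\ X(x)\ne0,\ v\in\mathcal N_x\}$ with the topology induced by $TM$. For $\beta>0$, the sectional Poincaré flow on $\{u\in\mathcal N_x:\|u\|<\beta\|X(x)\|\}$ is the local flow $P_t$ given by holonomy along the flow lines: $P_t(u)=w$, for $u\in \mathcal N_x$ and $w\in\mathcal N_{\varphi_t(x)}$, if there are a continuous function $\tau$ and a continuous family $\gamma(s)\in\mathcal N_{\varphi_s(x)}$, for $s$ between $0$ and $t$, with $\tau(0)=0$,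 $\gamma(0)=u$, $\gamma(t)=w$, $\|\gamma(s)\|<\beta\|X(\varphi_s(x))\|$ and $$\exp_{\varphi_s(x)}(\gamma(s))=\varphi_{\tau(s)}(\exp_x(u)).$$ The rescaled sectional Poincaré flow is $P^*_t(v)=\|X(\varphi_t(x))\|^{-1}\,P_t(\|X(x)\|\,v)$ for $v\in\mathcal N_x$; it is considered on the $\beta$-neighbourhood $\{\|v\|<\beta\}$ of the zero section. *Conclusion.* There exist a compact metric space $\widehat K$, a continuous flow $(\widehat\varphi_t)_{t\in\mathbb R}$ on $\widehat K$, a real vector bundle $\widehat{\mathcal N}\to\widehat K$ of rank $2$, and a continuous local flow $\widehat P^*_t$ on $\widehat{\mathcal N}$, with open domain in $\mathbb R\times\widehat{\mathcal N}$ containing the zero section for all times, which is fibered over $\widehat\varphi_t$ and preserves the zero section, such that: 1. There exist $\beta>0$ and an injective continuous map $p\colon\mathcal N\to\widehat{\mathcal N}$, sending fibers into fibers and the zero section into the zero section, which conjugates $P^*_t$ and $\widehat P^*_t$: the set of $(t,v)\in\mathbb R\times\mathcal N$ for which $P^*_t(v)$ is defined in the $\beta$-neighbourhood of the zero section is a neighbourhood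 of $\mathbb R\times\{\text{zero section}\}$, and for all such $(t,v)$ the vector $\widehat P^*_t(p(v))$ is defined and $\widehat P^*_t(p(v))=p(P^*_t(v))$. 2. $\widehat P^*_t$ is $C^{r-1}$ along fibers: for each $t\in\mathbb R$ and $x\in\widehat K$ it induces a local $C^{r-1}$-diffeomorphism $(\widehat{\mathcal N}_x,0)\to(\widehat{\mathcal N}_{\widehat\varphi_t(x)},0)$, and these maps depend continuously on $x$ for the $C^{r-1}$-topology, i.e. in local trivializations the derivatives along the fibers of order $0,\dots,r-1$ of $\widehat P^*_t$ are continuous in the base point and the vector. -/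

import Mathlib

open Bundle Set Filter Topology Manifold
open scoped ContDiff

universe u

/-- The model space `ℝ³` of a three-dimensional manifold. -/
abbrev R3 : Type := EuclideanSpace ℝ (Fin 3)

noncomputable section RiemannianExponential

variable {M : Type*} [TopologicalSpace M] [ChartedSpace R3 M]
  [IsManifold (𝓡 3) ∞ M]
  [RiemannianBundle (fun x : M => TangentSpace (𝓡 3) x)]

/-- The Riemannian metric read in the preferred chart at `x`: the value at the point `y` of the
chart, on the coordinate vectors `a` and `b`. -/
def chartMetric (x : M) (y a b : R3) : ℝ :=
  let D : R3 →L[ℝ] TangentSpace (𝓡 3) ((extChartAt (𝓡 3) x).symm y) :=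
    mfderiv 𝓘(ℝ, R3) (𝓡 3) (extChartAt (𝓡 3) x).symm y
  inner ℝ (D a) (D b)

/-- A `C²` curve is a geodesic on the open set `s` of times if it satisfies there the geodesic
equation.  With `c` the curve and `G` the metric, both read in the preferred chart at `γ t`,
this is the Euler-Lagrange equation of the energy,
`d/ds G(c)(c', a) = (1/2) D_a [G(c)(c', c')]` for every fixed vector `a`,
the second derivative being taken with the velocity frozen. -/
def IsGeodesicOn (γ : ℝ → M) (s : Set ℝ) : Prop :=
  ContMDiffOn 𝓘(ℝ, ℝ) (𝓡 3) 2 γ s ∧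
  ∀ t ∈ s, ∀ a : R3,
    let c : ℝ → R3 := fun s' => extChartAt (𝓡 3) (γ t) (γ s')
    deriv (fun s' => chartMetric (γ t) (c s') (deriv c s') a) t =
      (1 / 2 : ℝ) * fderiv ℝ (fun y => chartMetric (γ t) y (deriv c t) (deriv c t)) (c t) a

/-- `γ` is a geodesic defined on an open interval containing `[0,1]`, with initial vector `v`. -/
def IsGeodesicFrom (v : TangentBundle (𝓡 3) M) (γ : ℝ → M) : Prop :=
  (∃ ε > 0, IsGeodesicOn γ (Ioo (-ε) (1 + ε))) ∧
  (⟨γ 0, mfderiv 𝓘(ℝ, ℝ) (𝓡 3) γ 0 (1 : ℝ)⟩ : TangentBundle (𝓡 3) M) = v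

open Classical in
/-- The Riemannian exponential map: `exp_x(v) = γ(1)`, where `γ` is the geodesic with
`γ(0) = x`, `γ'(0) = v`. -/
def riemannianExp (v : TangentBundle (𝓡 3) M) : M :=
  if h : ∃ γ : ℝ → M, IsGeodesicFrom v γ then h.choose 1 else v.proj

end RiemannianExponential

noncomputable section SectionalPoincareFlow

variable {M : Type*} [TopologicalSpace M] [ChartedSpace R3 M]

/-- The vector field `X(x) = d/dt φ_t(x) |_{t=0}` generating the flow.  (The derivative lives in
the tangent space at `φ_0(x)`, which is `x`.) -/
def Flow.vectorField (φ : Flow ℝ M) (x : M) : TangentSpace (𝓡 3) x :=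
  (mfderiv 𝓘(ℝ, ℝ) (𝓡 3) (fun t : ℝ => φ t x) 0 : ℝ →L[ℝ] R3) (1 : ℝ)

/-- The vector field generating the flow, read in the preferred chart at `σ`. -/
def Flow.chartVectorField (φ : Flow ℝ M) (σ : M) (y : R3) : R3 :=
  deriv (fun t : ℝ => extChartAt (𝓡 3) σ (φ t ((extChartAt (𝓡 3) σ).symm y))) 0

/-- The linear part `DX(σ)` of the vector field at `σ`, in the preferred chart at `σ`.  At a
singularity it is, up to linear conjugacy, independent of the chart. -/
def Flow.linearPart (φ : Flow ℝ M) (σ : M) : R3 →L[ℝ] R3 :=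
  fderiv ℝ (φ.chartVectorField σ) (extChartAt (𝓡 3) σ σ)

/-- `σ` is a hyperbolic singularity: `X(σ) = 0` and no complex eigenvalue of `DX(σ)` has zero
real part. -/
def Flow.IsHyperbolicSingularity (φ : Flow ℝ M) (σ : M) : Prop :=
  φ.vectorField σ = 0 ∧
  ∀ z ∈ (LinearMap.charpoly (φ.linearPart σ : R3 →ₗ[ℝ] R3)).aroots ℂ, z.re ≠ 0

variable [IsManifold (𝓡 3) ∞ M]
  [RiemannianBundle (fun x : M => TangentSpace (𝓡 3) x)]

/-- The normal bundle over the regular points of `A`: the vectors `v ∈ T_x M` with `x ∈ A`,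
`X(x) ≠ 0` and `v` orthogonal to `X(x)`, as a subspace of the tangent bundle. -/
def Flow.normalBundle (φ : Flow ℝ M) (A : Set M) : Set (TangentBundle (𝓡 3) M) :=
  {v | v.proj ∈ A ∧ φ.vectorField v.proj ≠ 0 ∧ inner ℝ (φ.vectorField v.proj) v.snd = 0}

/-- The graph of the sectional Poincaré flow on the neighbourhood
`{u ∈ N_x : ‖u‖ < β ‖X(x)‖}` of the zero section: `w = P_t(u)`, obtained by following
continuously, for `s` from `0` to `t`, the intersection `exp(γ(s))` of the flow line of `exp(u)`
with the section `exp(N_{φ_s(x)})`, as long as it stays in this neighbourhood;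
`τ(s)` is the hitting time. -/
def Flow.SectionalPoincare (φ : Flow ℝ M) (β t : ℝ) (u w : TangentBundle (𝓡 3) M) : Prop :=
  ∃ (γ : ℝ → TangentBundle (𝓡 3) M) (τ : ℝ → ℝ),
    ContinuousOn γ (uIcc 0 t) ∧ ContinuousOn τ (uIcc 0 t) ∧
    γ 0 = u ∧ γ t = w ∧ τ 0 = 0 ∧
    ∀ s ∈ uIcc 0 t,
      γ s ∈ φ.normalBundle univ ∧
      (γ s).proj = φ s u.proj ∧
      ‖(γ s).snd‖ < β * ‖φ.vectorField (γ s).proj‖ ∧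
      riemannianExp (γ s) = φ (τ s) (riemannianExp u)

/-- The graph of the rescaled sectional Poincaré flow on the `β`-neighbourhood of the zero
section: `w = P*_t(v) = ‖X(φ_t(x))‖⁻¹ • P_t(‖X(x)‖ • v)` for `v ∈ N_x`. -/
def Flow.RescaledSectionalPoincare (φ : Flow ℝ M) (β t : ℝ)
    (v w : TangentBundle (𝓡 3) M) : Prop :=
  ∃ u : TangentBundle (𝓡 3) M,
    φ.SectionalPoincare β t ⟨v.proj, ‖φ.vectorField v.proj‖ • v.snd⟩ u ∧
    w = ⟨u.proj, ‖φ.vectorField u.proj‖⁻¹ • u.snd⟩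

end SectionalPoincareFlow

section LocalFiberedFlow

/-- A (continuous) local flow on the total space of a vector bundle, near the zero section, which
is fibered over a flow `φ` of the base and preserves the zero section.  `toFun t v` is
meaningful only for `(t, v) ∈ domain`; the domain is open, contains the zero section for all
times, and its times form an interval around `0` for each vector. -/
structure LocalFiberedFlow {B : Type*} [TopologicalSpace B] (F : Type*) (E : B → Type*)
    [∀ x, Zero (E x)] [TopologicalSpace (TotalSpace F E)] (φ : Flow ℝ B) where
  domain : Set (ℝ × TotalSpace F E)
  toFun : ℝ → TotalSpace F E → TotalSpace F E
  isOpen_domain : IsOpen domain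
  continuousOn : ContinuousOn (fun q : ℝ × TotalSpace F E => toFun q.1 q.2) domain
  ordConnected : ∀ v, OrdConnected {t | (t, v) ∈ domain}
  zero_time_mem : ∀ t v, (t, v) ∈ domain → (0, v) ∈ domain
  zero_section_mem : ∀ t (x : B), (t, (⟨x, 0⟩ : TotalSpace F E)) ∈ domain
  proj_eq : ∀ t v, (t, v) ∈ domain → (toFun t v).proj = φ t v.proj
  zero_section_eq : ∀ t (x : B), toFun t ⟨x, 0⟩ = ⟨φ t x, 0⟩
  zero_time : ∀ v, (0, v) ∈ domain → toFun 0 v = v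
  add_mem_iff : ∀ s t v, (s, v) ∈ domain →
    ((t, toFun s v) ∈ domain ↔ (s + t, v) ∈ domain)
  add_eq : ∀ s t v, (s, v) ∈ domain → (s + t, v) ∈ domain →
    toFun (s + t) v = toFun t (toFun s v)

variable {B : Type*} [TopologicalSpace B] {F : Type*} [NormedAddCommGroup F] [NormedSpace ℝ F]
  {E : B → Type*} [∀ x, AddCommGroup (E x)] [∀ x, Module ℝ (E x)]
  [TopologicalSpace (TotalSpace F E)] [∀ x, TopologicalSpace (E x)]
  [FiberBundle F E] [VectorBundle ℝ F E] {φ : Flow ℝ B}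

/-- The time `t` map of a local fibered flow on the fiber over `x`, read in the
trivializations `e` (at the source) and `e'` (at the target). -/
noncomputable def LocalFiberedFlow.fiberMap (P : LocalFiberedFlow F E φ)
    (e e' : Trivialization F (π F E)) (t : ℝ) (x : B) (w : F) : F :=
  (e' (P.toFun t ⟨x, e.symm x w⟩)).2

/-- The points `(x, w)` at which the time `t` map, read in the trivializations, is defined. -/
def LocalFiberedFlow.fiberDomain (P : LocalFiberedFlow F E φ)
    (e e' : Trivialization F (π F E)) (t : ℝ) : Set (B × F) :=
  {q | q.1 ∈ e.baseSet ∧ φ t q.1 ∈ e'.baseSet ∧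
    (t, (⟨q.1, e.symm q.1 q.2⟩ : TotalSpace F E)) ∈ P.domain}

/-- The local fibered flow is `C^k` along the fibers: it induces local `C^k` diffeomorphisms
`(E_x, 0) → (E_{φ_t(x)}, 0)`, and the time `t` map restricted to the fiber over `x` is `C^k`
and depends continuously on `x` for the `C^k` topology (uniform convergence on compact sets of
the derivatives along the fibers up to order `k`), i.e. its derivatives along the fibers up to
order `k` are continuous functions of `x` and of the vector. -/
def LocalFiberedFlow.IsContDiffAlongFibers (P : LocalFiberedFlow F E φ) (k : ℕ) : Prop :=
  ∀ (e e' : Trivialization F (π F E)) [MemTrivializationAtlas e] [MemTrivializationAtlas e']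
    (t : ℝ),
    (∀ q ∈ P.fiberDomain e e' t, ContDiffAt ℝ k (P.fiberMap e e' t q.1) q.2) ∧
    (∀ j ≤ k, ContinuousOn (fun q : B × F => iteratedFDeriv ℝ j (P.fiberMap e e' t q.1) q.2)
      (P.fiberDomain e e' t)) ∧
    (∀ x ∈ e.baseSet, φ t x ∈ e'.baseSet →
      ∃ Φ : OpenPartialHomeomorph F F, (0 : F) ∈ Φ.source ∧ Φ 0 = 0 ∧
        (∀ w ∈ Φ.source, (x, w) ∈ P.fiberDomain e e' t ∧ Φ w = P.fiberMap e e' t x w) ∧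
        ContDiffOn ℝ k Φ Φ.source ∧ ContDiffOn ℝ k Φ.symm Φ.target)

end LocalFiberedFlow

/-! The rescaled flow degenerates at a singularity only because the direction of `X` has no limit
there and the holonomy equation becomes void. The first defect is removed by a blow-up. Let
`directionSet` be the closure, in the unit tangent bundle, of the directions `X/‖X‖` at regular
points of `K`. It is compact, the normalized tangent flow acts on it (`directionFlow`), and the
planes orthogonal to its elements form a rank two bundle (`NormalFiber`). For every `ξ` in it over a
point `x`, the relation `X(x) = ‖X(x)‖ ξ` persists by closedness. In a chart, an element is thus
described by `(y, e, ρ)` with `X(y) = ρ e`, where `ρ = 0` is allowed.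

The second defect is removed by dividing by `ρ`. With `ψ` the flow and `E` the exponential in a
chart, the equation to solve for the hitting time `τ` and the rescaled vector `w` is `E(ψ_t(y), ρ w)
= ψ_τ(E(y, ρ v))`, together with the orthogonality of `w` to `Dψ_t e`. As the orbit of `y` has
velocity `ρ Dψ_σ(y) e`, one can write `ψ_t(y) = ψ_τ(y + ρ b(t - τ, y, e))` with `b` smooth
(`exists_displacement`). The difference of the two sides then vanishes for `ρ = 0`, and Hadamard's
lemma makes it `ρ` times a function which is less regular by one derivative
(`exists_rescaled_sectionDefect`); this is the loss from `C^r` to `C^{r-1}`. The derivative of the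
quotient in `(τ, w)`, completed by orthogonality, is `(s, w) ↦ (w - s e, ⟨w, e⟩)`, which is
invertible. The implicit function theorem gives `(τ, w)` as a `C^{r-1}` function of `(t, y, e, ρ,
v)` regarded as independent variables (`exists_poincare_chart`). In a fibre only `v` varies, and the
other parameters are continuous on the blow-up: the extended map is `C^{r-1}` along fibres with
continuous derivatives.

This yields germs of the extended flow near the zero section (`exists_isPoincareGerm_zero`). Over
regular points they are characterized by the holonomy equation, so uniqueness gives the cocycle
relation there, and density of the regular fibres gives it everywhere (`eventually_cocycle`).
Compatible germs generate a maximal local flow (`germFlow`). Adding the hitting time as one more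
coordinate gives a flow as well, which serves to compare with the original definition: a continuous
holonomy curve follows the germs (`germFlow_regularNormal`), and an orbit of the augmented flow is a
holonomy curve (`exists_rescaledSectionalPoincare`).

Smoothness of the exponential map is obtained by solving the integral equation of the geodesic spray
in a space of continuous curves, again with the implicit function theorem. -/

noncomputable section Analysis

/-! ### Calculus in spaces of continuous functions, smooth local flows, Hadamard's lemma. -/

section Shortcuts

variable {X : Type*} [TopologicalSpace X] [CompactSpace X]
  {E F : Type*} [NormedAddCommGroup E] [NormedSpace ℝ E] [NormedAddCommGroup F] [NormedSpace ℝ F]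

instance (priority := 2000) clmNormedAddCommGroup : NormedAddCommGroup (E →L[ℝ] F) :=
  ContinuousLinearMap.toNormedAddCommGroup

instance (priority := 2000) clmNormedSpace : NormedSpace ℝ (E →L[ℝ] F) :=
  ContinuousLinearMap.toNormedSpace

instance (priority := 2000) continuousMapNormedAddCommGroup : NormedAddCommGroup C(X, F) :=
  ContinuousMap.instNormedAddCommGroup

instance (priority := 2000) continuousMapNormedSpace : NormedSpace ℝ C(X, F) :=
  ContinuousMap.normedSpace

end Shortcuts

section Nemytskii

variable {X : Type*} [TopologicalSpace X] [CompactSpace X]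
  {E F : Type*} [NormedAddCommGroup E] [NormedSpace ℝ E] [NormedAddCommGroup F] [NormedSpace ℝ F]

/-- Pointwise application of a continuous family of operators, as a bounded bilinear map. -/
def pointwiseApply (X E F : Type*) [TopologicalSpace X] [CompactSpace X]
    [NormedAddCommGroup E] [NormedSpace ℝ E] [NormedAddCommGroup F] [NormedSpace ℝ F] :
    C(X, E →L[ℝ] F) →L[ℝ] C(X, E) →L[ℝ] C(X, F) :=
  LinearMap.mkContinuous₂
    (LinearMap.mk₂ ℝ
      (fun (A : C(X, E →L[ℝ] F)) (h : C(X, E)) =>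
        (⟨fun t => A t (h t), A.continuous.clm_apply h.continuous⟩ : C(X, F)))
      (fun A B h => by ext t; simp)
      (fun c A h => by ext t; simp)
      (fun A h k => by ext t; simp)
      (fun c A h => by ext t; simp)) 1
    (fun A h => by
      rw [one_mul]
      refine (ContinuousMap.norm_le _ (by positivity)).2 fun t => ?_
      exact (ContinuousLinearMap.le_opNorm _ _).trans
        (mul_le_mul (A.norm_coe_le_norm t) (h.norm_coe_le_norm t) (norm_nonneg _) (norm_nonneg _)))

@[simp] lemma pointwiseApply_apply (A : C(X, E →L[ℝ] F)) (h : C(X, E)) (t : X) :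
    pointwiseApply X E F A h t = A t (h t) := rfl

/-- The mean value inequality on the segment from `α t` to `α t + h t` bounds the error at `t` by `ε
* ‖h t‖`, provided `f'` varies by at most `ε` on it. Since `X` is compact, postcomposition with `f'`
is continuous for the sup norm, and one radius `δ` serves all `t`. -/
lemma hasFDerivAt_postcomp (f : C(E, F)) (f' : C(E, E →L[ℝ] F))
    (hf : ∀ x, HasFDerivAt f (f' x) x) (α : C(X, E)) :
    HasFDerivAt (fun α : C(X, E) => f.comp α) (pointwiseApply X E F (f'.comp α)) α := by
  rw [hasFDerivAt_iff_isLittleO_nhds_zero, Asymptotics.isLittleO_iff]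
  intro ε hε
  have hcont : Continuous (fun h : C(X, E) => f'.comp (α + h)) :=
    (ContinuousMap.continuous_postcomp f').comp (continuous_const.add continuous_id)
  have hlim : Tendsto (fun h : C(X, E) => f'.comp (α + h)) (𝓝 0) (𝓝 (f'.comp α)) := by
    simpa using hcont.tendsto 0
  obtain ⟨δ, hδ, hball⟩ := Metric.eventually_nhds_iff_ball.1
    (hlim.eventually (Metric.ball_mem_nhds _ hε))
  filter_upwards [Metric.ball_mem_nhds (0 : C(X, E)) hδ] with h hh
  refine (ContinuousMap.norm_le _ (by positivity)).2 fun t => ?_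
  have hseg : ∀ y ∈ segment ℝ (α t) (α t + h t), ‖f' y - f' (α t)‖ ≤ ε := by
    intro y hy
    rw [segment_eq_image'] at hy
    obtain ⟨θ, hθ, rfl⟩ := hy
    have hmem : θ • h ∈ Metric.ball (0 : C(X, E)) δ := by
      rw [mem_ball_zero_iff] at hh ⊢
      rw [norm_smul, Real.norm_eq_abs, abs_of_nonneg hθ.1]
      exact (mul_le_of_le_one_left (norm_nonneg _) hθ.2).trans_lt hh
    have := hball _ hmem
    rw [dist_eq_norm] at this
    have h2 := ((f'.comp (α + θ • h) - f'.comp α).norm_coe_le_norm t).trans this.le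
    simpa using h2
  have := (convex_segment (α t) (α t + h t)).norm_image_sub_le_of_norm_hasFDerivWithin_le'
    (fun y _ => (hf y).hasFDerivWithinAt) hseg (left_mem_segment ℝ _ _) (right_mem_segment ℝ _ _)
  simp only [add_sub_cancel_left] at this
  simpa using this.trans (mul_le_mul_of_nonneg_left (h.norm_coe_le_norm t) hε.le)

/-- The superposition operator of a `C^n` map is `C^n`. -/
lemma contDiff_postcomp {E : Type u} [NormedAddCommGroup E] [NormedSpace ℝ E] (n : ℕ) :
    ∀ {F : Type u} [NormedAddCommGroup F] [NormedSpace ℝ F]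
    (f : C(E, F)), ContDiff ℝ n f → ContDiff ℝ n (fun α : C(X, E) => f.comp α) := by
  induction n with
  | zero =>
    intro F _ _ f _
    exact contDiff_zero.2 (ContinuousMap.continuous_postcomp f)
  | succ n ih =>
    intro F _ _ f hf
    rw [Nat.cast_succ, contDiff_succ_iff_hasFDerivAt] at hf ⊢
    obtain ⟨f', hf', hd⟩ := hf
    -- The derivative is the superposition operator of `f'`, of class one less, followed by a
    -- bounded linear map. The induction therefore runs over all targets `F`.
    refine ⟨fun α => pointwiseApply X E F ((⟨f', hf'.continuous⟩ : C(E, E →L[ℝ] F)).comp α), ?_,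
      fun α => hasFDerivAt_postcomp f ⟨f', hf'.continuous⟩ hd α⟩
    exact (pointwiseApply X E F).contDiff.comp (ih ⟨f', hf'.continuous⟩ hf')

end Nemytskii

section Primitive

variable {E : Type*} [NormedAddCommGroup E]

/-- Functions on the interval are extended by constants, so that primitives live on the whole line.
The interval `[-2, 2]` leaves room around `[0, 1]`, because a geodesic must be defined slightly
beyond both ends. -/
lemma continuous_extend_Icc (α : C(Icc (-2 : ℝ) 2, E)) :
    Continuous fun s => α (projIcc (-2) 2 (by norm_num) s) :=
  α.continuous.comp continuous_projIcc

variable [NormedSpace ℝ E]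

/-- The value at `t` of the primitive vanishing at `0`, for continuous functions on `[-2,2]`. -/
def primitiveFun (α : C(Icc (-2 : ℝ) 2, E)) (t : ℝ) : E :=
  ∫ s in (0 : ℝ)..t, α (projIcc (-2) 2 (by norm_num) s)

variable [CompleteSpace E]

lemma hasDerivAt_primitiveFun (α : C(Icc (-2 : ℝ) 2, E)) (t : ℝ) :
    HasDerivAt (primitiveFun α) (α (projIcc (-2) 2 (by norm_num) t)) t :=
  intervalIntegral.integral_hasDerivAt_right ((continuous_extend_Icc α).intervalIntegrable _ _)
    ((continuous_extend_Icc α).stronglyMeasurableAtFilter _ _) (continuous_extend_Icc α).continuousAt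

lemma continuous_primitiveFun (α : C(Icc (-2 : ℝ) 2, E)) : Continuous (primitiveFun α) :=
  continuous_iff_continuousAt.2 fun t => (hasDerivAt_primitiveFun α t).continuousAt

/-- The primitive vanishing at `0`, as a bounded operator on continuous functions on `[-2,2]`. -/
def primitiveCLM (E : Type*) [NormedAddCommGroup E] [NormedSpace ℝ E] [CompleteSpace E] :
    C(Icc (-2 : ℝ) 2, E) →L[ℝ] C(Icc (-2 : ℝ) 2, E) :=
  LinearMap.mkContinuous
    { toFun := fun α => ⟨fun t => primitiveFun α t,
        (continuous_primitiveFun α).comp continuous_subtype_val⟩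
      map_add' := fun α β => by
        ext t
        simp only [primitiveFun, ContinuousMap.coe_mk, ContinuousMap.add_apply]
        exact intervalIntegral.integral_add ((continuous_extend_Icc α).intervalIntegrable _ _)
          ((continuous_extend_Icc β).intervalIntegrable _ _)
      map_smul' := fun c α => by
        ext t
        simp [primitiveFun] } 2
    (fun α => by
      refine (ContinuousMap.norm_le _ (by positivity)).2 fun t => ?_
      have := intervalIntegral.norm_integral_le_of_norm_le_const (a := (0 : ℝ)) (b := t)
        (f := fun s => α (projIcc (-2) 2 (by norm_num) s)) (C := ‖α‖)
        (fun s _ => α.norm_coe_le_norm _)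
      refine this.trans ?_
      rw [mul_comm]
      refine mul_le_mul_of_nonneg_right ?_ (norm_nonneg _)
      rw [sub_zero, abs_le]
      exact t.2)

@[simp] lemma primitiveCLM_apply (α : C(Icc (-2 : ℝ) 2, E)) (t : Icc (-2 : ℝ) 2) :
    primitiveCLM E α t = primitiveFun α t := rfl

end Primitive

section Extension

variable {E F : Type*} [NormedAddCommGroup E] [NormedSpace ℝ E] [FiniteDimensional ℝ E]
  [NormedAddCommGroup F] [NormedSpace ℝ F]

/-- A map which is `C^n` at a point coincides near this point with a global `C^n` map. -/
lemma ContDiffAt.exists_contDiff_eventuallyEq {n : ℕ} {f : E → F} {x : E}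
    (hf : ContDiffAt ℝ n f x) : ∃ g : E → F, ContDiff ℝ n g ∧ g =ᶠ[𝓝 x] f := by
  have hev : ∀ᶠ y in 𝓝 x, ContDiffAt ℝ n f y := hf.eventually (by simp)
  obtain ⟨δ, hδ, hball⟩ := Metric.eventually_nhds_iff_ball.1 hev
  -- The support has radius `δ / 2`, inside the ball where `f` is `C^n`. The product is then smooth
  -- everywhere, however wild `f` is further away.
  let χ : ContDiffBump x := ⟨δ / 4, δ / 2, by positivity, by linarith⟩
  refine ⟨fun y => χ y • f y, ?_, ?_⟩
  · rw [contDiff_iff_contDiffAt]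
    intro y
    by_cases hy : y ∈ Metric.ball x δ
    · exact χ.contDiff.contDiffAt.smul (hball y hy)
    · have : (fun y => χ y • f y) =ᶠ[𝓝 y] fun _ => 0 := by
        have hys : y ∉ tsupport χ := by
          rw [χ.tsupport_eq]
          intro h
          rw [Metric.mem_closedBall] at h
          rw [Metric.mem_ball, not_lt] at hy
          have : χ.rOut = δ / 2 := rfl
          linarith
        filter_upwards [(isClosed_tsupport χ).isOpen_compl.mem_nhds hys] with z hz
        rw [image_eq_zero_of_notMem_tsupport hz, zero_smul]
      exact contDiffAt_const.congr_of_eventuallyEq this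
  · filter_upwards [χ.eventuallyEq_one] with y hy
    rw [hy]; simp

end Extension

section LocalFlow

variable {E : Type u} [NormedAddCommGroup E] [NormedSpace ℝ E] [CompleteSpace E]

/-- The inclusion of constants into continuous functions on `[-2,2]`. -/
def constCLM (E : Type u) [NormedAddCommGroup E] [NormedSpace ℝ E] :
    E →L[ℝ] C(Icc (-2 : ℝ) 2, E) :=
  LinearMap.mkContinuous
    { toFun := fun z => ContinuousMap.const _ z
      map_add' := fun _ _ => rfl
      map_smul' := fun _ _ => rfl } 1
    (fun z => (ContinuousMap.norm_le _ (by positivity)).2 fun t => by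
      rw [one_mul]; exact le_rfl)

@[simp] lemma constCLM_apply {E : Type u} [NormedAddCommGroup E] [NormedSpace ℝ E] (z : E)
    (t : Icc (-2 : ℝ) 2) : constCLM E z t = z := rfl

/-- The integral equation of the flow of `μ • f`. -/
def flowEquation (f : C(E, E)) (q : (E × ℝ) × C(Icc (-2 : ℝ) 2, E)) : C(Icc (-2 : ℝ) 2, E) :=
  q.2 - constCLM E q.1.1 - q.1.2 • primitiveCLM E (f.comp q.2)

lemma contDiff_flowEquation {n : ℕ} (f : C(E, E)) (hf : ContDiff ℝ n f) :
    ContDiff ℝ n (flowEquation f) := by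
  have h1 : ContDiff ℝ n (fun α : C(Icc (-2 : ℝ) 2, E) => f.comp α) := contDiff_postcomp n f hf
  have h2 : ContDiff ℝ n fun q : (E × ℝ) × C(Icc (-2 : ℝ) 2, E) => f.comp q.2 :=
    h1.comp contDiff_snd
  have h3 : ContDiff ℝ n fun q : (E × ℝ) × C(Icc (-2 : ℝ) 2, E) => constCLM E q.1.1 :=
    (constCLM E).contDiff.comp (contDiff_fst.comp contDiff_fst)
  have h4 : ContDiff ℝ n fun q : (E × ℝ) × C(Icc (-2 : ℝ) 2, E) => q.1.2 :=
    contDiff_snd.comp contDiff_fst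
  exact (contDiff_snd.sub h3).sub (h4.smul ((primitiveCLM E).contDiff.comp h2))

lemma flowEquation_const (f : C(E, E)) (z : E) : flowEquation f ((z, 0), constCLM E z) = 0 := by
  simp [flowEquation]

/-- For `μ = 0` the equation is `α - constCLM E z`, affine in `α` with identity linear part. The
implicit function theorem thus applies on all of `[-2, 2]`; smallness is asked of `μ` rather than of
the time. -/
lemma fderiv_flowEquation_comp_inr (f : C(E, E)) (hf : ContDiff ℝ 1 f) (z : E) :
    fderiv ℝ (flowEquation f) ((z, 0), constCLM E z) ∘L
      .inr ℝ (E × ℝ) C(Icc (-2 : ℝ) 2, E) = .id ℝ _ := by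
  have hd : HasFDerivAt (flowEquation f) _ ((z, 0), constCLM E z) :=
    ((contDiff_flowEquation (n := 1) f hf).differentiable (by simp) _).hasFDerivAt
  have h1 := hd.comp (constCLM E z) (hasFDerivAt_prodMk_right (𝕜 := ℝ) (z, (0 : ℝ)) (constCLM E z))
  have h2 : HasFDerivAt (flowEquation f ∘ fun α => ((z, (0 : ℝ)), α))
      (.id ℝ C(Icc (-2 : ℝ) 2, E)) (constCLM E z) := by
    have : (flowEquation f ∘ fun α => ((z, (0 : ℝ)), α)) = fun α => α - constCLM E z := by
      ext α t
      simp [flowEquation]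
    rw [this]
    exact (hasFDerivAt_id _).sub_const _
  exact h1.unique h2

/-- Smooth local flow: the solutions on `[-2,2]` of `dz/dt = μ f(z)` depend smoothly on the initial
condition and on the parameter `μ`, near an initial condition and `μ = 0`. -/
lemma exists_contDiffAt_localFlow {n : ℕ} (hn : n ≠ 0) (f : C(E, E)) (hf : ContDiff ℝ n f)
    (z₀ : E) :
    ∃ α : E × ℝ → C(Icc (-2 : ℝ) 2, E), ContDiffAt ℝ n α (z₀, 0) ∧ α (z₀, 0) = constCLM E z₀ ∧
      (∀ᶠ q in 𝓝 (z₀, (0 : ℝ)), α q = constCLM E q.1 + q.2 • primitiveCLM E (f.comp (α q))) ∧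
      (∀ᶠ q in 𝓝 (z₀, (0 : ℝ)), f q.1 = 0 → α q = constCLM E q.1) := by
  have hf1 : ContDiff ℝ 1 f := hf.of_le (by exact_mod_cast Nat.one_le_iff_ne_zero.2 hn)
  have hc : ContDiffAt ℝ n (flowEquation f) ((z₀, 0), constCLM E z₀) :=
    (contDiff_flowEquation f hf).contDiffAt
  have hn' : (n : ℕ∞ω) ≠ 0 := by exact_mod_cast hn
  have hinv : (fderiv ℝ (flowEquation f) ((z₀, 0), constCLM E z₀) ∘L
      .inr ℝ (E × ℝ) C(Icc (-2 : ℝ) 2, E)).IsInvertible := by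
    rw [fderiv_flowEquation_comp_inr f hf1]
    exact ⟨ContinuousLinearEquiv.refl ℝ _, rfl⟩
  refine ⟨hc.implicitFunction hn' hinv, hc.contDiffAt_implicitFunction hn' hinv,
    hc.implicitFunction_apply_self hn' hinv, ?_, ?_⟩
  · filter_upwards [hc.eventually_apply_implicitFunction hn' hinv] with q hq
    rw [flowEquation_const] at hq
    rw [flowEquation, sub_sub, sub_eq_zero] at hq
    exact hq
  · have hlim : Tendsto (fun q : E × ℝ => (q, constCLM E q.1)) (𝓝 (z₀, 0))
        (𝓝 ((z₀, 0), constCLM E z₀)) :=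
      (Continuous.prodMk continuous_id ((constCLM E).continuous.comp continuous_fst)).tendsto' _ _
        rfl
    -- Where `f` vanishes, the constant curve solves the equation and is close to the reference
    -- solution; local uniqueness identifies it with `α`.
    filter_upwards [hlim.eventually (hc.eventually_apply_eq_iff_implicitFunction hn' hinv)]
      with q hq hz
    refine hq.1 ?_
    rw [flowEquation_const]
    ext t
    simp [flowEquation, primitiveFun, hz]

/-- Differentiating the integral equation in the initial condition gives `D t = id + μ ∫₀ᵗ A ∘ D`.
Since `A ∘ A = 0`, composing with `A` yields `A ∘ D = A`, and the integral is `t • A`. The intended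
case is the geodesic spray at a zero vector, whose linear part `(a, b) ↦ (b, 0)` has square zero. -/
lemma hasFDerivAt_localFlow {n : ℕ} (hn : n ≠ 0) (f : C(E, E)) (hf : ContDiff ℝ n f) {z₀ : E}
    {α : E × ℝ → C(Icc (-2 : ℝ) 2, E)} (hα : ContDiffAt ℝ n α (z₀, 0))
    (heq : ∀ᶠ q in 𝓝 (z₀, (0 : ℝ)), α q = constCLM E q.1 + q.2 • primitiveCLM E (f.comp (α q)))
    (hconst : ∀ᶠ μ in 𝓝 (0 : ℝ), α (z₀, μ) = constCLM E z₀) {A : E →L[ℝ] E}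
    (hA : HasFDerivAt f A z₀) (hA2 : ∀ ζ, A (A ζ) = 0) :
    ∀ᶠ μ in 𝓝 (0 : ℝ), ∀ t : Icc (-2 : ℝ) 2,
      HasFDerivAt (fun z => α (z, μ) t) (.id ℝ E + (μ * t) • A) z₀ := by
  have hf1 : ContDiff ℝ 1 f := hf.of_le (by exact_mod_cast Nat.one_le_iff_ne_zero.2 hn)
  have hlim : Tendsto (fun μ : ℝ => (z₀, μ)) (𝓝 0) (𝓝 (z₀, 0)) :=
    (Continuous.prodMk continuous_const continuous_id).tendsto' _ _ rfl
  have hn' : (n : ℕ∞ω) ≠ 0 := by exact_mod_cast hn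
  filter_upwards [hlim.eventually (hα.eventually (by simp)), hlim.eventually heq.eventually_nhds,
    hconst] with μ h1 h2 h3 t
  have hd := (h1.differentiableAt hn').hasFDerivAt.comp z₀
    (hasFDerivAt_prodMk_left (𝕜 := ℝ) z₀ μ)
  set D := (fderiv ℝ α (z₀, μ)) ∘L (.inl ℝ E ℝ) with hD
  have hd' : HasFDerivAt (fun z => α (z, μ)) D z₀ := hd
  let f' : C(E, E →L[ℝ] E) := ⟨fderiv ℝ f, hf1.continuous_fderiv (by simp)⟩
  have hN := hasFDerivAt_postcomp (X := Icc (-2 : ℝ) 2) f f'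
    (fun x => ((hf1.differentiable (by simp)) x).hasFDerivAt) (α (z₀, μ))
  have hr := ((constCLM E).hasFDerivAt (x := z₀)).add
    (((primitiveCLM E).hasFDerivAt.comp z₀ (hN.comp z₀ hd')).const_smul μ)
  have hz : Tendsto (fun z : E => (z, μ)) (𝓝 z₀) (𝓝 (z₀, μ)) :=
    (Continuous.prodMk continuous_id continuous_const).tendsto' _ _ rfl
  have huniq := hd'.unique (hr.congr_of_eventuallyEq (hz.eventually h2))
  have hfa : fderiv ℝ f z₀ = A := hA.fderiv
  have key : ∀ ζ (s : Icc (-2 : ℝ) 2), D ζ s = ζ + μ • ∫ x in (0 : ℝ)..s,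
      A (D ζ (projIcc (-2) 2 (by norm_num) x)) := by
    intro ζ s
    have h5 := congrArg (fun T : E →L[ℝ] C(Icc (-2 : ℝ) 2, E) => T ζ s) huniq
    refine h5.trans ?_
    change ζ + μ • primitiveFun _ (s : ℝ) = _
    simp [primitiveFun, f', h3, hfa]
  have hAD : ∀ ζ (s : Icc (-2 : ℝ) 2), A (D ζ s) = A ζ := by
    intro ζ s
    rw [key ζ s, map_add, map_smul, ← A.intervalIntegral_comp_comm]
    · simp [hA2]
    · exact (A.continuous.comp (continuous_extend_Icc (D ζ))).intervalIntegrable _ _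
  have hev := (ContinuousMap.evalCLM ℝ t : C(Icc (-2 : ℝ) 2, E) →L[ℝ] E).hasFDerivAt.comp z₀ hd'
  have hev' : HasFDerivAt (fun z => α (z, μ) t) _ z₀ := hev
  convert hev' using 1
  ext ζ
  have := key ζ t
  simp only [hAD] at this
  change ζ + (μ * t) • A ζ = D ζ t
  rw [this]
  simp [mul_smul]

/-- A local flow solves the differential equation. -/
lemma hasDerivAt_localFlow (f : C(E, E)) {z : E} {μ : ℝ} {α : C(Icc (-2 : ℝ) 2, E)}
    (h : α = constCLM E z + μ • primitiveCLM E (f.comp α)) {t : ℝ} (ht : t ∈ Ioo (-2 : ℝ) 2) :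
    HasDerivAt (fun s => α (projIcc (-2) 2 (by norm_num) s))
      (μ • f (α (projIcc (-2) 2 (by norm_num) t))) t := by
  have h1 := ((hasDerivAt_primitiveFun (f.comp α) t).const_smul μ).const_add z
  refine h1.congr_of_eventuallyEq ?_
  filter_upwards [isOpen_Ioo.mem_nhds ht] with s hs
  conv_lhs => rw [h]
  simp [projIcc_of_mem _ (Ioo_subset_Icc_self hs)]

lemma localFlow_zero (f : C(E, E)) {z : E} {μ : ℝ} {α : C(Icc (-2 : ℝ) 2, E)}
    (h : α = constCLM E z + μ • primitiveCLM E (f.comp α)) :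
    α (projIcc (-2) 2 (by norm_num) 0) = z := by
  conv_lhs => rw [h]
  simp [projIcc_of_mem _ (show (0 : ℝ) ∈ Icc (-2 : ℝ) 2 by norm_num), primitiveFun]

end LocalFlow

section Hadamard

variable {E F : Type u} [NormedAddCommGroup E] [NormedSpace ℝ E]
  [NormedAddCommGroup F] [NormedSpace ℝ F] [CompleteSpace F]

/-- Integrals over `[0,1]` along segments issued from zero depend smoothly on the parameters. -/
lemma contDiff_integral_segment {n : ℕ} {f : E → F} (hf : ContDiff ℝ n f) (L₀ L₁ : E →L[ℝ] E) :
    ContDiff ℝ n fun p : E => ∫ θ in (0 : ℝ)..1, f (L₀ p + θ • L₁ p) := by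
  -- `S p` is the curve `θ ↦ L₀ p + θ • L₁ p`, linear in `p`. The integral becomes a superposition
  -- operator followed by the primitive and the evaluation at `1`.
  let S : E →L[ℝ] C(Icc (-2 : ℝ) 2, E) :=
    (constCLM E) ∘L L₀ + LinearMap.mkContinuous
      { toFun := fun z => (⟨fun t => (t : ℝ) • L₁ z, by fun_prop⟩ : C(Icc (-2 : ℝ) 2, E))
        map_add' := fun _ _ => by ext; simp
        map_smul' := fun c _ => by ext t; simp [smul_comm c] } (2 * ‖L₁‖)
      (fun z => (ContinuousMap.norm_le _ (by positivity)).2 fun t => by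
        simp only [LinearMap.coe_mk, AddHom.coe_mk, ContinuousMap.coe_mk, norm_smul, mul_assoc]
        exact mul_le_mul (abs_le.2 t.2) (L₁.le_opNorm z) (norm_nonneg _) (by norm_num))
  have h1 : ContDiff ℝ n fun p => primitiveCLM F ((⟨f, hf.continuous⟩ : C(E, F)).comp (S p))
      ⟨1, by norm_num⟩ :=
    ((ContinuousMap.evalCLM ℝ (⟨1, by norm_num⟩ : Icc (-2 : ℝ) 2) :
      C(Icc (-2 : ℝ) 2, F) →L[ℝ] F)).contDiff.comp
      ((primitiveCLM F).contDiff.comp ((contDiff_postcomp n _ hf).comp S.contDiff))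
  convert h1 using 2 with p
  simp only [primitiveCLM_apply, primitiveFun]
  refine intervalIntegral.integral_congr fun θ hθ => ?_
  rw [uIcc_of_le zero_le_one] at hθ
  have hθ' : θ ∈ Icc (-2 : ℝ) 2 := ⟨by linarith [hθ.1], by linarith [hθ.2]⟩
  simp [S, projIcc_of_mem _ hθ']

variable {P : Type} [NormedAddCommGroup P] [NormedSpace ℝ P] [FiniteDimensional ℝ P]
  {V : Type} [NormedAddCommGroup V] [NormedSpace ℝ V] [CompleteSpace V]

/-- Hadamard's lemma: a `C^{n+1}` map vanishing for `ρ = 0` is `ρ` times a `C^n` map. -/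
lemma exists_contDiffAt_eq_smul {n : ℕ} {f : ℝ × P → V} {p₀ : P}
    (hf : ContDiffAt ℝ (n + 1 : ℕ) f (0, p₀)) (h0 : ∀ᶠ p in 𝓝 p₀, f (0, p) = 0) :
    ∃ g : ℝ × P → V, ContDiffAt ℝ n g (0, p₀) ∧ ∀ᶠ q in 𝓝 ((0 : ℝ), p₀), f q = q.1 • g q := by
  obtain ⟨F, hF, hFf⟩ := hf.exists_contDiff_eventuallyEq
  have hd : ContDiff ℝ n fun q => fderiv ℝ F q (1, 0) :=
    (hF.fderiv_right (m := n) (by exact_mod_cast le_rfl)).clm_apply contDiff_const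
  -- `L₀ + θ • L₁` sends `(ρ, p)` to `(θ ρ, p)`. The quotient is the integral over `θ` of `∂_ρ F(θ
  -- ρ, p)`, whence the loss of one derivative.
  let L₀ : ℝ × P →L[ℝ] ℝ × P := (0 : ℝ × P →L[ℝ] ℝ).prod (.snd ℝ ℝ P)
  let L₁ : ℝ × P →L[ℝ] ℝ × P := (ContinuousLinearMap.fst ℝ ℝ P).prod 0
  refine ⟨fun p => ∫ θ in (0 : ℝ)..1, fderiv ℝ F (L₀ p + θ • L₁ p) (1, 0),
    (contDiff_integral_segment hd L₀ L₁).contDiffAt, ?_⟩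
  have hsnd : Tendsto (fun q : ℝ × P => q.2) (𝓝 (0, p₀)) (𝓝 p₀) := continuous_snd.tendsto' _ _ rfl
  have hz : Tendsto (fun q : ℝ × P => ((0 : ℝ), q.2)) (𝓝 (0, p₀)) (𝓝 (0, p₀)) :=
    (Continuous.prodMk continuous_const continuous_snd).tendsto' _ _ rfl
  filter_upwards [hFf, hsnd.eventually h0, hz.eventually hFf] with q hq hq0 hqz
  have hderiv : ∀ θ : ℝ, HasDerivAt (fun θ : ℝ => F (L₀ q + θ • L₁ q))
      (q.1 • fderiv ℝ F (L₀ q + θ • L₁ q) (1, 0)) θ := by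
    intro θ
    have h1 : HasDerivAt (fun θ : ℝ => L₀ q + θ • L₁ q) (L₁ q) θ := by
      simpa using ((hasDerivAt_id θ).smul_const (L₁ q)).const_add (L₀ q)
    have h2 := ((hF.differentiable (by simp)) (L₀ q + θ • L₁ q)).hasFDerivAt.comp_hasDerivAt θ h1
    have h3 : L₁ q = q.1 • ((1, 0) : ℝ × P) := by ext <;> simp [L₁]
    rw [h3, map_smul] at h2
    rw [h3]
    exact h2
  have hcont : Continuous fun θ : ℝ => q.1 • fderiv ℝ F (L₀ q + θ • L₁ q) (1, 0) :=
    (hd.continuous.comp (by fun_prop : Continuous fun θ : ℝ => L₀ q + θ • L₁ q)).const_smul q.1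
  have hint := intervalIntegral.integral_eq_sub_of_hasDerivAt (a := 0) (b := 1)
    (fun θ _ => hderiv θ) (hcont.intervalIntegrable _ _)
  rw [intervalIntegral.integral_smul] at hint
  rw [hint]
  have e0 : L₀ q + (0 : ℝ) • L₁ q = (0, q.2) := by ext <;> simp [L₀]
  have e1 : L₀ q + (1 : ℝ) • L₁ q = q := by ext <;> simp [L₀, L₁]
  rw [e0, e1, hqz, hq0, hq, sub_zero]

end Hadamard

end Analysis

/-! ### Tangent vectors and the metric in the preferred charts. -/

noncomputable section ChartMetric

set_option linter.unusedSectionVars false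

/-- The pullback of an inner product by a linear map. -/
def pullbackInner {T : Type*} [NormedAddCommGroup T] [InnerProductSpace ℝ T] (D : R3 →ₗ[ℝ] T) :
    R3 →L[ℝ] R3 →L[ℝ] ℝ :=
  LinearMap.toContinuousLinearMap
    (LinearMap.toContinuousLinearMap.toLinearMap ∘ₗ
      LinearMap.mk₂ ℝ (fun a b => inner ℝ (D a) (D b))
        (fun a b c => by simp only [map_add, inner_add_left])
        (fun a b c => by simp only [map_smul, real_inner_smul_left, smul_eq_mul])
        (fun a b c => by simp only [map_add, inner_add_right])
        (fun a b c => by simp only [map_smul, real_inner_smul_right, smul_eq_mul]))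

variable {M : Type u} [TopologicalSpace M] [ChartedSpace R3 M] [IsManifold (𝓡 3) ∞ M]

section Coordinates

/-- The coordinates of a tangent vector in the preferred chart at `x`. -/
def tangentCoord (x : M) (ζ : TangentBundle (𝓡 3) M) : R3 :=
  (trivializationAt R3 (TangentSpace (𝓡 3)) x ζ).2

/-- The tangent vector at the point `z` with coordinates `a` in the preferred chart at `x`. -/
def ofTangentCoord (x z : M) (a : R3) : TangentBundle (𝓡 3) M :=
  (trivializationAt R3 (TangentSpace (𝓡 3)) x).toOpenPartialHomeomorph.symm (z, a)

lemma extChartAt_mem_target {x z : M} (hz : z ∈ (chartAt R3 x).source) :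
    extChartAt (𝓡 3) x z ∈ (extChartAt (𝓡 3) x).target :=
  (extChartAt (𝓡 3) x).map_source (by rwa [extChartAt_source])

lemma extChartAt_symm_mem_source {x : M} {y : R3} (hy : y ∈ (extChartAt (𝓡 3) x).target) :
    (extChartAt (𝓡 3) x).symm y ∈ (chartAt R3 x).source := by
  have := (extChartAt (𝓡 3) x).map_target hy
  rwa [extChartAt_source] at this

lemma extChartAt_symm_extChartAt {x z : M} (hz : z ∈ (chartAt R3 x).source) :
    (extChartAt (𝓡 3) x).symm (extChartAt (𝓡 3) x z) = z :=
  (extChartAt (𝓡 3) x).left_inv (by rwa [extChartAt_source])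

lemma tangentCoord_eq_mfderiv {x z : M} (hz : z ∈ (chartAt R3 x).source)
    (v : TangentSpace (𝓡 3) z) :
    tangentCoord x ⟨z, v⟩ = mfderiv (𝓡 3) 𝓘(ℝ, R3) (extChartAt (𝓡 3) x) z v := by
  have h := congrArg (fun T => T v)
    (TangentBundle.continuousLinearMapAt_trivializationAt (I := 𝓡 3) hz)
  have h2 := Trivialization.continuousLinearMapAt_apply_of_mem (R := ℝ)
    (trivializationAt R3 (TangentSpace (𝓡 3)) x) (b := z) (by simpa using hz) v
  exact h2.symm.trans h

lemma trivializationAt_eq {x : M} {ζ : TangentBundle (𝓡 3) M}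
    (hz : ζ.proj ∈ (chartAt R3 x).source) :
    trivializationAt R3 (TangentSpace (𝓡 3)) x ζ = (ζ.proj, tangentCoord x ζ) :=
  Prod.ext (Trivialization.coe_fst' _ (by simpa using hz)) rfl

lemma ofTangentCoord_tangentCoord {x : M} {ζ : TangentBundle (𝓡 3) M}
    (hz : ζ.proj ∈ (chartAt R3 x).source) :
    ofTangentCoord x ζ.proj (tangentCoord x ζ) = ζ := by
  rw [ofTangentCoord, ← trivializationAt_eq hz]
  exact (trivializationAt R3 (TangentSpace (𝓡 3)) x).left_inv
    ((Trivialization.mem_source _).2 (by simpa using hz))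

lemma proj_ofTangentCoord {x z : M} (hz : z ∈ (chartAt R3 x).source) (a : R3) :
    (ofTangentCoord x z a).proj = z :=
  Trivialization.proj_symm_apply' _ (by simpa using hz)

lemma tangentCoord_ofTangentCoord {x z : M} (hz : z ∈ (chartAt R3 x).source) (a : R3) :
    tangentCoord x (ofTangentCoord x z a) = a := by
  have := (trivializationAt R3 (TangentSpace (𝓡 3)) x).right_inv (x := (z, a))
    ((Trivialization.mem_target _).2 (by simpa using hz))
  exact congrArg Prod.snd this

lemma tangentBundle_ext {x : M} {ζ ξ : TangentBundle (𝓡 3) M}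
    (hζ : ζ.proj ∈ (chartAt R3 x).source) (hp : ζ.proj = ξ.proj)
    (h : tangentCoord x ζ = tangentCoord x ξ) : ζ = ξ := by
  rw [← ofTangentCoord_tangentCoord hζ, ← ofTangentCoord_tangentCoord (ζ := ξ) (hp ▸ hζ), hp, h]

lemma continuousOn_tangentCoord (x : M) :
    ContinuousOn (tangentCoord x) {ζ : TangentBundle (𝓡 3) M | ζ.proj ∈ (chartAt R3 x).source} := by
  have h := (trivializationAt R3 (TangentSpace (𝓡 3)) x).continuousOn
  refine (continuous_snd.comp_continuousOn h).mono ?_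
  intro ζ hζ
  exact (Trivialization.mem_source _).2 (by simpa using hζ)

lemma isOpen_proj_chart_source (x : M) :
    IsOpen {ζ : TangentBundle (𝓡 3) M | ζ.proj ∈ (chartAt R3 x).source} :=
  (chartAt R3 x).open_source.preimage (FiberBundle.continuous_proj R3 (TangentSpace (𝓡 3)))

lemma continuousAt_tangentCoord {x : M} {ζ : TangentBundle (𝓡 3) M}
    (hζ : ζ.proj ∈ (chartAt R3 x).source) : ContinuousAt (tangentCoord x) ζ :=
  (continuousOn_tangentCoord x).continuousAt ((isOpen_proj_chart_source x).mem_nhds hζ)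

lemma continuousOn_ofTangentCoord (x : M) :
    ContinuousOn (fun q : M × R3 => ofTangentCoord x q.1 q.2)
      ((chartAt R3 x).source ×ˢ univ) := by
  refine (trivializationAt R3 (TangentSpace (𝓡 3))
    x).toOpenPartialHomeomorph.continuousOn_symm.mono ?_
  intro q hq
  exact (Trivialization.mem_target _).2 (by simpa using hq.1)

lemma tangentCoord_add {x z : M} (hz : z ∈ (chartAt R3 x).source) (v w : TangentSpace (𝓡 3) z) :
    tangentCoord x ⟨z, v + w⟩ = tangentCoord x ⟨z, v⟩ + tangentCoord x ⟨z, w⟩ := by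
  rw [tangentCoord_eq_mfderiv hz, tangentCoord_eq_mfderiv hz, tangentCoord_eq_mfderiv hz]
  exact map_add _ _ _

lemma tangentCoord_smul {x z : M} (hz : z ∈ (chartAt R3 x).source) (c : ℝ)
    (v : TangentSpace (𝓡 3) z) :
    tangentCoord x ⟨z, c • v⟩ = c • tangentCoord x ⟨z, v⟩ := by
  rw [tangentCoord_eq_mfderiv hz, tangentCoord_eq_mfderiv hz]
  exact map_smul _ _ _

lemma tangentCoord_zero {x z : M} (hz : z ∈ (chartAt R3 x).source) :
    tangentCoord x ⟨z, 0⟩ = 0 := by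
  rw [tangentCoord_eq_mfderiv hz]
  exact map_zero _

lemma mdifferentiableAt_extChartAt_symm {x : M} {y : R3} (hy : y ∈ (extChartAt (𝓡 3) x).target) :
    MDifferentiableAt 𝓘(ℝ, R3) (𝓡 3) (extChartAt (𝓡 3) x).symm y := by
  have := mdifferentiableWithinAt_extChartAt_symm (I := 𝓡 3) hy
  rwa [ModelWithCorners.range_eq_univ, mdifferentiableWithinAt_univ] at this

lemma mfderiv_extChartAt_symm_apply {x : M} {y : R3} (hy : y ∈ (extChartAt (𝓡 3) x).target)
    (a : R3) :
    (⟨(extChartAt (𝓡 3) x).symm y, mfderiv 𝓘(ℝ, R3) (𝓡 3) (extChartAt (𝓡 3) x).symm y a⟩ :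
      TangentBundle (𝓡 3) M) = ofTangentCoord x ((extChartAt (𝓡 3) x).symm y) a := by
  have hs := extChartAt_symm_mem_source hy
  refine tangentBundle_ext (x := x) hs (proj_ofTangentCoord hs a).symm ?_
  rw [tangentCoord_ofTangentCoord hs, tangentCoord_eq_mfderiv hs]
  have := mfderiv_extChartAt_comp_mfderivWithin_extChartAt_symm (I := 𝓡 3) hy
  rw [ModelWithCorners.range_eq_univ, mfderivWithin_univ] at this
  exact congrArg (fun T => T a) this

lemma tangentCoord_velocity {x : M} {γ : ℝ → M} {t : ℝ}
    (hγ : MDifferentiableAt 𝓘(ℝ, ℝ) (𝓡 3) γ t) (hz : γ t ∈ (chartAt R3 x).source) :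
    tangentCoord x ⟨γ t, mfderiv 𝓘(ℝ, ℝ) (𝓡 3) γ t (1 : ℝ)⟩ =
      deriv (fun s => extChartAt (𝓡 3) x (γ s)) t := by
  rw [tangentCoord_eq_mfderiv hz]
  have h := mfderiv_comp t (mdifferentiableAt_extChartAt (I := 𝓡 3) hz) hγ
  rw [← fderiv_apply_one_eq_deriv, ← mfderiv_eq_fderiv]
  exact (congrArg (fun T => T (1 : ℝ)) h).symm

end Coordinates

section Metric

variable [RiemannianBundle (fun x : M => TangentSpace (𝓡 3) x)]

/-- The metric in the preferred chart at `x`, as a field of bilinear forms. -/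
def chartGram (x : M) (y : R3) : R3 →L[ℝ] R3 →L[ℝ] ℝ :=
  let D : R3 →L[ℝ] TangentSpace (𝓡 3) ((extChartAt (𝓡 3) x).symm y) :=
    mfderiv 𝓘(ℝ, R3) (𝓡 3) (extChartAt (𝓡 3) x).symm y
  pullbackInner D.toLinearMap

lemma chartGram_apply (x : M) (y a b : R3) : chartGram x y a b = chartMetric x y a b := rfl

lemma chartGram_symm (x : M) (y a b : R3) : chartGram x y a b = chartGram x y b a := by
  simp only [chartGram_apply, chartMetric]
  exact real_inner_comm _ _

lemma chartGram_tangentCoord {x : M} {z : M} (hz : z ∈ (chartAt R3 x).source)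
    (v w : TangentSpace (𝓡 3) z) :
    chartGram x (extChartAt (𝓡 3) x z) (tangentCoord x ⟨z, v⟩) (tangentCoord x ⟨z, w⟩) =
      inner ℝ v w := by
  have hy := extChartAt_mem_target hz
  -- The coordinate metric at `y` is built on the tangent space at the inverse image of `y`, which
  -- is equal, but not definitionally, to `z`. The identity is proved there for all `y` and only
  -- then specialized.
  have key : ∀ (y : R3) (hy : y ∈ (extChartAt (𝓡 3) x).target)
      (v' w' : TangentSpace (𝓡 3) ((extChartAt (𝓡 3) x).symm y)),
      chartGram x y (tangentCoord x ⟨_, v'⟩) (tangentCoord x ⟨_, w'⟩) = inner ℝ v' w' := by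
    intro y hy v' w'
    have hs := extChartAt_symm_mem_source hy
    have h1 : ∀ v' : TangentSpace (𝓡 3) ((extChartAt (𝓡 3) x).symm y),
        mfderiv 𝓘(ℝ, R3) (𝓡 3) (extChartAt (𝓡 3) x).symm y (tangentCoord x ⟨_, v'⟩) = v' := by
      intro v'
      have h2 := mfderiv_extChartAt_symm_apply hy (tangentCoord x ⟨_, v'⟩)
      rw [ofTangentCoord_tangentCoord (ζ := ⟨_, v'⟩) hs] at h2
      exact eq_of_heq (TotalSpace.mk.inj h2).2
    exact congrArg₂ (fun a b => inner ℝ a b) (h1 v') (h1 w')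
  have := key _ hy
  rw [extChartAt_symm_extChartAt hz] at this
  exact this v w

lemma chartGram_pos {x : M} {y : R3} (hy : y ∈ (extChartAt (𝓡 3) x).target) {a : R3}
    (ha : a ≠ 0) : 0 < chartGram x y a a := by
  have hs := extChartAt_symm_mem_source hy
  rw [chartGram_apply, chartMetric, real_inner_self_pos]
  intro h
  have h2 := mfderiv_extChartAt_symm_apply hy a
  have h3 := congrArg (tangentCoord x) h2
  rw [tangentCoord_ofTangentCoord hs] at h3
  refine ha (h3.symm.trans ((congrArg (fun v => tangentCoord x ⟨_, v⟩) h).trans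
    (tangentCoord_zero hs)))

variable [IsContMDiffRiemannianBundle (𝓡 3) ∞ R3 (fun x : M => TangentSpace (𝓡 3) x)]

/-- In finite dimension it suffices to evaluate on fixed vectors `a` and `b`. Fields with constant
coordinates are smooth sections, being the inverse trivialization along a fixed vector, and the
metric of two smooth sections is smooth. -/
lemma contDiffOn_chartGram (x : M) :
    ContDiffOn ℝ ∞ (chartGram x) (extChartAt (𝓡 3) x).target := by
  have key : ∀ a : R3, ContMDiffOn 𝓘(ℝ, R3) (𝓡 3).tangent ∞
      (fun y => (⟨(extChartAt (𝓡 3) x).symm y,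
        mfderiv 𝓘(ℝ, R3) (𝓡 3) (extChartAt (𝓡 3) x).symm y a⟩ : TangentBundle (𝓡 3) M))
      (extChartAt (𝓡 3) x).target := by
    intro a
    have h1 := (trivializationAt R3 (TangentSpace (𝓡 3)) x).contMDiffOn_symm (n := ∞) (IB := 𝓡 3)
    have h2 : ContMDiffOn 𝓘(ℝ, R3) ((𝓡 3).prod 𝓘(ℝ, R3)) ∞
        (fun y => ((extChartAt (𝓡 3) x).symm y, a)) (extChartAt (𝓡 3) x).target :=
      (contMDiffOn_extChartAt_symm x).prodMk contMDiffOn_const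
    refine (h1.comp h2 ?_).congr fun y hy => mfderiv_extChartAt_symm_apply hy a
    intro y hy
    rw [mem_preimage, Trivialization.mem_target]
    simpa using extChartAt_symm_mem_source hy
  rw [contDiffOn_clm_apply]
  intro a
  rw [contDiffOn_clm_apply]
  intro b
  simp only [chartGram_apply]
  rw [← contMDiffOn_iff_contDiffOn]
  exact (key a).inner_bundle (key b)

end Metric

end ChartMetric

/-! ### The geodesic equation in coordinates and its invariance. -/

noncomputable section EulerLagrange

set_option synthInstance.maxHeartbeats 400000
set_option maxHeartbeats 1000000

section BilinearDerivatives

variable {V : Type*} [NormedAddCommGroup V] [NormedSpace ℝ V]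

lemma HasFDerivAt.bilin_apply {B : V → R3 →L[ℝ] R3 →L[ℝ] ℝ} {B' : V →L[ℝ] R3 →L[ℝ] R3 →L[ℝ] ℝ}
    {f g : V → R3} {f' g' : V →L[ℝ] R3} {x : V} (hB : HasFDerivAt B B' x)
    (hf : HasFDerivAt f f' x) (hg : HasFDerivAt g g' x) :
    HasFDerivAt (fun y => B y (f y) (g y))
      ((B x (f x)) ∘L g' + ((B x).flip (g x)) ∘L f' + (B'.flip (f x)).flip (g x)) x := by
  have h1 := HasFDerivAt.clm_apply (c := B) hB hf
  have h2 := HasFDerivAt.clm_apply (c := fun y => B y (f y)) h1 hg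
  refine h2.congr_fderiv ?_
  ext v
  simp [add_assoc]

lemma HasDerivAt.bilin_apply {B : R3 → R3 →L[ℝ] R3 →L[ℝ] ℝ} {c f g : ℝ → R3} {c' f' g' : R3}
    {t : ℝ} (hB : DifferentiableAt ℝ B (c t)) (hc : HasDerivAt c c' t) (hf : HasDerivAt f f' t)
    (hg : HasDerivAt g g' t) :
    HasDerivAt (fun s => B (c s) (f s) (g s))
      (fderiv ℝ B (c t) c' (f t) (g t) + B (c t) f' (g t) + B (c t) (f t) g') t := by
  have h0 := HasFDerivAt.comp (g := B) (f := c) t hB.hasFDerivAt hc.hasFDerivAt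
  have h := (HasFDerivAt.bilin_apply h0 hf.hasFDerivAt hg.hasFDerivAt).hasDerivAt
  refine h.congr_deriv ?_
  simp
  ring

end BilinearDerivatives

/-- The Euler-Lagrange equation of the energy of the metric `G`, at time `t`, for the curve `c`. -/
def EulerLagrangeAt (G : R3 → R3 →L[ℝ] R3 →L[ℝ] ℝ) (c : ℝ → R3) (t : ℝ) : Prop :=
  ∀ a : R3, deriv (fun s => G (c s) (deriv c s) a) t =
    (1 / 2 : ℝ) * fderiv ℝ (fun y => G y (deriv c t) (deriv c t)) (c t) a

/-- The covector whose dual is the geodesic acceleration. -/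
def geodesicForce (G : R3 → R3 →L[ℝ] R3 →L[ℝ] ℝ) (z : R3 × R3) : R3 →L[ℝ] ℝ :=
  (1 / 2 : ℝ) • ((fderiv ℝ G z.1).flip z.2).flip z.2 - fderiv ℝ G z.1 z.2 z.2

/-- The geodesic acceleration. -/
def geodesicAccel (G : R3 → R3 →L[ℝ] R3 →L[ℝ] ℝ) (z : R3 × R3) : R3 :=
  (G z.1).inverse (geodesicForce G z)

variable {G : R3 → R3 →L[ℝ] R3 →L[ℝ] ℝ}

lemma geodesicForce_apply (z : R3 × R3) (a : R3) :
    geodesicForce G z a = (1 / 2 : ℝ) * fderiv ℝ G z.1 a z.2 z.2 - fderiv ℝ G z.1 z.2 z.2 a := by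
  simp [geodesicForce]

/-- The force is quadratic in the velocity and the metric does not involve it. This homogeneity
later allows long times to be traded for large velocities. -/
lemma geodesicAccel_smul (y w : R3) (ε : ℝ) :
    geodesicAccel G (y, ε • w) = (ε ^ 2) • geodesicAccel G (y, w) := by
  rw [geodesicAccel, geodesicAccel, ← map_smul]
  congr 1
  ext a
  rw [smul_apply, geodesicForce_apply, geodesicForce_apply]
  simp only [map_smul, smul_apply, smul_eq_mul]
  ring

lemma isInvertible_of_posDef (B : R3 →L[ℝ] R3 →L[ℝ] ℝ) (hB : ∀ a, a ≠ 0 → 0 < B a a) :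
    B.IsInvertible := by
  have hinj : Function.Injective (B : R3 →ₗ[ℝ] R3 →L[ℝ] ℝ) := by
    rw [← LinearMap.ker_eq_bot, LinearMap.ker_eq_bot']
    intro a ha
    by_contra h
    have h1 := hB a h
    have h2 : B a = 0 := ha
    rw [h2] at h1
    simp at h1
  have hdim : Module.finrank ℝ R3 = Module.finrank ℝ (R3 →L[ℝ] ℝ) := by
    have e1 : Module.finrank ℝ (R3 →L[ℝ] ℝ) = Module.finrank ℝ (R3 →ₗ[ℝ] ℝ) :=
      (LinearMap.toContinuousLinearMap (𝕜 := ℝ) (E := R3) (F' := ℝ)).finrank_eq.symm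
    rw [e1, Module.finrank_linearMap]; simp
  let e := LinearEquiv.ofInjectiveOfFinrankEq (B : R3 →ₗ[ℝ] R3 →L[ℝ] ℝ) hinj hdim
  exact ⟨e.toContinuousLinearEquiv, by ext a; rfl⟩

/-- With `w` the velocity, the product rule turns the left side into `DG(w)(w, a) + G(A, a)`, so the
equation says that `G(A, ·)` is `geodesicForce`. A positive definite form is invertible as a map to
covectors, which puts the equation in explicit form. -/
lemma eulerLagrangeAt_iff {c : ℝ → R3} {t : ℝ} {A : R3}
    (hG : DifferentiableAt ℝ G (c t)) (hpos : ∀ a, a ≠ 0 → 0 < G (c t) a a)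
    (hc : DifferentiableAt ℝ c t) (hA : HasDerivAt (deriv c) A t) :
    EulerLagrangeAt G c t ↔ A = geodesicAccel G (c t, deriv c t) := by
  have h1 : ∀ a, deriv (fun s => G (c s) (deriv c s) a) t =
      fderiv ℝ G (c t) (deriv c t) (deriv c t) a + G (c t) A a := by
    intro a
    have h := HasDerivAt.bilin_apply hG hc.hasDerivAt hA (hasDerivAt_const t a)
    simpa using h.deriv
  have h2 : ∀ a, fderiv ℝ (fun y => G y (deriv c t) (deriv c t)) (c t) a =
      fderiv ℝ G (c t) a (deriv c t) (deriv c t) := by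
    intro a
    have h := HasFDerivAt.bilin_apply hG.hasFDerivAt (hasFDerivAt_const (deriv c t) (c t))
      (hasFDerivAt_const (deriv c t) (c t))
    rw [h.fderiv]
    simp
  have hinv := isInvertible_of_posDef _ hpos
  have h3 : EulerLagrangeAt G c t ↔ G (c t) A = geodesicForce G (c t, deriv c t) := by
    rw [ContinuousLinearMap.ext_iff]
    refine forall_congr' fun a => ?_
    rw [h1, h2, geodesicForce_apply]
    constructor <;> intro h <;> linarith
  rw [h3]
  obtain ⟨e, he⟩ := hinv
  rw [geodesicAccel, ← he, ContinuousLinearMap.inverse_equiv]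
  exact ⟨fun h => by rw [← h]; simp, fun h => by rw [h]; simp⟩

lemma ContDiffOn.fderiv_fst_apply {Y : Type*} [NormedAddCommGroup Y] [NormedSpace ℝ Y]
    {H : R3 → Y} {U : Set R3} (hU : IsOpen U) {n : ℕ} (hH : ContDiffOn ℝ ∞ H U)
    {f : R3 × R3 → R3} (hf : ContDiff ℝ n f) :
    ContDiffOn ℝ n (fun z : R3 × R3 => fderiv ℝ H z.1 (f z)) (U ×ˢ univ) := by
  have h1 : ContDiffOn ℝ n (fderiv ℝ H) U := hH.fderiv_of_isOpen hU (by exact_mod_cast le_top)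
  exact (h1.comp contDiffOn_fst fun z hz => hz.1).clm_apply hf.contDiffOn

lemma contDiffOn_geodesicForce {U : Set R3} (hU : IsOpen U) (hG : ContDiffOn ℝ ∞ G U) (n : ℕ) :
    ContDiffOn ℝ n (geodesicForce G) (U ×ˢ univ) := by
  rw [contDiffOn_clm_apply]
  intro a
  simp only [geodesicForce_apply]
  have h2 : ContDiffOn ℝ n (fun z : R3 × R3 => z.2) (U ×ˢ univ) := contDiffOn_snd
  have h3 := ((ContDiffOn.fderiv_fst_apply hU (n := n) hG (f := fun _ => a)
    contDiff_const).clm_apply h2).clm_apply h2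
  have h4 := ((ContDiffOn.fderiv_fst_apply hU (n := n) hG contDiff_snd).clm_apply h2).clm_apply
    (contDiffOn_const (c := a))
  exact (contDiffOn_const.mul h3).sub h4

lemma contDiffOn_geodesicAccel {U : Set R3} (hU : IsOpen U) (hG : ContDiffOn ℝ ∞ G U)
    (hpos : ∀ y ∈ U, ∀ a, a ≠ 0 → 0 < G y a a) (n : ℕ) :
    ContDiffOn ℝ n (geodesicAccel G) (U ×ˢ univ) := by
  have hinv : ContDiffOn ℝ n (fun z : R3 × R3 => (G z.1).inverse) (U ×ˢ univ) := by
    intro z hz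
    have hG1 : ContDiffWithinAt ℝ n (fun z : R3 × R3 => G z.1) (U ×ˢ univ) z :=
      (hG.of_le (by exact_mod_cast le_top)).comp contDiffOn_fst (fun z hz => hz.1) z hz
    obtain ⟨e, he⟩ := isInvertible_of_posDef _ (hpos z.1 hz.1)
    have h := contDiffAt_map_inverse (𝕜 := ℝ) (n := n) e
    rw [he] at h
    exact ContDiffAt.comp_contDiffWithinAt (g := ContinuousLinearMap.inverse)
      (f := fun z : R3 × R3 => G z.1) z h hG1
  exact hinv.clm_apply (contDiffOn_geodesicForce hU hG n)

lemma geodesicAccel_zero (y : R3) : geodesicAccel G (y, 0) = 0 := by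
  have := geodesicAccel_smul (G := G) y 0 0
  simpa using this

/-- The acceleration is zero along the zero section and equals `s²` times a constant along `s ↦ (y,
s • b)`, so both partial derivatives vanish at a zero vector. -/
lemma hasFDerivAt_geodesicAccel_zero {y : R3} (h0 : DifferentiableAt ℝ (geodesicAccel G) (y, 0)) :
    HasFDerivAt (geodesicAccel G) (0 : R3 × R3 →L[ℝ] R3) (y, 0) := by
  have hd := h0.hasFDerivAt
  suffices h : fderiv ℝ (geodesicAccel G) (y, 0) = 0 by rwa [h] at hd
  have h1 : ∀ a, fderiv ℝ (geodesicAccel G) (y, 0) (a, 0) = 0 := by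
    intro a
    have h := hd.comp y (hasFDerivAt_prodMk_left (𝕜 := ℝ) y (0 : R3))
    have h' : HasFDerivAt (geodesicAccel G ∘ fun y' => (y', (0 : R3))) (0 : R3 →L[ℝ] R3) y := by
      have : (geodesicAccel G ∘ fun y' => (y', (0 : R3))) = fun _ => 0 := funext geodesicAccel_zero
      rw [this]
      exact hasFDerivAt_const _ _
    simpa using congrArg (fun T => T a) (h.unique h')
  have h2 : ∀ b, fderiv ℝ (geodesicAccel G) (y, 0) (0, b) = 0 := by
    intro b
    have hline : HasDerivAt (fun s : ℝ => (y, s • b)) ((0 : R3), b) 0 := by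
      have := (hasDerivAt_id (0 : ℝ)).smul_const b
      exact (hasDerivAt_const (0 : ℝ) y).prodMk (by simpa using this)
    have hd' : HasFDerivAt (geodesicAccel G) (fderiv ℝ (geodesicAccel G) (y, 0))
        (y, (0 : ℝ) • b) := by simpa using hd
    have h := hd'.comp_hasDerivAt (0 : ℝ) hline
    have h' : HasDerivAt (geodesicAccel G ∘ fun s : ℝ => (y, s • b)) 0 0 := by
      have e : (geodesicAccel G ∘ fun s : ℝ => (y, s • b)) =
          fun s => (s ^ 2) • geodesicAccel G (y, b) := funext fun s => geodesicAccel_smul y b s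
      rw [e]
      have := (hasDerivAt_pow 2 (0 : ℝ)).smul_const (geodesicAccel G (y, b))
      simpa using this
    exact h.unique h'
  refine ContinuousLinearMap.ext fun ⟨a, b⟩ => ?_
  have : ((a, b) : R3 × R3) = (a, 0) + (0, b) := by simp
  rw [this, map_add, h1, h2]
  simp

/-- The Euler-Lagrange equation does not depend on the coordinates. -/
lemma EulerLagrangeAt.of_change {G₁ G₂ : R3 → R3 →L[ℝ] R3 →L[ℝ] ℝ} {ψ : R3 → R3}
    {c₁ c₂ : ℝ → R3} {t : ℝ}
    (hψ : ContDiffAt ℝ 2 ψ (c₁ t)) (hc₁ : ContDiffAt ℝ 2 c₁ t)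
    (hc : c₂ =ᶠ[𝓝 t] ψ ∘ c₁)
    (hG : ∀ᶠ y in 𝓝 (c₁ t), ∀ a b, G₁ y a b = G₂ (ψ y) (fderiv ℝ ψ y a) (fderiv ℝ ψ y b))
    (hG₂ : DifferentiableAt ℝ G₂ (ψ (c₁ t))) (hsymm : ∀ y a b, G₂ y a b = G₂ y b a)
    (h : EulerLagrangeAt G₂ c₂ t) : EulerLagrangeAt G₁ c₁ t := by
  intro a
  have hct : Tendsto c₁ (𝓝 t) (𝓝 (c₁ t)) := hc₁.continuousAt
  set w := deriv c₁ t with hw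
  have hψd : ∀ᶠ y in 𝓝 (c₁ t), DifferentiableAt ℝ ψ y :=
    (hψ.eventually (by simp)).mono fun y hy => hy.differentiableAt (by simp)
  have hcd : ∀ᶠ s in 𝓝 t, DifferentiableAt ℝ c₁ s :=
    (hc₁.eventually (by simp)).mono fun y hy => hy.differentiableAt (by simp)
  have hderiv : ∀ᶠ s in 𝓝 t, deriv c₂ s = fderiv ℝ ψ (c₁ s) (deriv c₁ s) := by
    filter_upwards [hc.eventually_nhds, hct.eventually hψd, hcd] with s h1 h2 h3
    rw [Filter.EventuallyEq.deriv_eq h1]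
    exact (h2.hasFDerivAt.comp_hasDerivAt s h3.hasDerivAt).deriv
  have hct2 : c₂ t = ψ (c₁ t) := hc.self_of_nhds
  have hψ2 : HasFDerivAt (fderiv ℝ ψ) (fderiv ℝ (fderiv ℝ ψ) (c₁ t)) (c₁ t) :=
    ((hψ.fderiv_right (m := 1) (by norm_num)).differentiableAt (by simp)).hasFDerivAt
  have hS : ∀ u v, fderiv ℝ (fderiv ℝ ψ) (c₁ t) u v = fderiv ℝ (fderiv ℝ ψ) (c₁ t) v u :=
    fun u v => (hψ.isSymmSndFDerivAt (by simp)).eq u v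
  have hc1' : HasDerivAt (deriv c₁) (deriv (deriv c₁) t) t := by
    have h1 : ContDiffAt ℝ 1 (fderiv ℝ c₁) t := hc₁.fderiv_right (m := 1) (by norm_num)
    have h2 : DifferentiableAt ℝ (deriv c₁) t := by
      have := (h1.differentiableAt (by simp)).clm_apply (differentiableAt_const (1 : ℝ))
      simpa [fderiv_apply_one_eq_deriv] using this
    exact h2.hasDerivAt
  have hP : HasDerivAt (fun s => fderiv ℝ ψ (c₁ s)) (fderiv ℝ (fderiv ℝ ψ) (c₁ t) w) t :=
    HasFDerivAt.comp_hasDerivAt (l := fderiv ℝ ψ) (f := c₁) t hψ2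
      (hc₁.differentiableAt (by simp)).hasDerivAt
  have hPa : HasDerivAt (fun s => fderiv ℝ ψ (c₁ s) a) (fderiv ℝ (fderiv ℝ ψ) (c₁ t) w a) t := by
    simpa using hP.clm_apply (hasDerivAt_const t a)
  have hc2 : HasDerivAt c₂ (deriv c₂ t) t := by
    have := (hψd.self_of_nhds.hasFDerivAt.comp_hasDerivAt t hcd.self_of_nhds.hasDerivAt)
    exact (this.congr_of_eventuallyEq hc).differentiableAt.hasDerivAt
  have hc2' : HasDerivAt (deriv c₂) (deriv (deriv c₂) t) t := by
    have := (hP.clm_apply hc1').congr_of_eventuallyEq hderiv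
    exact this.differentiableAt.hasDerivAt
  have hG₂' : DifferentiableAt ℝ G₂ (c₂ t) := by rwa [hct2]
  have hw2 : deriv c₂ t = fderiv ℝ ψ (c₁ t) w := hderiv.self_of_nhds
  -- In the second chart the fixed vector `a` becomes `Dψ(c₁ s) a`, which moves with `s`, whereas
  -- the equation for `c₂` is known for frozen vectors. The discrepancy is the term `G₂(c₂', D²ψ(w,
  -- a))`. On the right side, half the derivative of the pulled back energy contains `D²ψ(a, w)`
  -- once in each slot of `G₂`. The symmetries of `D²ψ` and of `G₂` make the two contributions
  -- equal.
  have e1 : (fun s => G₁ (c₁ s) (deriv c₁ s) a) =ᶠ[𝓝 t]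
      fun s => G₂ (c₂ s) (deriv c₂ s) (fderiv ℝ ψ (c₁ s) a) := by
    filter_upwards [hct.eventually hG, hderiv, hc] with s h1 h2 h3
    rw [h1, h2, h3]
    rfl
  have d1 := HasDerivAt.bilin_apply hG₂' hc2 hc2' hPa
  have d2 := HasDerivAt.bilin_apply hG₂' hc2 hc2' (hasDerivAt_const t (fderiv ℝ ψ (c₁ t) a))
  have e2 : (fun y => G₁ y w w) =ᶠ[𝓝 (c₁ t)]
      fun y => G₂ (ψ y) (fderiv ℝ ψ y w) (fderiv ℝ ψ y w) := by
    filter_upwards [hG] with y hy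
    exact hy w w
  have hGψ : HasFDerivAt (fun y => G₂ (ψ y))
      (fderiv ℝ G₂ (ψ (c₁ t)) ∘L fderiv ℝ ψ (c₁ t)) (c₁ t) := HasFDerivAt.comp (g := G₂) (f := ψ) (c₁ t) hG₂.hasFDerivAt
    hψd.self_of_nhds.hasFDerivAt
  have hψw : HasFDerivAt (fun y => fderiv ℝ ψ y w) ((fderiv ℝ (fderiv ℝ ψ) (c₁ t)).flip w)
      (c₁ t) := by
    have := hψ2.clm_apply (hasFDerivAt_const w (c₁ t))
    simpa using this
  have d3 := HasFDerivAt.bilin_apply hGψ hψw hψw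
  have d4 := HasFDerivAt.bilin_apply hG₂'.hasFDerivAt (hasFDerivAt_const (deriv c₂ t) (c₂ t))
    (hasFDerivAt_const (deriv c₂ t) (c₂ t))
  have hel := h (fderiv ℝ ψ (c₁ t) a)
  rw [d2.deriv, d4.fderiv] at hel
  rw [e1.deriv_eq, d1.deriv, e2.fderiv_eq, d3.fderiv]
  simp only [hct2, hw2, ContinuousLinearMap.comp_zero, zero_add, add_apply,
    ContinuousLinearMap.comp_apply, ContinuousLinearMap.flip_apply, map_zero,
    add_zero] at hel ⊢
  rw [hel, hS w a, hsymm _ (fderiv ℝ (fderiv ℝ ψ) (c₁ t) a w)]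
  ring

end EulerLagrange

/-! ### Geodesics as orbits of the spray, and their uniqueness. -/

noncomputable section Geodesics

set_option linter.unusedSectionVars false
set_option synthInstance.maxHeartbeats 400000
set_option maxHeartbeats 1000000

variable {M : Type u} [TopologicalSpace M] [ChartedSpace R3 M] [IsManifold (𝓡 3) ∞ M]
  [RiemannianBundle (fun x : M => TangentSpace (𝓡 3) x)]

lemma two_le_infty : (2 : WithTop ℕ∞) ≤ ∞ :=
  WithTop.coe_le_coe.2 (le_top : (2 : ℕ∞) ≤ ⊤)

/-- The transition map between two preferred charts. -/
def chartTransition (x₁ x₂ : M) (y : R3) : R3 :=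
  extChartAt (𝓡 3) x₂ ((extChartAt (𝓡 3) x₁).symm y)

lemma contDiffAt_chartTransition {x₁ x₂ : M} {y : R3} (hy : y ∈ (extChartAt (𝓡 3) x₁).target)
    (hy₂ : (extChartAt (𝓡 3) x₁).symm y ∈ (chartAt R3 x₂).source) :
    ContDiffAt ℝ ∞ (chartTransition x₁ x₂) y := by
  rw [← contMDiffAt_iff_contDiffAt]
  have h1 : ContMDiffAt 𝓘(ℝ, R3) (𝓡 3) ∞ (extChartAt (𝓡 3) x₁).symm y :=
    (contMDiffOn_extChartAt_symm x₁).contMDiffAt ((isOpen_extChartAt_target x₁).mem_nhds hy)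
  exact (contMDiffAt_extChartAt' hy₂).comp y h1

lemma fderiv_chartTransition {x₁ x₂ : M} {y : R3} (hy : y ∈ (extChartAt (𝓡 3) x₁).target)
    (hy₂ : (extChartAt (𝓡 3) x₁).symm y ∈ (chartAt R3 x₂).source) (a : R3) :
    fderiv ℝ (chartTransition x₁ x₂) y a =
      tangentCoord x₂ ⟨(extChartAt (𝓡 3) x₁).symm y,
        mfderiv 𝓘(ℝ, R3) (𝓡 3) (extChartAt (𝓡 3) x₁).symm y a⟩ := by
  rw [tangentCoord_eq_mfderiv hy₂]
  have h := mfderiv_comp y (mdifferentiableAt_extChartAt (I := 𝓡 3) hy₂)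
    (mdifferentiableAt_extChartAt_symm hy)
  rw [← mfderiv_eq_fderiv]
  exact congrArg (fun T => T a) h

lemma chartGram_chartTransition {x₁ x₂ : M} {y : R3} (hy : y ∈ (extChartAt (𝓡 3) x₁).target)
    (hy₂ : (extChartAt (𝓡 3) x₁).symm y ∈ (chartAt R3 x₂).source) (a b : R3) :
    chartGram x₁ y a b = chartGram x₂ (chartTransition x₁ x₂ y)
      (fderiv ℝ (chartTransition x₁ x₂) y a) (fderiv ℝ (chartTransition x₁ x₂) y b) := by
  rw [fderiv_chartTransition hy hy₂, fderiv_chartTransition hy hy₂]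
  exact (chartGram_tangentCoord hy₂ _ _).symm

variable [IsContMDiffRiemannianBundle (𝓡 3) ∞ R3 (fun x : M => TangentSpace (𝓡 3) x)]

lemma contDiffAt_chartGram {x : M} {y : R3} (hy : y ∈ (extChartAt (𝓡 3) x).target) :
    ContDiffAt ℝ ∞ (chartGram x) y :=
  (contDiffOn_chartGram x).contDiffAt ((isOpen_extChartAt_target x).mem_nhds hy)

lemma contDiffAt_extChartAt_curve {x : M} {γ : ℝ → M} {t : ℝ} {n : ℕ∞}
    (hγ : ContMDiffAt 𝓘(ℝ, ℝ) (𝓡 3) n γ t) (hz : γ t ∈ (chartAt R3 x).source) :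
    ContDiffAt ℝ n (fun s => extChartAt (𝓡 3) x (γ s)) t := by
  rw [← contMDiffAt_iff_contDiffAt]
  exact ContMDiffAt.comp (g := extChartAt (𝓡 3) x) (f := γ) t
    ((contMDiffAt_extChartAt' (n := ∞) hz).of_le (WithTop.coe_le_coe.2 le_top)) hγ

/-- The definition of a geodesic uses at time `t` the chart centred at `γ t`, which varies with `t`.
To obtain one differential equation, it is transported to a fixed chart; the transition map is an
isometry of the coordinate metrics, so `EulerLagrangeAt.of_change` applies. -/
lemma eulerLagrangeAt_of_chart {x₁ x₂ : M} {γ : ℝ → M} {t : ℝ}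
    (hγ : ContMDiffAt 𝓘(ℝ, ℝ) (𝓡 3) 2 γ t) (h₁ : γ t ∈ (chartAt R3 x₁).source)
    (h₂ : γ t ∈ (chartAt R3 x₂).source)
    (h : EulerLagrangeAt (chartGram x₂) (fun s => extChartAt (𝓡 3) x₂ (γ s)) t) :
    EulerLagrangeAt (chartGram x₁) (fun s => extChartAt (𝓡 3) x₁ (γ s)) t := by
  have hy := extChartAt_mem_target h₁
  have hy₂ : (extChartAt (𝓡 3) x₁).symm (extChartAt (𝓡 3) x₁ (γ t)) ∈ (chartAt R3 x₂).source := by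
    rwa [extChartAt_symm_extChartAt h₁]
  have hcont : ContinuousAt (extChartAt (𝓡 3) x₁).symm (extChartAt (𝓡 3) x₁ (γ t)) :=
    continuousAt_extChartAt_symm'' hy
  refine EulerLagrangeAt.of_change (ψ := chartTransition x₁ x₂)
    ((contDiffAt_chartTransition hy hy₂).of_le two_le_infty)
    (contDiffAt_extChartAt_curve hγ h₁) ?_ ?_ ?_ (chartGram_symm x₂) h
  · filter_upwards [hγ.continuousAt.eventually ((chartAt R3 x₁).open_source.mem_nhds h₁)] with s hs
    simp only [Function.comp_apply, chartTransition, extChartAt_symm_extChartAt hs]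
  · filter_upwards [(isOpen_extChartAt_target x₁).mem_nhds hy,
      hcont.eventually ((chartAt R3 x₂).open_source.mem_nhds hy₂)] with y h1 h2 a b
    exact chartGram_chartTransition h1 h2 a b
  · refine (contDiffAt_chartGram ?_).differentiableAt (by simp)
    exact extChartAt_mem_target hy₂

lemma isGeodesicOn_iff {γ : ℝ → M} {s : Set ℝ} :
    IsGeodesicOn γ s ↔ ContMDiffOn 𝓘(ℝ, ℝ) (𝓡 3) 2 γ s ∧
      ∀ t ∈ s, EulerLagrangeAt (chartGram (γ t)) (fun s => extChartAt (𝓡 3) (γ t) (γ s)) t :=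
  Iff.rfl

lemma ContDiffAt.hasDerivAt_deriv {c : ℝ → R3} {t : ℝ} (hc : ContDiffAt ℝ 2 c t) :
    HasDerivAt (deriv c) (deriv (deriv c) t) t := by
  have h1 : ContDiffAt ℝ 1 (fderiv ℝ c) t := hc.fderiv_right (m := 1) (by norm_num)
  have h2 : DifferentiableAt ℝ (deriv c) t := by
    have := (h1.differentiableAt (by simp)).clm_apply (differentiableAt_const (1 : ℝ))
    simpa [fderiv_apply_one_eq_deriv] using this
  exact h2.hasDerivAt

/-- The geodesic vector field on the coordinate tangent bundle. -/
def geodesicSpray (x : M) (z : R3 × R3) : R3 × R3 := (z.2, geodesicAccel (chartGram x) z)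

lemma contDiffAt_geodesicSpray {x : M} {z : R3 × R3} (hz : z.1 ∈ (extChartAt (𝓡 3) x).target)
    (n : ℕ) : ContDiffAt ℝ n (geodesicSpray x) z := by
  have h := contDiffOn_geodesicAccel (isOpen_extChartAt_target x) (contDiffOn_chartGram x)
    (fun y hy a ha => chartGram_pos hy ha) n
  exact contDiffAt_snd.prodMk (h.contDiffAt
    (((isOpen_extChartAt_target x).prod isOpen_univ).mem_nhds ⟨hz, mem_univ _⟩))

lemma IsGeodesicOn.hasDerivAt_chart {γ : ℝ → M} {J : Set ℝ} (hJ : IsOpen J)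
    (hγ : IsGeodesicOn γ J) {t : ℝ} (ht : t ∈ J) {x : M} (hx : γ t ∈ (chartAt R3 x).source) :
    HasDerivAt (fun s => (extChartAt (𝓡 3) x (γ s), deriv (fun s => extChartAt (𝓡 3) x (γ s)) s))
      (geodesicSpray x (extChartAt (𝓡 3) x (γ t), deriv (fun s => extChartAt (𝓡 3) x (γ s)) t))
      t := by
  have hγt : ContMDiffAt 𝓘(ℝ, ℝ) (𝓡 3) 2 γ t := hγ.1.contMDiffAt (hJ.mem_nhds ht)
  have hc := contDiffAt_extChartAt_curve (n := 2) hγt hx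
  have hel := eulerLagrangeAt_of_chart hγt hx (mem_chart_source R3 (γ t)) (hγ.2 t ht)
  have h2 := hc.hasDerivAt_deriv
  have hd : DifferentiableAt ℝ (fun s => extChartAt (𝓡 3) x (γ s)) t :=
    hc.differentiableAt (by simp)
  rw [eulerLagrangeAt_iff
    ((contDiffAt_chartGram (extChartAt_mem_target hx)).differentiableAt (by simp))
    (fun a ha => chartGram_pos (extChartAt_mem_target hx) ha) hd h2] at hel
  rw [hel] at h2
  exact hd.hasDerivAt.prodMk h2

/-- Converse of `IsGeodesicOn.hasDerivAt_chart`. The `C²` regularity comes from the equation itself: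
`c' = w`, and `w'` is a continuous function of `(c, w)`. -/
lemma isGeodesicOn_symm_comp {x : M} {c w : ℝ → R3} {J : Set ℝ} (hJ : IsOpen J)
    (hc : ∀ t ∈ J, c t ∈ (extChartAt (𝓡 3) x).target)
    (hz : ∀ t ∈ J, HasDerivAt (fun s => (c s, w s)) (geodesicSpray x (c t, w t)) t) :
    IsGeodesicOn (fun t => (extChartAt (𝓡 3) x).symm (c t)) J := by
  have h1 : ∀ t ∈ J, HasDerivAt c (w t) t := fun t ht =>
    HasFDerivAt.comp_hasDerivAt (l := Prod.fst) (f := fun s => (c s, w s)) t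
      (hasFDerivAt_fst (𝕜 := ℝ)) (hz t ht)
  have h2 : ∀ t ∈ J, HasDerivAt w (geodesicAccel (chartGram x) (c t, w t)) t := fun t ht =>
    HasFDerivAt.comp_hasDerivAt (l := Prod.snd) (f := fun s => (c s, w s)) t
      (hasFDerivAt_snd (𝕜 := ℝ)) (hz t ht)
  have hd : ∀ t ∈ J, deriv c =ᶠ[𝓝 t] w := fun t ht => by
    filter_upwards [hJ.mem_nhds ht] with s hs
    exact (h1 s hs).deriv
  have hacc : ContinuousOn (fun t => geodesicAccel (chartGram x) (c t, w t)) J := by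
    intro t ht
    have := (contDiffAt_geodesicSpray (z := (c t, w t)) (hc t ht) 0).continuousAt
    exact (ContinuousAt.comp (f := fun t => (c t, w t)) (g := fun z => (geodesicSpray x z).2)
      (continuous_snd.continuousAt.comp this)
      ((h1 t ht).continuousAt.prodMk (h2 t ht).continuousAt)).continuousWithinAt
  have hc2 : ContDiffOn ℝ 2 c J := by
    rw [show (2 : WithTop ℕ∞) = 1 + 1 by norm_num, contDiffOn_succ_iff_deriv_of_isOpen hJ]
    refine ⟨fun t ht => (h1 t ht).differentiableAt.differentiableWithinAt, by simp, ?_⟩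
    have hw : ContDiffOn ℝ 1 w J := by
      rw [show (1 : WithTop ℕ∞) = 0 + 1 by norm_num, contDiffOn_succ_iff_deriv_of_isOpen hJ]
      refine ⟨fun t ht => (h2 t ht).differentiableAt.differentiableWithinAt, by simp, ?_⟩
      rw [contDiffOn_zero]
      exact hacc.congr fun t ht => (h2 t ht).deriv
    exact hw.congr fun t ht => (h1 t ht).deriv
  have hM : ContMDiffOn 𝓘(ℝ, ℝ) (𝓡 3) 2 (fun t => (extChartAt (𝓡 3) x).symm (c t)) J :=
    ((contMDiffOn_extChartAt_symm (n := ∞) x).of_le two_le_infty).comp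
      (contMDiffOn_iff_contDiffOn.2 hc2) hc
  refine isGeodesicOn_iff.2 ⟨hM, fun t ht => ?_⟩
  have hs := extChartAt_symm_mem_source (hc t ht)
  refine eulerLagrangeAt_of_chart (x₂ := x) (hM.contMDiffAt (hJ.mem_nhds ht))
    (mem_chart_source R3 _) hs ?_
  have hcc : (fun s => extChartAt (𝓡 3) x ((extChartAt (𝓡 3) x).symm (c s))) =ᶠ[𝓝 t] c := by
    filter_upwards [hJ.mem_nhds ht] with s hs
    exact (extChartAt (𝓡 3) x).right_inv (hc s hs)
  have hd1 := Filter.EventuallyEq.deriv hcc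
  have e0 : extChartAt (𝓡 3) x ((extChartAt (𝓡 3) x).symm (c t)) = c t := hcc.self_of_nhds
  have e1 := hd1.self_of_nhds
  have e2 := (hd t ht).self_of_nhds
  rw [eulerLagrangeAt_iff (A := geodesicAccel (chartGram x) (c t, w t)), e0, e1, e2]
  · exact (contDiffAt_chartGram (by rw [e0]; exact hc t ht)).differentiableAt (by simp)
  · intro a ha
    exact chartGram_pos (by rw [e0]; exact hc t ht) ha
  · exact ((h1 t ht).differentiableAt.congr_of_eventuallyEq hcc)
  · exact (h2 t ht).congr_of_eventuallyEq (hd1.trans (hd t ht))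

/-- The velocity of a curve, as a tangent vector. -/
def curveVelocity (γ : ℝ → M) (t : ℝ) : TangentBundle (𝓡 3) M :=
  ⟨γ t, mfderiv 𝓘(ℝ, ℝ) (𝓡 3) γ t (1 : ℝ)⟩

/-- Geodesics are determined by one velocity. -/
lemma IsGeodesicOn.curveVelocity_eq [T2Space M] {γ₁ γ₂ : ℝ → M} {J : Set ℝ} (hJ : IsOpen J)
    (hJc : IsPreconnected J) (h₁ : IsGeodesicOn γ₁ J) (h₂ : IsGeodesicOn γ₂ J) {t₀ : ℝ}
    (ht₀ : t₀ ∈ J) (h0 : curveVelocity γ₁ t₀ = curveVelocity γ₂ t₀) {t : ℝ} (ht : t ∈ J) :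
    curveVelocity γ₁ t = curveVelocity γ₂ t := by
  -- The truth value of the equality of velocities is locally constant: equality propagates by
  -- uniqueness for differential equations, and inequality persists because `M`, respectively `R3 ×
  -- R3`, is Hausdorff. It is therefore constant on the preconnected set `J`.
  refine (hJc.induction₂ (fun s s' => curveVelocity γ₁ s = curveVelocity γ₂ s ↔
    curveVelocity γ₁ s' = curveVelocity γ₂ s') ?_ (fun a b c _ _ _ h h' => h.trans h')
    (fun a b _ _ h => h.symm)
    ht₀ ht).1 h0
  intro s hs
  refine Filter.Eventually.filter_mono nhdsWithin_le_nhds ?_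
  have c₁ : ContMDiffAt 𝓘(ℝ, ℝ) (𝓡 3) 2 γ₁ s := h₁.1.contMDiffAt (hJ.mem_nhds hs)
  have c₂ : ContMDiffAt 𝓘(ℝ, ℝ) (𝓡 3) 2 γ₂ s := h₂.1.contMDiffAt (hJ.mem_nhds hs)
  by_cases hp : γ₁ s = γ₂ s
  swap
  · have hne : ∀ᶠ s' in 𝓝 s, γ₁ s' ≠ γ₂ s' :=
      (c₁.continuousAt.prodMk c₂.continuousAt).eventually
        ((isClosed_diagonal (X := M)).isOpen_compl.mem_nhds hp)
    filter_upwards [hne] with s' hs'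
    exact iff_of_false (fun h => hp (congrArg TotalSpace.proj h))
      (fun h => hs' (congrArg TotalSpace.proj h))
  set x := γ₁ s
  have hx₁ : γ₁ s ∈ (chartAt R3 x).source := mem_chart_source R3 _
  have hx₂ : γ₂ s ∈ (chartAt R3 x).source := by rw [← hp]; exact hx₁
  have ev : ∀ᶠ s' in 𝓝 s, s' ∈ J ∧ γ₁ s' ∈ (chartAt R3 x).source ∧
      γ₂ s' ∈ (chartAt R3 x).source := by
    filter_upwards [hJ.mem_nhds hs,
      c₁.continuousAt.eventually ((chartAt R3 x).open_source.mem_nhds hx₁),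
      c₂.continuousAt.eventually ((chartAt R3 x).open_source.mem_nhds hx₂)] with s' a b c
    exact ⟨a, b, c⟩
  let z : (ℝ → M) → ℝ → R3 × R3 := fun γ s => (extChartAt (𝓡 3) x (γ s),
    deriv (fun s => extChartAt (𝓡 3) x (γ s)) s)
  have hag : ∀ s', s' ∈ J ∧ γ₁ s' ∈ (chartAt R3 x).source ∧ γ₂ s' ∈ (chartAt R3 x).source →
      (curveVelocity γ₁ s' = curveVelocity γ₂ s' ↔ z γ₁ s' = z γ₂ s') := by
    rintro s' ⟨a, b, c⟩
    have v1 := tangentCoord_velocity (x := x)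
      ((h₁.1.contMDiffAt (hJ.mem_nhds a)).mdifferentiableAt (by simp)) b
    have v2 := tangentCoord_velocity (x := x)
      ((h₂.1.contMDiffAt (hJ.mem_nhds a)).mdifferentiableAt (by simp)) c
    constructor
    · intro h
      have e1 : γ₁ s' = γ₂ s' := congrArg TotalSpace.proj h
      have e2 := congrArg (tangentCoord x) h
      exact Prod.ext (congrArg (extChartAt (𝓡 3) x) e1) (v1.symm.trans (e2.trans v2))
    · intro h
      have e1 : γ₁ s' = γ₂ s' := (extChartAt (𝓡 3) x).injOn (by rwa [extChartAt_source])
        (by rwa [extChartAt_source]) (congrArg Prod.fst h)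
      exact tangentBundle_ext (x := x) b e1 (v1.trans ((congrArg Prod.snd h).trans v2.symm))
  have d₁ : ∀ᶠ s' in 𝓝 s, HasDerivAt (z γ₁) (geodesicSpray x (z γ₁ s')) s' :=
    ev.mono fun s' h => h₁.hasDerivAt_chart hJ h.1 h.2.1
  have d₂ : ∀ᶠ s' in 𝓝 s, HasDerivAt (z γ₂) (geodesicSpray x (z γ₂ s')) s' :=
    ev.mono fun s' h => h₂.hasDerivAt_chart hJ h.1 h.2.2
  have hev := ev.self_of_nhds
  by_cases hz : z γ₁ s = z γ₂ s
  · have hlip := (contDiffAt_geodesicSpray (x := x) (z := z γ₁ s)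
      (extChartAt_mem_target hx₁) 1).exists_lipschitzOnWith
    obtain ⟨C, S, hS, hC⟩ := hlip
    have := ODE_solution_unique_of_eventually (v := fun _ => geodesicSpray x) (s := fun _ => S)
      (K := C) (f := z γ₁) (g := z γ₂) (t₀ := s) (Eventually.of_forall fun _ => hC)
      (d₁.and (d₁.self_of_nhds.continuousAt.eventually hS))
      (d₂.and (d₂.self_of_nhds.continuousAt.eventually (by rw [← hz]; exact hS))) hz
    filter_upwards [this, ev] with s' h1 h2
    exact iff_of_true ((hag s hev).2 hz) ((hag s' h2).2 h1)
  · have hne : ∀ᶠ s' in 𝓝 s, z γ₁ s' ≠ z γ₂ s' :=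
      (d₁.self_of_nhds.continuousAt.prodMk d₂.self_of_nhds.continuousAt).eventually
        ((isClosed_diagonal (X := R3 × R3)).isOpen_compl.mem_nhds hz)
    filter_upwards [hne, ev] with s' h1 h2
    exact iff_of_false (fun h => hz ((hag s hev).1 h)) (fun h => h1 ((hag s' h2).1 h))

end Geodesics

/-! ### Smoothness of the exponential map near the zero section. -/

noncomputable section ExponentialChart

set_option linter.unusedSectionVars false
set_option synthInstance.maxHeartbeats 400000
set_option maxHeartbeats 1000000

variable {M : Type u} [TopologicalSpace M] [ChartedSpace R3 M] [IsManifold (𝓡 3) ∞ M]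
  [RiemannianBundle (fun x : M => TangentSpace (𝓡 3) x)]
  [IsContMDiffRiemannianBundle (𝓡 3) ∞ R3 (fun x : M => TangentSpace (𝓡 3) x)]

lemma IsGeodesicOn.mono {γ : ℝ → M} {s t : Set ℝ} (h : IsGeodesicOn γ s) (hts : t ⊆ s) :
    IsGeodesicOn γ t :=
  ⟨h.1.mono hts, fun t' ht' => h.2 t' (hts ht')⟩

/-- The exponential map relies on a chosen geodesic. Any other one with the same initial vector
agrees with it on a common open interval containing `[0, 1]`, so the choice is immaterial. -/
lemma riemannianExp_eq [T2Space M] {ζ : TangentBundle (𝓡 3) M} {γ : ℝ → M}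
    (h : IsGeodesicFrom ζ γ) : riemannianExp ζ = γ 1 := by
  have hex : ∃ γ : ℝ → M, IsGeodesicFrom ζ γ := ⟨γ, h⟩
  rw [riemannianExp, dif_pos hex]
  obtain ⟨⟨ε₁, hε₁, g₁⟩, i₁⟩ := hex.choose_spec
  obtain ⟨⟨ε₂, hε₂, g₂⟩, i₂⟩ := h
  set ε := min ε₁ ε₂
  have hε : 0 < ε := lt_min hε₁ hε₂
  have s₁ : Ioo (-ε) (1 + ε) ⊆ Ioo (-ε₁) (1 + ε₁) :=
    Ioo_subset_Ioo (neg_le_neg (min_le_left _ _)) (by linarith [min_le_left ε₁ ε₂])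
  have s₂ : Ioo (-ε) (1 + ε) ⊆ Ioo (-ε₂) (1 + ε₂) :=
    Ioo_subset_Ioo (neg_le_neg (min_le_right _ _)) (by linarith [min_le_right ε₁ ε₂])
  have := IsGeodesicOn.curveVelocity_eq isOpen_Ioo isPreconnected_Ioo (g₁.mono s₁) (g₂.mono s₂)
    (t₀ := 0) (t := 1) ⟨by linarith, by linarith⟩ (i₁.trans i₂.symm) ⟨by linarith, by linarith⟩
  exact congrArg TotalSpace.proj this

lemma hasFDerivAt_geodesicSpray_zero (x : M) {y : R3} (hy : y ∈ (extChartAt (𝓡 3) x).target) :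
    HasFDerivAt (geodesicSpray x) ((ContinuousLinearMap.snd ℝ R3 R3).prod 0) (y, 0) := by
  have h := (contDiffAt_geodesicSpray (x := x) (z := (y, 0)) hy 1).differentiableAt (by simp)
  exact hasFDerivAt_snd.prodMk (hasFDerivAt_geodesicAccel_zero h.snd)

lemma geodesicSpray_smul (x : M) (y w : R3) (ε : ℝ) :
    geodesicSpray x (y, ε • w) =
      (ε • (geodesicSpray x (y, w)).1, ε ^ 2 • (geodesicSpray x (y, w)).2) :=
  Prod.ext rfl (geodesicAccel_smul y w ε)

/-- The exponential map in the preferred chart at `x`. -/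
lemma exists_riemannianExp_chart [T2Space M] (x : M) (n : ℕ) :
    ∃ E : R3 × R3 → R3, ContDiffAt ℝ n E (extChartAt (𝓡 3) x x, 0) ∧
      (∀ᶠ y in 𝓝 (extChartAt (𝓡 3) x x), E (y, 0) = y) ∧
      HasFDerivAt (fun u => E (extChartAt (𝓡 3) x x, u)) (.id ℝ R3) 0 ∧
      ∀ᶠ q in 𝓝 (extChartAt (𝓡 3) x x, (0 : R3)), E q ∈ (extChartAt (𝓡 3) x).target ∧
        riemannianExp (ofTangentCoord x ((extChartAt (𝓡 3) x).symm q.1) q.2) =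
          (extChartAt (𝓡 3) x).symm (E q) := by
  set y₀ := extChartAt (𝓡 3) x x with hy₀
  have hyt : y₀ ∈ (extChartAt (𝓡 3) x).target := extChartAt_mem_target (mem_chart_source R3 x)
  set z₀ : R3 × R3 := (y₀, 0) with hz₀
  -- The spray is replaced by a global map equal to it near `z₀`; the curves used below stay in the
  -- ball where the two agree. The order `n + 1` only guarantees a nonzero order of
  -- differentiability.
  obtain ⟨f₁, hf₁, hff⟩ := (contDiffAt_geodesicSpray (x := x) (z := z₀) hyt
    (n + 1)).exists_contDiff_eventuallyEq
  let f : C(R3 × R3, R3 × R3) := ⟨f₁, hf₁.continuous⟩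
  have hf : ContDiff ℝ (n + 1 : ℕ) f := hf₁
  have hn : n + 1 ≠ 0 := Nat.succ_ne_zero n
  obtain ⟨α, hα, hα0, heq, hzero⟩ := exists_contDiffAt_localFlow hn f hf z₀
  have hA : HasFDerivAt f ((ContinuousLinearMap.snd ℝ R3 R3).prod 0) z₀ :=
    (hasFDerivAt_geodesicSpray_zero x hyt).congr_of_eventuallyEq hff
  have hlim : Tendsto (fun μ : ℝ => (z₀, μ)) (𝓝 0) (𝓝 (z₀, 0)) :=
    (Continuous.prodMk continuous_const continuous_id).tendsto' _ _ rfl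
  have hspray0 : ∀ y, geodesicSpray x (y, 0) = 0 := fun y => Prod.ext rfl (geodesicAccel_zero y)
  have hconst : ∀ᶠ μ in 𝓝 (0 : ℝ), α (z₀, μ) = constCLM _ z₀ := by
    filter_upwards [hlim.eventually hzero] with μ h
    exact h (hff.self_of_nhds.trans (hspray0 y₀))
  have hder := hasFDerivAt_localFlow hn f hf hα heq hconst hA (fun ζ => by simp)
  have hVn : ∀ᶠ z in 𝓝 z₀, f z = geodesicSpray x z ∧ z.1 ∈ (extChartAt (𝓡 3) x).target :=
    hff.and (continuous_fst.continuousAt.eventually ((isOpen_extChartAt_target x).mem_nhds hyt))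
  obtain ⟨δ, hδ, hV⟩ := Metric.eventually_nhds_iff_ball.1 hVn
  have hαV : ∀ᶠ q in 𝓝 (z₀, (0 : ℝ)), ∀ t, α q t ∈ Metric.ball z₀ δ := by
    have h1 : ∀ᶠ q in 𝓝 (z₀, (0 : ℝ)), dist (α q) (α (z₀, 0)) < δ :=
      hα.continuousAt.eventually (Metric.ball_mem_nhds _ hδ)
    filter_upwards [h1] with q hq t
    have := (ContinuousMap.dist_apply_le_dist t).trans_lt hq
    rwa [hα0] at this
  have hall := (heq.and (hzero.and hαV)).eventually_nhds
  have hpick : ∀ᶠ μ in 𝓝[>] (0 : ℝ), 0 < μ ∧ ContDiffAt ℝ (n + 1 : ℕ) α (z₀, μ) ∧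
      (∀ t : Icc (-2 : ℝ) 2, HasFDerivAt (fun z => α (z, μ) t)
        (.id ℝ (R3 × R3) + (μ * t) • (ContinuousLinearMap.snd ℝ R3 R3).prod 0) z₀) ∧
      ∀ᶠ z in 𝓝 z₀, α (z, μ) = constCLM _ z + μ • primitiveCLM _ (f.comp (α (z, μ))) ∧
        (f z = 0 → α (z, μ) = constCLM _ z) ∧ ∀ t, α (z, μ) t ∈ Metric.ball z₀ δ := by
    have h : ∀ᶠ μ in 𝓝 (0 : ℝ), ContDiffAt ℝ (n + 1 : ℕ) α (z₀, μ) ∧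
        (∀ t : Icc (-2 : ℝ) 2, HasFDerivAt (fun z => α (z, μ) t)
        (.id ℝ (R3 × R3) + (μ * t) • (ContinuousLinearMap.snd ℝ R3 R3).prod 0) z₀) ∧
        ∀ᶠ z in 𝓝 z₀, α (z, μ) = constCLM _ z + μ • primitiveCLM _ (f.comp (α (z, μ))) ∧
        (f z = 0 → α (z, μ) = constCLM _ z) ∧ ∀ t, α (z, μ) t ∈ Metric.ball z₀ δ := by
      filter_upwards [hlim.eventually (hα.eventually (by simp)), hder, hlim.eventually hall]
        with μ h1 h2 h3
      have hl : Tendsto (fun z : R3 × R3 => (z, μ)) (𝓝 z₀) (𝓝 (z₀, μ)) :=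
        (Continuous.prodMk continuous_id continuous_const).tendsto' _ _ rfl
      exact ⟨h1, h2, hl.eventually h3⟩
    filter_upwards [h.filter_mono nhdsWithin_le_nhds, self_mem_nhdsWithin] with μ h1 h2
    exact ⟨h2, h1⟩
  obtain ⟨ε, hε, hαε, hdε, hloc⟩ := hpick.exists
  have hone : (1 : ℝ) ∈ Icc (-2 : ℝ) 2 := by norm_num
  -- `E (y, u)` is the position at time `1` of the flow of `ε •` spray issued from `(y, ε⁻¹ • u)`.
  -- Multiplying the velocity component of that curve by `ε` gives, by homogeneity, a genuine
  -- solution of the spray issued from `(y, u)`. The derivative in `u` at zero is `ε * ε⁻¹`, hence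
  -- the identity.
  let S : R3 × R3 →L[ℝ] R3 × R3 :=
    (ContinuousLinearMap.fst ℝ R3 R3).prod (ε⁻¹ • ContinuousLinearMap.snd ℝ R3 R3)
  have hS0 : S (y₀, 0) = z₀ := by simp [S, hz₀]
  have hSt : Tendsto S (𝓝 (y₀, 0)) (𝓝 z₀) := by
    have := S.continuous.tendsto (y₀, 0)
    rwa [hS0] at this
  refine ⟨fun q => (α (S q, ε) ⟨1, hone⟩).1, ?_, ?_, ?_, ?_⟩
  · have h1 : ContDiffAt ℝ n α (S (y₀, 0), ε) := by
      rw [hS0]; exact hαε.of_le (by exact_mod_cast Nat.le_succ n)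
    have h2 : ContDiffAt ℝ n (fun q : R3 × R3 => α (S q, ε)) (y₀, 0) :=
      ContDiffAt.comp (g := α) (f := fun q : R3 × R3 => (S q, ε)) (y₀, 0) h1
        (S.contDiff.contDiffAt.prodMk contDiffAt_const)
    have h3 := (ContinuousMap.evalCLM ℝ (M := R3 × R3) (⟨1, hone⟩ : Icc (-2 : ℝ) 2)).contDiff.contDiffAt.comp
      (n := n) (y₀, (0 : R3)) h2
    exact h3.fst
  · have hl : Tendsto (fun y : R3 => (y, (0 : R3))) (𝓝 y₀) (𝓝 z₀) :=
      (Continuous.prodMk continuous_id continuous_const).tendsto' _ _ rfl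
    filter_upwards [hl.eventually hloc, hl.eventually hff] with y h1 h2
    have hSy : S (y, 0) = (y, 0) := by simp [S]
    have h3 := h1.2.1 (h2.trans (hspray0 y))
    simp only [hSy, h3]
    rfl
  · have h1 := hdε ⟨1, hone⟩
    rw [← hS0] at h1
    have h2 : HasFDerivAt (fun u : R3 => S (y₀, u)) (S ∘L .inr ℝ R3 R3) 0 :=
      S.hasFDerivAt.comp (0 : R3) (hasFDerivAt_prodMk_right (𝕜 := ℝ) y₀ (0 : R3))
    have h3 := HasFDerivAt.comp (g := fun z => α (z, ε) ⟨1, hone⟩)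
      (f := fun u : R3 => S (y₀, u)) (0 : R3) h1 h2
    have h4 := h3.fst
    refine h4.congr_fderiv ?_
    ext1 u
    simp [S, smul_smul, mul_inv_cancel₀ hε.ne']
  · filter_upwards [hSt.eventually hloc, continuous_fst.continuousAt.eventually
      ((isOpen_extChartAt_target x).mem_nhds hyt)] with q hq hqt
    obtain ⟨h1, -, h3⟩ := hq
    have hqt : q.1 ∈ (extChartAt (𝓡 3) x).target := hqt
    have hqs := extChartAt_symm_mem_source hqt
    let Z : ℝ → R3 × R3 := fun s => α (S q, ε) (projIcc (-2) 2 (by norm_num) s)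
    have hZt : ∀ s, (Z s).1 ∈ (extChartAt (𝓡 3) x).target := fun s => (hV _ (h3 _)).2
    have hZ : ∀ s ∈ Ioo (-2 : ℝ) 2, HasDerivAt Z (ε • geodesicSpray x (Z s)) s := by
      intro s hs
      have := hasDerivAt_localFlow f h1 hs
      rwa [(hV _ (h3 _)).1] at this
    have hZ0 : Z 0 = S q := localFlow_zero f h1
    let L : R3 × R3 →L[ℝ] R3 × R3 :=
      (ContinuousLinearMap.fst ℝ R3 R3).prod (ε • ContinuousLinearMap.snd ℝ R3 R3)
    have hcw : ∀ s ∈ Ioo (-2 : ℝ) 2, HasDerivAt (fun s => ((Z s).1, ε • (Z s).2))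
        (geodesicSpray x ((Z s).1, ε • (Z s).2)) s := by
      intro s hs
      have := L.hasFDerivAt.comp_hasDerivAt s (hZ s hs)
      rw [geodesicSpray_smul]
      refine this.congr_deriv ?_
      simp [L, smul_smul, pow_two]
    have hsub : Ioo (-1 : ℝ) (1 + 1) ⊆ Ioo (-2) 2 := Ioo_subset_Ioo (by norm_num) (by norm_num)
    have hgeo : IsGeodesicOn (fun t => (extChartAt (𝓡 3) x).symm (Z t).1) (Ioo (-1) (1 + 1)) :=
      isGeodesicOn_symm_comp isOpen_Ioo (fun t _ => hZt t) (fun t ht => hcw t (hsub ht))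
    have hfrom : IsGeodesicFrom (ofTangentCoord x ((extChartAt (𝓡 3) x).symm q.1) q.2)
        (fun t => (extChartAt (𝓡 3) x).symm (Z t).1) := by
      refine ⟨⟨1, one_pos, hgeo⟩, ?_⟩
      have e0 : (Z 0).1 = q.1 := by rw [hZ0]; rfl
      have hmem : (0 : ℝ) ∈ Ioo (-1 : ℝ) (1 + 1) := by norm_num
      have hs0 : (extChartAt (𝓡 3) x).symm (Z 0).1 ∈ (chartAt R3 x).source :=
        extChartAt_symm_mem_source (hZt 0)
      refine tangentBundle_ext (x := x) hs0 ?_ ?_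
      · exact (congrArg (extChartAt (𝓡 3) x).symm e0).trans (proj_ofTangentCoord hqs _).symm
      · rw [tangentCoord_ofTangentCoord hqs]
        refine (tangentCoord_velocity (x := x)
          ((hgeo.1.contMDiffAt (isOpen_Ioo.mem_nhds hmem)).mdifferentiableAt (by simp)) hs0).trans ?_
        have hcc : (fun s => extChartAt (𝓡 3) x ((extChartAt (𝓡 3) x).symm (Z s).1)) =
            fun s => (Z s).1 := funext fun s => (extChartAt (𝓡 3) x).right_inv (hZt s)
        rw [hcc]
        have := HasFDerivAt.comp_hasDerivAt (l := Prod.fst)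
          (f := fun s => ((Z s).1, ε • (Z s).2)) (0 : ℝ)
          (hasFDerivAt_fst (𝕜 := ℝ)) (hcw 0 (by norm_num))
        refine this.deriv.trans ?_
        simp [geodesicSpray, hZ0, S, smul_smul, mul_inv_cancel₀ hε.ne']
    have hproj : projIcc (-2 : ℝ) 2 (by norm_num) 1 = ⟨1, hone⟩ := projIcc_of_mem _ hone
    refine ⟨?_, ?_⟩
    · have := hZt 1
      simp only [Z, hproj] at this
      exact this
    · rw [riemannianExp_eq hfrom]
      simp only [Z, hproj]

end ExponentialChart

/-! ### The holonomy equation in a chart, divided by the speed. -/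

noncomputable section PoincareChart

set_option linter.unusedSectionVars false
set_option synthInstance.maxHeartbeats 400000
set_option maxHeartbeats 1000000

variable {V : Type} [NormedAddCommGroup V] [NormedSpace ℝ V] [FiniteDimensional ℝ V]
  [CompleteSpace V] {n : ℕ} {ψ : ℝ × V → V} {y₀ : V}

/-- Differentiate `ψ(s + h, y) = ψ(s, ψ(h, y))` at `h = 0`. The velocity at every time of the orbit
is thus a linear image of the field at `y`, and carries the same factor `ρ`. -/
lemma fderiv_flow_apply {s : ℝ} {y : V} (hs : DifferentiableAt ℝ ψ (s, y))
    (h0 : DifferentiableAt ℝ ψ (0, y)) (hy : ψ (0, y) = y)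
    (hgrp : ∀ᶠ h in 𝓝 (0 : ℝ), ψ (s + h, y) = ψ (s, ψ (h, y))) :
    fderiv ℝ ψ (s, y) (1, 0) = fderiv ℝ ψ (s, y) (0, fderiv ℝ ψ (0, y) (1, 0)) := by
  have h1 : HasDerivAt (fun h : ℝ => ψ (s + h, y)) (fderiv ℝ ψ (s, y) (1, 0)) 0 := by
    have hd : HasDerivAt (fun h : ℝ => (s + h, y)) ((1 : ℝ), (0 : V)) 0 :=
      ((hasDerivAt_id (0 : ℝ)).const_add s).prodMk (hasDerivAt_const _ _)
    exact HasFDerivAt.comp_hasDerivAt (l := ψ) (f := fun h : ℝ => (s + h, y)) 0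
      (by simpa using hs.hasFDerivAt) hd
  have h2 : HasDerivAt (fun h : ℝ => ψ (h, y)) (fderiv ℝ ψ (0, y) (1, 0)) 0 :=
    HasFDerivAt.comp_hasDerivAt (l := ψ) (f := fun h : ℝ => (h, y)) 0 h0.hasFDerivAt
      ((hasDerivAt_id (0 : ℝ)).prodMk (hasDerivAt_const _ _))
  have h3 : HasDerivAt (fun h : ℝ => ψ (s, ψ (h, y)))
      (fderiv ℝ ψ (s, y) (0, fderiv ℝ ψ (0, y) (1, 0))) 0 :=
    HasFDerivAt.comp_hasDerivAt (l := ψ) (f := fun h : ℝ => (s, ψ (h, y))) 0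
      (by simpa [hy] using hs.hasFDerivAt) ((hasDerivAt_const (0 : ℝ) s).prodMk h2)
  exact h1.unique (h3.congr_of_eventuallyEq hgrp)

/-- The rescaled displacement along the orbits: `ψ_σ(y) - y = ρ b(σ, y, e)` if the vector field
at `y` is `ρ e`. -/
lemma exists_displacement (hψ : ContDiffAt ℝ (n + 1 : ℕ) ψ (0, y₀))
    (hψ0 : ∀ᶠ y in 𝓝 y₀, ψ (0, y) = y)
    (hgrp : ∀ᶠ q in 𝓝 ((0 : ℝ), (0 : ℝ), y₀),
      ψ (q.1 + q.2.1, q.2.2) = ψ (q.1, ψ (q.2.1, q.2.2))) :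
    ∃ b : ℝ × V × V → V, (∀ p, ContDiffAt ℝ n b p) ∧ (∀ y e, b (0, y, e) = 0) ∧
      (∀ e, HasDerivAt (fun σ => b (σ, y₀, e)) e 0) ∧
      ∀ᶠ p in 𝓝 ((0 : ℝ), y₀), ∀ (ρ : ℝ) (e : V), fderiv ℝ ψ (0, p.2) (1, 0) = ρ • e →
        ψ p = p.2 + ρ • b (p.1, p.2, e) := by
  obtain ⟨ψ', hψ', heq⟩ := hψ.exists_contDiff_eventuallyEq
  -- `f (σ, y, e)` is `Dψ_σ(y) e`. If the field at `y` is `ρ e`, the orbit has velocity `ρ f(σ, y,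
  -- e)`, so `b = σ ∫₀¹ f(θ σ, y, e) dθ` involves no division by `ρ`. Working with the extension
  -- `ψ'` makes `b` smooth at every point.
  let f : ℝ × V × V → V := fun p => fderiv ℝ ψ' (p.1, p.2.1) (0, p.2.2)
  have hf : ContDiff ℝ n f := by
    have h1 : ContDiff ℝ n (fderiv ℝ ψ') := hψ'.fderiv_right (by exact_mod_cast le_rfl)
    exact (h1.comp (contDiff_fst.prodMk contDiff_snd.fst)).clm_apply
      (contDiff_const.prodMk contDiff_snd.snd)
  let L₀ : ℝ × V × V →L[ℝ] ℝ × V × V := (0 : ℝ × V × V →L[ℝ] ℝ).prod (.snd ℝ ℝ (V × V))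
  let L₁ : ℝ × V × V →L[ℝ] ℝ × V × V := (ContinuousLinearMap.fst ℝ ℝ (V × V)).prod 0
  have hL : ∀ (p : ℝ × V × V) (θ : ℝ), L₀ p + θ • L₁ p = (θ * p.1, p.2.1, p.2.2) := fun p θ => by
    simp [L₀, L₁]
  have hI := contDiff_integral_segment hf L₀ L₁
  simp only [hL] at hI
  refine ⟨fun p => p.1 • ∫ θ in (0 : ℝ)..1, f (θ * p.1, p.2.1, p.2.2), fun p =>
    (contDiff_fst.smul hI).contDiffAt, fun y e => by simp, ?_, ?_⟩
  · intro e
    have hf0 : f (0, y₀, e) = e := by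
      have h1 : HasFDerivAt (fun y => ψ' (0, y)) (fderiv ℝ ψ' (0, y₀) ∘L .inr ℝ ℝ V) y₀ :=
        HasFDerivAt.comp (g := ψ') y₀
          (hψ'.differentiable (by simp)).differentiableAt.hasFDerivAt
          (hasFDerivAt_prodMk_right (𝕜 := ℝ) (0 : ℝ) y₀)
      have hl : Tendsto (fun y : V => ((0 : ℝ), y)) (𝓝 y₀) (𝓝 (0, y₀)) :=
        (Continuous.prodMk continuous_const continuous_id).tendsto' _ _ rfl
      have h2 : (fun y => ψ' (0, y)) =ᶠ[𝓝 y₀] id := by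
        filter_upwards [hl.eventually heq, hψ0] with y h h'
        exact h.trans h'
      have h3 := h1.unique ((hasFDerivAt_id y₀).congr_of_eventuallyEq h2)
      exact congrArg (fun T => T e) h3
    have hc : ContinuousAt (fun σ : ℝ => ∫ θ in (0 : ℝ)..1, f (θ * σ, y₀, e)) 0 :=
      (Continuous.comp (f := fun σ : ℝ => (σ, y₀, e)) hI.continuous
        (Continuous.prodMk continuous_id continuous_const)).continuousAt
    have hval : (∫ θ in (0 : ℝ)..1, f (θ * 0, y₀, e)) = e := by simp [hf0]
    rw [hasDerivAt_iff_tendsto_slope_zero]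
    have : Tendsto (fun σ : ℝ => ∫ θ in (0 : ℝ)..1, f (θ * σ, y₀, e)) (𝓝[≠] 0) (𝓝 e) := by
      have := hc.tendsto
      rw [hval] at this
      exact this.mono_left nhdsWithin_le_nhds
    refine this.congr' ?_
    filter_upwards [self_mem_nhdsWithin] with σ hσ
    have hσ : σ ≠ 0 := hσ
    simp [smul_smul, inv_mul_cancel₀ hσ]
  · have hd : ∀ᶠ p in 𝓝 ((0 : ℝ), y₀), DifferentiableAt ℝ ψ p :=
      (hψ.eventually (by simp)).mono fun p hp => hp.differentiableAt (by simp)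
    have hg : ∀ᶠ p in 𝓝 ((0 : ℝ), y₀), ∀ᶠ h in 𝓝 (0 : ℝ),
        ψ (p.1 + h, p.2) = ψ (p.1, ψ (h, p.2)) := by
      have hl : Tendsto (fun p : ℝ × V => (p.1, (0 : ℝ), p.2)) (𝓝 (0, y₀)) (𝓝 (0, 0, y₀)) :=
        (Continuous.prodMk continuous_fst
          (Continuous.prodMk continuous_const continuous_snd)).tendsto' _ _ rfl
      filter_upwards [hl.eventually hgrp.eventually_nhds] with p hp
      have hl2 : Tendsto (fun h : ℝ => (p.1, h, p.2)) (𝓝 0) (𝓝 (p.1, 0, p.2)) :=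
        (Continuous.prodMk continuous_const
          (Continuous.prodMk continuous_id continuous_const)).tendsto' _ _ rfl
      exact hl2.eventually hp
    have hl0 : Tendsto (fun p : ℝ × V => ((0 : ℝ), p.2)) (𝓝 (0, y₀)) (𝓝 (0, y₀)) :=
      (Continuous.prodMk continuous_const continuous_snd).tendsto' _ _ rfl
    have h0 : ∀ᶠ p in 𝓝 ((0 : ℝ), y₀), ψ (0, p.2) = p.2 :=
      (continuous_snd.tendsto' ((0 : ℝ), y₀) y₀ rfl).eventually hψ0
    have key : ∀ᶠ p in 𝓝 ((0 : ℝ), y₀), ψ' =ᶠ[𝓝 p] ψ ∧ ψ (0, p.2) = p.2 ∧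
        fderiv ℝ ψ p (1, 0) = fderiv ℝ ψ p (0, fderiv ℝ ψ (0, p.2) (1, 0)) := by
      filter_upwards [heq.eventually_nhds, hd, hl0.eventually hd, hg, h0] with p h1 h2 h3 h4 h5
      exact ⟨h1, h5, fderiv_flow_apply h2 h3 h5 h4⟩
    obtain ⟨δ, hδ, hball⟩ := Metric.eventually_nhds_iff_ball.1 key
    filter_upwards [Metric.ball_mem_nhds ((0 : ℝ), y₀) hδ] with p hp ρ e hX
    have hmem : ∀ θ ∈ Icc (0 : ℝ) 1, (θ * p.1, p.2) ∈ Metric.ball ((0 : ℝ), y₀) δ := by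
      intro θ hθ
      rw [Metric.mem_ball, Prod.dist_eq, max_lt_iff] at hp ⊢
      refine ⟨?_, hp.2⟩
      have h1 := hp.1
      rw [Real.dist_0_eq_abs] at h1 ⊢
      rw [abs_mul, abs_of_nonneg hθ.1]
      exact (mul_le_of_le_one_left (abs_nonneg _) hθ.2).trans_lt h1
    have hder : ∀ θ ∈ uIcc (0 : ℝ) 1, HasDerivAt (fun θ => ψ' (θ * p.1, p.2))
        (p.1 • ρ • f (θ * p.1, p.2, e)) θ := by
      intro θ hθ
      rw [uIcc_of_le zero_le_one] at hθ
      obtain ⟨h1, -, h3⟩ := hball _ (hmem θ hθ)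
      have hd1 : HasDerivAt (fun θ : ℝ => (θ * p.1, p.2)) (p.1, (0 : V)) θ := by
        simpa using ((hasDerivAt_id θ).mul_const p.1).prodMk (hasDerivAt_const θ p.2)
      have hd2 := HasFDerivAt.comp_hasDerivAt (l := ψ') (f := fun θ : ℝ => (θ * p.1, p.2)) θ
          (hψ'.differentiable (by simp)).differentiableAt.hasFDerivAt hd1
      refine hd2.congr_deriv ?_
      rw [← h1.fderiv_eq] at h3
      rw [show ((p.1, (0 : V)) : ℝ × V) = p.1 • ((1 : ℝ), (0 : V)) by simp, map_smul, h3, hX,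
        show ((0 : ℝ), ρ • e) = ρ • ((0 : ℝ), e) by simp, map_smul]
    have hcont : Continuous fun θ : ℝ => p.1 • ρ • f (θ * p.1, p.2, e) := by
      have := hf.continuous
      fun_prop
    have hint := intervalIntegral.integral_eq_sub_of_hasDerivAt hder
      (hcont.intervalIntegrable _ _)
    rw [intervalIntegral.integral_smul, intervalIntegral.integral_smul] at hint
    have e1 := (hball _ (hmem 1 ⟨zero_le_one, le_rfl⟩)).1.self_of_nhds
    have e0 := (hball _ (hmem 0 ⟨le_rfl, zero_le_one⟩))
    simp only [one_mul, zero_mul] at hint e1 e0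
    rw [e1, e0.1.self_of_nhds, e0.2.1] at hint
    rw [smul_comm, hint]
    simp

/-- The displacement between the exponential of a normal vector and the orbit of the exponential
of another one. -/
def sectionDefect (E : V × V → V) (ψ : ℝ × V → V) (q : ℝ × ℝ × V × V × V × V) : V :=
  E (ψ (q.2.1, q.2.2.1 + q.1 • q.2.2.2.1), q.1 • q.2.2.2.2.1) -
    ψ (q.2.1, E (q.2.2.1, q.1 • q.2.2.2.2.2))

variable {E : V × V → V}

lemma contDiffAt_sectionDefect {m : ℕ} (hψ : ContDiffAt ℝ m ψ (0, y₀))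
    (hy₀ : ψ (0, y₀) = y₀) (hE : ContDiffAt ℝ m E (y₀, 0)) (hE₀ : E (y₀, 0) = y₀) (ρ : ℝ) :
    ContDiffAt ℝ m (sectionDefect E ψ) (ρ, 0, y₀, 0, 0, 0) := by
  set q₀ : ℝ × ℝ × V × V × V × V := (ρ, 0, y₀, 0, 0, 0)
  have c1 : ContDiff ℝ m fun q : ℝ × ℝ × V × V × V × V =>
      (q.2.1, q.2.2.1 + q.1 • q.2.2.2.1) := by fun_prop
  have c2 : ContDiff ℝ m fun q : ℝ × ℝ × V × V × V × V => q.1 • q.2.2.2.2.1 := by fun_prop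
  have c3 : ContDiff ℝ m fun q : ℝ × ℝ × V × V × V × V => (q.2.2.1, q.1 • q.2.2.2.2.2) := by
    fun_prop
  have c4 : ContDiff ℝ m fun q : ℝ × ℝ × V × V × V × V => q.2.1 := by fun_prop
  have h1 := ContDiffAt.comp (g := ψ) (f := fun q : ℝ × ℝ × V × V × V × V =>
    (q.2.1, q.2.2.1 + q.1 • q.2.2.2.1)) q₀ (by simpa [q₀] using hψ) c1.contDiffAt
  have h2 := ContDiffAt.comp (g := E) (f := fun q : ℝ × ℝ × V × V × V × V =>
    (ψ (q.2.1, q.2.2.1 + q.1 • q.2.2.2.1), q.1 • q.2.2.2.2.1)) q₀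
    (by simpa [q₀, hy₀] using hE) (ContDiffAt.prodMk h1 c2.contDiffAt)
  have h3 := ContDiffAt.comp (g := E) (f := fun q : ℝ × ℝ × V × V × V × V =>
    (q.2.2.1, q.1 • q.2.2.2.2.2)) q₀ (by simpa [q₀] using hE) c3.contDiffAt
  have h4 := ContDiffAt.comp (g := ψ) (f := fun q : ℝ × ℝ × V × V × V × V =>
    (q.2.1, E (q.2.2.1, q.1 • q.2.2.2.2.2))) q₀ (by simpa [q₀, hE₀] using hψ)
    (ContDiffAt.prodMk c4.contDiffAt h3)
  exact h2.sub h4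

/-- The inclusion of the parameters with respect to which the rescaled defect is solved. -/
def defectParam (y₀ : V) (k : ℝ × V × V) : ℝ × V × V × V × V := (k.1, y₀, k.2.1, k.2.2, 0)

lemma hasFDerivAt_of_apply_zero_eq {y₀ : V} (hE : DifferentiableAt ℝ E (y₀, 0))
    (hE0 : ∀ᶠ y in 𝓝 y₀, E (y, 0) = y) (hE1 : HasFDerivAt (fun u => E (y₀, u)) (.id ℝ V) 0) :
    HasFDerivAt E (ContinuousLinearMap.fst ℝ V V + .snd ℝ V V) (y₀, 0) := by
  refine hE.hasFDerivAt.congr_fderiv ?_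
  have h1 : HasFDerivAt (fun y => E (y, 0)) (fderiv ℝ E (y₀, 0) ∘L .inl ℝ V V) y₀ :=
    HasFDerivAt.comp (g := E) y₀ hE.hasFDerivAt (hasFDerivAt_prodMk_left (𝕜 := ℝ) y₀ (0 : V))
  have h2 : HasFDerivAt (fun u => E (y₀, u)) (fderiv ℝ E (y₀, 0) ∘L .inr ℝ V V) 0 :=
    HasFDerivAt.comp (g := E) (0 : V) hE.hasFDerivAt (hasFDerivAt_prodMk_right (𝕜 := ℝ) y₀ (0 : V))
  have e1 := h1.unique ((hasFDerivAt_id y₀).congr_of_eventuallyEq hE0)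
  have e2 := h2.unique hE1
  refine ContinuousLinearMap.ext fun ⟨a, c⟩ => ?_
  have f1 : fderiv ℝ E (y₀, 0) (a, 0) = a := congrArg (fun T => T a) e1
  have f2 : fderiv ℝ E (y₀, 0) (0, c) = c := congrArg (fun T => T c) e2
  rw [show ((a, c) : V × V) = (a, 0) + (0, c) by simp, map_add, f1, f2]
  simp

lemma hasFDerivAt_flow_zero (hψ : DifferentiableAt ℝ ψ (0, y₀))
    (hψ0 : ∀ᶠ y in 𝓝 y₀, ψ (0, y) = y) :
    HasFDerivAt ψ ((ContinuousLinearMap.fst ℝ ℝ V).smulRight (fderiv ℝ ψ (0, y₀) (1, 0)) +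
      .snd ℝ ℝ V) (0, y₀) := by
  refine hψ.hasFDerivAt.congr_fderiv ?_
  have h1 : HasFDerivAt (fun y => ψ (0, y)) (fderiv ℝ ψ (0, y₀) ∘L .inr ℝ ℝ V) y₀ :=
    HasFDerivAt.comp (g := ψ) y₀ hψ.hasFDerivAt (hasFDerivAt_prodMk_right (𝕜 := ℝ) (0 : ℝ) y₀)
  have e1 := h1.unique ((hasFDerivAt_id y₀).congr_of_eventuallyEq hψ0)
  refine ContinuousLinearMap.ext fun ⟨s, c⟩ => ?_
  have f1 : fderiv ℝ ψ (0, y₀) (0, c) = c := congrArg (fun T => T c) e1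
  rw [show ((s, c) : ℝ × V) = s • ((1 : ℝ), (0 : V)) + (0, c) by simp, map_add, map_smul, f1]
  simp

/-- A change `s` of the hitting time moves both terms of the defect by `s` times the field at `y₀`,
and these cancel. What remains comes from the displacement of the base point and from the target
vector, and both carry the factor `ρ`. -/
lemma hasFDerivAt_sectionDefect (hψ : DifferentiableAt ℝ ψ (0, y₀))
    (hψ0 : ∀ᶠ y in 𝓝 y₀, ψ (0, y) = y) (hE : DifferentiableAt ℝ E (y₀, 0))
    (hE0 : ∀ᶠ y in 𝓝 y₀, E (y, 0) = y) (hE1 : HasFDerivAt (fun u => E (y₀, u)) (.id ℝ V) 0)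
    (ρ : ℝ) :
    HasFDerivAt (fun k : ℝ × V × V => sectionDefect E ψ (ρ, defectParam y₀ k))
      (ρ • ((ContinuousLinearMap.fst ℝ V V + .snd ℝ V V) ∘L .snd ℝ ℝ (V × V))) 0 := by
  have dE := hasFDerivAt_of_apply_zero_eq hE hE0 hE1
  have dψ := hasFDerivAt_flow_zero hψ hψ0
  set X := fderiv ℝ ψ (0, y₀) (1, 0)
  let A : ℝ × V × V →L[ℝ] ℝ × V :=
    (ContinuousLinearMap.fst ℝ ℝ (V × V)).prod (ρ • (.fst ℝ V V ∘L .snd ℝ ℝ (V × V)))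
  let B : ℝ × V × V →L[ℝ] V := ρ • (.snd ℝ V V ∘L .snd ℝ ℝ (V × V))
  have hA : HasFDerivAt (fun k : ℝ × V × V => (k.1, y₀ + ρ • k.2.1)) A 0 := by
    have := (A.hasFDerivAt (x := 0)).const_add (0, y₀)
    simpa [A, Prod.mk_add_mk, Pi.add_def] using this
  have e0 := hψ0.self_of_nhds
  have h1 := HasFDerivAt.comp (g := ψ) (f := fun k : ℝ × V × V => (k.1, y₀ + ρ • k.2.1)) 0
    (by simpa using dψ) hA
  have h2 := HasFDerivAt.comp (g := E)
    (f := fun k : ℝ × V × V => (ψ (k.1, y₀ + ρ • k.2.1), ρ • k.2.2)) 0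
    (by simpa [e0] using dE) (h1.prodMk (B.hasFDerivAt (x := 0)))
  have h3 := HasFDerivAt.comp (g := ψ) (f := fun k : ℝ × V × V => (k.1, y₀)) 0 dψ
    (((ContinuousLinearMap.fst ℝ ℝ (V × V)).hasFDerivAt (x := 0)).prodMk (hasFDerivAt_const y₀ _))
  have h4 := h2.sub h3
  refine (h4.congr_fderiv ?_).congr_of_eventuallyEq (Eventually.of_forall fun k => ?_)
  · refine ContinuousLinearMap.ext fun ⟨s, b, w⟩ => ?_
    simp [A, B]
    abel
  · simp [sectionDefect, defectParam, hE0.self_of_nhds]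

/-- For `ρ = 0` both terms of the defect reduce to `ψ(τ, y)`, so near `ρ₀ = 0` Hadamard's lemma
provides the quotient; elsewhere it is an ordinary division. In both cases the value and the
derivative at `ρ₀` are found as limits through nonzero `ρ ≠ ρ₀`, where the quotient can be computed
from the defect. -/
lemma exists_rescaled_sectionDefect (hn : n ≠ 0) (hψ : ContDiffAt ℝ (n + 1 : ℕ) ψ (0, y₀))
    (hψ0 : ∀ᶠ y in 𝓝 y₀, ψ (0, y) = y) (hE : ContDiffAt ℝ (n + 1 : ℕ) E (y₀, 0))
    (hE0 : ∀ᶠ y in 𝓝 y₀, E (y, 0) = y) (hE1 : HasFDerivAt (fun u => E (y₀, u)) (.id ℝ V) 0)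
    (ρ₀ : ℝ) :
    ∃ D : ℝ × ℝ × V × V × V × V → V, ContDiffAt ℝ n D (ρ₀, 0, y₀, 0, 0, 0) ∧
      D (ρ₀, 0, y₀, 0, 0, 0) = 0 ∧
      HasFDerivAt (fun k : ℝ × V × V => D (ρ₀, defectParam y₀ k))
        ((ContinuousLinearMap.fst ℝ V V + .snd ℝ V V) ∘L .snd ℝ ℝ (V × V)) 0 ∧
      ∀ᶠ q in 𝓝 (ρ₀, (0 : ℝ), y₀, (0 : V), (0 : V), (0 : V)),
        sectionDefect E ψ q = q.1 • D q := by
  have e0 := hψ0.self_of_nhds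
  have e0' := hE0.self_of_nhds
  have hF := contDiffAt_sectionDefect hψ e0 hE e0' ρ₀
  have hn' : (n : WithTop ℕ∞) ≠ 0 := by exact_mod_cast hn
  set p₀ : ℝ × V × V × V × V := (0, y₀, 0, 0, 0) with hp₀
  have hex : ∃ D : ℝ × ℝ × V × V × V × V → V, ContDiffAt ℝ n D (ρ₀, p₀) ∧
      ∀ᶠ q in 𝓝 (ρ₀, p₀), sectionDefect E ψ q = q.1 • D q := by
    by_cases hρ : ρ₀ = 0
    · subst hρ
      refine exists_contDiffAt_eq_smul hF ?_
      have l1 : Tendsto (fun p : ℝ × V × V × V × V => p.2.1) (𝓝 p₀) (𝓝 y₀) :=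
        continuous_snd.fst.tendsto' _ _ rfl
      have l2 : Tendsto (fun p : ℝ × V × V × V × V => ψ (p.1, p.2.1)) (𝓝 p₀) (𝓝 y₀) := by
        have h1 : ContinuousAt ψ (0, y₀) := hψ.continuousAt
        have h2 : Tendsto (fun p : ℝ × V × V × V × V => (p.1, p.2.1)) (𝓝 p₀) (𝓝 (0, y₀)) :=
          (Continuous.prodMk continuous_fst continuous_snd.fst).tendsto' _ _ rfl
        have h3 := h1.tendsto.comp h2
        rwa [e0] at h3
      filter_upwards [l1.eventually hE0, l2.eventually hE0] with p h1 h2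
      simp [sectionDefect, h1, h2]
    · refine ⟨fun q => q.1⁻¹ • sectionDefect E ψ q, ?_, ?_⟩
      · exact (contDiffAt_fst.inv hρ).smul (hF.of_le (by exact_mod_cast Nat.le_succ n))
      · have : ∀ᶠ q in 𝓝 (ρ₀, p₀), q.1 ≠ 0 :=
          (continuous_fst.tendsto' (ρ₀, p₀) ρ₀ rfl).eventually_ne hρ
        filter_upwards [this] with q hq
        rw [smul_smul, mul_inv_cancel₀ hq, one_smul]
  obtain ⟨D, hD, hFD⟩ := hex
  have hl : Tendsto (fun ρ : ℝ => (ρ, p₀)) (𝓝[≠] ρ₀) (𝓝 (ρ₀, p₀)) :=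
    ((Continuous.prodMk continuous_id continuous_const).tendsto' _ _ rfl).mono_left
      nhdsWithin_le_nhds
  have hne : ∀ᶠ ρ in 𝓝[≠] ρ₀, ρ ≠ 0 := by
    by_cases hρ : ρ₀ = 0
    · rw [hρ]; exact self_mem_nhdsWithin
    · exact (eventually_ne_nhds hρ).filter_mono nhdsWithin_le_nhds
  have hdef0 : ∀ ρ : ℝ, sectionDefect E ψ (ρ, p₀) = 0 := fun ρ => by
    simp [sectionDefect, hp₀, e0, e0']
  have hpar : HasFDerivAt (defectParam y₀)
      ((ContinuousLinearMap.fst ℝ ℝ (V × V)).prod ((0 : ℝ × V × V →L[ℝ] V).prod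
        ((.fst ℝ V V ∘L .snd ℝ ℝ (V × V)).prod
          ((.snd ℝ V V ∘L .snd ℝ ℝ (V × V)).prod (0 : ℝ × V × V →L[ℝ] V))))) 0 := by
    have a1 := (ContinuousLinearMap.fst ℝ ℝ (V × V)).hasFDerivAt (x := 0)
    have a2 := (ContinuousLinearMap.fst ℝ V V ∘L .snd ℝ ℝ (V × V)).hasFDerivAt (x := 0)
    have a3 := (ContinuousLinearMap.snd ℝ V V ∘L .snd ℝ ℝ (V × V)).hasFDerivAt (x := 0)
    exact a1.prodMk ((hasFDerivAt_const y₀ _).prodMk (a2.prodMk (a3.prodMk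
      (hasFDerivAt_const (0 : V) _))))
  have hpar0 : defectParam y₀ (0 : ℝ × V × V) = p₀ := rfl
  set J := ((ContinuousLinearMap.fst ℝ ℝ (V × V)).prod ((0 : ℝ × V × V →L[ℝ] V).prod
        ((.fst ℝ V V ∘L .snd ℝ ℝ (V × V)).prod
          ((.snd ℝ V V ∘L .snd ℝ ℝ (V × V)).prod (0 : ℝ × V × V →L[ℝ] V)))))
  set S := (ContinuousLinearMap.fst ℝ V V + .snd ℝ V V) ∘L ContinuousLinearMap.snd ℝ ℝ (V × V)
  have hDpar : ∀ ρ : ℝ, DifferentiableAt ℝ D (ρ, p₀) →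
      HasFDerivAt (fun k : ℝ × V × V => D (ρ, defectParam y₀ k))
        (fderiv ℝ D (ρ, p₀) ∘L ((0 : ℝ × V × V →L[ℝ] ℝ).prod J)) 0 := fun ρ h =>
    HasFDerivAt.comp (g := D) (f := fun k : ℝ × V × V => (ρ, defectParam y₀ k)) 0 h.hasFDerivAt
      ((hasFDerivAt_const ρ _).prodMk hpar)
  have hS : ∀ᶠ ρ in 𝓝[≠] ρ₀, fderiv ℝ D (ρ, p₀) ∘L ((0 : ℝ × V × V →L[ℝ] ℝ).prod J) = S := by
    filter_upwards [hl.eventually (hD.eventually (by simp)), hl.eventually hFD.eventually_nhds,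
      hne] with ρ h1 h2 h3
    have d1 := hDpar ρ (h1.differentiableAt hn')
    have d2 := hasFDerivAt_sectionDefect (hψ.differentiableAt (by simp)) hψ0
      (hE.differentiableAt (by simp)) hE0 hE1 ρ
    have hl2 : Tendsto (fun k : ℝ × V × V => (ρ, defectParam y₀ k)) (𝓝 0) (𝓝 (ρ, p₀)) :=
      (hasFDerivAt_const ρ _ |>.prodMk hpar).continuousAt.tendsto
    have d3 : HasFDerivAt (fun k : ℝ × V × V => D (ρ, defectParam y₀ k)) (ρ⁻¹ • ρ • S) 0 := by
      refine (d2.const_smul ρ⁻¹).congr_of_eventuallyEq ?_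
      filter_upwards [hl2.eventually h2] with k hk
      simp only [Pi.smul_apply]
      rw [hk, smul_smul, inv_mul_cancel₀ h3, one_smul]
    rw [smul_smul, inv_mul_cancel₀ h3, one_smul] at d3
    exact d1.unique d3
  refine ⟨D, hD, ?_, ?_, hFD⟩
  · have h1 : Tendsto (fun ρ : ℝ => D (ρ, p₀)) (𝓝[≠] ρ₀) (𝓝 (D (ρ₀, p₀))) :=
      hD.continuousAt.tendsto.comp hl
    refine tendsto_nhds_unique (h1.congr' ?_) tendsto_const_nhds
    filter_upwards [hl.eventually hFD, hne] with ρ h2 h3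
    rw [hdef0] at h2
    exact (smul_eq_zero.1 h2.symm).resolve_left h3
  · refine (hDpar ρ₀ (hD.differentiableAt hn')).congr_fderiv ?_
    have hc : ContinuousAt (fderiv ℝ D) (ρ₀, p₀) :=
      (hD.fderiv_right (m := 0) (by
        rw [zero_add]; exact_mod_cast Nat.one_le_iff_ne_zero.2 hn)).continuousAt
    have h1 : Tendsto (fun ρ : ℝ => fderiv ℝ D (ρ, p₀) ∘L ((0 : ℝ × V × V →L[ℝ] ℝ).prod J))
        (𝓝[≠] ρ₀) (𝓝 (fderiv ℝ D (ρ₀, p₀) ∘L ((0 : ℝ × V × V →L[ℝ] ℝ).prod J))) :=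
      (((ContinuousLinearMap.compL ℝ (ℝ × V × V) (ℝ × ℝ × V × V × V × V) V).flip
        ((0 : ℝ × V × V →L[ℝ] ℝ).prod J)).continuous.tendsto _).comp (hc.tendsto.comp hl)
    exact tendsto_nhds_unique (h1.congr' hS) tendsto_const_nhds

/-- In the kernel, `w = s • e` and then `s * B e e = 0`, so `s = 0`. This is the transversality of
the orbit to its orthogonal section; injectivity suffices since the dimensions agree. -/
lemma isInvertible_transversal (B : V →L[ℝ] V →L[ℝ] ℝ) {e : V} (he : B e e ≠ 0) :
    ((ContinuousLinearMap.snd ℝ ℝ V - (ContinuousLinearMap.fst ℝ ℝ V).smulRight e).prod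
      (B.flip e ∘L .snd ℝ ℝ V)).IsInvertible := by
  set T := (ContinuousLinearMap.snd ℝ ℝ V - (ContinuousLinearMap.fst ℝ ℝ V).smulRight e).prod
      (B.flip e ∘L .snd ℝ ℝ V)
  have hinj : Function.Injective (T : ℝ × V →ₗ[ℝ] V × ℝ) := by
    rw [← LinearMap.ker_eq_bot, LinearMap.ker_eq_bot']
    rintro ⟨s, w⟩ h
    have h1 : w - s • e = 0 := congrArg Prod.fst h
    have h2 : B w e = 0 := congrArg Prod.snd h
    rw [sub_eq_zero.1 h1, map_smul, smul_apply, smul_eq_mul] at h2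
    have hs := (mul_eq_zero.1 h2).resolve_right he
    rw [hs, zero_smul, sub_zero] at h1
    rw [hs, h1]
    rfl
  have hdim : Module.finrank ℝ (ℝ × V) = Module.finrank ℝ (V × ℝ) := by
    simp [Module.finrank_prod, add_comm]
  let e' := LinearEquiv.ofInjectiveOfFinrankEq (T : ℝ × V →ₗ[ℝ] V × ℝ) hinj hdim
  exact ⟨e'.toContinuousLinearEquiv, by ext a <;> rfl⟩

/-- The rescaled sectional Poincaré map in a chart: it is the restriction to the regular part of
a smooth map of the independent parameters `(t, y, e, ρ, v)`, where the vector field at `y` is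
`ρ e`. -/
lemma exists_poincare_chart (hn : n ≠ 0) (hψ : ContDiffAt ℝ (n + 1 : ℕ) ψ (0, y₀))
    (hψ0 : ∀ᶠ y in 𝓝 y₀, ψ (0, y) = y)
    (hgrp : ∀ᶠ q in 𝓝 ((0 : ℝ), (0 : ℝ), y₀),
      ψ (q.1 + q.2.1, q.2.2) = ψ (q.1, ψ (q.2.1, q.2.2)))
    (hE : ContDiffAt ℝ (n + 1 : ℕ) E (y₀, 0))
    (hE0 : ∀ᶠ y in 𝓝 y₀, E (y, 0) = y) (hE1 : HasFDerivAt (fun u => E (y₀, u)) (.id ℝ V) 0)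
    {G : V → V →L[ℝ] V →L[ℝ] ℝ} (hG : ContDiffAt ℝ n G y₀) (ρ₀ : ℝ) {e₀ : V}
    (he₀ : G y₀ e₀ e₀ ≠ 0) :
    ∃ TW : ℝ × V × V × ℝ × V → ℝ × V, ContDiffAt ℝ n TW (0, y₀, e₀, ρ₀, 0) ∧
      TW (0, y₀, e₀, ρ₀, 0) = 0 ∧
      (∀ᶠ u in 𝓝 ((0 : ℝ), y₀, e₀, ρ₀, (0 : V)),
        G (ψ (u.1, u.2.1)) (TW u).2 (fderiv ℝ ψ (u.1, u.2.1) (0, u.2.2.1)) = 0) ∧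
      ∀ᶠ q in 𝓝 (((0 : ℝ), y₀, e₀, ρ₀, (0 : V)), ((0 : ℝ), (0 : V))),
        fderiv ℝ ψ (0, q.1.2.1) (1, 0) = q.1.2.2.2.1 • q.1.2.2.1 → q.1.2.2.2.1 ≠ 0 →
        (E (ψ (q.1.1, q.1.2.1), q.1.2.2.2.1 • q.2.2) =
            ψ (q.2.1, E (q.1.2.1, q.1.2.2.2.1 • q.1.2.2.2.2)) ∧
          G (ψ (q.1.1, q.1.2.1)) q.2.2 (fderiv ℝ ψ (q.1.1, q.1.2.1) (0, q.1.2.2.1)) = 0 ↔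
          q.2 = TW q.1) := by
  have hn' : (n : WithTop ℕ∞) ≠ 0 := by exact_mod_cast hn
  have e0 := hψ0.self_of_nhds
  obtain ⟨b, hb, hb0, hb1, hbψ⟩ := exists_displacement hψ hψ0 hgrp
  obtain ⟨D, hD, hD0, hD1, hDF⟩ := exists_rescaled_sectionDefect hn hψ hψ0 hE hE0 hE1 ρ₀
  set u₀ : ℝ × V × V × ℝ × V := (0, y₀, e₀, ρ₀, 0) with hu₀
  -- The displacement slot receives `b(t - τ, y, e)`. As `ψ_t(y) = ψ_τ(y + ρ b(t - τ, y, e))`, the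
  -- vanishing of the defect at `a q` is the holonomy equation, while `f₂` expresses the
  -- orthogonality to `Dψ_t e`.
  let a : (ℝ × V × V × ℝ × V) × (ℝ × V) → ℝ × ℝ × V × V × V × V := fun q =>
    (q.1.2.2.2.1, q.2.1, q.1.2.1, b (q.1.1 - q.2.1, q.1.2.1, q.1.2.2.1), q.2.2, q.1.2.2.2.2)
  let f₁ : (ℝ × V × V × ℝ × V) × (ℝ × V) → V := fun q => D (a q)
  let f₂ : (ℝ × V × V × ℝ × V) × (ℝ × V) → ℝ := fun q =>
    G (ψ (q.1.1, q.1.2.1)) q.2.2 (fderiv ℝ ψ (q.1.1, q.1.2.1) (0, q.1.2.2.1))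
  have ha : ContDiffAt ℝ n a (u₀, 0) := by
    have h1 : ContDiffAt ℝ n (fun q : (ℝ × V × V × ℝ × V) × (ℝ × V) =>
        b (q.1.1 - q.2.1, q.1.2.1, q.1.2.2.1)) (u₀, 0) :=
      ContDiffAt.comp (g := b) (f := fun q : (ℝ × V × V × ℝ × V) × (ℝ × V) =>
        (q.1.1 - q.2.1, q.1.2.1, q.1.2.2.1)) (u₀, 0) (hb _) (by fun_prop)
    have k1 : ContDiffAt ℝ n (fun q : (ℝ × V × V × ℝ × V) × (ℝ × V) => q.1.2.2.2.1) (u₀, 0) := by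
      fun_prop
    have k2 : ContDiffAt ℝ n (fun q : (ℝ × V × V × ℝ × V) × (ℝ × V) => q.2.1) (u₀, 0) := by
      fun_prop
    have k3 : ContDiffAt ℝ n (fun q : (ℝ × V × V × ℝ × V) × (ℝ × V) => q.1.2.1) (u₀, 0) := by
      fun_prop
    have k4 : ContDiffAt ℝ n (fun q : (ℝ × V × V × ℝ × V) × (ℝ × V) => q.2.2) (u₀, 0) := by
      fun_prop
    have k5 : ContDiffAt ℝ n (fun q : (ℝ × V × V × ℝ × V) × (ℝ × V) => q.1.2.2.2.2) (u₀, 0) := by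
      fun_prop
    exact k1.prodMk (k2.prodMk (k3.prodMk (h1.prodMk (k4.prodMk k5))))
  have ha0 : a (u₀, 0) = (ρ₀, 0, y₀, 0, 0, 0) := by simp [a, hu₀, hb0]
  have hf₁ : ContDiffAt ℝ n f₁ (u₀, 0) :=
    ContDiffAt.comp (g := D) (f := a) (u₀, 0) (by rw [ha0]; exact hD) ha
  have hψc : ContDiffAt ℝ n (fun q : (ℝ × V × V × ℝ × V) × (ℝ × V) => ψ (q.1.1, q.1.2.1))
      (u₀, 0) :=
    ContDiffAt.comp (g := ψ) (f := fun q : (ℝ × V × V × ℝ × V) × (ℝ × V) => (q.1.1, q.1.2.1))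
      (u₀, 0) (hψ.of_le (by exact_mod_cast Nat.le_succ n)) (by fun_prop)
  have hψ'c : ContDiffAt ℝ n
      (fun q : (ℝ × V × V × ℝ × V) × (ℝ × V) => fderiv ℝ ψ (q.1.1, q.1.2.1)) (u₀, 0) :=
    ContDiffAt.comp (g := fderiv ℝ ψ)
      (f := fun q : (ℝ × V × V × ℝ × V) × (ℝ × V) => (q.1.1, q.1.2.1))
      (u₀, 0) (hψ.fderiv_right (by exact_mod_cast le_rfl)) (by fun_prop)
  have hGc : ContDiffAt ℝ n (fun q : (ℝ × V × V × ℝ × V) × (ℝ × V) => G (ψ (q.1.1, q.1.2.1)))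
      (u₀, 0) :=
    ContDiffAt.comp (g := G) (f := fun q : (ℝ × V × V × ℝ × V) × (ℝ × V) => ψ (q.1.1, q.1.2.1))
      (u₀, 0) (by simpa [hu₀, e0] using hG) hψc
  have hf₂ : ContDiffAt ℝ n f₂ (u₀, 0) :=
    (hGc.clm_apply (by fun_prop)).clm_apply (hψ'c.clm_apply (by fun_prop))
  have hf : ContDiffAt ℝ n (fun q => (f₁ q, f₂ q)) (u₀, 0) := hf₁.prodMk hf₂
  -- Lengthening the hitting time by `s` changes the displacement by `-s • e₀` at first order, since
  -- `b(·, y₀, e₀)` has derivative `e₀` at `0`. This is the source of the term `w - s • e₀`.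
  have hpart : HasFDerivAt (fun k : ℝ × V => (f₁ (u₀, k), f₂ (u₀, k)))
      ((ContinuousLinearMap.snd ℝ ℝ V - (ContinuousLinearMap.fst ℝ ℝ V).smulRight e₀).prod
      ((G y₀).flip e₀ ∘L .snd ℝ ℝ V)) 0 := by
    refine HasFDerivAt.prodMk ?_ ?_
    · have hfst : HasFDerivAt (fun k : ℝ × V => (0 : ℝ) - k.1) (-(ContinuousLinearMap.fst ℝ ℝ V)) 0 := by
        simpa using (hasFDerivAt_fst (𝕜 := ℝ) (p := (0 : ℝ × V))).const_sub (0 : ℝ)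
      have h1 : HasFDerivAt (fun k : ℝ × V => b (0 - k.1, y₀, e₀))
          (-((ContinuousLinearMap.fst ℝ ℝ V).smulRight e₀)) 0 := by
        have := HasFDerivAt.comp (g := fun σ => b (σ, y₀, e₀)) (f := fun k : ℝ × V => (0 : ℝ) - k.1)
          0 (by simpa using (hb1 e₀).hasFDerivAt) hfst
        refine this.congr_fderiv ?_
        refine ContinuousLinearMap.ext fun k => ?_
        simp
      have h2 : HasFDerivAt (fun k : ℝ × V => (k.1, b (0 - k.1, y₀, e₀), k.2))
          ((ContinuousLinearMap.fst ℝ ℝ V).prod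
            ((-((ContinuousLinearMap.fst ℝ ℝ V).smulRight e₀)).prod (.snd ℝ ℝ V))) 0 :=
        hasFDerivAt_fst.prodMk (h1.prodMk hasFDerivAt_snd)
      have hz : ((0 : ℝ × V).1, b (0 - (0 : ℝ × V).1, y₀, e₀), (0 : ℝ × V).2) =
          (0 : ℝ × V × V) := by simp [hb0]
      have h3 := HasFDerivAt.comp (g := fun k : ℝ × V × V => D (ρ₀, defectParam y₀ k))
        (f := fun k : ℝ × V => (k.1, b (0 - k.1, y₀, e₀), k.2)) 0 (by rw [hz]; exact hD1) h2
      refine h3.congr_fderiv ?_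
      refine ContinuousLinearMap.ext fun k => ?_
      simp
      abel
    · have h1 := ((G y₀).flip e₀ ∘L ContinuousLinearMap.snd ℝ ℝ V).hasFDerivAt (x := 0)
      refine h1.congr_of_eventuallyEq (Eventually.of_forall fun k => ?_)
      have h2 : fderiv ℝ ψ (0, y₀) (0, e₀) = e₀ := by
        rw [(hasFDerivAt_flow_zero (hψ.differentiableAt (by simp)) hψ0).fderiv]
        simp
      simp [f₂, hu₀, e0, h2]
  have hinv : (fderiv ℝ (fun q => (f₁ q, f₂ q)) (u₀, 0) ∘L
      .inr ℝ (ℝ × V × V × ℝ × V) (ℝ × V)).IsInvertible := by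
    have h1 : HasFDerivAt (fun k : ℝ × V => (f₁ (u₀, k), f₂ (u₀, k)))
        (fderiv ℝ (fun q => (f₁ q, f₂ q)) (u₀, 0) ∘L
          .inr ℝ (ℝ × V × V × ℝ × V) (ℝ × V)) 0 :=
      HasFDerivAt.comp (g := fun q => (f₁ q, f₂ q)) (0 : ℝ × V)
        (hf.differentiableAt hn').hasFDerivAt
        (hasFDerivAt_prodMk_right (𝕜 := ℝ) u₀ (0 : ℝ × V))
    rw [h1.unique hpart]
    exact isInvertible_transversal (G y₀) he₀
  have hf0 : (f₁ (u₀, 0), f₂ (u₀, 0)) = 0 := by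
    refine Prod.ext ?_ ?_
    · change D (a (u₀, 0)) = 0
      rw [ha0, hD0]
    · simp [f₂]
  refine ⟨hf.implicitFunction hn' hinv, hf.contDiffAt_implicitFunction hn' hinv,
    hf.implicitFunction_apply_self hn' hinv, ?_, ?_⟩
  · filter_upwards [hf.eventually_apply_implicitFunction hn' hinv] with u hu
    rw [hf0] at hu
    exact congrArg Prod.snd hu
  · have lσ : Tendsto (fun q : (ℝ × V × V × ℝ × V) × (ℝ × V) => (q.1.1 - q.2.1, q.1.2.1))
        (𝓝 (u₀, 0)) (𝓝 (0, y₀)) :=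
      (show Continuous fun q : (ℝ × V × V × ℝ × V) × (ℝ × V) => (q.1.1 - q.2.1, q.1.2.1) by
        fun_prop).tendsto' _ _ (by simp [hu₀])
    have lg : Tendsto (fun q : (ℝ × V × V × ℝ × V) × (ℝ × V) => (q.2.1, q.1.1 - q.2.1, q.1.2.1))
        (𝓝 (u₀, 0)) (𝓝 (0, 0, y₀)) :=
      (show Continuous fun q : (ℝ × V × V × ℝ × V) × (ℝ × V) =>
        (q.2.1, q.1.1 - q.2.1, q.1.2.1) by fun_prop).tendsto' _ _ (by simp [hu₀])
    have la : Tendsto a (𝓝 (u₀, 0)) (𝓝 (ρ₀, 0, y₀, 0, 0, 0)) := by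
      rw [← ha0]
      exact ha.continuousAt
    filter_upwards [hf.eventually_apply_eq_iff_implicitFunction hn' hinv, lσ.eventually hbψ,
      lg.eventually hgrp, la.eventually hDF] with q h1 h2 h3 h4 hX hρ
    rw [hf0] at h1
    rw [eq_comm (a := q.2), ← h1, Prod.mk_eq_zero]
    refine and_congr ?_ Iff.rfl
    have h5 := h2 _ _ hX
    have h3' : ψ (q.1.1, q.1.2.1) = ψ (q.2.1, ψ (q.1.1 - q.2.1, q.1.2.1)) := by
      rw [← h3]; simp
    rw [h3', h5, ← sub_eq_zero]
    change sectionDefect E ψ (a q) = 0 ↔ D (a q) = 0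
    -- Here `ρ ≠ 0` is essential: for `ρ = 0` the holonomy equation is void, whereas `D = 0` still
    -- selects a solution.
    rw [h4, smul_eq_zero]
    exact or_iff_right hρ

end PoincareChart

/-! ### Maximal local flows generated by germs of curves. -/

noncomputable section LocalFlowOfGerms

set_option linter.unusedSectionVars false

variable {Z : Type*} [TopologicalSpace Z]

/-- A system of germs of curves `h ↦ q z h`, for `z` in the open set `U`, which is locally given
by continuous local flows. -/
structure IsFlowGerm (U : Set Z) (q : Z → ℝ → Z) : Prop where
  isOpen : IsOpen U
  exists_flow : ∀ z ∈ U, ∃ Q : ℝ × Z → Z, (∀ᶠ p in 𝓝 ((0 : ℝ), z), ContinuousAt Q p) ∧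
    (∀ᶠ z' in 𝓝 z, Q (0, z') = z') ∧
    ∀ᶠ p in 𝓝 ((0 : ℝ), z), ∀ᶠ h in 𝓝 (0 : ℝ), Q (p.1 + h, p.2) = q (Q p) h

/-- A curve in `U` following the germs `q`. -/
def FollowsGerm (U : Set Z) (q : Z → ℝ → Z) (γ : ℝ → Z) (I : Set ℝ) : Prop :=
  ∀ s ∈ I, γ s ∈ U ∧ ∀ᶠ s' in 𝓝 s, γ s' = q (γ s) (s' - s)

/-- `γ` is a solution issued from `z` on the open interval `I`. -/
structure IsGermSolution (U : Set Z) (q : Z → ℝ → Z) (z : Z) (γ : ℝ → Z) (I : Set ℝ) : Prop where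
  isOpen : IsOpen I
  isPreconnected : IsPreconnected I
  zero_mem : (0 : ℝ) ∈ I
  apply_zero : γ 0 = z
  follows : FollowsGerm U q γ I

/-- The domain of the maximal flow. -/
def germDomain (U : Set Z) (q : Z → ℝ → Z) : Set (ℝ × Z) :=
  {p | ∃ γ I, IsGermSolution U q p.2 γ I ∧ p.1 ∈ I}

open Classical in
/-- The maximal flow. -/
def germFlow (U : Set Z) (q : Z → ℝ → Z) (t : ℝ) (z : Z) : Z :=
  if h : (t, z) ∈ germDomain U q then h.choose t else z

variable {U : Set Z} {q : Z → ℝ → Z}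

lemma isPreconnected_inter_real {I J : Set ℝ} (hI : IsPreconnected I) (hJ : IsPreconnected J) :
    IsPreconnected (I ∩ J) := by
  rw [isPreconnected_iff_ordConnected] at *
  exact hI.inter hJ

namespace IsFlowGerm

lemma eventually_germ_eq (H : IsFlowGerm U q) {z : Z} (hz : z ∈ U) :
    q z 0 = z ∧ ContinuousAt (q z) 0 := by
  obtain ⟨Q, h1, h2, h3⟩ := H.exists_flow z hz
  have e0 := h2.self_of_nhds
  have e1 := h3.self_of_nhds
  simp only [zero_add, e0] at e1
  have e2 := e1.self_of_nhds
  refine ⟨by rw [← e2, e0], ?_⟩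
  have hc : ContinuousAt (fun h : ℝ => Q (h, z)) 0 :=
    ContinuousAt.comp (g := Q) (f := fun h : ℝ => (h, z)) h1.self_of_nhds
      (Continuous.prodMk continuous_id continuous_const).continuousAt
  exact hc.congr e1

lemma continuousAt_of_follows (H : IsFlowGerm U q) {γ : ℝ → Z} {I : Set ℝ}
    (h : FollowsGerm U q γ I) {s : ℝ} (hs : s ∈ I) : ContinuousAt γ s := by
  obtain ⟨hU, hev⟩ := h s hs
  obtain ⟨h0, hc⟩ := H.eventually_germ_eq hU
  have : ContinuousAt (fun s' => q (γ s) (s' - s)) s :=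
    ContinuousAt.comp (g := q (γ s)) (f := fun s' => s' - s) (by simpa using hc) (by fun_prop)
  exact this.congr (hev.mono fun _ h => h.symm)

variable [T2Space Z]

/-- Curves which agree at a time follow the same germ and agree nearby; curves which differ stay
apart in a Hausdorff space. Agreement is locally constant on a preconnected set. -/
lemma eqOn_of_follows (H : IsFlowGerm U q) {γ₁ γ₂ : ℝ → Z} {I : Set ℝ} (hI : IsPreconnected I)
    (h₁ : FollowsGerm U q γ₁ I) (h₂ : FollowsGerm U q γ₂ I) {s : ℝ} (hs : s ∈ I)
    (h : γ₁ s = γ₂ s) : EqOn γ₁ γ₂ I := by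
  intro t ht
  refine (hI.induction₂ (fun a b => γ₁ a = γ₂ a ↔ γ₁ b = γ₂ b) ?_
    (fun a b c _ _ _ h h' => h.trans h') (fun a b _ _ h => h.symm) hs ht).1 h
  intro a ha
  refine Filter.Eventually.filter_mono nhdsWithin_le_nhds ?_
  by_cases he : γ₁ a = γ₂ a
  · filter_upwards [(h₁ a ha).2, (h₂ a ha).2] with b hb hb'
    exact iff_of_true he (by rw [hb, hb', he])
  · have := ((H.continuousAt_of_follows h₁ ha).prodMk (H.continuousAt_of_follows h₂ ha)).eventually
      (isClosed_diagonal.isOpen_compl.mem_nhds he)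
    filter_upwards [this] with b hb
    exact iff_of_false he hb

lemma exists_union (H : IsFlowGerm U q) {γ₁ γ₂ : ℝ → Z} {I₁ I₂ : Set ℝ} (o₁ : IsOpen I₁)
    (o₂ : IsOpen I₂) (c₁ : IsPreconnected I₁) (c₂ : IsPreconnected I₂)
    (h₁ : FollowsGerm U q γ₁ I₁) (h₂ : FollowsGerm U q γ₂ I₂) {s : ℝ} (hs₁ : s ∈ I₁)
    (hs₂ : s ∈ I₂) (h : γ₁ s = γ₂ s) :
    ∃ γ, FollowsGerm U q γ (I₁ ∪ I₂) ∧ EqOn γ γ₁ I₁ ∧ EqOn γ γ₂ I₂ := by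
  classical
  have hi : EqOn γ₁ γ₂ (I₁ ∩ I₂) := H.eqOn_of_follows (isPreconnected_inter_real c₁ c₂)
    (fun a ha => h₁ a ha.1) (fun a ha => h₂ a ha.2) ⟨hs₁, hs₂⟩ h
  have e₁ : EqOn (fun a => if a ∈ I₁ then γ₁ a else γ₂ a) γ₁ I₁ := fun a ha => if_pos ha
  have e₂ : EqOn (fun a => if a ∈ I₁ then γ₁ a else γ₂ a) γ₂ I₂ := fun a ha => by
    by_cases h' : a ∈ I₁
    · exact (if_pos h').trans (hi ⟨h', ha⟩)
    · exact if_neg h'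
  refine ⟨_, ?_, e₁, e₂⟩
  rintro a (ha | ha)
  · rw [e₁ ha]
    refine ⟨(h₁ a ha).1, ?_⟩
    filter_upwards [(h₁ a ha).2, o₁.mem_nhds ha] with b hb hb'
    exact (e₁ hb').trans hb
  · rw [e₂ ha]
    refine ⟨(h₂ a ha).1, ?_⟩
    filter_upwards [(h₂ a ha).2, o₂.mem_nhds ha] with b hb hb'
    exact (e₂ hb').trans hb

lemma germFlow_eq (H : IsFlowGerm U q) {z : Z} {γ : ℝ → Z} {I : Set ℝ}
    (h : IsGermSolution U q z γ I) {t : ℝ} (ht : t ∈ I) : germFlow U q t z = γ t := by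
  have hd : (t, z) ∈ germDomain U q := ⟨γ, I, h, ht⟩
  rw [germFlow, dif_pos hd]
  obtain ⟨J, hJ, htJ⟩ := hd.choose_spec
  exact H.eqOn_of_follows (isPreconnected_inter_real hJ.isPreconnected h.isPreconnected)
    (fun a ha => hJ.follows a ha.1) (fun a ha => h.follows a ha.2)
    ⟨hJ.zero_mem, h.zero_mem⟩ (hJ.apply_zero.trans h.apply_zero.symm) ⟨htJ, ht⟩

end IsFlowGerm

lemma FollowsGerm.comp_add {γ : ℝ → Z} {I : Set ℝ} (h : FollowsGerm U q γ I) (s : ℝ) :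
    FollowsGerm U q (fun a => γ (a + s)) ((fun a => a + s) ⁻¹' I) := by
  intro a ha
  refine ⟨(h _ ha).1, ?_⟩
  have hl : Tendsto (fun b : ℝ => b + s) (𝓝 a) (𝓝 (a + s)) :=
    (continuous_add_const s).tendsto a
  filter_upwards [hl.eventually (h _ ha).2] with b hb
  rw [hb, add_sub_add_right_eq_sub]

lemma isPreconnected_preimage_add {I : Set ℝ} (hI : IsPreconnected I) (s : ℝ) :
    IsPreconnected ((fun a => a + s) ⁻¹' I) := by
  rw [isPreconnected_iff_ordConnected] at *
  exact hI.preimage_mono fun a b hab => by gcongr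

namespace IsFlowGerm

variable [T2Space Z]

/-- A solution issued from `z` and the translate by `s` of a solution issued from its value at `s`
agree at time `s`. By `exists_union` they glue to a solution on the union of the two intervals.
Conversely, a solution issued from `z` and covering `0`, `s` and `s + t` is translated by `-s`. -/
lemma add_mem_germDomain_iff (H : IsFlowGerm U q) {s t : ℝ} {z : Z}
    (hs : (s, z) ∈ germDomain U q) :
    (t, germFlow U q s z) ∈ germDomain U q ↔ (s + t, z) ∈ germDomain U q := by
  obtain ⟨γ, I, hγ, hsI⟩ := hs
  rw [H.germFlow_eq hγ hsI]
  constructor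
  · rintro ⟨γ', I', hγ', htI'⟩
    have htI' : t ∈ I' := htI'
    have hf := hγ'.follows.comp_add (-s)
    have h0 : s ∈ (fun a => a + -s) ⁻¹' I' := by simpa using hγ'.zero_mem
    obtain ⟨γ'', h1, h2, -⟩ := H.exists_union hγ.isOpen
      (hγ'.isOpen.preimage (continuous_add_const (-s))) hγ.isPreconnected
      (isPreconnected_preimage_add hγ'.isPreconnected (-s)) hγ.follows hf hsI h0
      (by simpa using hγ'.apply_zero.symm)
    refine ⟨γ'', _, ⟨hγ.isOpen.union (hγ'.isOpen.preimage (continuous_add_const (-s))),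
      hγ.isPreconnected.union s hsI h0 (isPreconnected_preimage_add hγ'.isPreconnected (-s)),
      Or.inl hγ.zero_mem, (h2 hγ.zero_mem).trans hγ.apply_zero, h1⟩, Or.inr ?_⟩
    simpa [add_comm s t] using htI'
  · rintro ⟨γ', I', hγ', htI'⟩
    obtain ⟨γ'', h1, h2, -⟩ := H.exists_union hγ.isOpen hγ'.isOpen hγ.isPreconnected
      hγ'.isPreconnected hγ.follows hγ'.follows hγ.zero_mem hγ'.zero_mem
      (hγ.apply_zero.trans hγ'.apply_zero.symm)
    refine ⟨_, _, ⟨(hγ.isOpen.union hγ'.isOpen).preimage (continuous_add_const s),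
      isPreconnected_preimage_add (hγ.isPreconnected.union 0 hγ.zero_mem hγ'.zero_mem
        hγ'.isPreconnected) s, ?_, ?_, h1.comp_add s⟩, ?_⟩
    · exact Or.inl (by simpa using hsI)
    · simpa using h2 hsI
    · exact Or.inr (by simpa [add_comm s t] using htI')

lemma germFlow_add (H : IsFlowGerm U q) {s t : ℝ} {z : Z} (hs : (s, z) ∈ germDomain U q)
    (hst : (s + t, z) ∈ germDomain U q) :
    germFlow U q (s + t) z = germFlow U q t (germFlow U q s z) := by
  obtain ⟨γ, I, hγ, hsI⟩ := hs
  obtain ⟨γ', I', hγ', htI'⟩ := hst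
  obtain ⟨γ'', h1, h2, h3⟩ := H.exists_union hγ.isOpen hγ'.isOpen hγ.isPreconnected
    hγ'.isPreconnected hγ.follows hγ'.follows hγ.zero_mem hγ'.zero_mem
    (hγ.apply_zero.trans hγ'.apply_zero.symm)
  rw [H.germFlow_eq hγ hsI, H.germFlow_eq hγ' htI']
  have hsol : IsGermSolution U q (γ s) (fun a => γ'' (a + s))
      ((fun a => a + s) ⁻¹' (I ∪ I')) :=
    ⟨(hγ.isOpen.union hγ'.isOpen).preimage (continuous_add_const s),
      isPreconnected_preimage_add (hγ.isPreconnected.union 0 hγ.zero_mem hγ'.zero_mem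
        hγ'.isPreconnected) s, Or.inl (by simpa using hsI), by simpa using h2 hsI, h1.comp_add s⟩
  rw [H.germFlow_eq hsol (Or.inr (by simpa [add_comm s t] using htI'))]
  simp only [add_comm t s]
  exact (h3 htI').symm

lemma ordConnected_germDomain (H : IsFlowGerm U q) (z : Z) :
    OrdConnected {t | (t, z) ∈ germDomain U q} := by
  refine ⟨?_⟩
  rintro a ⟨γ, I, hγ, ha⟩ b ⟨γ', I', hγ', hb⟩ c hc
  obtain ⟨γ'', h1, h2, -⟩ := H.exists_union hγ.isOpen hγ'.isOpen hγ.isPreconnected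
    hγ'.isPreconnected hγ.follows hγ'.follows hγ.zero_mem hγ'.zero_mem
    (hγ.apply_zero.trans hγ'.apply_zero.symm)
  have hp := hγ.isPreconnected.union 0 hγ.zero_mem hγ'.zero_mem hγ'.isPreconnected
  exact ⟨γ'', _, ⟨hγ.isOpen.union hγ'.isOpen, hp, Or.inl hγ.zero_mem,
    (h2 hγ.zero_mem).trans hγ.apply_zero, h1⟩,
    (isPreconnected_iff_ordConnected.1 hp).out (Or.inl ha) (Or.inr hb) hc⟩

lemma mem_of_mem_germDomain {t : ℝ} {z : Z} (h : (t, z) ∈ germDomain U q) :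
    z ∈ U ∧ (0, z) ∈ germDomain U q := by
  obtain ⟨γ, I, hγ, -⟩ := h
  have := (hγ.follows 0 hγ.zero_mem).1
  rw [hγ.apply_zero] at this
  exact ⟨this, γ, I, hγ, hγ.zero_mem⟩

lemma germFlow_mem (H : IsFlowGerm U q) {t : ℝ} {z : Z} (h : (t, z) ∈ germDomain U q) :
    germFlow U q t z ∈ U := by
  obtain ⟨γ, I, hγ, ht⟩ := h
  rw [H.germFlow_eq hγ ht]
  exact (hγ.follows t ht).1

lemma germFlow_zero (H : IsFlowGerm U q) {z : Z} (h : (0, z) ∈ germDomain U q) :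
    germFlow U q 0 z = z := by
  obtain ⟨γ, I, hγ, ht⟩ := h
  rw [H.germFlow_eq hγ ht, hγ.apply_zero]

/-- The local flows solve the germ equation. -/
lemma eventually_germFlow_eq (H : IsFlowGerm U q) {z : Z} (hz : z ∈ U) {Q : ℝ × Z → Z}
    (h1 : ∀ᶠ p in 𝓝 ((0 : ℝ), z), ContinuousAt Q p) (h2 : ∀ᶠ z' in 𝓝 z, Q (0, z') = z')
    (h3 : ∀ᶠ p in 𝓝 ((0 : ℝ), z), ∀ᶠ h in 𝓝 (0 : ℝ), Q (p.1 + h, p.2) = q (Q p) h) :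
    ∀ᶠ p in 𝓝 ((0 : ℝ), z), p ∈ germDomain U q ∧ germFlow U q p.1 p.2 = Q p := by
  have h4 : ∀ᶠ p in 𝓝 ((0 : ℝ), z), Q p ∈ U := by
    refine h1.self_of_nhds.eventually ?_
    rw [h2.self_of_nhds]
    exact H.isOpen.mem_nhds hz
  have hall := h3.and h4
  -- A rectangle is needed: on one common time interval, `Q(·, z')` must be a solution for all `z'`
  -- near `z`.
  rw [nhds_prod_eq, eventually_prod_iff] at hall
  obtain ⟨pa, ha, pb, hb, hab⟩ := hall
  obtain ⟨ε, hε, hball⟩ := Metric.eventually_nhds_iff_ball.1 ha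
  have hI : ∀ᶠ p in 𝓝 ((0 : ℝ), z), p.1 ∈ Metric.ball (0 : ℝ) ε ∧ pb p.2 ∧ Q (0, p.2) = p.2 := by
    rw [nhds_prod_eq]
    exact (Eventually.prod_mk (Metric.ball_mem_nhds (0 : ℝ) hε) (hb.and h2))
  filter_upwards [hI] with p hp
  have hsol : IsGermSolution U q p.2 (fun s => Q (s, p.2)) (Metric.ball (0 : ℝ) ε) := by
    refine ⟨Metric.isOpen_ball, (convex_ball _ _).isPreconnected, Metric.mem_ball_self hε,
      hp.2.2, fun s hs => ?_⟩
    obtain ⟨k1, k2⟩ := hab (hball s hs) hp.2.1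
    refine ⟨k2, ?_⟩
    have hl : Tendsto (fun s' : ℝ => s' - s) (𝓝 s) (𝓝 0) :=
      (show Continuous fun s' : ℝ => s' - s by fun_prop).tendsto' _ _ (by simp)
    filter_upwards [hl.eventually k1] with s' hs'
    rw [← hs']
    simp
  exact ⟨⟨_, _, hsol, hp.1⟩, H.germFlow_eq hsol hp.1⟩

/-- Propagation along solutions of properties of the flow which hold for small times and are
stable by composition. -/
lemma germFlow_induction (H : IsFlowGerm U q) {S : ℝ → Z → Prop}
    (hloc : ∀ z ∈ U, ∀ᶠ p in 𝓝 ((0 : ℝ), z), S p.1 p.2)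
    (hcomp : ∀ s t z, (s, z) ∈ germDomain U q → (s + t, z) ∈ germDomain U q → S s z →
      S t (germFlow U q s z) → S (s + t) z)
    {t : ℝ} {z : Z} (ht : (t, z) ∈ germDomain U q) : S t z := by
  obtain ⟨γ, I, hγ, htI⟩ := ht
  have key : ∀ a ∈ I, ∀ b ∈ I, (b - a, γ a) ∈ germDomain U q ∧
      germFlow U q (b - a) (γ a) = γ b := by
    intro a ha b hb
    have hsol : IsGermSolution U q (γ a) (fun s => γ (s + a)) ((fun s => s + a) ⁻¹' I) :=
      ⟨hγ.isOpen.preimage (continuous_add_const a),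
        isPreconnected_preimage_add hγ.isPreconnected a, by simpa using ha, by simp,
        hγ.follows.comp_add a⟩
    have hb' : b - a ∈ (fun s => s + a) ⁻¹' I := by simpa using hb
    exact ⟨⟨_, _, hsol, hb'⟩, by rw [H.germFlow_eq hsol hb']; simp⟩
  -- The relation between two times `a` and `b` of the solution is that `S` holds for the flow from
  -- `γ a` during `b - a`, a possibly negative time. It holds in both directions for nearby times,
  -- and it is transitive by `hcomp`.
  have := hγ.isPreconnected.induction₂' (fun a b => S (b - a) (γ a)) ?_ ?_ hγ.zero_mem htI
  · simpa [hγ.apply_zero] using this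
  · intro a ha
    refine Filter.Eventually.filter_mono nhdsWithin_le_nhds ?_
    have hc := H.continuousAt_of_follows hγ.follows ha
    have l1 : Tendsto (fun b : ℝ => (b - a, γ a)) (𝓝 a) (𝓝 (0, γ a)) :=
      (show Continuous fun b : ℝ => (b - a, γ a) by fun_prop).tendsto' _ _ (by simp)
    have l2 : Tendsto (fun b : ℝ => (a - b, γ b)) (𝓝 a) (𝓝 (0, γ a)) := by
      have : ContinuousAt (fun b : ℝ => (a - b, γ b)) a := by fun_prop
      simpa using this.tendsto
    have hU := (hγ.follows a ha).1
    filter_upwards [l1.eventually (hloc _ hU), l2.eventually (hloc _ hU)] with b h1 h2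
    exact ⟨h1, h2⟩
  · intro a b c ha hb hc h1 h2
    obtain ⟨k1, k2⟩ := key a ha b hb
    obtain ⟨k3, -⟩ := key a ha c hc
    have := hcomp (b - a) (c - b) (γ a) k1 (by simpa using k3) h1 (by rwa [k2])
    simpa using this

/-- For small times the flow is one of the given local flows. Near `(s + t, z)` it is the flow
during a time close to `t` composed with the flow during the fixed time `s`, so the property is
stable by composition and `germFlow_induction` applies. Openness of the domain is obtained
simultaneously. -/
lemma eventually_continuousAt_germFlow (H : IsFlowGerm U q) {t : ℝ} {z : Z}
    (ht : (t, z) ∈ germDomain U q) :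
    ∀ᶠ p in 𝓝 (t, z), p ∈ germDomain U q ∧
      ContinuousAt (fun p : ℝ × Z => germFlow U q p.1 p.2) p := by
  refine H.germFlow_induction (S := fun t z => ∀ᶠ p in 𝓝 (t, z), p ∈ germDomain U q ∧
      ContinuousAt (fun p : ℝ × Z => germFlow U q p.1 p.2) p) ?_ ?_ ht
  · intro z hz
    obtain ⟨Q, h1, h2, h3⟩ := H.exists_flow z hz
    have h4 := H.eventually_germFlow_eq hz h1 h2 h3
    refine ((h4.eventually_nhds.and h1).mono fun p hp => ?_).eventually_nhds
    exact ⟨hp.1.self_of_nhds.1, hp.2.congr (hp.1.mono fun p' hp' => hp'.2.symm)⟩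
  · intro s t z hs hst h1 h2
    have hfix : ContinuousAt (fun z' => germFlow U q s z') z :=
      ContinuousAt.comp (g := fun p : ℝ × Z => germFlow U q p.1 p.2) (f := fun z' => (s, z'))
        h1.self_of_nhds.2 (Continuous.prodMk continuous_const continuous_id).continuousAt
    have hl : Tendsto (fun p : ℝ × Z => (p.1 - s, germFlow U q s p.2)) (𝓝 (s + t, z))
        (𝓝 (t, germFlow U q s z)) := by
      have hc : ContinuousAt (fun p : ℝ × Z => (p.1 - s, germFlow U q s p.2)) (s + t, z) :=
        ContinuousAt.prodMk (by fun_prop)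
          (ContinuousAt.comp (g := fun z' => germFlow U q s z') (f := fun p : ℝ × Z => p.2)
            hfix continuousAt_snd)
      simpa using hc.tendsto
    have hl2 : Tendsto (fun p : ℝ × Z => (s, p.2)) (𝓝 (s + t, z)) (𝓝 (s, z)) :=
      (Continuous.prodMk continuous_const continuous_snd).tendsto' _ _ rfl
    have hmem : ∀ᶠ p in 𝓝 (s + t, z), p ∈ germDomain U q ∧
        germFlow U q p.1 p.2 = germFlow U q (p.1 - s) (germFlow U q s p.2) := by
      filter_upwards [hl.eventually h2, hl2.eventually h1] with p k1 k2
      have k3 := (H.add_mem_germDomain_iff k2.1).1 k1.1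
      have k4 := H.germFlow_add k2.1 k3
      rw [add_sub_cancel] at k3 k4
      exact ⟨k3, k4⟩
    filter_upwards [hmem.eventually_nhds, hl.eventually h2, hl2.eventually h1] with p k1 k2 k3
    refine ⟨k1.self_of_nhds.1, ?_⟩
    have hfix' : ContinuousAt (fun z' => germFlow U q s z') p.2 :=
      ContinuousAt.comp (g := fun p : ℝ × Z => germFlow U q p.1 p.2) (f := fun z' => (s, z'))
        k3.2 (Continuous.prodMk continuous_const continuous_id).continuousAt
    have hc : ContinuousAt (fun p : ℝ × Z => (p.1 - s, germFlow U q s p.2)) p :=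
      ContinuousAt.prodMk (by fun_prop)
        (ContinuousAt.comp (g := fun z' => germFlow U q s z') (f := fun p : ℝ × Z => p.2)
          hfix' continuousAt_snd)
    exact (ContinuousAt.comp (g := fun p : ℝ × Z => germFlow U q p.1 p.2)
      (f := fun p : ℝ × Z => (p.1 - s, germFlow U q s p.2)) k2.2 hc).congr
      (k1.mono fun p' hp' => hp'.2.symm)

lemma isOpen_germDomain (H : IsFlowGerm U q) : IsOpen (germDomain U q) :=
  isOpen_iff_mem_nhds.2 fun _ hp =>
    (H.eventually_continuousAt_germFlow hp).mono fun _ h => h.1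

lemma continuousAt_germFlow (H : IsFlowGerm U q) {t : ℝ} {z : Z} (ht : (t, z) ∈ germDomain U q) :
    ContinuousAt (fun p : ℝ × Z => germFlow U q p.1 p.2) (t, z) :=
  (H.eventually_continuousAt_germFlow ht).self_of_nhds.2

/-- A curve following the germs on a closed interval is an orbit of the flow. -/
lemma germFlow_eq_of_uIcc (H : IsFlowGerm U q) {γ : ℝ → Z} {t : ℝ}
    (h : ∀ s ∈ uIcc 0 t, γ s ∈ U ∧ ∀ᶠ s' in 𝓝[uIcc 0 t] s, γ s' = q (γ s) (s' - s)) :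
    (t, γ 0) ∈ germDomain U q ∧ germFlow U q t (γ 0) = γ t := by
  -- At the end points the curve follows its germ on one side only, so it need not be a solution on
  -- an open interval. The comparison with the flow is therefore made between pairs of times inside
  -- the closed interval.
  have := isPreconnected_uIcc.induction₂' (s := uIcc 0 t) (fun a b => (b - a, γ a) ∈ germDomain U q ∧
    germFlow U q (b - a) (γ a) = γ b) ?_ ?_ left_mem_uIcc right_mem_uIcc
  · simpa using this
  · intro a ha
    obtain ⟨hU, hev⟩ := h a ha
    obtain ⟨Q, h1, h2, h3⟩ := H.exists_flow _ hU
    have h4 := H.eventually_germFlow_eq hU h1 h2 h3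
    have e1 := h3.self_of_nhds
    simp only [zero_add, h2.self_of_nhds] at e1
    have l0 : Tendsto (fun b : ℝ => b - a) (𝓝[uIcc 0 t] a) (𝓝 0) :=
      ((show Continuous fun b : ℝ => b - a by fun_prop).tendsto' _ _ (by simp)).mono_left
        nhdsWithin_le_nhds
    have l1 : Tendsto (fun b : ℝ => (b - a, γ a)) (𝓝[uIcc 0 t] a) (𝓝 (0, γ a)) :=
      l0.prodMk_nhds tendsto_const_nhds
    filter_upwards [hev, l0.eventually e1, l1.eventually h4] with b k1 k2 k3
    have hb : germFlow U q (b - a) (γ a) = γ b := by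
      rw [k3.2, k2, k1]
    have h0 := (mem_of_mem_germDomain k3.1).2
    have hd : (a - b, germFlow U q (b - a) (γ a)) ∈ germDomain U q := by
      rw [H.add_mem_germDomain_iff k3.1]
      simpa using h0
    have h5 := H.germFlow_add k3.1 (t := a - b) (by simpa using h0)
    rw [sub_add_sub_cancel, sub_self, H.germFlow_zero h0, hb] at h5
    rw [hb] at hd
    exact ⟨⟨k3.1, hb⟩, hd, h5.symm⟩
  · rintro a b c - - - ⟨k1, k2⟩ ⟨k3, k4⟩
    have h1 : (b - a + (c - b), γ a) ∈ germDomain U q := by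
      rw [← H.add_mem_germDomain_iff k1, k2]
      exact k3
    have h2 := H.germFlow_add k1 h1
    rw [k2, k4] at h2
    rw [show b - a + (c - b) = c - a by ring] at h1 h2
    exact ⟨h1, h2⟩

end IsFlowGerm

end LocalFlowOfGerms

/-! ### Smoothness along fibres with continuous dependence on the base. -/

noncomputable section FiberwiseSmooth

set_option linter.unusedSectionVars false
set_option synthInstance.maxHeartbeats 400000

variable {B : Type*} [TopologicalSpace B] {F : Type} [NormedAddCommGroup F] [NormedSpace ℝ F]

/-- `f` is `C^k` along the fibers near `p`, with derivatives along the fibers which are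
continuous in the base point and the vector. -/
def FibContDiffAt : ∀ (_ : ℕ) {F' : Type} [NormedAddCommGroup F'] [NormedSpace ℝ F']
    (_ : B × F → F') (_ : B × F), Prop
  | 0, _, _, _, f, p => ∀ᶠ q in 𝓝 p, ContinuousAt f q
  | k + 1, F', _, _, f, p => (∀ᶠ q in 𝓝 p, ContinuousAt f q) ∧ ∃ f' : B × F → F →L[ℝ] F',
      (∀ᶠ q in 𝓝 p, HasFDerivAt (fun w => f (q.1, w)) (f' q) q.2) ∧ FibContDiffAt k f' p

variable {F' : Type} [NormedAddCommGroup F'] [NormedSpace ℝ F']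
  {F₁ : Type} [NormedAddCommGroup F₁] [NormedSpace ℝ F₁]
  {F₂ : Type} [NormedAddCommGroup F₂] [NormedSpace ℝ F₂]

namespace FibContDiffAt

lemma eventually_continuousAt {k : ℕ} {f : B × F → F'} {p : B × F} (h : FibContDiffAt k f p) :
    ∀ᶠ q in 𝓝 p, ContinuousAt f q := by
  cases k with
  | zero => exact h
  | succ k => exact h.1

lemma continuousAt {k : ℕ} {f : B × F → F'} {p : B × F} (h : FibContDiffAt k f p) :
    ContinuousAt f p := h.eventually_continuousAt.self_of_nhds

lemma congr {k : ℕ} {f g : B × F → F'} {p : B × F} (h : FibContDiffAt k f p)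
    (hfg : g =ᶠ[𝓝 p] f) : FibContDiffAt k g p := by
  have hc : ∀ᶠ q in 𝓝 p, ContinuousAt g q := by
    filter_upwards [h.eventually_continuousAt, hfg.eventually_nhds] with q h1 h2
    exact h1.congr (h2.mono fun _ h => h.symm)
  cases k with
  | zero => exact hc
  | succ k =>
    obtain ⟨-, f', h1, h2⟩ := h
    refine ⟨hc, f', ?_, h2⟩
    filter_upwards [h1, hfg.eventually_nhds] with q h3 h4
    have hl : Tendsto (fun w : F => (q.1, w)) (𝓝 q.2) (𝓝 q) :=
      (Continuous.prodMk continuous_const continuous_id).tendsto' _ _ rfl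
    exact h3.congr_of_eventuallyEq (hl.eventually h4)

lemma of_succ {k : ℕ} {F' : Type} [NormedAddCommGroup F'] [NormedSpace ℝ F']
    {f : B × F → F'} {p : B × F} (h : FibContDiffAt (k + 1) f p) :
    FibContDiffAt k f p := by
  induction k generalizing F' with
  | zero => exact h.1
  | succ k ih =>
    obtain ⟨h0, f', h1, h2⟩ := h
    exact ⟨h0, f', h1, ih h2⟩

lemma zero_fun (k : ℕ) {F' : Type} [NormedAddCommGroup F'] [NormedSpace ℝ F'] (p : B × F) :
    FibContDiffAt k (fun _ => (0 : F')) p := by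
  induction k generalizing F' with
  | zero => exact Eventually.of_forall fun _ => continuousAt_const
  | succ k ih =>
    exact ⟨Eventually.of_forall fun _ => continuousAt_const, fun _ => 0,
      Eventually.of_forall fun _ => hasFDerivAt_const _ _, ih⟩

/-- Functions of the base point. -/
lemma base (k : ℕ) {c : B → F'} {p : B × F} (h : ∀ᶠ b in 𝓝 p.1, ContinuousAt c b) :
    FibContDiffAt k (fun q : B × F => c q.1) p := by
  have hc : ∀ᶠ q in 𝓝 p, ContinuousAt (fun q : B × F => c q.1) q := by
    filter_upwards [continuousAt_fst.eventually h] with q hq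
    exact ContinuousAt.comp (g := c) (f := Prod.fst) hq continuousAt_fst
  cases k with
  | zero => exact hc
  | succ k => exact ⟨hc, fun _ => 0, Eventually.of_forall fun q => hasFDerivAt_const (c q.1) q.2,
      zero_fun k p⟩

lemma const (k : ℕ) (c : F') (p : B × F) : FibContDiffAt k (fun _ : B × F => c) p :=
  base k (c := fun _ => c) (Eventually.of_forall fun _ => continuousAt_const)

lemma snd (k : ℕ) (p : B × F) : FibContDiffAt k (fun q : B × F => q.2) p := by
  cases k with
  | zero => exact Eventually.of_forall fun _ => continuousAt_snd
  | succ k => exact ⟨Eventually.of_forall fun _ => continuousAt_snd, fun _ => .id ℝ F,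
      Eventually.of_forall fun q => hasFDerivAt_id q.2, const k _ p⟩

lemma add {k : ℕ} {F' : Type} [NormedAddCommGroup F'] [NormedSpace ℝ F']
    {f g : B × F → F'} {p : B × F} (hf : FibContDiffAt k f p)
    (hg : FibContDiffAt k g p) : FibContDiffAt k (fun q => f q + g q) p := by
  have hc : ∀ᶠ q in 𝓝 p, ContinuousAt (fun q => f q + g q) q := by
    filter_upwards [hf.eventually_continuousAt, hg.eventually_continuousAt] with q h1 h2
    exact h1.add h2
  induction k generalizing F' with
  | zero => exact hc
  | succ k ih =>
    obtain ⟨-, f', h1, h2⟩ := hf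
    obtain ⟨-, g', h3, h4⟩ := hg
    refine ⟨hc, fun q => f' q + g' q, ?_, ih h2 h4 ?_⟩
    · filter_upwards [h1, h3] with q a b
      exact a.add b
    · filter_upwards [h2.eventually_continuousAt, h4.eventually_continuousAt] with q a b
      exact a.add b

/-- By Leibniz's rule the fibre derivative is a sum of two bilinear expressions, in `(f, g')` and in
`(f', g)`. The three spaces change at each step, so the induction generalizes over them. -/
lemma bilinear {k : ℕ} {F' F₁ F₂ : Type} [NormedAddCommGroup F'] [NormedSpace ℝ F']
    [NormedAddCommGroup F₁] [NormedSpace ℝ F₁] [NormedAddCommGroup F₂] [NormedSpace ℝ F₂]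
    (L : F₁ →L[ℝ] F₂ →L[ℝ] F') {f : B × F → F₁} {g : B × F → F₂} {p : B × F}
    (hf : FibContDiffAt k f p) (hg : FibContDiffAt k g p) :
    FibContDiffAt k (fun q => L (f q) (g q)) p := by
  have hc : ∀ᶠ q in 𝓝 p, ContinuousAt (fun q => L (f q) (g q)) q := by
    filter_upwards [hf.eventually_continuousAt, hg.eventually_continuousAt] with q h1 h2
    exact (L.continuous.continuousAt.comp h1).clm_apply h2
  induction k generalizing F' F₁ F₂ with
  | zero => exact hc
  | succ k ih =>
    have hf0 := hf.of_succ
    have hg0 := hg.of_succ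
    obtain ⟨-, f', h1, h2⟩ := hf
    obtain ⟨-, g', h3, h4⟩ := hg
    refine ⟨hc, fun q => L.precompR F (f q) (g' q) + L.precompL F (f' q) (g q), ?_,
      add (ih (L.precompR F) hf0 h4 ?_) (ih (L.precompL F) h2 hg0 ?_)⟩
    · filter_upwards [h1, h3] with q a b
      exact L.hasFDerivAt_of_bilinear a b
    · filter_upwards [hf0.eventually_continuousAt, h4.eventually_continuousAt] with q a b
      exact ((L.precompR F).continuous.continuousAt.comp a).clm_apply b
    · filter_upwards [h2.eventually_continuousAt, hg0.eventually_continuousAt] with q a b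
      exact ((L.precompL F).continuous.continuousAt.comp a).clm_apply b

/-- Continuous families of linear maps. -/
lemma clm_apply {k : ℕ} {c : B → F₁ →L[ℝ] F'} {f : B × F → F₁} {p : B × F}
    (hc : ∀ᶠ b in 𝓝 p.1, ContinuousAt c b) (hf : FibContDiffAt k f p) :
    FibContDiffAt k (fun q => c q.1 (f q)) p :=
  bilinear (.id ℝ (F₁ →L[ℝ] F')) (base k hc) hf

/-- The base map only has to be continuous, since one never differentiates across fibres. The chain
rule gives a composition of operators, which is bilinear and handled by `bilinear`. -/
lemma comp {k : ℕ} {B' : Type*} [TopologicalSpace B'] {F'' : Type} [NormedAddCommGroup F'']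
    [NormedSpace ℝ F''] {g : B' × F' → F''} {φ : B → B'} {f : B × F → F'} {p : B × F}
    (hg : FibContDiffAt k g (φ p.1, f p)) (hφ : ∀ᶠ b in 𝓝 p.1, ContinuousAt φ b)
    (hf : FibContDiffAt k f p) : FibContDiffAt k (fun q => g (φ q.1, f q)) p := by
  have hφ1 : ∀ᶠ q in 𝓝 p, ContinuousAt (fun q : B × F => φ q.1) q := by
    filter_upwards [continuousAt_fst.eventually hφ] with q hq
    exact ContinuousAt.comp (g := φ) (f := Prod.fst) hq continuousAt_fst
  have hpair : ∀ᶠ q in 𝓝 p, ContinuousAt (fun q : B × F => (φ q.1, f q)) q := by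
    filter_upwards [hφ1, hf.eventually_continuousAt] with q h1 h2
    exact h1.prodMk h2
  have hl : Tendsto (fun q : B × F => (φ q.1, f q)) (𝓝 p) (𝓝 (φ p.1, f p)) :=
    hpair.self_of_nhds
  have hc : ∀ᶠ q in 𝓝 p, ContinuousAt (fun q => g (φ q.1, f q)) q := by
    filter_upwards [hl.eventually hg.eventually_continuousAt, hpair] with q h1 h2
    exact ContinuousAt.comp (g := g) (f := fun q : B × F => (φ q.1, f q)) h1 h2
  induction k generalizing F'' with
  | zero => exact hc
  | succ k ih =>
    obtain ⟨-, g', h1, h2⟩ := hg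
    have hf0 := hf.of_succ
    obtain ⟨-, f', h3, h4⟩ := hf
    refine ⟨hc, fun q => ContinuousLinearMap.compL ℝ F F' F'' (g' (φ q.1, f q)) (f' q), ?_,
      bilinear _ (ih h2 hf0 ?_) h4⟩
    · filter_upwards [hl.eventually h1, h3] with q a b
      exact HasFDerivAt.comp (g := fun w => g (φ q.1, w)) (f := fun w => f (q.1, w)) q.2 a b
    · filter_upwards [hl.eventually h2.eventually_continuousAt, hpair] with q h1 h2
      exact ContinuousAt.comp (g := g') (f := fun q : B × F => (φ q.1, f q)) h1 h2

/-- Jointly smooth maps of continuous parameters and of the vector. -/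
lemma of_contDiffAt {k : ℕ} {P F' : Type} [NormedAddCommGroup P] [NormedSpace ℝ P]
    [NormedAddCommGroup F'] [NormedSpace ℝ F']
    {H : P × F → F'} {c : B → P} {p : B × F} (hH : ContDiffAt ℝ k H (c p.1, p.2))
    (hc : ∀ᶠ b in 𝓝 p.1, ContinuousAt c b) :
    FibContDiffAt k (fun q : B × F => H (c q.1, q.2)) p := by
  have hpair : ∀ᶠ q in 𝓝 p, ContinuousAt (fun q : B × F => (c q.1, q.2)) q := by
    filter_upwards [continuousAt_fst.eventually hc] with q hq
    exact (ContinuousAt.comp (g := c) (f := Prod.fst) hq continuousAt_fst).prodMk continuousAt_snd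
  have hl : Tendsto (fun q : B × F => (c q.1, q.2)) (𝓝 p) (𝓝 (c p.1, p.2)) :=
    hpair.self_of_nhds
  have hcont : ∀ᶠ q in 𝓝 p, ContinuousAt (fun q : B × F => H (c q.1, q.2)) q := by
    filter_upwards [hl.eventually (hH.eventually (by simp)), hpair] with q h1 h2
    exact ContinuousAt.comp (g := H) (f := fun q : B × F => (c q.1, q.2)) h1.continuousAt h2
  induction k generalizing F' with
  | zero => exact hcont
  | succ k ih =>
    have hH' : ContDiffAt ℝ k (fun z => fderiv ℝ H z ∘L .inr ℝ P F) (c p.1, p.2) :=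
      (hH.fderiv_right (m := k) (by exact_mod_cast le_rfl)).clm_comp contDiffAt_const
    refine ⟨hcont, fun q => fderiv ℝ H (c q.1, q.2) ∘L .inr ℝ P F, ?_, ih hH' ?_⟩
    · filter_upwards [hl.eventually (hH.eventually (by simp))] with q hq
      exact HasFDerivAt.comp (g := H) q.2 (hq.differentiableAt (by simp)).hasFDerivAt
        (hasFDerivAt_prodMk_right (𝕜 := ℝ) (c q.1) q.2)
    · filter_upwards [hl.eventually (hH'.eventually (by simp)), hpair] with q h1 h2
      exact ContinuousAt.comp (g := fun z => fderiv ℝ H z ∘L .inr ℝ P F)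
        (f := fun q : B × F => (c q.1, q.2)) h1.continuousAt h2

lemma contDiffAt {k : ℕ} {F' : Type} [NormedAddCommGroup F'] [NormedSpace ℝ F']
    {f : B × F → F'} {p : B × F} (h : FibContDiffAt k f p) :
    ContDiffAt ℝ k (fun w => f (p.1, w)) p.2 := by
  have hl : Tendsto (fun w : F => (p.1, w)) (𝓝 p.2) (𝓝 p) :=
    (Continuous.prodMk continuous_const continuous_id).tendsto' _ _ rfl
  induction k generalizing F' with
  | zero =>
    refine contDiffAt_zero.2 ⟨_, hl.eventually h, fun w hw => ?_⟩
    exact (ContinuousAt.comp (g := f) (f := fun w : F => (p.1, w)) hw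
      (Continuous.prodMk continuous_const continuous_id).continuousAt).continuousWithinAt
  | succ k ih =>
    obtain ⟨-, f', h1, h2⟩ := h
    have := (contDiffAt_succ_iff_hasFDerivAt (𝕜 := ℝ) (n := k) (f := fun w => f (p.1, w))
      (x := p.2)).2 ⟨fun w => f' (p.1, w), ⟨_, hl.eventually h1, fun w hw => hw⟩, ih h2⟩
    exact_mod_cast this

/-- The innermost derivative is peeled off: up to a currying isometry, the derivative of order `j +
1` of `f` is that of order `j` of `f'`, which is the actual fibre derivative near `p`. -/
lemma continuousAt_iteratedFDeriv {k : ℕ} {F' : Type} [NormedAddCommGroup F'] [NormedSpace ℝ F']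
    {f : B × F → F'} {p : B × F} (h : FibContDiffAt k f p) {j : ℕ} (hj : j ≤ k) :
    ContinuousAt (fun q : B × F => iteratedFDeriv ℝ j (fun w => f (q.1, w)) q.2) p := by
  induction k generalizing F' j with
  | zero =>
    obtain rfl : j = 0 := Nat.le_zero.1 hj
    exact ContinuousAt.comp (g := (continuousMultilinearCurryFin0 ℝ F F').symm) (f := f)
      (LinearIsometryEquiv.continuous _).continuousAt h.continuousAt
  | succ k ih =>
    cases j with
    | zero =>
      exact ContinuousAt.comp (g := (continuousMultilinearCurryFin0 ℝ F F').symm) (f := f)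
        (LinearIsometryEquiv.continuous _).continuousAt h.continuousAt
    | succ j =>
      obtain ⟨-, f', h1, h2⟩ := h
      have h3 := ih h2 (Nat.le_of_succ_le_succ hj)
      have hcont := (continuousMultilinearCurryRightEquiv' ℝ j F F').symm.continuous
      refine ContinuousAt.congr (hcont.continuousAt.comp h3) ?_
      filter_upwards [h1.eventually_nhds] with q hq
      have hl : Tendsto (fun w : F => (q.1, w)) (𝓝 q.2) (𝓝 q) :=
        (Continuous.prodMk continuous_const continuous_id).tendsto' _ _ rfl
      have e1 : (fun w => f' (q.1, w)) =ᶠ[𝓝 q.2] fun w => fderiv ℝ (fun w => f (q.1, w)) w := by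
        filter_upwards [hl.eventually hq] with w hw
        exact hw.fderiv.symm
      have e2 := (e1.iteratedFDeriv ℝ j).self_of_nhds
      rw [iteratedFDeriv_succ_eq_comp_right]
      simp only [Function.comp_apply]
      exact congrArg _ e2

end FibContDiffAt

end FiberwiseSmooth

/-! ### Germs of flows on a vector bundle. -/

noncomputable section FiberedGermFlow

set_option linter.unusedSectionVars false
set_option synthInstance.maxHeartbeats 400000

variable {B : Type*} [TopologicalSpace B] {F : Type} [NormedAddCommGroup F] [NormedSpace ℝ F]
  {E : B → Type*} [∀ x, AddCommGroup (E x)] [∀ x, Module ℝ (E x)]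
  [TopologicalSpace (TotalSpace F E)] [∀ x, TopologicalSpace (E x)]
  [FiberBundle F E] [VectorBundle ℝ F E]

/-- The point of the total space with given coordinates in a trivialization. -/
def trivPoint (e : Trivialization F (π F E)) (q : B × F) : TotalSpace F E :=
  ⟨q.1, e.symm q.1 q.2⟩

lemma trivPoint_apply {e : Trivialization F (π F E)} {z : TotalSpace F E}
    (hz : z.proj ∈ e.baseSet) : trivPoint e (e z) = z := by
  rw [← e.mk_proj_snd' hz, trivPoint]
  simp only
  rw [e.symm_proj_apply z hz]

lemma apply_trivPoint {e : Trivialization F (π F E)} {q : B × F} (hq : q.1 ∈ e.baseSet) :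
    e (trivPoint e q) = q :=
  e.apply_mk_symm hq q.2

lemma continuousAt_trivPoint {e : Trivialization F (π F E)} {q : B × F} (hq : q.1 ∈ e.baseSet) :
    ContinuousAt (trivPoint e) q := by
  refine (e.toOpenPartialHomeomorph.continuousAt_symm (e.mem_target.2 hq)).congr ?_
  filter_upwards [continuousAt_fst.eventually (e.open_baseSet.mem_nhds hq)] with q' hq'
  exact (e.mk_symm hq' q'.2).symm

/-- A map of the total space is `C^k` along the fibers near `z`. -/
def FibSmoothAt (k : ℕ) (g : TotalSpace F E → TotalSpace F E) (z : TotalSpace F E) : Prop :=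
  ∀ (e e' : Trivialization F (π F E)) [MemTrivializationAtlas e] [MemTrivializationAtlas e'],
    z.proj ∈ e.baseSet → (g z).proj ∈ e'.baseSet →
    FibContDiffAt k (fun q : B × F => (e' (g (trivPoint e q))).2) (e z)

lemma tendsto_trivPoint {e : Trivialization F (π F E)} {z : TotalSpace F E}
    (hz : z.proj ∈ e.baseSet) : Tendsto (trivPoint e) (𝓝 (e z)) (𝓝 z) := by
  have h : ContinuousAt (trivPoint e) (e z) :=
    continuousAt_trivPoint (by rw [e.coe_fst' hz]; exact hz)
  have h' := h.tendsto
  rwa [trivPoint_apply hz] at h'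

lemma eventually_fst_mem_baseSet {e : Trivialization F (π F E)} {z : TotalSpace F E}
    {s : Set B} (hs : IsOpen s) (hz : z.proj ∈ e.baseSet) (hzs : z.proj ∈ s) :
    ∀ᶠ q in 𝓝 (e z), q.1 ∈ s :=
  continuousAt_fst.eventually (hs.mem_nhds (by rw [e.coe_fst' hz]; exact hzs))

namespace FibSmoothAt

lemma congr {k : ℕ} {g g' : TotalSpace F E → TotalSpace F E} {z : TotalSpace F E}
    (h : FibSmoothAt k g z) (hg : g' =ᶠ[𝓝 z] g) : FibSmoothAt k g' z := by
  intro e e' _ _ he he'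
  rw [hg.self_of_nhds] at he'
  refine (h e e' he he').congr ?_
  filter_upwards [(tendsto_trivPoint he).eventually hg] with q hq
  rw [hq]

/-- Changes of trivialization are continuous families of linear maps, hence of every class along the
fibres. One pair of trivializations therefore decides for all others. -/
lemma of_trivialization {k : ℕ} {g : TotalSpace F E → TotalSpace F E} {z : TotalSpace F E}
    {φ : B → B} (hφ : Continuous φ) (hg : ∀ᶠ z' in 𝓝 z, (g z').proj = φ z'.proj)
    {e₁ e₁' : Trivialization F (π F E)} [MemTrivializationAtlas e₁] [MemTrivializationAtlas e₁']
    (he₁ : z.proj ∈ e₁.baseSet) (he₁' : (g z).proj ∈ e₁'.baseSet)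
    (h : FibContDiffAt k (fun q : B × F => (e₁' (g (trivPoint e₁ q))).2) (e₁ z)) :
    FibSmoothAt k g z := by
  intro e e' _ _ he he'
  have hgz := hg.self_of_nhds
  have hez : (e z).1 = z.proj := e.coe_fst' he
  have c1 : ∀ᶠ b in 𝓝 (e z).1,
      ContinuousAt (fun b => (e.coordChangeL ℝ e₁ b : F →L[ℝ] F)) b := by
    rw [hez]
    have ho : IsOpen (e.baseSet ∩ e₁.baseSet) := e.open_baseSet.inter e₁.open_baseSet
    filter_upwards [ho.mem_nhds ⟨he, he₁⟩] with b hb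
    exact (continuousOn_coordChange ℝ e e₁).continuousAt (ho.mem_nhds hb)
  have c2 : ∀ᶠ b in 𝓝 (e z).1,
      ContinuousAt (fun b => (e₁'.coordChangeL ℝ e' (φ b) : F →L[ℝ] F)) b := by
    rw [hez]
    have ho : IsOpen (e₁'.baseSet ∩ e'.baseSet) := e₁'.open_baseSet.inter e'.open_baseSet
    filter_upwards [hφ.continuousAt.eventually (ho.mem_nhds (x := φ z.proj)
      (by rw [← hgz]; exact ⟨he₁', he'⟩))] with b hb
    exact ContinuousAt.comp (f := φ)
      ((continuousOn_coordChange ℝ e₁' e').continuousAt (ho.mem_nhds hb)) hφ.continuousAt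
  have h1 : FibContDiffAt k (fun q : B × F => e.coordChangeL ℝ e₁ q.1 q.2) (e z) :=
    FibContDiffAt.clm_apply (c := fun b => (e.coordChangeL ℝ e₁ b : F →L[ℝ] F)) c1
      (FibContDiffAt.snd k _)
  have hval : ((e z).1, e.coordChangeL ℝ e₁ (e z).1 (e z).2) = e₁ z := by
    rw [hez, e.mk_coordChangeL e₁ ⟨he, he₁⟩, e.symm_proj_apply z he]
  have h2 : FibContDiffAt k (fun q : B × F =>
      (e₁' (g (trivPoint e₁ (q.1, e.coordChangeL ℝ e₁ q.1 q.2)))).2) (e z) :=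
    FibContDiffAt.comp (φ := fun b => b) (f := fun q : B × F => e.coordChangeL ℝ e₁ q.1 q.2)
      (g := fun q : B × F => (e₁' (g (trivPoint e₁ q))).2) (p := e z) (by rw [hval]; exact h)
      (Eventually.of_forall fun b => continuousAt_id) h1
  have h3 := FibContDiffAt.clm_apply
    (c := fun b => (e₁'.coordChangeL ℝ e' (φ b) : F →L[ℝ] F)) c2 h2
  refine h3.congr ?_
  have hφ' : ∀ᶠ b in 𝓝 z.proj, φ b ∈ e₁'.baseSet ∩ e'.baseSet :=
    hφ.continuousAt.eventually ((e₁'.open_baseSet.inter e'.open_baseSet).mem_nhds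
      (by rw [← hgz]; exact ⟨he₁', he'⟩))
  have hφ2 : ∀ᶠ q in 𝓝 (e z), φ q.1 ∈ e₁'.baseSet ∩ e'.baseSet := by
    rw [← hez] at hφ'
    exact continuousAt_fst.eventually hφ'
  filter_upwards [(tendsto_trivPoint he).eventually hg, hφ2,
    eventually_fst_mem_baseSet (e.open_baseSet.inter e₁.open_baseSet) he ⟨he, he₁⟩] with q k1 k2 k3
  have e1 : trivPoint e₁ (q.1, e.coordChangeL ℝ e₁ q.1 q.2) = trivPoint e q := by
    rw [e.mk_coordChangeL e₁ k3]
    exact trivPoint_apply (e := e₁) (z := trivPoint e q) k3.2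
  have hp : (g (trivPoint e q)).proj = φ q.1 := k1
  rw [e1]
  simp only [ContinuousLinearEquiv.coe_coe]
  rw [e₁'.coordChangeL_apply e' k2, ← hp, e₁'.symm_proj_apply _ (by rw [hp]; exact k2.1)]

lemma comp {k : ℕ} {g g' : TotalSpace F E → TotalSpace F E} {z : TotalSpace F E}
    {φ : B → B} (hφ : Continuous φ) (hg : ∀ᶠ z' in 𝓝 z, (g z').proj = φ z'.proj)
    (h : FibSmoothAt k g z) (h' : FibSmoothAt k g' (g z)) :
    FibSmoothAt k (fun z' => g' (g z')) z := by
  intro e e' _ _ he he'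
  have hgz := hg.self_of_nhds
  set e₁ := trivializationAt F E (g z).proj
  have he₁ : (g z).proj ∈ e₁.baseSet := FiberBundle.mem_baseSet_trivializationAt' _
  have hez : (e z).1 = z.proj := e.coe_fst' he
  have h1 := h e e₁ he he₁
  have h2 := h' e₁ e' he₁ he'
  have hval : (φ (e z).1, (e₁ (g (trivPoint e (e z)))).2) = e₁ (g z) := by
    rw [trivPoint_apply he, hez, ← hgz, e₁.mk_proj_snd' he₁]
  have h3 : FibContDiffAt k (fun q : B × F =>
      (e' (g' (trivPoint e₁ (φ q.1, (e₁ (g (trivPoint e q))).2)))).2) (e z) :=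
    FibContDiffAt.comp (φ := φ) (f := fun q : B × F => (e₁ (g (trivPoint e q))).2)
      (g := fun q : B × F => (e' (g' (trivPoint e₁ q))).2) (p := e z) (by rw [hval]; exact h2)
      (Eventually.of_forall fun b => hφ.continuousAt) h1
  refine h3.congr ?_
  have hφ' : ∀ᶠ b in 𝓝 z.proj, φ b ∈ e₁.baseSet :=
    hφ.continuousAt.eventually (e₁.open_baseSet.mem_nhds (by rw [← hgz]; exact he₁))
  have hφ2 : ∀ᶠ q in 𝓝 (e z), φ q.1 ∈ e₁.baseSet := by
    rw [← hez] at hφ'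
    exact continuousAt_fst.eventually hφ'
  filter_upwards [(tendsto_trivPoint he).eventually hg, hφ2] with q k1 k2
  have hp : (g (trivPoint e q)).proj = φ q.1 := k1
  rw [← hp] at k2 ⊢
  rw [e₁.mk_proj_snd' k2, trivPoint_apply k2]

end FibSmoothAt

variable [T2Space (TotalSpace F E)] {φ : Flow ℝ B} {U : Set (TotalSpace F E)}
  {q : TotalSpace F E → ℝ → TotalSpace F E} {k : ℕ}

/-- Germs of local flows on a vector bundle, fibered over a flow of the base and preserving the
zero section. -/
structure IsFiberedGerm (φ : Flow ℝ B) (k : ℕ) (U : Set (TotalSpace F E))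
    (q : TotalSpace F E → ℝ → TotalSpace F E) : Prop extends IsFlowGerm U q where
  zero_mem : ∀ x, (⟨x, 0⟩ : TotalSpace F E) ∈ U
  zero_eq : ∀ x, ∀ᶠ h in 𝓝 (0 : ℝ), q ⟨x, 0⟩ h = ⟨φ h x, 0⟩
  proj_eq : ∀ z ∈ U, ∀ᶠ p in 𝓝 ((0 : ℝ), z), (germFlow U q p.1 p.2).proj = φ p.1 p.2.proj
  smooth : ∀ z ∈ U, ∀ᶠ p in 𝓝 ((0 : ℝ), z), FibSmoothAt k (germFlow U q p.1) p.2

namespace IsFiberedGerm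

lemma proj_germFlow (H : IsFiberedGerm φ k U q) {t : ℝ} {z : TotalSpace F E}
    (h : (t, z) ∈ germDomain U q) : (germFlow U q t z).proj = φ t z.proj := by
  refine H.toIsFlowGerm.germFlow_induction
    (S := fun t z => (germFlow U q t z).proj = φ t z.proj) H.proj_eq ?_ h
  intro s t z hs hst h1 h2
  rw [H.toIsFlowGerm.germFlow_add hs hst, h2, h1, ← φ.map_add, add_comm]

lemma zero_section (H : IsFiberedGerm φ k U q) (t : ℝ) (x : B) :
    (t, (⟨x, 0⟩ : TotalSpace F E)) ∈ germDomain U q ∧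
      germFlow U q t ⟨x, 0⟩ = ⟨φ t x, 0⟩ := by
  have h := H.toIsFlowGerm.germFlow_eq_of_uIcc (t := t)
    (γ := fun s => (⟨φ s x, 0⟩ : TotalSpace F E)) ?_
  · have e0 : (⟨φ 0 x, 0⟩ : TotalSpace F E) = ⟨x, 0⟩ :=
      congrArg (fun y => (⟨y, 0⟩ : TotalSpace F E)) (φ.map_zero_apply x)
    beta_reduce at h
    rwa [e0] at h
  · intro s _
    refine ⟨H.zero_mem _, Filter.Eventually.filter_mono nhdsWithin_le_nhds ?_⟩
    have hl : Tendsto (fun s' : ℝ => s' - s) (𝓝 s) (𝓝 0) :=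
      (show Continuous fun s' : ℝ => s' - s by fun_prop).tendsto' _ _ (by simp)
    filter_upwards [hl.eventually (H.zero_eq (φ s x))] with s' hs'
    rw [hs', ← φ.map_add, sub_add_cancel]

lemma fibSmoothAt_germFlow (H : IsFiberedGerm φ k U q) {t : ℝ} {z : TotalSpace F E}
    (h : (t, z) ∈ germDomain U q) : FibSmoothAt k (germFlow U q t) z := by
  have H' := H.toIsFlowGerm
  refine H'.germFlow_induction (S := fun t z => FibSmoothAt k (germFlow U q t) z) H.smooth ?_ h
  intro s t z hs hst h1 h2
  have ls : Tendsto (fun z' => (s, z')) (𝓝 z) (𝓝 (s, z)) :=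
    (Continuous.prodMk continuous_const continuous_id).tendsto' _ _ rfl
  have lst : Tendsto (fun z' => (s + t, z')) (𝓝 z) (𝓝 (s + t, z)) :=
    (Continuous.prodMk continuous_const continuous_id).tendsto' _ _ rfl
  have d1 := ls.eventually (H'.isOpen_germDomain.mem_nhds hs)
  have d2 := lst.eventually (H'.isOpen_germDomain.mem_nhds hst)
  refine (FibSmoothAt.comp (φ := φ s) (φ.continuous continuous_const continuous_id)
    (d1.mono fun z' hz' => H.proj_germFlow hz') h1 h2).congr ?_
  filter_upwards [d1, d2] with z' k1 k2
  exact H'.germFlow_add k1 k2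

/-- The local fibered flow generated by germs. -/
def localFiberedFlow (H : IsFiberedGerm φ k U q) : LocalFiberedFlow F E φ where
  domain := germDomain U q
  toFun := germFlow U q
  isOpen_domain := H.toIsFlowGerm.isOpen_germDomain
  continuousOn := fun _ hp => (H.toIsFlowGerm.continuousAt_germFlow hp).continuousWithinAt
  ordConnected := H.toIsFlowGerm.ordConnected_germDomain
  zero_time_mem := fun _ _ h => (IsFlowGerm.mem_of_mem_germDomain h).2
  zero_section_mem := fun t x => (H.zero_section t x).1
  proj_eq := fun _ _ h => H.proj_germFlow h
  zero_section_eq := fun t x => (H.zero_section t x).2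
  zero_time := fun _ h => H.toIsFlowGerm.germFlow_zero h
  add_mem_iff := fun _ _ _ h => H.toIsFlowGerm.add_mem_germDomain_iff h
  add_eq := fun _ _ _ h h' => H.toIsFlowGerm.germFlow_add h h'

/-- The inverse of the time `t` map of a fibre is the time `-t` map, of the same class. Thus `Φ` is
the map on its whole fibre domain, and no inverse function theorem is needed. -/
lemma isContDiffAlongFibers (H : IsFiberedGerm φ k U q) :
    H.localFiberedFlow.IsContDiffAlongFibers k := by
  have H' := H.toIsFlowGerm
  have key : ∀ (e e' : Trivialization F (π F E)) [MemTrivializationAtlas e]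
      [MemTrivializationAtlas e'] (t : ℝ), ∀ p ∈ H.localFiberedFlow.fiberDomain e e' t,
      FibContDiffAt k (fun p : B × F => H.localFiberedFlow.fiberMap e e' t p.1 p.2) p := by
    rintro e e' _ _ t p ⟨h1, h2, h3⟩
    have h3 : (t, trivPoint e p) ∈ germDomain U q := h3
    have h4 := H.fibSmoothAt_germFlow h3 e e' h1 (by rw [H.proj_germFlow h3]; exact h2)
    rw [apply_trivPoint h1] at h4
    exact h4
  have hopen : ∀ (e e' : Trivialization F (π F E)) [MemTrivializationAtlas e]
      [MemTrivializationAtlas e'] (t : ℝ) (x : B),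
      IsOpen {w | (x, w) ∈ H.localFiberedFlow.fiberDomain e e' t} := by
    intro e e' _ _ t x
    rw [isOpen_iff_mem_nhds]
    rintro w ⟨h1, h2, h3⟩
    have hl : Tendsto (fun w' : F => (t, trivPoint e (x, w'))) (𝓝 w) (𝓝 (t, trivPoint e (x, w))) :=
      tendsto_const_nhds.prodMk_nhds (ContinuousAt.comp (g := trivPoint e)
        (f := fun w' : F => (x, w')) (continuousAt_trivPoint h1)
        (Continuous.prodMk continuous_const continuous_id).continuousAt)
    filter_upwards [hl.eventually (H'.isOpen_germDomain.mem_nhds h3)] with w' hw'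
    exact ⟨h1, h2, hw'⟩
  have hinv : ∀ (e e' : Trivialization F (π F E)) [MemTrivializationAtlas e]
      [MemTrivializationAtlas e'] (t : ℝ) (x : B) (w : F),
      (x, w) ∈ H.localFiberedFlow.fiberDomain e e' t →
      (φ t x, H.localFiberedFlow.fiberMap e e' t x w) ∈
        H.localFiberedFlow.fiberDomain e' e (-t) ∧
      H.localFiberedFlow.fiberMap e' e (-t) (φ t x) (H.localFiberedFlow.fiberMap e e' t x w) =
        w := by
    rintro e e' _ _ t x w ⟨h1, h2, h3⟩
    have h3 : (t, trivPoint e (x, w)) ∈ germDomain U q := h3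
    have h1 : x ∈ e.baseSet := h1
    have h2 : φ t x ∈ e'.baseSet := h2
    have hp : (germFlow U q t (trivPoint e (x, w))).proj = φ t x := H.proj_germFlow h3
    have e1 : trivPoint e' (φ t x, H.localFiberedFlow.fiberMap e e' t x w) =
        germFlow U q t (trivPoint e (x, w)) := by
      have : (φ t x, H.localFiberedFlow.fiberMap e e' t x w) =
          e' (germFlow U q t (trivPoint e (x, w))) := by
        rw [← e'.mk_proj_snd' (by rw [hp]; exact h2), hp]
        rfl
      rw [this, trivPoint_apply (by rw [hp]; exact h2)]
    have h0 := (IsFlowGerm.mem_of_mem_germDomain h3).2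
    have h4 : (-t, germFlow U q t (trivPoint e (x, w))) ∈ germDomain U q := by
      rw [H'.add_mem_germDomain_iff h3, add_neg_cancel]
      exact h0
    have h5 : germFlow U q (-t) (germFlow U q t (trivPoint e (x, w))) = trivPoint e (x, w) := by
      rw [← H'.germFlow_add h3 (by rw [add_neg_cancel]; exact h0), add_neg_cancel,
        H'.germFlow_zero h0]
    have hx : φ (-t) (φ t x) = x := by rw [← φ.map_add, neg_add_cancel, φ.map_zero_apply]
    refine ⟨⟨h2, by rw [hx]; exact h1, ?_⟩, ?_⟩
    · rw [← e1] at h4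
      exact h4
    · have : (e (germFlow U q (-t) (trivPoint e' (φ t x,
          H.localFiberedFlow.fiberMap e e' t x w)))).2 = w := by
        rw [e1, h5, apply_trivPoint h1]
      exact this
  intro e e' _ _ t
  refine ⟨fun p hp => (key e e' t p hp).contDiffAt, fun j hj p hp =>
    ((key e e' t p hp).continuousAt_iteratedFDeriv hj).continuousWithinAt, ?_⟩
  intro x hx hx'
  have hxx : φ (-t) (φ t x) = x := by rw [← φ.map_add, neg_add_cancel, φ.map_zero_apply]
  have hinv' : ∀ w, (φ t x, w) ∈ H.localFiberedFlow.fiberDomain e' e (-t) →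
      (x, H.localFiberedFlow.fiberMap e' e (-t) (φ t x) w) ∈
        H.localFiberedFlow.fiberDomain e e' t ∧
      H.localFiberedFlow.fiberMap e e' t x (H.localFiberedFlow.fiberMap e' e (-t) (φ t x) w) =
        w := by
    intro w hw
    have := hinv e' e (-t) (φ t x) w hw
    rwa [hxx, neg_neg] at this
  have cd : ContDiffOn ℝ k (H.localFiberedFlow.fiberMap e e' t x)
      {w | (x, w) ∈ H.localFiberedFlow.fiberDomain e e' t} := fun w hw =>
    (key e e' t (x, w) hw).contDiffAt.contDiffWithinAt
  have cd' : ContDiffOn ℝ k (H.localFiberedFlow.fiberMap e' e (-t) (φ t x))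
      {w | (φ t x, w) ∈ H.localFiberedFlow.fiberDomain e' e (-t)} := fun w hw =>
    (key e' e (-t) (φ t x, w) hw).contDiffAt.contDiffWithinAt
  have z0 : ∀ (e : Trivialization F (π F E)) [MemTrivializationAtlas e] (x : B),
      x ∈ e.baseSet → trivPoint e (x, 0) = ⟨x, 0⟩ := by
    intro e _ x hx
    have h := (e.symmₗ ℝ x).map_zero
    rw [e.coe_symmₗ hx] at h
    exact congrArg (TotalSpace.mk x) h
  let Φ : OpenPartialHomeomorph F F :=
    { toFun := H.localFiberedFlow.fiberMap e e' t x
      invFun := H.localFiberedFlow.fiberMap e' e (-t) (φ t x)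
      source := {w | (x, w) ∈ H.localFiberedFlow.fiberDomain e e' t}
      target := {w | (φ t x, w) ∈ H.localFiberedFlow.fiberDomain e' e (-t)}
      map_source' := fun w hw => (hinv e e' t x w hw).1
      map_target' := fun w hw => (hinv' w hw).1
      left_inv' := fun w hw => (hinv e e' t x w hw).2
      right_inv' := fun w hw => (hinv' w hw).2
      open_source := hopen e e' t x
      open_target := hopen e' e (-t) (φ t x)
      continuousOn_toFun := cd.continuousOn
      continuousOn_invFun := cd'.continuousOn }
  refine ⟨Φ, ?_, ?_, fun w hw => ⟨hw, rfl⟩, cd, cd'⟩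
  · refine ⟨hx, hx', ?_⟩
    have := (H.zero_section t x).1
    rw [← z0 e x hx] at this
    exact this
  · have : (e' (germFlow U q t (trivPoint e (x, 0)))).2 = 0 := by
      rw [z0 e x hx, (H.zero_section t x).2, ← z0 e' _ hx', apply_trivPoint hx']
    exact this

end IsFiberedGerm

end FiberedGermFlow

/-! ### Topology of the tangent bundle. -/

noncomputable section TangentTopology

set_option linter.unusedSectionVars false
set_option synthInstance.maxHeartbeats 400000
set_option maxHeartbeats 1000000

variable {M : Type u} [TopologicalSpace M] [ChartedSpace R3 M] [IsManifold (𝓡 3) ∞ M]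

lemma continuous_tangentProj : Continuous fun ζ : TangentBundle (𝓡 3) M => ζ.proj :=
  FiberBundle.continuous_proj R3 (TangentSpace (𝓡 3))

lemma continuousAt_tangentBundle {Y : Type*} [TopologicalSpace Y]
    {f : Y → TangentBundle (𝓡 3) M} {y : Y} {x : M} (hx : (f y).proj ∈ (chartAt R3 x).source)
    (h1 : ContinuousAt (fun y => (f y).proj) y)
    (h2 : ContinuousAt (fun y => tangentCoord x (f y)) y) : ContinuousAt f y := by
  have ho : IsOpen ((chartAt R3 x).source ×ˢ (univ : Set R3)) :=
    (chartAt R3 x).open_source.prod isOpen_univ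
  have h3 := (continuousOn_ofTangentCoord x).continuousAt
    (x := ((f y).proj, tangentCoord x (f y))) (ho.mem_nhds ⟨hx, mem_univ _⟩)
  have h4 := ContinuousAt.comp (g := fun q : M × R3 => ofTangentCoord x q.1 q.2)
    (f := fun y => ((f y).proj, tangentCoord x (f y))) h3 (h1.prodMk h2)
  refine h4.congr ?_
  filter_upwards [h1.eventually ((chartAt R3 x).open_source.mem_nhds hx)] with y' hy'
  exact ofTangentCoord_tangentCoord hy'

instance t2Space_tangentBundle [T2Space M] : T2Space (TangentBundle (𝓡 3) M) := by
  refine ⟨fun ζ ξ hne => ?_⟩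
  by_cases hp : ζ.proj = ξ.proj
  · have hs : ζ.proj ∈ (chartAt R3 ζ.proj).source := mem_chart_source R3 _
    have hs' : ξ.proj ∈ (chartAt R3 ζ.proj).source := hp ▸ hs
    have hc : tangentCoord ζ.proj ζ ≠ tangentCoord ζ.proj ξ := fun h =>
      hne (tangentBundle_ext hs hp h)
    obtain ⟨u, v, hu, hv, h1, h2, hd⟩ := t2_separation hc
    have ho := isOpen_proj_chart_source (M := M) ζ.proj
    refine ⟨_, _, (continuousOn_tangentCoord ζ.proj).isOpen_inter_preimage ho hu,
      (continuousOn_tangentCoord ζ.proj).isOpen_inter_preimage ho hv, ⟨hs, h1⟩, ⟨hs', h2⟩, ?_⟩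
    exact (hd.preimage _).mono inter_subset_right inter_subset_right
  · obtain ⟨u, v, hu, hv, h1, h2, hd⟩ := t2_separation hp
    exact ⟨_, _, hu.preimage continuous_tangentProj, hv.preimage continuous_tangentProj, h1, h2,
      hd.preimage _⟩

/-- Multiplication by scalars on the tangent bundle. -/
def tangentSmul (c : ℝ) (ζ : TangentBundle (𝓡 3) M) : TangentBundle (𝓡 3) M :=
  ⟨ζ.proj, c • ζ.snd⟩

lemma tangentCoord_tangentSmul {x : M} {c : ℝ} {ζ : TangentBundle (𝓡 3) M}
    (hx : ζ.proj ∈ (chartAt R3 x).source) :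
    tangentCoord x (tangentSmul c ζ) = c • tangentCoord x ζ :=
  tangentCoord_smul hx c ζ.snd

lemma tangentSmul_tangentSmul (c d : ℝ) (ζ : TangentBundle (𝓡 3) M) :
    tangentSmul c (tangentSmul d ζ) = tangentSmul (c * d) ζ :=
  congrArg (TotalSpace.mk ζ.proj) (smul_smul c d ζ.snd)

lemma tangentSmul_one (ζ : TangentBundle (𝓡 3) M) : tangentSmul 1 ζ = ζ :=
  congrArg (TotalSpace.mk ζ.proj) (one_smul ℝ ζ.snd)

lemma continuous_tangentSmul :
    Continuous fun q : ℝ × TangentBundle (𝓡 3) M => tangentSmul q.1 q.2 := by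
  rw [continuous_iff_continuousAt]
  rintro ⟨c, ζ⟩
  have hs : ζ.proj ∈ (chartAt R3 ζ.proj).source := mem_chart_source R3 _
  refine continuousAt_tangentBundle (x := ζ.proj) hs
    (continuous_tangentProj.comp continuous_snd).continuousAt ?_
  have h : ContinuousAt (fun q : ℝ × TangentBundle (𝓡 3) M => q.1 • tangentCoord ζ.proj q.2)
      (c, ζ) :=
    continuousAt_fst.smul (ContinuousAt.comp (g := tangentCoord ζ.proj) (f := Prod.snd)
      (continuousAt_tangentCoord hs) continuousAt_snd)
  refine h.congr ?_
  filter_upwards [continuousAt_snd.eventually ((isOpen_proj_chart_source (M := M)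
    ζ.proj).mem_nhds hs)] with q hq
  exact (tangentCoord_tangentSmul hq).symm

lemma continuous_tangentZero : Continuous fun x : M => (⟨x, 0⟩ : TangentBundle (𝓡 3) M) := by
  rw [continuous_iff_continuousAt]
  intro x
  refine continuousAt_tangentBundle (x := x) (mem_chart_source R3 x) continuousAt_id ?_
  refine ContinuousAt.congr (f := fun _ => (0 : R3)) continuousAt_const ?_
  filter_upwards [(chartAt R3 x).open_source.mem_nhds (mem_chart_source R3 x)] with y hy
  exact (tangentCoord_zero hy).symm

variable [RiemannianBundle (fun x : M => TangentSpace (𝓡 3) x)]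
  [IsContMDiffRiemannianBundle (𝓡 3) ∞ R3 (fun x : M => TangentSpace (𝓡 3) x)]

instance isContinuousRiemannianBundle_tangent :
    IsContinuousRiemannianBundle R3 (fun x : M => TangentSpace (𝓡 3) x) := by
  obtain ⟨g, g_smooth, hg⟩ := IsContMDiffRiemannianBundle.exists_contMDiff
    (IB := 𝓡 3) (n := ∞) (F := R3) (E := fun x : M => TangentSpace (𝓡 3) x)
  exact ⟨g, g_smooth.continuous, hg⟩

/-- The length of a tangent vector. -/
def tangentNorm (ζ : TangentBundle (𝓡 3) M) : ℝ := ‖ζ.snd‖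

lemma continuous_tangentNorm : Continuous (tangentNorm (M := M)) := by
  have h := Continuous.inner_bundle (F := R3) (E := fun x : M => TangentSpace (𝓡 3) x)
    (b := fun ζ : TangentBundle (𝓡 3) M => ζ.proj) (v := fun ζ => ζ.snd) (w := fun ζ => ζ.snd)
    continuous_id continuous_id
  have h2 := h.sqrt
  refine h2.congr fun ζ => ?_
  exact (norm_eq_sqrt_real_inner ζ.snd).symm

lemma tangentNorm_tangentSmul (c : ℝ) (ζ : TangentBundle (𝓡 3) M) :
    tangentNorm (tangentSmul c ζ) = |c| * tangentNorm ζ :=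
  (norm_smul c ζ.snd).trans (by rw [Real.norm_eq_abs]; rfl)

lemma tangentNorm_sq_eq {x : M} {ζ : TangentBundle (𝓡 3) M}
    (hx : ζ.proj ∈ (chartAt R3 x).source) :
    tangentNorm ζ ^ 2 = chartGram x (extChartAt (𝓡 3) x ζ.proj) (tangentCoord x ζ)
      (tangentCoord x ζ) := by
  have := chartGram_tangentCoord hx ζ.snd ζ.snd
  rw [real_inner_self_eq_norm_sq] at this
  exact this.symm

lemma exists_norm_tangentCoord_le (x : M) :
    ∃ C > 0, ∀ᶠ y in 𝓝 x, ∀ ζ : TangentBundle (𝓡 3) M, ζ.proj = y →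
      ‖tangentCoord x ζ‖ ≤ C * tangentNorm ζ := by
  obtain ⟨C, hC, h⟩ := eventually_norm_trivializationAt_lt R3
    (fun x : M => TangentSpace (𝓡 3) x) x
  refine ⟨C, hC, ?_⟩
  filter_upwards [h, (chartAt R3 x).open_source.mem_nhds (mem_chart_source R3 x)] with y hy hys
  rintro ζ rfl
  have h2 := Trivialization.continuousLinearMapAt_apply_of_mem (R := ℝ)
    (trivializationAt R3 (TangentSpace (𝓡 3)) x) (b := ζ.proj) (by simpa using hys) ζ.snd
  have h3 := ((trivializationAt R3 (TangentSpace (𝓡 3)) x).continuousLinearMapAt ℝ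
    ζ.proj).le_opNorm ζ.snd
  have h4 : ‖tangentCoord x ζ‖ =
    ‖(trivializationAt R3 (TangentSpace (𝓡 3)) x).continuousLinearMapAt ℝ ζ.proj ζ.snd‖ := by
      rw [h2]; rfl
  rw [h4]
  exact h3.trans (mul_le_mul_of_nonneg_right hy.le (norm_nonneg _))

/-- Over a small compact neighbourhood, vectors of bounded length have bounded coordinates, so they
form a closed subset of the continuous image of a compact product. Finitely many such neighbourhoods
cover `M`. -/
lemma isCompact_tangentNorm_le [T2Space M] [CompactSpace M] (R : ℝ) :
    IsCompact {ζ : TangentBundle (𝓡 3) M | tangentNorm ζ ≤ R} := by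
  have hloc : ∀ x : M, ∃ V ∈ 𝓝 x,
      IsCompact {ζ : TangentBundle (𝓡 3) M | ζ.proj ∈ V ∧ tangentNorm ζ ≤ R} := by
    intro x
    obtain ⟨C, hC, h⟩ := exists_norm_tangentCoord_le (M := M) x
    have hN := h.and ((chartAt R3 x).open_source.mem_nhds (mem_chart_source R3 x))
    have : LocallyCompactSpace M := ChartedSpace.locallyCompactSpace R3 M
    obtain ⟨V, hV, hVs, hVc⟩ := LocallyCompactSpace.local_compact_nhds x _ hN
    refine ⟨V, hV, ?_⟩
    have hK : IsCompact ((fun q : M × R3 => ofTangentCoord x q.1 q.2) ''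
        (V ×ˢ Metric.closedBall 0 (C * R))) :=
      (hVc.prod (isCompact_closedBall _ _)).image_of_continuousOn
        ((continuousOn_ofTangentCoord x).mono fun q hq => ⟨(hVs hq.1).2, mem_univ _⟩)
    refine hK.of_isClosed_subset ?_ ?_
    · exact (hVc.isClosed.preimage continuous_tangentProj).inter
        (isClosed_le continuous_tangentNorm continuous_const)
    · rintro ζ ⟨h1, h2⟩
      refine ⟨(ζ.proj, tangentCoord x ζ), ⟨h1, ?_⟩, ofTangentCoord_tangentCoord (hVs h1).2⟩
      rw [mem_closedBall_zero_iff]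
      exact ((hVs h1).1 ζ rfl).trans (mul_le_mul_of_nonneg_left h2 hC.le)
  choose V hV hVc using hloc
  obtain ⟨s, hs⟩ := CompactSpace.elim_nhds_subcover V hV
  have : {ζ : TangentBundle (𝓡 3) M | tangentNorm ζ ≤ R} =
      ⋃ x ∈ s, {ζ : TangentBundle (𝓡 3) M | ζ.proj ∈ V x ∧ tangentNorm ζ ≤ R} := by
    ext ζ
    have hζ : ζ.proj ∈ ⋃ x ∈ s, V x := hs ▸ mem_univ _
    simp only [mem_iUnion] at hζ ⊢
    obtain ⟨x, hx, hx'⟩ := hζ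
    exact ⟨fun h => ⟨x, hx, hx', h⟩, fun ⟨_, _, h⟩ => h.2⟩
  rw [this]
  exact s.isCompact_biUnion fun x _ => hVc x

/-- The ball bundles of integer radius exhaust the tangent bundle by compact sets. This will make
the compact space of directions metrizable. -/
lemma secondCountableTopology_tangentBundle [T2Space M] [CompactSpace M] :
    SecondCountableTopology (TangentBundle (𝓡 3) M) := by
  have : SigmaCompactSpace (TangentBundle (𝓡 3) M) := by
    refine ⟨⟨fun n : ℕ => {ζ | tangentNorm ζ ≤ n}, fun n => isCompact_tangentNorm_le _, ?_⟩⟩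
    refine eq_univ_of_forall fun ζ => mem_iUnion.2 ?_
    exact exists_nat_ge (tangentNorm ζ)
  have : SecondCountableTopology (ModelProd R3 R3) :=
    inferInstanceAs (SecondCountableTopology (R3 × R3))
  exact ChartedSpace.secondCountable_of_sigmaCompact (ModelProd R3 R3) (TangentBundle (𝓡 3) M)

end TangentTopology

/-! ### The tangent flow. -/

noncomputable section TangentFlow

set_option linter.unusedSectionVars false
set_option synthInstance.maxHeartbeats 400000
set_option maxHeartbeats 1000000

variable {M : Type u} [TopologicalSpace M] [ChartedSpace R3 M] [IsManifold (𝓡 3) ∞ M]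
  {φ : Flow ℝ M} {r : ℕ}

/-- The flow read in the preferred chart at `x`. -/
def flowChart (φ : Flow ℝ M) (x : M) (q : ℝ × R3) : R3 :=
  extChartAt (𝓡 3) x (φ q.1 ((extChartAt (𝓡 3) x).symm q.2))

/-- The action of the flow on tangent vectors. -/
def tangentFlow (φ : Flow ℝ M) (t : ℝ) (ζ : TangentBundle (𝓡 3) M) : TangentBundle (𝓡 3) M :=
  tangentMap (𝓡 3) (𝓡 3) (φ t) ζ

/-- The vector field generating the flow, as a map to the tangent bundle. -/
def fieldVec (φ : Flow ℝ M) (x : M) : TangentBundle (𝓡 3) M := ⟨x, φ.vectorField x⟩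

lemma flowChart_extChartAt {x z : M} (hz : z ∈ (chartAt R3 x).source) (t : ℝ) :
    flowChart φ x (t, extChartAt (𝓡 3) x z) = extChartAt (𝓡 3) x (φ t z) := by
  rw [flowChart, extChartAt_symm_extChartAt hz]

lemma contDiffAt_flowChart
    (hφ : ContMDiff (𝓘(ℝ, ℝ).prod (𝓡 3)) (𝓡 3) r (fun q : ℝ × M => φ q.1 q.2))
    {x z : M} {t : ℝ} (hz : z ∈ (chartAt R3 x).source) (hz' : φ t z ∈ (chartAt R3 x).source) :
    ContDiffAt ℝ r (flowChart φ x) (t, extChartAt (𝓡 3) x z) := by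
  rw [← contMDiffAt_iff_contDiffAt]
  have hle : ((r : ℕ) : WithTop ℕ∞) ≤ ∞ := WithTop.coe_le_coe.2 le_top
  have hy := extChartAt_mem_target hz
  have h1 : ContMDiffAt 𝓘(ℝ, R3) (𝓡 3) r (extChartAt (𝓡 3) x).symm (extChartAt (𝓡 3) x z) := by
    have := (contMDiffOn_extChartAt_symm (I := 𝓡 3) (n := ∞) x).contMDiffAt
      ((isOpen_extChartAt_target x).mem_nhds hy)
    exact this.of_le hle
  have h2 : ContMDiffAt (𝓘(ℝ, ℝ).prod 𝓘(ℝ, R3)) (𝓘(ℝ, ℝ).prod (𝓡 3)) r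
      (fun q : ℝ × R3 => (q.1, (extChartAt (𝓡 3) x).symm q.2)) (t, extChartAt (𝓡 3) x z) :=
    contMDiffAt_fst.prodMk (ContMDiffAt.comp (g := (extChartAt (𝓡 3) x).symm) (f := Prod.snd)
      _ h1 contMDiffAt_snd)
  have h3 : ContMDiffAt (𝓡 3) 𝓘(ℝ, R3) r (extChartAt (𝓡 3) x) (φ t z) :=
    (contMDiffAt_extChartAt' (I := 𝓡 3) (n := ∞) hz').of_le hle
  have h4 : (φ t ((extChartAt (𝓡 3) x).symm (extChartAt (𝓡 3) x z))) = φ t z := by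
    rw [extChartAt_symm_extChartAt hz]
  have h5 := ContMDiffAt.comp (g := fun q : ℝ × M => φ q.1 q.2)
    (f := fun q : ℝ × R3 => (q.1, (extChartAt (𝓡 3) x).symm q.2)) _ (hφ _) h2
  have h6 := ContMDiffAt.comp (g := extChartAt (𝓡 3) x)
    (f := fun q : ℝ × R3 => φ q.1 ((extChartAt (𝓡 3) x).symm q.2)) _ (by exact h4 ▸ h3) h5
  rw [← modelWithCornersSelf_prod, chartedSpaceSelf_prod] at h6
  exact h6

lemma contMDiff_flow_time
    (hφ : ContMDiff (𝓘(ℝ, ℝ).prod (𝓡 3)) (𝓡 3) r (fun q : ℝ × M => φ q.1 q.2)) (t : ℝ) :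
    ContMDiff (𝓡 3) (𝓡 3) r (φ t) :=
  ContMDiff.comp (g := fun q : ℝ × M => φ q.1 q.2) (f := fun x => (t, x)) hφ
    (contMDiff_const.prodMk contMDiff_id)

lemma contMDiff_flow_orbit
    (hφ : ContMDiff (𝓘(ℝ, ℝ).prod (𝓡 3)) (𝓡 3) r (fun q : ℝ × M => φ q.1 q.2)) (x : M) :
    ContMDiff 𝓘(ℝ, ℝ) (𝓡 3) r (fun t => φ t x) :=
  ContMDiff.comp (g := fun q : ℝ × M => φ q.1 q.2) (f := fun t => (t, x)) hφ
    (contMDiff_id.prodMk contMDiff_const)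

lemma fieldVec_eq (x : M) : fieldVec φ x =
    tangentMap 𝓘(ℝ, ℝ) (𝓡 3) (fun t => φ t x) ⟨0, (1 : ℝ)⟩ := by
  have key : ∀ (a b : M) (v : R3), a = b →
      (⟨a, v⟩ : TangentBundle (𝓡 3) M) = ⟨b, v⟩ := fun a b v h => by rw [h]
  exact key _ _ _ (φ.map_zero_apply x).symm

lemma tangentCoord_tangentFlow (hr : r ≠ 0)
    (hφ : ContMDiff (𝓘(ℝ, ℝ).prod (𝓡 3)) (𝓡 3) r (fun q : ℝ × M => φ q.1 q.2))
    {x : M} {t : ℝ} {ζ : TangentBundle (𝓡 3) M}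
    (hz : ζ.proj ∈ (chartAt R3 x).source) (hz' : φ t ζ.proj ∈ (chartAt R3 x).source) :
    tangentCoord x (tangentFlow φ t ζ) =
      fderiv ℝ (flowChart φ x) (t, extChartAt (𝓡 3) x ζ.proj) (0, tangentCoord x ζ) := by
  have hr' : ((r : ℕ) : WithTop ℕ∞) ≠ 0 := by exact_mod_cast hr
  have hd := (contDiffAt_flowChart hφ hz hz').differentiableAt hr'
  have hD : HasFDerivAt (fun y => flowChart φ x (t, y))
      ((fderiv ℝ (flowChart φ x) (t, extChartAt (𝓡 3) x ζ.proj)).comp (.inr ℝ ℝ R3))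
      (extChartAt (𝓡 3) x ζ.proj) :=
    HasFDerivAt.comp (g := flowChart φ x) (f := fun y => (t, y)) _ hd.hasFDerivAt
      (hasFDerivAt_prodMk_right t _)
  have hφt : MDifferentiableAt (𝓡 3) (𝓡 3) (φ t) ζ.proj :=
    (contMDiff_flow_time hφ t).mdifferentiableAt hr'
  have h1 := mfderiv_comp ζ.proj (mdifferentiableAt_extChartAt (I := 𝓡 3) hz') hφt
  have h2 := mfderiv_comp (I'' := 𝓘(ℝ, R3)) (g := fun y => flowChart φ x (t, y)) ζ.proj
    hD.differentiableAt.mdifferentiableAt (mdifferentiableAt_extChartAt (I := 𝓡 3) hz)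
  have h3 : (extChartAt (𝓡 3) x ∘ φ t) =ᶠ[𝓝 ζ.proj]
      ((fun y => flowChart φ x (t, y)) ∘ extChartAt (𝓡 3) x) := by
    filter_upwards [(chartAt R3 x).open_source.mem_nhds hz] with y hy
    exact (flowChart_extChartAt hy t).symm
  have h4 := h3.mfderiv_eq (I := 𝓡 3) (I' := 𝓘(ℝ, R3))
  rw [mfderiv_eq_fderiv, hD.fderiv] at h2
  have e1 : tangentCoord x (tangentFlow φ t ζ) =
      mfderiv (𝓡 3) 𝓘(ℝ, R3) (extChartAt (𝓡 3) x) (φ t ζ.proj)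
        (mfderiv (𝓡 3) (𝓡 3) (φ t) ζ.proj ζ.snd) := tangentCoord_eq_mfderiv hz' _
  have e2 : tangentCoord x ζ = mfderiv (𝓡 3) 𝓘(ℝ, R3) (extChartAt (𝓡 3) x) ζ.proj ζ.snd :=
    tangentCoord_eq_mfderiv hz ζ.snd
  rw [e1, e2]
  exact (congrArg (fun T => T ζ.snd) h1).symm.trans
    ((congrArg (fun T => T ζ.snd) h4).trans (congrArg (fun T => T ζ.snd) h2))

lemma tangentCoord_fieldVec (hr : r ≠ 0)
    (hφ : ContMDiff (𝓘(ℝ, ℝ).prod (𝓡 3)) (𝓡 3) r (fun q : ℝ × M => φ q.1 q.2))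
    {x z : M} (hz : z ∈ (chartAt R3 x).source) :
    tangentCoord x (fieldVec φ z) =
      fderiv ℝ (flowChart φ x) (0, extChartAt (𝓡 3) x z) (1, 0) := by
  have hr' : ((r : ℕ) : WithTop ℕ∞) ≠ 0 := by exact_mod_cast hr
  have h0 : φ 0 z ∈ (chartAt R3 x).source := by rwa [φ.map_zero_apply]
  have hd := (contDiffAt_flowChart hφ hz h0).differentiableAt hr'
  have hD : HasDerivAt (fun s => flowChart φ x (s, extChartAt (𝓡 3) x z))
      (fderiv ℝ (flowChart φ x) (0, extChartAt (𝓡 3) x z) (1, 0)) 0 :=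
    HasFDerivAt.comp_hasDerivAt (l := flowChart φ x)
      (f := fun s => (s, extChartAt (𝓡 3) x z)) _ hd.hasFDerivAt
      ((hasDerivAt_id _).prodMk (hasDerivAt_const _ _))
  rw [fieldVec_eq]
  refine (tangentCoord_velocity ((contMDiff_flow_orbit hφ z).mdifferentiableAt hr') h0).trans ?_
  rw [← hD.deriv]
  congr 1
  funext s
  exact (flowChart_extChartAt hz s).symm

lemma continuousAt_fderiv_flowChart (hr : r ≠ 0)
    (hφ : ContMDiff (𝓘(ℝ, ℝ).prod (𝓡 3)) (𝓡 3) r (fun q : ℝ × M => φ q.1 q.2))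
    {x z : M} {t : ℝ}
    (hz : z ∈ (chartAt R3 x).source) (hz' : φ t z ∈ (chartAt R3 x).source) :
    ContinuousAt (fderiv ℝ (flowChart φ x)) (t, extChartAt (𝓡 3) x z) :=
  (contDiffAt_flowChart hφ hz hz').continuousAt_fderiv (by exact_mod_cast hr)

lemma continuous_fieldVec (hr : r ≠ 0)
    (hφ : ContMDiff (𝓘(ℝ, ℝ).prod (𝓡 3)) (𝓡 3) r (fun q : ℝ × M => φ q.1 q.2)) : Continuous (fieldVec φ) := by
  rw [continuous_iff_continuousAt]
  intro x
  have hs : x ∈ (chartAt R3 x).source := mem_chart_source R3 x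
  have h0 : φ 0 x ∈ (chartAt R3 x).source := by rwa [φ.map_zero_apply]
  refine continuousAt_tangentBundle (x := x) hs continuousAt_id ?_
  have h1 : ContinuousAt (fun z => ((0 : ℝ), extChartAt (𝓡 3) x z)) x :=
    continuousAt_const.prodMk (continuousAt_extChartAt x)
  have h2 := ContinuousAt.comp (g := fderiv ℝ (flowChart φ x))
    (f := fun z => ((0 : ℝ), extChartAt (𝓡 3) x z)) (x := x)
    (continuousAt_fderiv_flowChart hr hφ hs h0) h1
  refine (h2.clm_apply (continuousAt_const (y := ((1 : ℝ), (0 : R3))))).congr ?_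
  filter_upwards [(chartAt R3 x).open_source.mem_nhds hs] with z hz
  exact (tangentCoord_fieldVec hr hφ hz).symm

lemma tangentFlow_add (hr : r ≠ 0)
    (hφ : ContMDiff (𝓘(ℝ, ℝ).prod (𝓡 3)) (𝓡 3) r (fun q : ℝ × M => φ q.1 q.2))
    (s t : ℝ) (ζ : TangentBundle (𝓡 3) M) :
    tangentFlow φ (s + t) ζ = tangentFlow φ s (tangentFlow φ t ζ) := by
  have hr' : ((r : ℕ) : WithTop ℕ∞) ≠ 0 := by exact_mod_cast hr
  have h := tangentMap_comp_at (I := 𝓡 3) (I' := 𝓡 3) (I'' := 𝓡 3) (g := φ s) (f := φ t) ζ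
    ((contMDiff_flow_time hφ s).mdifferentiableAt hr')
    ((contMDiff_flow_time hφ t).mdifferentiableAt hr')
  have h2 : (φ s ∘ φ t : M → M) = φ (s + t) := funext fun x => (φ.map_add s t x).symm
  rw [h2] at h
  exact h

lemma tangentFlow_zero (ζ : TangentBundle (𝓡 3) M) : tangentFlow φ 0 ζ = ζ := by
  have h2 : (φ 0 : M → M) = id := funext fun x => φ.map_zero_apply x
  rw [tangentFlow, h2, tangentMap_id]
  rfl

lemma continuousAt_tangentFlow_zero (hr : r ≠ 0)
    (hφ : ContMDiff (𝓘(ℝ, ℝ).prod (𝓡 3)) (𝓡 3) r (fun q : ℝ × M => φ q.1 q.2))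
    (ζ : TangentBundle (𝓡 3) M) :
    ContinuousAt (fun q : ℝ × TangentBundle (𝓡 3) M => tangentFlow φ q.1 q.2) (0, ζ) := by
  have hs : ζ.proj ∈ (chartAt R3 ζ.proj).source := mem_chart_source R3 _
  have h0 : φ 0 ζ.proj ∈ (chartAt R3 ζ.proj).source := by rwa [φ.map_zero_apply]
  have hpc : Continuous fun q : ℝ × TangentBundle (𝓡 3) M => q.2.proj :=
    continuous_tangentProj.comp continuous_snd
  have hc : Continuous fun q : ℝ × TangentBundle (𝓡 3) M => φ q.1 q.2.proj :=
    φ.cont'.comp (continuous_fst.prodMk hpc)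
  refine continuousAt_tangentBundle (x := ζ.proj) h0 hc.continuousAt ?_
  have h1 : ContinuousAt (fun q : ℝ × TangentBundle (𝓡 3) M =>
      (q.1, extChartAt (𝓡 3) ζ.proj q.2.proj)) (0, ζ) :=
    continuousAt_fst.prodMk (ContinuousAt.comp (g := extChartAt (𝓡 3) ζ.proj)
      (continuousAt_extChartAt ζ.proj) hpc.continuousAt)
  have h2 := ContinuousAt.comp (g := fderiv ℝ (flowChart φ ζ.proj))
    (f := fun q : ℝ × TangentBundle (𝓡 3) M => (q.1, extChartAt (𝓡 3) ζ.proj q.2.proj))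
    (x := (0, ζ)) (continuousAt_fderiv_flowChart hr hφ hs h0) h1
  have h3 : ContinuousAt (fun q : ℝ × TangentBundle (𝓡 3) M => tangentCoord ζ.proj q.2) (0, ζ) :=
    ContinuousAt.comp (g := tangentCoord ζ.proj) (f := Prod.snd)
      (continuousAt_tangentCoord hs) continuousAt_snd
  refine (h2.clm_apply ((continuousAt_const (y := (0 : ℝ))).prodMk h3)).congr ?_
  filter_upwards [hpc.continuousAt.eventually ((chartAt R3 ζ.proj).open_source.mem_nhds hs),
    hc.continuousAt.eventually ((chartAt R3 ζ.proj).open_source.mem_nhds h0)] with q hq hq'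
  exact (tangentCoord_tangentFlow hr hφ hq hq').symm

/-- Continuity at time zero is read in one chart, which small times do not leave. At time `t` one
writes the tangent flow at time `q` as that at time `q - t` after that at the fixed time `t`. -/
lemma continuous_tangentFlow (hr : r ≠ 0)
    (hφ : ContMDiff (𝓘(ℝ, ℝ).prod (𝓡 3)) (𝓡 3) r (fun q : ℝ × M => φ q.1 q.2)) :
    Continuous fun q : ℝ × TangentBundle (𝓡 3) M => tangentFlow φ q.1 q.2 := by
  rw [continuous_iff_continuousAt]
  rintro ⟨t, ζ⟩
  have h1 : Continuous (tangentFlow φ t) :=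
    (contMDiff_flow_time hφ t).continuous_tangentMap
      (by exact_mod_cast Nat.one_le_iff_ne_zero.2 hr)
  have h2 : Continuous fun q : ℝ × TangentBundle (𝓡 3) M => (q.1 - t, tangentFlow φ t q.2) :=
    (continuous_fst.sub continuous_const).prodMk (h1.comp continuous_snd)
  have h3 := continuousAt_tangentFlow_zero hr hφ (tangentFlow φ t ζ)
  have h4 := ContinuousAt.comp_of_eq (x := (t, ζ)) h3 h2.continuousAt (by simp)
  refine h4.congr (Eventually.of_forall fun q => ?_)
  have := tangentFlow_add hr hφ (q.1 - t) t q.2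
  rw [sub_add_cancel] at this
  exact this.symm

lemma tangentFlow_fieldVec (hr : r ≠ 0)
    (hφ : ContMDiff (𝓘(ℝ, ℝ).prod (𝓡 3)) (𝓡 3) r (fun q : ℝ × M => φ q.1 q.2))
    (t : ℝ) (x : M) :
    tangentFlow φ t (fieldVec φ x) = fieldVec φ (φ t x) := by
  have hr' : ((r : ℕ) : WithTop ℕ∞) ≠ 0 := by exact_mod_cast hr
  rw [fieldVec_eq, fieldVec_eq]
  have h := tangentMap_comp_at (I := 𝓘(ℝ, ℝ)) (I' := 𝓡 3) (I'' := 𝓡 3) (g := φ t)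
    (f := fun s => φ s x) ⟨0, (1 : ℝ)⟩
    ((contMDiff_flow_time hφ t).mdifferentiableAt hr')
    ((contMDiff_flow_orbit hφ x).mdifferentiableAt hr')
  have h2 : (φ t ∘ fun s => φ s x : ℝ → M) = fun s => φ s (φ t x) := by
    funext s
    simp only [Function.comp_apply]
    rw [← φ.map_add, ← φ.map_add, add_comm]
  rw [h2] at h
  exact h.symm

lemma tangentFlow_tangentSmul (t c : ℝ) (ζ : TangentBundle (𝓡 3) M) :
    tangentFlow φ t (tangentSmul c ζ) = tangentSmul c (tangentFlow φ t ζ) :=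
  congrArg (TotalSpace.mk (φ t ζ.proj)) (map_smul (mfderiv (𝓡 3) (𝓡 3) (φ t) ζ.proj) c ζ.snd)

variable [RiemannianBundle (fun x : M => TangentSpace (𝓡 3) x)]
  [IsContMDiffRiemannianBundle (𝓡 3) ∞ R3 (fun x : M => TangentSpace (𝓡 3) x)]

/-- A zero image would be sent back by the tangent flow at time `-t` to a zero vector. Normalizing
after transport is therefore harmless, over singularities too. -/
lemma tangentNorm_tangentFlow_pos (hr : r ≠ 0)
    (hφ : ContMDiff (𝓘(ℝ, ℝ).prod (𝓡 3)) (𝓡 3) r (fun q : ℝ × M => φ q.1 q.2))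
    {t : ℝ} {ζ : TangentBundle (𝓡 3) M} (h : 0 < tangentNorm ζ) :
    0 < tangentNorm (tangentFlow φ t ζ) := by
  refine lt_of_le_of_ne (norm_nonneg _) fun h0 => ?_
  have h1 : tangentSmul 0 (tangentFlow φ t ζ) = tangentFlow φ t ζ := by
    have : (tangentFlow φ t ζ).snd = 0 := norm_eq_zero.1 h0.symm
    refine congrArg (TotalSpace.mk (φ t ζ.proj)) ?_
    exact (zero_smul ℝ _).trans this.symm
  have h2 := congrArg (tangentFlow φ (-t)) h1
  rw [tangentFlow_tangentSmul, ← tangentFlow_add hr hφ, neg_add_cancel,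
    tangentFlow_zero] at h2
  have h3 := congrArg tangentNorm h2
  rw [tangentNorm_tangentSmul] at h3
  simp at h3
  exact h.ne h3

end TangentFlow

/-! ### The compactified base: limits of directions of the vector field. -/

noncomputable section Directions

set_option linter.unusedSectionVars false
set_option synthInstance.maxHeartbeats 400000
set_option maxHeartbeats 1000000

variable {M : Type u} [TopologicalSpace M] [ChartedSpace R3 M] [IsManifold (𝓡 3) ∞ M]
  [RiemannianBundle (fun x : M => TangentSpace (𝓡 3) x)]
  [IsContMDiffRiemannianBundle (𝓡 3) ∞ R3 (fun x : M => TangentSpace (𝓡 3) x)]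
  {φ : Flow ℝ M} {K : Set M} {r : ℕ}

/-- The speed of the flow. -/
def speed (φ : Flow ℝ M) (x : M) : ℝ := tangentNorm (fieldVec φ x)

lemma speed_nonneg (x : M) : 0 ≤ speed φ x := norm_nonneg _

lemma speed_ne_zero_iff {x : M} : speed φ x ≠ 0 ↔ φ.vectorField x ≠ 0 := norm_ne_zero_iff

/-- Rescaling a tangent vector to unit length. -/
def tangentNormalize (ζ : TangentBundle (𝓡 3) M) : TangentBundle (𝓡 3) M :=
  tangentSmul (tangentNorm ζ)⁻¹ ζ

lemma tangentNorm_tangentNormalize {ζ : TangentBundle (𝓡 3) M} (h : 0 < tangentNorm ζ) :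
    tangentNorm (tangentNormalize ζ) = 1 := by
  rw [tangentNormalize, tangentNorm_tangentSmul, abs_of_pos (inv_pos.2 h), inv_mul_cancel₀ h.ne']

lemma tangentNormalize_tangentSmul {c : ℝ} (hc : 0 < c) (ζ : TangentBundle (𝓡 3) M) :
    tangentNormalize (tangentSmul c ζ) = tangentNormalize ζ := by
  rw [tangentNormalize, tangentNormalize, tangentNorm_tangentSmul, tangentSmul_tangentSmul,
    abs_of_pos hc, mul_inv, mul_comm c⁻¹, mul_assoc, inv_mul_cancel₀ hc.ne', mul_one]

lemma tangentNormalize_of_norm_eq_one {ζ : TangentBundle (𝓡 3) M} (h : tangentNorm ζ = 1) :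
    tangentNormalize ζ = ζ := by
  rw [tangentNormalize, h, inv_one, tangentSmul_one]

lemma continuousAt_tangentNormalize {ζ : TangentBundle (𝓡 3) M} (h : tangentNorm ζ ≠ 0) :
    ContinuousAt tangentNormalize ζ :=
  ContinuousAt.comp (g := fun q : ℝ × TangentBundle (𝓡 3) M => tangentSmul q.1 q.2)
    (f := fun ζ => ((tangentNorm ζ)⁻¹, ζ)) continuous_tangentSmul.continuousAt
    ((continuous_tangentNorm.continuousAt.inv₀ h).prodMk continuousAt_id)

/-- The limits of the directions of the vector field at the regular points of `K`. -/
def directionSet (φ : Flow ℝ M) (K : Set M) : Set (TangentBundle (𝓡 3) M) :=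
  closure ((fun x => tangentNormalize (fieldVec φ x)) '' {x | x ∈ K ∧ φ.vectorField x ≠ 0})

lemma tangentNormalize_fieldVec_mem {x : M} (hx : x ∈ K) (h : φ.vectorField x ≠ 0) :
    tangentNormalize (fieldVec φ x) ∈ directionSet φ K :=
  subset_closure ⟨x, ⟨hx, h⟩, rfl⟩

/-- Closed conditions have to be checked at regular points only. Unit length and collinearity with
the vector field are both obtained in this way. -/
lemma directionSet_subset_of_isClosed {S : Set (TangentBundle (𝓡 3) M)} (hS : IsClosed S)
    (h : ∀ x ∈ K, φ.vectorField x ≠ 0 → tangentNormalize (fieldVec φ x) ∈ S) :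
    directionSet φ K ⊆ S :=
  closure_minimal (by rintro _ ⟨x, hx, rfl⟩; exact h x hx.1 hx.2) hS

lemma fieldVec_norm_pos {x : M} (h : φ.vectorField x ≠ 0) : 0 < tangentNorm (fieldVec φ x) :=
  norm_pos_iff.2 h

lemma tangentNorm_of_mem_directionSet {ξ : TangentBundle (𝓡 3) M} (h : ξ ∈ directionSet φ K) :
    tangentNorm ξ = 1 :=
  directionSet_subset_of_isClosed (isClosed_eq continuous_tangentNorm continuous_const)
    (fun _ _ hx => tangentNorm_tangentNormalize (fieldVec_norm_pos hx)) h

lemma isCompact_directionSet [T2Space M] [CompactSpace M] : IsCompact (directionSet φ K) :=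
  (isCompact_tangentNorm_le 1).of_isClosed_subset isClosed_closure
    fun _ h => (tangentNorm_of_mem_directionSet h).le

lemma dense_regular_directions :
    Dense {ξ : directionSet φ K | φ.vectorField ξ.1.proj ≠ 0 ∧ ξ.1.proj ∈ K} := by
  rw [Subtype.dense_iff]
  refine closure_mono ?_
  rintro _ ⟨x, hx, rfl⟩
  exact ⟨⟨_, tangentNormalize_fieldVec_mem hx.1 hx.2⟩, ⟨hx.2, hx.1⟩, rfl⟩

section Flow

variable [T2Space M]

lemma continuous_speed (hr : r ≠ 0)
    (hφ : ContMDiff (𝓘(ℝ, ℝ).prod (𝓡 3)) (𝓡 3) r (fun q : ℝ × M => φ q.1 q.2)) : Continuous (speed φ) :=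
  continuous_tangentNorm.comp (continuous_fieldVec hr hφ)

/-- The relation is closed and holds at regular points. Over a singularity it survives as `0 = 0 •
ξ`, so the direction and the speed may be used as separate coordinates everywhere. -/
lemma fieldVec_proj_of_mem_directionSet (hr : r ≠ 0)
    (hφ : ContMDiff (𝓘(ℝ, ℝ).prod (𝓡 3)) (𝓡 3) r (fun q : ℝ × M => φ q.1 q.2))
    {ξ : TangentBundle (𝓡 3) M} (h : ξ ∈ directionSet φ K) :
    fieldVec φ ξ.proj = tangentSmul (speed φ ξ.proj) ξ := by
  refine directionSet_subset_of_isClosed (S := {ξ | fieldVec φ ξ.proj =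
    tangentSmul (speed φ ξ.proj) ξ}) (isClosed_eq ?_ ?_) ?_ h
  · exact (continuous_fieldVec hr hφ).comp continuous_tangentProj
  · exact continuous_tangentSmul.comp
      (((continuous_speed hr hφ).comp continuous_tangentProj).prodMk continuous_id)
  · intro x _ hx
    have hp := fieldVec_norm_pos hx
    change fieldVec φ x = tangentSmul (speed φ x) (tangentSmul _ (fieldVec φ x))
    rw [tangentSmul_tangentSmul, speed, mul_inv_cancel₀ hp.ne', tangentSmul_one]

/-- Only one direction lies over a regular point; several can accumulate only over singularities.
This is why the regular part of `K` embeds in the compactified base. -/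
lemma eq_tangentNormalize_fieldVec (hr : r ≠ 0)
    (hφ : ContMDiff (𝓘(ℝ, ℝ).prod (𝓡 3)) (𝓡 3) r (fun q : ℝ × M => φ q.1 q.2))
    {ξ : TangentBundle (𝓡 3) M} (h : ξ ∈ directionSet φ K)
    (hx : φ.vectorField ξ.proj ≠ 0) : ξ = tangentNormalize (fieldVec φ ξ.proj) := by
  rw [fieldVec_proj_of_mem_directionSet hr hφ h,
    tangentNormalize_tangentSmul (show 0 < speed φ ξ.proj from fieldVec_norm_pos hx),
    tangentNormalize_of_norm_eq_one (tangentNorm_of_mem_directionSet h)]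

lemma continuous_tangentNormalize_tangentFlow (hr : r ≠ 0)
    (hφ : ContMDiff (𝓘(ℝ, ℝ).prod (𝓡 3)) (𝓡 3) r (fun q : ℝ × M => φ q.1 q.2)) :
    Continuous fun q : ℝ × directionSet φ K => tangentNormalize (tangentFlow φ q.1 q.2) := by
  rw [continuous_iff_continuousAt]
  rintro ⟨t, ξ⟩
  have hpos : 0 < tangentNorm (tangentFlow φ t ξ.1) := tangentNorm_tangentFlow_pos hr hφ
    (by rw [tangentNorm_of_mem_directionSet ξ.2]; exact one_pos)
  exact ContinuousAt.comp (g := tangentNormalize)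
    (f := fun q : ℝ × directionSet φ K => tangentFlow φ q.1 q.2)
    (continuousAt_tangentNormalize hpos.ne')
    ((continuous_tangentFlow hr hφ).comp
      (continuous_fst.prodMk (continuous_subtype_val.comp continuous_snd))).continuousAt

lemma speed_flow_pos (hr : r ≠ 0)
    (hφ : ContMDiff (𝓘(ℝ, ℝ).prod (𝓡 3)) (𝓡 3) r (fun q : ℝ × M => φ q.1 q.2))
    {x : M} (t : ℝ) (h : φ.vectorField x ≠ 0) : φ.vectorField (φ t x) ≠ 0 := by
  have h1 := tangentNorm_tangentFlow_pos hr hφ (t := t) (fieldVec_norm_pos h)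
  rw [tangentFlow_fieldVec hr hφ] at h1
  exact norm_pos_iff.1 h1

lemma tangentNormalize_tangentFlow_mem (hr : r ≠ 0)
    (hφ : ContMDiff (𝓘(ℝ, ℝ).prod (𝓡 3)) (𝓡 3) r (fun q : ℝ × M => φ q.1 q.2))
    (hK : IsInvariant φ K) (t : ℝ) (ξ : directionSet φ K) :
    tangentNormalize (tangentFlow φ t ξ) ∈ directionSet φ K := by
  have hcl : IsClosed {ξ : directionSet φ K |
      tangentNormalize (tangentFlow φ t ξ) ∈ directionSet φ K} :=
    isClosed_closure.preimage ((continuous_tangentNormalize_tangentFlow hr hφ).comp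
      (continuous_const.prodMk continuous_id))
  have hsub : {ξ : directionSet φ K | φ.vectorField ξ.1.proj ≠ 0 ∧ ξ.1.proj ∈ K} ⊆
      {ξ : directionSet φ K | tangentNormalize (tangentFlow φ t ξ) ∈ directionSet φ K} := by
    rintro ⟨ξ, hξ⟩ ⟨hx, hx'⟩
    change tangentNormalize (tangentFlow φ t ξ) ∈ directionSet φ K
    have h1 := eq_tangentNormalize_fieldVec hr hφ hξ hx
    rw [h1, tangentNormalize.eq_1 (fieldVec φ ξ.proj), tangentFlow_tangentSmul,
      tangentNormalize_tangentSmul (inv_pos.2 (fieldVec_norm_pos hx)),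
      tangentFlow_fieldVec hr hφ]
    exact tangentNormalize_fieldVec_mem (hK t hx') (speed_flow_pos hr hφ t hx)
  have h2 := closure_minimal hsub hcl
  rw [dense_regular_directions.closure_eq] at h2
  exact h2 (mem_univ ξ)

/-- The flow induced on the limits of directions. -/
def directionFlow (hr : r ≠ 0)
    (hφ : ContMDiff (𝓘(ℝ, ℝ).prod (𝓡 3)) (𝓡 3) r (fun q : ℝ × M => φ q.1 q.2))
    (hK : IsInvariant φ K) : Flow ℝ (directionSet φ K) where
  toFun t ξ := ⟨tangentNormalize (tangentFlow φ t ξ), tangentNormalize_tangentFlow_mem hr hφ hK t ξ⟩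
  cont' := (continuous_tangentNormalize_tangentFlow hr hφ).subtype_mk _
  map_add' s t ξ := by
    refine Subtype.ext ?_
    change tangentNormalize (tangentFlow φ (s + t) ξ) =
      tangentNormalize (tangentFlow φ s (tangentNormalize (tangentFlow φ t ξ)))
    have hpos : 0 < tangentNorm (tangentFlow φ t ξ.1) := tangentNorm_tangentFlow_pos hr hφ
      (by rw [tangentNorm_of_mem_directionSet ξ.2]; exact one_pos)
    rw [tangentNormalize.eq_1 (tangentFlow φ t ξ), tangentFlow_tangentSmul,
      tangentNormalize_tangentSmul (inv_pos.2 hpos), tangentFlow_add hr hφ]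
  map_zero' ξ := by
    refine Subtype.ext ?_
    change tangentNormalize (tangentFlow φ 0 ξ) = ξ
    rw [tangentFlow_zero,
      tangentNormalize_of_norm_eq_one (tangentNorm_of_mem_directionSet ξ.2)]

lemma coe_directionFlow (hr : r ≠ 0)
    (hφ : ContMDiff (𝓘(ℝ, ℝ).prod (𝓡 3)) (𝓡 3) r (fun q : ℝ × M => φ q.1 q.2))
    (hK : IsInvariant φ K) (t : ℝ) (ξ : directionSet φ K) :
    (directionFlow hr hφ hK t ξ : TangentBundle (𝓡 3) M) =
      tangentNormalize (tangentFlow φ t ξ) := rfl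

lemma directionFlow_regular (hr : r ≠ 0)
    (hφ : ContMDiff (𝓘(ℝ, ℝ).prod (𝓡 3)) (𝓡 3) r (fun q : ℝ × M => φ q.1 q.2))
    (hK : IsInvariant φ K) (t : ℝ) {ξ : directionSet φ K}
    (h : φ.vectorField ξ.1.proj ≠ 0) :
    φ.vectorField (directionFlow hr hφ hK t ξ).1.proj ≠ 0 :=
  speed_flow_pos hr hφ t h

end Flow

end Directions

/-! ### The bundle of planes normal to the limit directions. -/

noncomputable section NormalBundle

set_option linter.unusedSectionVars false
set_option synthInstance.maxHeartbeats 400000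
set_option maxHeartbeats 1000000

/-- The model fiber of the normal bundle. -/
abbrev R2 : Type := EuclideanSpace ℝ (Fin 2)

lemma exists_ker_eq_span {e : R3} (he : e ≠ 0) :
    ∃ B : R3 →L[ℝ] R2, ∀ w, B w = 0 → ∃ c : ℝ, w = c • e := by
  have h1 := (Submodule.span ℝ {e}).finrank_quotient_add_finrank
  rw [finrank_span_singleton he, finrank_euclideanSpace_fin] at h1
  have h2 : Module.finrank ℝ (R3 ⧸ Submodule.span ℝ {e}) = Module.finrank ℝ R2 := by
    rw [finrank_euclideanSpace_fin]; omega
  let B : R3 →ₗ[ℝ] R2 := (LinearEquiv.ofFinrankEq _ _ h2).toLinearMap ∘ₗ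
    (Submodule.span ℝ {e}).mkQ
  refine ⟨LinearMap.toContinuousLinearMap B, fun w hw => ?_⟩
  have h3 : LinearEquiv.ofFinrankEq _ _ h2 ((Submodule.span ℝ {e}).mkQ w) = 0 := hw
  rw [LinearEquiv.map_eq_zero_iff, Submodule.mkQ_apply, Submodule.Quotient.mk_eq_zero,
    Submodule.mem_span_singleton] at h3
  obtain ⟨c, hc⟩ := h3
  exact ⟨c, hc.symm⟩

lemma isInvertible_of_ker {L : R3 →L[ℝ] R2 × ℝ} (h : ∀ w, L w = 0 → w = 0) : L.IsInvertible := by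
  have hinj : Function.Injective L.toLinearMap := by
    rw [injective_iff_map_eq_zero]
    exact h
  have hd : Module.finrank ℝ R3 = Module.finrank ℝ (R2 × ℝ) := by
    rw [Module.finrank_prod, finrank_euclideanSpace_fin, finrank_euclideanSpace_fin,
      Module.finrank_self]
  refine ⟨(LinearMap.linearEquivOfInjective L.toLinearMap hinj hd).toContinuousLinearEquiv, ?_⟩
  refine ContinuousLinearMap.ext fun w => ?_
  rfl

variable {M : Type u} [TopologicalSpace M] [ChartedSpace R3 M] [IsManifold (𝓡 3) ∞ M]
  [RiemannianBundle (fun x : M => TangentSpace (𝓡 3) x)]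

/-- The tangent vectors orthogonal to a given one. -/
def normalSubmodule (ξ : TangentBundle (𝓡 3) M) : Submodule ℝ (TangentSpace (𝓡 3) ξ.proj) where
  carrier := {v | inner ℝ ξ.snd v = 0}
  add_mem' {v w} hv hw := by
    change inner ℝ ξ.snd (v + w) = 0
    rw [inner_add_right, show inner ℝ ξ.snd v = 0 from hv, show inner ℝ ξ.snd w = 0 from hw,
      add_zero]
  zero_mem' := inner_zero_right _
  smul_mem' c v hv := by
    change inner ℝ ξ.snd (c • v) = 0
    rw [inner_smul_right, show inner ℝ ξ.snd v = 0 from hv, mul_zero]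

variable [IsContMDiffRiemannianBundle (𝓡 3) ∞ R3 (fun x : M => TangentSpace (𝓡 3) x)]
  {φ : Flow ℝ M} {K : Set M} {r : ℕ}

variable (φ K) in
/-- The plane normal to a limit of directions. -/
def NormalFiber (ξ : directionSet φ K) : Type := normalSubmodule ξ.1

instance (ξ : directionSet φ K) : AddCommGroup (NormalFiber φ K ξ) :=
  inferInstanceAs (AddCommGroup (normalSubmodule ξ.1))

instance (ξ : directionSet φ K) : Module ℝ (NormalFiber φ K ξ) :=
  inferInstanceAs (Module ℝ (normalSubmodule ξ.1))

variable (φ K) in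
/-- The total space of the normal bundle over the limits of directions. -/
abbrev NormalTotal : Type u := TotalSpace R2 (NormalFiber φ K)

/-- The tangent vector underlying a normal vector. -/
def normalVec (z : NormalTotal φ K) : TangentBundle (𝓡 3) M :=
  ⟨z.proj.1.proj, (show normalSubmodule z.proj.1 from z.snd).1⟩

lemma normalVec_zero (ξ : directionSet φ K) :
    normalVec (⟨ξ, 0⟩ : NormalTotal φ K) = ⟨ξ.1.proj, 0⟩ := rfl

lemma normalTotal_ext {z z' : NormalTotal φ K} (h : z.proj = z'.proj)
    (h' : normalVec z = normalVec z') : z = z' := by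
  obtain ⟨ξ, v⟩ := z
  obtain ⟨ξ', v'⟩ := z'
  obtain rfl : ξ = ξ' := h
  have h1 : (show normalSubmodule ξ.1 from v).1 = (show normalSubmodule ξ.1 from v').1 :=
    TotalSpace.mk_injective _ h'
  exact congrArg _ (Subtype.ext h1)

lemma inner_normalVec (z : NormalTotal φ K) :
    inner ℝ z.proj.1.snd (show TangentSpace (𝓡 3) z.proj.1.proj from (normalVec z).snd) = 0 :=
  (show normalSubmodule z.proj.1 from z.snd).2

lemma chartGram_normalVec {x : M} {z : NormalTotal φ K}
    (hz : z.proj.1.proj ∈ (chartAt R3 x).source) :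
    chartGram x (extChartAt (𝓡 3) x z.proj.1.proj) (tangentCoord x z.proj.1)
      (tangentCoord x (normalVec z)) = 0 :=
  (chartGram_tangentCoord hz _ _).trans (inner_normalVec z)

open Classical in
/-- The normal vector with given coordinates in the preferred chart at `x`. -/
def normalOf (x : M) (ξ : directionSet φ K) (w : R3) : NormalTotal φ K :=
  -- The default value `0` makes the map total in `w`; it is only evaluated in a useful way on
  -- coordinates of vectors orthogonal to `ξ`.
  ⟨ξ, if h : inner ℝ ξ.1.snd ((trivializationAt R3 (TangentSpace (𝓡 3)) x).symm ξ.1.proj w) = 0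
    then (show normalSubmodule ξ.1 from ⟨_, h⟩) else 0⟩

lemma normalVec_normalOf {x : M} {ξ : directionSet φ K} {w : R3}
    (hz : ξ.1.proj ∈ (chartAt R3 x).source)
    (h : chartGram x (extChartAt (𝓡 3) x ξ.1.proj) (tangentCoord x ξ.1) w = 0) :
    normalVec (normalOf x ξ w) = ofTangentCoord x ξ.1.proj w := by
  have h1 : (⟨ξ.1.proj, (trivializationAt R3 (TangentSpace (𝓡 3)) x).symm ξ.1.proj w⟩ :
      TangentBundle (𝓡 3) M) = ofTangentCoord x ξ.1.proj w :=
    Trivialization.mk_symm _ (by simpa using hz) w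
  have h2 : inner ℝ ξ.1.snd
      ((trivializationAt R3 (TangentSpace (𝓡 3)) x).symm ξ.1.proj w) = 0 := by
    rw [← chartGram_tangentCoord hz, h1, tangentCoord_ofTangentCoord hz]
    exact h
  have h3 : normalOf x ξ w = ⟨ξ, (show normalSubmodule ξ.1 from ⟨_, h2⟩)⟩ :=
    congrArg (TotalSpace.mk ξ) (dif_pos h2)
  rw [← h1, h3]
  rfl

lemma tangentCoord_normalOf {x : M} {ξ : directionSet φ K} {w : R3}
    (hz : ξ.1.proj ∈ (chartAt R3 x).source)
    (h : chartGram x (extChartAt (𝓡 3) x ξ.1.proj) (tangentCoord x ξ.1) w = 0) :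
    tangentCoord x (normalVec (normalOf x ξ w)) = w := by
  rw [normalVec_normalOf hz h, tangentCoord_ofTangentCoord hz]

lemma normalOf_tangentCoord {x : M} {z : NormalTotal φ K}
    (hz : z.proj.1.proj ∈ (chartAt R3 x).source) :
    normalOf x z.proj (tangentCoord x (normalVec z)) = z := by
  refine normalTotal_ext rfl ?_
  rw [normalVec_normalOf hz (chartGram_normalVec hz)]
  exact ofTangentCoord_tangentCoord (ζ := normalVec z) hz

/-- Over a singularity the tangent vector does not determine the direction to which it is normal, so
the topology records both. -/
instance : TopologicalSpace (NormalTotal φ K) :=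
  TopologicalSpace.induced (fun z => (z.proj, normalVec z)) inferInstance

lemma isInducing_normalTotal :
    IsInducing (fun z : NormalTotal φ K => (z.proj, normalVec z)) := ⟨rfl⟩

lemma continuous_normalProj : Continuous fun z : NormalTotal φ K => z.proj :=
  continuous_fst.comp isInducing_normalTotal.continuous

lemma continuous_normalVec : Continuous fun z : NormalTotal φ K => normalVec z :=
  continuous_snd.comp isInducing_normalTotal.continuous

lemma continuous_normalBase : Continuous fun z : NormalTotal φ K => z.proj.1.proj :=
  continuous_tangentProj.comp (continuous_subtype_val.comp continuous_normalProj)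

instance t2Space_normalTotal [T2Space M] : T2Space (NormalTotal φ K) := by
  refine T2Space.of_injective_continuous (f := fun z : NormalTotal φ K => (z.proj, normalVec z))
    (fun z z' h => ?_) isInducing_normalTotal.continuous
  exact normalTotal_ext (congrArg Prod.fst h) (congrArg Prod.snd h)

lemma continuousAt_normalTotal {Y : Type*} [TopologicalSpace Y] {f : Y → NormalTotal φ K} {y : Y}
    {x : M} (hx : (f y).proj.1.proj ∈ (chartAt R3 x).source)
    (h1 : ContinuousAt (fun y => (f y).proj) y)
    (h2 : ContinuousAt (fun y => tangentCoord x (normalVec (f y))) y) : ContinuousAt f y := by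
  refine isInducing_normalTotal.continuousAt_iff.2 (h1.prodMk ?_)
  refine continuousAt_tangentBundle (x := x) hx ?_ h2
  exact ContinuousAt.comp (g := fun ξ : directionSet φ K => ξ.1.proj) (f := fun y => (f y).proj)
    (continuous_tangentProj.comp continuous_subtype_val).continuousAt h1

/-- The linear map whose first component is `B` and whose kernel of the second component is, in
the preferred chart at `x`, the plane normal to `ξ`. -/
def frameMap (x : M) (B : R3 →L[ℝ] R2) (ξ : TangentBundle (𝓡 3) M) : R3 →L[ℝ] R2 × ℝ :=
  (ContinuousLinearMap.inl ℝ R2 ℝ).comp B + (ContinuousLinearMap.inr ℝ R2 ℝ).comp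
    (chartGram x (extChartAt (𝓡 3) x ξ.proj) (tangentCoord x ξ))

lemma frameMap_apply (x : M) (B : R3 →L[ℝ] R2) (ξ : TangentBundle (𝓡 3) M) (w : R3) :
    frameMap x B ξ w =
      (B w, chartGram x (extChartAt (𝓡 3) x ξ.proj) (tangentCoord x ξ) w) := by
  simp [frameMap]

lemma continuousAt_chartGram_tangentCoord {x : M} {ξ : TangentBundle (𝓡 3) M}
    (hξ : ξ.proj ∈ (chartAt R3 x).source) :
    ContinuousAt (fun ξ : TangentBundle (𝓡 3) M =>
      chartGram x (extChartAt (𝓡 3) x ξ.proj) (tangentCoord x ξ)) ξ := by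
  have h1 : ContinuousAt (fun ξ : TangentBundle (𝓡 3) M => extChartAt (𝓡 3) x ξ.proj) ξ :=
    ContinuousAt.comp (g := extChartAt (𝓡 3) x) (f := fun ξ : TangentBundle (𝓡 3) M => ξ.proj)
      (continuousAt_extChartAt' (by rwa [extChartAt_source])) continuous_tangentProj.continuousAt
  have h2 : ContinuousAt (fun ξ : TangentBundle (𝓡 3) M =>
      chartGram x (extChartAt (𝓡 3) x ξ.proj)) ξ :=
    ContinuousAt.comp (g := chartGram x)
      (f := fun ξ : TangentBundle (𝓡 3) M => extChartAt (𝓡 3) x ξ.proj)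
      (contDiffAt_chartGram (extChartAt_mem_target hξ)).continuousAt h1
  exact h2.clm_apply (continuousAt_tangentCoord hξ)

lemma continuousAt_frameMap {x : M} {B : R3 →L[ℝ] R2} {ξ : TangentBundle (𝓡 3) M}
    (hξ : ξ.proj ∈ (chartAt R3 x).source) : ContinuousAt (frameMap x B) ξ :=
  continuousAt_const.add (continuousAt_const.clm_comp (continuousAt_chartGram_tangentCoord hξ))

/-- The coordinates of the vector normal to `ξ` whose image by `B` is `a`. -/
def frameInv (x : M) (B : R3 →L[ℝ] R2) (ξ : TangentBundle (𝓡 3) M) : R2 →L[ℝ] R3 :=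
  (frameMap x B ξ).inverse.comp (ContinuousLinearMap.inl ℝ R2 ℝ)

lemma continuousAt_frameInv {x : M} {B : R3 →L[ℝ] R2} {ξ : TangentBundle (𝓡 3) M}
    (hξ : ξ.proj ∈ (chartAt R3 x).source) (hL : (frameMap x B ξ).IsInvertible) :
    ContinuousAt (frameInv x B) ξ := by
  have h : ContinuousAt ContinuousLinearMap.inverse (frameMap x B ξ) :=
    (hL.contDiffAt_map_inverse (n := 0)).continuousAt
  exact (ContinuousAt.comp (g := ContinuousLinearMap.inverse) (f := frameMap x B) h
    (continuousAt_frameMap hξ)).clm_comp continuousAt_const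

lemma frameInv_spec {x : M} {B : R3 →L[ℝ] R2} {ξ : TangentBundle (𝓡 3) M}
    (hL : (frameMap x B ξ).IsInvertible) (a : R2) :
    B (frameInv x B ξ a) = a ∧
      chartGram x (extChartAt (𝓡 3) x ξ.proj) (tangentCoord x ξ) (frameInv x B ξ a) = 0 := by
  have h := hL.self_apply_inverse (a, 0)
  rw [frameMap_apply] at h
  exact Prod.ext_iff.1 h

lemma frameInv_apply {x : M} {B : R3 →L[ℝ] R2} {ξ : TangentBundle (𝓡 3) M}
    (hL : (frameMap x B ξ).IsInvertible) {w : R3}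
    (hw : chartGram x (extChartAt (𝓡 3) x ξ.proj) (tangentCoord x ξ) w = 0) :
    frameInv x B ξ (B w) = w := by
  have h := hL.inverse_apply_self w
  rw [frameMap_apply, hw] at h
  exact h

variable (φ K) in
/-- The limits of directions over which `B` trivializes the normal bundle. -/
def frameBase (x : M) (B : R3 →L[ℝ] R2) : Set (directionSet φ K) :=
  {ξ | ξ.1.proj ∈ (chartAt R3 x).source ∧ (frameMap x B ξ.1).IsInvertible}

lemma isOpen_frameBase (x : M) (B : R3 →L[ℝ] R2) : IsOpen (frameBase φ K x B) := by
  have h : IsOpen {ξ : TangentBundle (𝓡 3) M |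
      ξ.proj ∈ (chartAt R3 x).source ∧ (frameMap x B ξ).IsInvertible} := by
    rw [isOpen_iff_mem_nhds]
    rintro ξ ⟨h1, h2⟩
    have ho : IsOpen {L : R3 →L[ℝ] R2 × ℝ | L.IsInvertible} := ContinuousLinearEquiv.isOpen
    filter_upwards [(isOpen_proj_chart_source x).mem_nhds h1,
      (continuousAt_frameMap h1).eventually (ho.mem_nhds h2)] with ζ h3 h4
    exact ⟨h3, h4⟩
  exact h.preimage continuous_subtype_val

lemma continuousOn_normalTotal_symm (x : M) (B : R3 →L[ℝ] R2) :
    ContinuousOn (fun q : directionSet φ K × R2 => normalOf x q.1 (frameInv x B q.1 q.2))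
      (frameBase φ K x B ×ˢ univ) := by
  have ho : IsOpen (frameBase φ K x B ×ˢ (univ : Set R2)) := (isOpen_frameBase x B).prod isOpen_univ
  intro q hq
  refine ContinuousAt.continuousWithinAt ?_
  refine continuousAt_normalTotal (x := x) hq.1.1 continuousAt_fst ?_
  have h1 : ContinuousAt (fun q : directionSet φ K × R2 => frameInv x B q.1.1) q :=
    ContinuousAt.comp (g := frameInv x B) (f := fun q : directionSet φ K × R2 => q.1.1)
      (continuousAt_frameInv hq.1.1 hq.1.2) (continuous_subtype_val.comp continuous_fst).continuousAt
  refine (h1.clm_apply continuousAt_snd).congr ?_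
  filter_upwards [ho.mem_nhds hq] with q' hq'
  exact (tangentCoord_normalOf hq'.1.1 (frameInv_spec hq'.1.2 _).2).symm

variable (φ K) in
/-- The trivialization of the normal bundle given by a linear map in a chart. -/
def normalTriv (x : M) (B : R3 →L[ℝ] R2) : Trivialization R2 (π R2 (NormalFiber φ K)) where
  toFun z := (z.proj, B (tangentCoord x (normalVec z)))
  invFun q := normalOf x q.1 (frameInv x B q.1 q.2)
  source := {z | z.proj ∈ frameBase φ K x B}
  target := frameBase φ K x B ×ˢ univ
  map_source' z hz := ⟨hz, mem_univ _⟩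
  map_target' q hq := hq.1
  left_inv' z hz := by
    change normalOf x z.proj (frameInv x B z.proj (B (tangentCoord x (normalVec z)))) = z
    rw [frameInv_apply hz.2 (chartGram_normalVec hz.1), normalOf_tangentCoord hz.1]
  right_inv' q hq := by
    refine Prod.ext rfl ?_
    change B (tangentCoord x (normalVec (normalOf x q.1 (frameInv x B q.1 q.2)))) = q.2
    rw [tangentCoord_normalOf hq.1.1 (frameInv_spec hq.1.2 _).2, (frameInv_spec hq.1.2 _).1]
  open_source := (isOpen_frameBase x B).preimage continuous_normalProj
  open_target := (isOpen_frameBase x B).prod isOpen_univ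
  continuousOn_toFun := by
    refine continuous_normalProj.continuousOn.prodMk (B.continuous.comp_continuousOn ?_)
    refine (continuousOn_tangentCoord x).comp continuous_normalVec.continuousOn ?_
    exact fun z hz => hz.1
  continuousOn_invFun := continuousOn_normalTotal_symm x B
  baseSet := frameBase φ K x B
  open_baseSet := isOpen_frameBase x B
  source_eq := rfl
  target_eq := rfl
  proj_toFun z _ := rfl

lemma normalTriv_apply (x : M) (B : R3 →L[ℝ] R2) (z : NormalTotal φ K) :
    normalTriv φ K x B z = (z.proj, B (tangentCoord x (normalVec z))) := rfl

lemma normalTriv_symm_apply {x : M} {B : R3 →L[ℝ] R2} {ξ : directionSet φ K}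
    (hξ : ξ ∈ frameBase φ K x B) (a : R2) :
    (⟨ξ, (normalTriv φ K x B).symm ξ a⟩ : NormalTotal φ K) = normalOf x ξ (frameInv x B ξ a) :=
  Trivialization.mk_symm _ hξ a

/-- Take `B` with kernel in the line of `e`, the coordinates of `ξ`. A vector killed by `frameMap`
is `c • e` and is orthogonal to `e`, and `c = 0` because `ξ` has length one. -/
lemma exists_mem_frameBase (ξ : directionSet φ K) :
    ∃ B : R3 →L[ℝ] R2, ξ ∈ frameBase φ K ξ.1.proj B := by
  have hs : ξ.1.proj ∈ (chartAt R3 ξ.1.proj).source := mem_chart_source R3 _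
  have h1 := tangentNorm_sq_eq hs
  rw [tangentNorm_of_mem_directionSet ξ.2] at h1
  have he : tangentCoord ξ.1.proj ξ.1 ≠ 0 := by
    intro h0
    rw [h0] at h1
    simp at h1
  obtain ⟨B, hB⟩ := exists_ker_eq_span he
  refine ⟨B, hs, isInvertible_of_ker fun w hw => ?_⟩
  rw [frameMap_apply] at hw
  obtain ⟨hw1, hw2⟩ := Prod.ext_iff.1 hw
  obtain ⟨c, rfl⟩ := hB w hw1
  have : chartGram ξ.1.proj (extChartAt (𝓡 3) ξ.1.proj ξ.1.proj) (tangentCoord ξ.1.proj ξ.1)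
    (c • tangentCoord ξ.1.proj ξ.1) = 0 := hw2
  rw [map_smul, ← h1] at this
  have hc : c = 0 := by simpa using this
  rw [hc, zero_smul]

instance (ξ : directionSet φ K) : TopologicalSpace (NormalFiber φ K ξ) :=
  TopologicalSpace.induced (fun v => (⟨ξ, v⟩ : NormalTotal φ K)) inferInstance

instance : FiberBundle R2 (NormalFiber φ K) where
  totalSpaceMk_isInducing' _ := ⟨rfl⟩
  trivializationAtlas' := {e | ∃ x B, e = normalTriv φ K x B}
  trivializationAt' ξ := normalTriv φ K ξ.1.proj (exists_mem_frameBase ξ).choose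
  mem_baseSet_trivializationAt' ξ := (exists_mem_frameBase ξ).choose_spec
  trivialization_mem_atlas' _ := ⟨_, _, rfl⟩

instance (x : M) (B : R3 →L[ℝ] R2) : MemTrivializationAtlas (normalTriv φ K x B) := ⟨⟨x, B, rfl⟩⟩

lemma isLinear_normalTriv (x : M) (B : R3 →L[ℝ] R2) : (normalTriv φ K x B).IsLinear ℝ where
  linear ξ hξ :=
    { map_add := fun v w => by
        have h := tangentCoord_add hξ.1 (show normalSubmodule ξ.1 from v).1
          (show normalSubmodule ξ.1 from w).1
        exact (congrArg B h).trans (map_add B _ _)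
      map_smul := fun c v => by
        have h := tangentCoord_smul hξ.1 c (show normalSubmodule ξ.1 from v).1
        exact (congrArg B h).trans (map_smul B _ _) }

instance : VectorBundle ℝ R2 (NormalFiber φ K) where
  trivialization_linear' := by
    rintro e ⟨x, B, rfl⟩
    exact isLinear_normalTriv x B
  continuousOn_coordChange' := by
    rintro e e' ⟨x, B, rfl⟩ ⟨x', B', rfl⟩
    have := isLinear_normalTriv (φ := φ) (K := K) x B
    have := isLinear_normalTriv (φ := φ) (K := K) x' B'
    rw [continuousOn_clm_apply]
    intro a
    have h1 : ContinuousOn (fun ξ : directionSet φ K => normalOf x ξ (frameInv x B ξ a))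
        (frameBase φ K x B ∩ frameBase φ K x' B') :=
      (continuousOn_normalTotal_symm x B).comp (continuous_id.prodMk continuous_const).continuousOn
        fun ξ hξ => ⟨hξ.1, mem_univ _⟩
    have h2 := (normalTriv φ K x' B').continuousOn_toFun.comp h1 fun ξ hξ => hξ.2
    refine (continuous_snd.comp_continuousOn h2).congr fun ξ hξ => ?_
    exact (Trivialization.coordChangeL_apply _ _ hξ a).trans
      (congrArg (fun z => (normalTriv φ K x' B' z).2) (normalTriv_symm_apply hξ.1 a))

end NormalBundle

/-! ### Germs of the extended rescaled Poincaré flow. -/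

noncomputable section PoincareGerm

set_option linter.unusedSectionVars false
set_option synthInstance.maxHeartbeats 400000
set_option maxHeartbeats 1000000

variable {M : Type u} [TopologicalSpace M] [ChartedSpace R3 M] [IsManifold (𝓡 3) ∞ M]
  [RiemannianBundle (fun x : M => TangentSpace (𝓡 3) x)]
  [IsContMDiffRiemannianBundle (𝓡 3) ∞ R3 (fun x : M => TangentSpace (𝓡 3) x)]
  {φ : Flow ℝ M} {K : Set M} {n : ℕ}

/-- The image by the exponential map of a normal vector multiplied by the speed of the flow. -/
def rescaledExp (z : NormalTotal φ K) : M :=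
  riemannianExp (tangentSmul (speed φ z.proj.1.proj) (normalVec z))

/-- `Q` is the rescaled sectional Poincaré flow and `T` the hitting time, near the vector `z` and
for small times. -/
structure IsPoincareGerm (φhat : Flow ℝ (directionSet φ K)) (n : ℕ) (z : NormalTotal φ K)
    (Q : ℝ × NormalTotal φ K → NormalTotal φ K) (T : ℝ × NormalTotal φ K → ℝ) : Prop where
  continuousAt : ∀ᶠ p in 𝓝 ((0 : ℝ), z), ContinuousAt Q p ∧ ContinuousAt T p
  proj_eq : ∀ p, (Q p).proj = φhat p.1 p.2.proj
  smooth : ∀ᶠ p in 𝓝 ((0 : ℝ), z), FibSmoothAt n (fun z' => Q (p.1, z')) p.2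
  unique : ∀ᶠ p in 𝓝 ((((0 : ℝ), z), (0 : ℝ)), z), φ.vectorField p.1.1.2.proj.1.proj ≠ 0 →
    p.2.proj = φhat p.1.1.1 p.1.1.2.proj →
    (rescaledExp p.2 = φ p.1.2 (rescaledExp p.1.1.2) ↔ p.1.2 = T p.1.1 ∧ p.2 = Q p.1.1)

/-- The fibered identity is global, and the other clauses hold near points depending continuously on
`z`. Hence the set of vectors admitting a germ is open, and a tube around the zero section will fit
into it by compactness. -/
lemma IsPoincareGerm.eventually {φhat : Flow ℝ (directionSet φ K)} {z : NormalTotal φ K}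
    {Q : ℝ × NormalTotal φ K → NormalTotal φ K} {T : ℝ × NormalTotal φ K → ℝ}
    (h : IsPoincareGerm φhat n z Q T) : ∀ᶠ z' in 𝓝 z, IsPoincareGerm φhat n z' Q T := by
  have l1 : Tendsto (fun z' : NormalTotal φ K => ((0 : ℝ), z')) (𝓝 z) (𝓝 ((0 : ℝ), z)) :=
    (Continuous.prodMk continuous_const continuous_id).tendsto' _ _ rfl
  have l2 : Tendsto (fun z' : NormalTotal φ K => ((((0 : ℝ), z'), (0 : ℝ)), z')) (𝓝 z)
      (𝓝 ((((0 : ℝ), z), (0 : ℝ)), z)) :=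
    (Continuous.prodMk (Continuous.prodMk (Continuous.prodMk continuous_const continuous_id)
      continuous_const) continuous_id).tendsto' _ _ rfl
  filter_upwards [l1.eventually h.continuousAt.eventually_nhds,
    l1.eventually h.smooth.eventually_nhds, l2.eventually h.unique.eventually_nhds] with z' h1 h2 h3
  exact ⟨h1, h.proj_eq, h2, h3⟩

/-- The parameters of the Poincaré map in a chart. -/
def poincareParam (φ : Flow ℝ M) (x : M) (t : ℝ) (ξ : TangentBundle (𝓡 3) M) :
    ℝ × R3 × R3 × ℝ :=
  (t, extChartAt (𝓡 3) x ξ.proj, tangentCoord x ξ, speed φ ξ.proj)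

/-- The arguments of the Poincaré map in a chart. -/
def poincareArg (φ : Flow ℝ M) (x : M) (t : ℝ) (ξ : TangentBundle (𝓡 3) M) (v : R3) :
    ℝ × R3 × R3 × ℝ × R3 :=
  (t, extChartAt (𝓡 3) x ξ.proj, tangentCoord x ξ, speed φ ξ.proj, v)

/-- The rate of expansion of the flow in a given direction. -/
def stretch (φ : Flow ℝ M) (t : ℝ) (ξ : TangentBundle (𝓡 3) M) : ℝ :=
  tangentNorm (tangentFlow φ t ξ)

lemma tangentSmul_normalVec {x : M} {z : NormalTotal φ K} (c : ℝ)
    (hz : z.proj.1.proj ∈ (chartAt R3 x).source) :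
    tangentSmul c (normalVec z) =
      ofTangentCoord x z.proj.1.proj (c • tangentCoord x (normalVec z)) := by
  refine tangentBundle_ext (x := x) hz (proj_ofTangentCoord hz _).symm ?_
  rw [tangentCoord_ofTangentCoord hz]
  exact tangentCoord_tangentSmul (ζ := normalVec z) hz

variable [T2Space M]

lemma stretch_pos
    (hφ : ContMDiff (𝓘(ℝ, ℝ).prod (𝓡 3)) (𝓡 3) (n + 1 : ℕ) (fun q : ℝ × M => φ q.1 q.2))
    (t : ℝ) (ξ : directionSet φ K) : 0 < stretch φ t ξ.1 :=
  tangentNorm_tangentFlow_pos (Nat.succ_ne_zero n) hφ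
    (by rw [tangentNorm_of_mem_directionSet ξ.2]; exact one_pos)

lemma continuous_stretch
    (hφ : ContMDiff (𝓘(ℝ, ℝ).prod (𝓡 3)) (𝓡 3) (n + 1 : ℕ) (fun q : ℝ × M => φ q.1 q.2)) :
    Continuous fun q : ℝ × TangentBundle (𝓡 3) M => stretch φ q.1 q.2 :=
  continuous_tangentNorm.comp (continuous_tangentFlow (Nat.succ_ne_zero n) hφ)

/-- The tangent flow preserves the vector field, which is the speed times `ξ`. The factor `stretch`
is positive even over singularities, so it can convert a rescaling by the initial speed into one by
the final speed. -/
lemma speed_flow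
    (hφ : ContMDiff (𝓘(ℝ, ℝ).prod (𝓡 3)) (𝓡 3) (n + 1 : ℕ) (fun q : ℝ × M => φ q.1 q.2))
    (t : ℝ) (ξ : directionSet φ K) :
    speed φ (φ t ξ.1.proj) = speed φ ξ.1.proj * stretch φ t ξ.1 := by
  rw [speed, ← tangentFlow_fieldVec (Nat.succ_ne_zero n) hφ,
    fieldVec_proj_of_mem_directionSet (Nat.succ_ne_zero n) hφ ξ.2, tangentFlow_tangentSmul,
    tangentNorm_tangentSmul, abs_of_nonneg (speed_nonneg _)]
  rfl

lemma tangentCoord_directionFlow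
    (hφ : ContMDiff (𝓘(ℝ, ℝ).prod (𝓡 3)) (𝓡 3) (n + 1 : ℕ) (fun q : ℝ × M => φ q.1 q.2)) (hK : IsInvariant φ K)
    {x : M} {t : ℝ} {ξ : directionSet φ K}
    (h : ξ.1.proj ∈ (chartAt R3 x).source) (h' : φ t ξ.1.proj ∈ (chartAt R3 x).source) :
    tangentCoord x (directionFlow (Nat.succ_ne_zero n) hφ hK t ξ).1 = (stretch φ t ξ.1)⁻¹ •
      fderiv ℝ (flowChart φ x) (t, extChartAt (𝓡 3) x ξ.1.proj) (0, tangentCoord x ξ.1) := by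
  rw [coe_directionFlow, tangentNormalize, tangentCoord_tangentSmul (ζ := tangentFlow φ t ξ.1) h',
    tangentCoord_tangentFlow (Nat.succ_ne_zero n) hφ h h']
  rfl

lemma continuousAt_poincareParam
    (hφ : ContMDiff (𝓘(ℝ, ℝ).prod (𝓡 3)) (𝓡 3) (n + 1 : ℕ) (fun q : ℝ × M => φ q.1 q.2))
    {x : M} {q : ℝ × directionSet φ K}
    (h : q.2.1.proj ∈ (chartAt R3 x).source) :
    ContinuousAt (fun q : ℝ × directionSet φ K => poincareParam φ x q.1 q.2.1) q := by
  have hp : Continuous fun q : ℝ × directionSet φ K => q.2.1.proj :=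
    continuous_tangentProj.comp (continuous_subtype_val.comp continuous_snd)
  refine continuousAt_fst.prodMk (ContinuousAt.prodMk ?_ (ContinuousAt.prodMk ?_ ?_))
  · exact ContinuousAt.comp (g := extChartAt (𝓡 3) x)
      (f := fun q : ℝ × directionSet φ K => q.2.1.proj)
      (continuousAt_extChartAt' (by rwa [extChartAt_source])) hp.continuousAt
  · exact ContinuousAt.comp (g := tangentCoord x) (f := fun q : ℝ × directionSet φ K => q.2.1)
      (continuousAt_tangentCoord h) (continuous_subtype_val.comp continuous_snd).continuousAt
  · exact ((continuous_speed (Nat.succ_ne_zero n) hφ).comp hp).continuousAt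

lemma continuousAt_poincareArg
    (hφ : ContMDiff (𝓘(ℝ, ℝ).prod (𝓡 3)) (𝓡 3) (n + 1 : ℕ) (fun q : ℝ × M => φ q.1 q.2))
    {x : M} {p : ℝ × NormalTotal φ K}
    (h : p.2.proj.1.proj ∈ (chartAt R3 x).source) :
    ContinuousAt (fun p : ℝ × NormalTotal φ K =>
      poincareArg φ x p.1 p.2.proj.1 (tangentCoord x (normalVec p.2))) p := by
  have h1 : ContinuousAt (fun p : ℝ × NormalTotal φ K => poincareParam φ x p.1 p.2.proj.1) p :=
    ContinuousAt.comp (g := fun q : ℝ × directionSet φ K => poincareParam φ x q.1 q.2.1)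
      (f := fun p : ℝ × NormalTotal φ K => (p.1, p.2.proj))
      (continuousAt_poincareParam hφ h)
      (continuous_fst.prodMk (continuous_normalProj.comp continuous_snd)).continuousAt
  have h2 : ContinuousAt (fun p : ℝ × NormalTotal φ K => tangentCoord x (normalVec p.2)) p :=
    ContinuousAt.comp (g := tangentCoord x) (f := fun p : ℝ × NormalTotal φ K => normalVec p.2)
      (continuousAt_tangentCoord h) (continuous_normalVec.comp continuous_snd).continuousAt
  exact h1.fst.prodMk (h1.snd.fst.prodMk (h1.snd.snd.fst.prodMk (h1.snd.snd.snd.prodMk h2)))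

lemma eventually_flowChart_zero (x : M) :
    ∀ᶠ y in 𝓝 (extChartAt (𝓡 3) x x), flowChart φ x (0, y) = y := by
  filter_upwards [(isOpen_extChartAt_target x).mem_nhds
    (extChartAt_mem_target (mem_chart_source R3 x))] with y hy
  rw [flowChart, φ.map_zero_apply, (extChartAt (𝓡 3) x).right_inv hy]

lemma continuousAt_flow_symm (x : M) {y : R3} (hy : y ∈ (extChartAt (𝓡 3) x).target) (t : ℝ) :
    ContinuousAt (fun q : ℝ × R3 => φ q.1 ((extChartAt (𝓡 3) x).symm q.2)) (t, y) := by
  refine ContinuousAt.comp (g := fun q : ℝ × M => φ q.1 q.2)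
    (f := fun q : ℝ × R3 => (q.1, (extChartAt (𝓡 3) x).symm q.2)) φ.cont'.continuousAt ?_
  exact continuousAt_fst.prodMk (ContinuousAt.comp (g := (extChartAt (𝓡 3) x).symm)
    (f := Prod.snd) ((continuousOn_extChartAt_symm x).continuousAt
      ((isOpen_extChartAt_target x).mem_nhds hy)) continuousAt_snd)

lemma eventually_flow_symm_mem (x : M) :
    ∀ᶠ q in 𝓝 ((0 : ℝ), extChartAt (𝓡 3) x x),
      φ q.1 ((extChartAt (𝓡 3) x).symm q.2) ∈ (chartAt R3 x).source := by
  refine (continuousAt_flow_symm x (extChartAt_mem_target (mem_chart_source R3 x)) 0).eventually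
    ((chartAt R3 x).open_source.mem_nhds ?_)
  beta_reduce
  rw [extChartAt_symm_extChartAt (mem_chart_source R3 x), φ.map_zero_apply]
  exact mem_chart_source R3 x

lemma eventually_flowChart_add (x : M) :
    ∀ᶠ q in 𝓝 ((0 : ℝ), (0 : ℝ), extChartAt (𝓡 3) x x),
      flowChart φ x (q.1 + q.2.1, q.2.2) = flowChart φ x (q.1, flowChart φ x (q.2.1, q.2.2)) := by
  filter_upwards [continuousAt_snd.eventually (eventually_flow_symm_mem x)] with q hq
  rw [flowChart, flowChart, flowChart]
  simp only
  rw [extChartAt_symm_extChartAt hq, φ.map_add]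

/-- The rescaled sectional Poincaré flow extends near the zero section. -/
lemma exists_isPoincareGerm_zero
    (hφ : ContMDiff (𝓘(ℝ, ℝ).prod (𝓡 3)) (𝓡 3) (n + 1 : ℕ) (fun q : ℝ × M => φ q.1 q.2)) (hK : IsInvariant φ K)
    (hn : n ≠ 0) (ξ : directionSet φ K) :
    ∃ Q T, IsPoincareGerm (directionFlow (Nat.succ_ne_zero n) hφ hK) n ⟨ξ, 0⟩ Q T := by
  have hr : n + 1 ≠ 0 := Nat.succ_ne_zero n
  set φh := directionFlow hr hφ hK with hφh
  set x := ξ.1.proj with hx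
  set y := extChartAt (𝓡 3) x x with hy
  set e := tangentCoord x ξ.1 with he
  set S := (chartAt R3 x).source with hS
  set z₀ : NormalTotal φ K := ⟨ξ, 0⟩ with hz₀
  have hxS : x ∈ S := mem_chart_source R3 x
  have hyt : y ∈ (extChartAt (𝓡 3) x).target := extChartAt_mem_target hxS
  have hSo : IsOpen S := (chartAt R3 x).open_source
  obtain ⟨E, hE, hE0, hE1, hexp⟩ := exists_riemannianExp_chart x (n + 1)
  have hψ : ContDiffAt ℝ (n + 1 : ℕ) (flowChart φ x) (0, y) :=
    contDiffAt_flowChart hφ hxS (by rw [φ.map_zero_apply]; exact hxS)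
  have hG : ContDiffAt ℝ n (chartGram x) y :=
    (contDiffAt_chartGram hyt).of_le (WithTop.coe_le_coe.2 le_top)
  have he0 : chartGram x y e e ≠ 0 := by
    have h1 := tangentNorm_sq_eq (ζ := ξ.1) hxS
    rw [tangentNorm_of_mem_directionSet ξ.2] at h1
    rw [← h1]; norm_num
  obtain ⟨TW, hTW, -, hTWo, hTWu⟩ := exists_poincare_chart hn hψ
    (eventually_flowChart_zero x) (eventually_flowChart_add x) hE hE0 hE1 hG (speed φ x) he0
  let u : ℝ × NormalTotal φ K → ℝ × R3 × R3 × ℝ × R3 := fun p =>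
    poincareArg φ x p.1 p.2.proj.1 (tangentCoord x (normalVec p.2))
  let c : ℝ × directionSet φ K → ℝ := fun p => stretch φ p.1 p.2.1
  have hc : Continuous c := (continuous_stretch hφ).comp
    (continuous_fst.prodMk (continuous_subtype_val.comp continuous_snd))
  have hcpos : ∀ p, 0 < c p := fun p => stretch_pos hφ p.1 p.2
  let cz : ℝ × NormalTotal φ K → ℝ := fun p => c (p.1, p.2.proj)
  have hcz : Continuous cz := hc.comp
    (continuous_fst.prodMk (continuous_normalProj.comp continuous_snd))
  -- `TW` is rescaled by the speed at the initial point, whereas `P*` uses the speed at the image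
  -- point. By `speed_flow` the ratio of the two is the stretch.
  let W : ℝ × NormalTotal φ K → R3 := fun p => (cz p)⁻¹ • (TW (u p)).2
  let Q : ℝ × NormalTotal φ K → NormalTotal φ K := fun p => normalOf x (φh p.1 p.2.proj) (W p)
  let T : ℝ × NormalTotal φ K → ℝ := fun p => (TW (u p)).1
  have hu : ∀ p : ℝ × NormalTotal φ K, p.2.proj.1.proj ∈ S → ContinuousAt u p :=
    fun p hp => continuousAt_poincareArg hφ hp
  have hu0 : u (0, z₀) = (0, y, e, speed φ x, 0) := by
    change ((0 : ℝ), y, e, speed φ x, tangentCoord x (normalVec z₀)) = _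
    rw [normalVec_zero, tangentCoord_zero hxS]
  have hul : Tendsto u (𝓝 (0, z₀)) (𝓝 (0, y, e, speed φ x, 0)) := by
    rw [← hu0]; exact hu (0, z₀) hxS
  have hbase : Continuous fun p : ℝ × NormalTotal φ K => p.2.proj.1.proj :=
    continuous_normalBase.comp continuous_snd
  have hbaset : Continuous fun p : ℝ × NormalTotal φ K => φ p.1 p.2.proj.1.proj :=
    φ.cont'.comp (continuous_fst.prodMk hbase)
  have ev1 : ∀ᶠ p in 𝓝 ((0 : ℝ), z₀), p.2.proj.1.proj ∈ S ∧ φ p.1 p.2.proj.1.proj ∈ S := by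
    refine (hbase.continuousAt.eventually (hSo.mem_nhds hxS)).and
      (hbaset.continuousAt.eventually (hSo.mem_nhds ?_))
    beta_reduce
    rw [φ.map_zero_apply]; exact hxS
  have ev2 : ∀ᶠ p in 𝓝 ((0 : ℝ), z₀), chartGram x (extChartAt (𝓡 3) x (φh p.1 p.2.proj).1.proj)
      (tangentCoord x (φh p.1 p.2.proj).1) (W p) = 0 := by
    filter_upwards [ev1, hul.eventually hTWo] with p hp hp'
    have h1 := tangentCoord_directionFlow hφ hK hp.1 hp.2
    have h2 : flowChart φ x (p.1, extChartAt (𝓡 3) x p.2.proj.1.proj) =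
      extChartAt (𝓡 3) x (φ p.1 p.2.proj.1.proj) := flowChart_extChartAt hp.1 p.1
    change chartGram x (flowChart φ x (p.1, extChartAt (𝓡 3) x p.2.proj.1.proj)) _ _ = 0 at hp'
    rw [h2] at hp'
    rw [chartGram_symm, h1]
    change chartGram x (extChartAt (𝓡 3) x (φ p.1 p.2.proj.1.proj)) (_ • (TW (u p)).2) _ = 0
    rw [map_smul, map_smul, smul_apply]
    rw [show chartGram x (extChartAt (𝓡 3) x (φ p.1 p.2.proj.1.proj)) (TW (u p)).2
      (fderiv ℝ (flowChart φ x) (p.1, extChartAt (𝓡 3) x p.2.proj.1.proj)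
        (0, tangentCoord x p.2.proj.1)) = 0 from hp', smul_zero, smul_zero]
  have ev3 : ∀ᶠ p in 𝓝 ((0 : ℝ), z₀), tangentCoord x (normalVec (Q p)) = W p := by
    filter_upwards [ev1, ev2] with p hp hp'
    exact tangentCoord_normalOf hp.2 hp'
  have ev4 : ∀ᶠ p in 𝓝 ((0 : ℝ), z₀), ContDiffAt ℝ n TW (u p) :=
    hul.eventually (hTW.eventually (by simp))
  have ev5 : ∀ᶠ p in 𝓝 ((0 : ℝ), z₀), ContinuousAt (fun p => TW (u p)) p := by
    filter_upwards [ev1, ev4] with p hp hp'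
    exact ContinuousAt.comp (g := TW) (f := u) hp'.continuousAt (hu p hp.1)
  have ev6 : ∀ᶠ p in 𝓝 ((0 : ℝ), z₀), ContinuousAt W p := by
    filter_upwards [ev5] with p hp
    exact (hcz.continuousAt.inv₀ (hcpos _).ne').smul hp.snd
  have hφhc : Continuous fun p : ℝ × NormalTotal φ K => φh p.1 p.2.proj :=
    φh.cont'.comp (continuous_fst.prodMk (continuous_normalProj.comp continuous_snd))
  refine ⟨Q, T, ⟨?_, fun p => rfl, ?_, ?_⟩⟩
  · filter_upwards [ev1, ev3.eventually_nhds, ev5, ev6] with p h1 h3 h5 h6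
    refine ⟨?_, h5.fst⟩
    exact continuousAt_normalTotal (x := x) h1.2 hφhc.continuousAt
      (h6.congr (h3.mono fun _ h => h.symm))
  · obtain ⟨B, hB⟩ := exists_mem_frameBase ξ
    have hFo := isOpen_frameBase (φ := φ) (K := K) x B
    have ev7 : ∀ᶠ p in 𝓝 ((0 : ℝ), z₀), p.2.proj ∈ frameBase φ K x B ∧
        φh p.1 p.2.proj ∈ frameBase φ K x B := by
      refine ((continuous_normalProj.comp continuous_snd).continuousAt.eventually
        (hFo.mem_nhds ?_)).and (hφhc.continuousAt.eventually (hFo.mem_nhds ?_))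
      · exact hB
      beta_reduce
      rw [φh.map_zero_apply]; exact hB
    filter_upwards [ev7, ev4, ev3.eventually_nhds] with p h7 h4 h3
    refine FibSmoothAt.of_trivialization (φ := φh p.1) (φh.continuous continuous_const continuous_id)
      (Eventually.of_forall fun _ => rfl) (e₁ := normalTriv φ K x B) (e₁' := normalTriv φ K x B)
      h7.1 h7.2 ?_
    have hz : normalTriv φ K x B p.2 = (p.2.proj, B (tangentCoord x (normalVec p.2))) := rfl
    have hF : ∀ᶠ ζ in 𝓝 p.2.proj, ζ ∈ frameBase φ K x B := hFo.mem_nhds h7.1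
    have k1 : ∀ᶠ ζ in 𝓝 p.2.proj, ContinuousAt (fun ζ : directionSet φ K => frameInv x B ζ.1) ζ := by
      filter_upwards [hF] with ζ hζ
      exact ContinuousAt.comp (g := frameInv x B) (f := fun ζ : directionSet φ K => ζ.1)
        (continuousAt_frameInv hζ.1 hζ.2) continuous_subtype_val.continuousAt
    have k2 : ∀ᶠ ζ in 𝓝 p.2.proj,
        ContinuousAt (fun ζ : directionSet φ K => poincareParam φ x p.1 ζ.1) ζ := by
      filter_upwards [hF] with ζ hζ
      exact ContinuousAt.comp (g := fun q : ℝ × directionSet φ K => poincareParam φ x q.1 q.2.1)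
        (f := fun ζ : directionSet φ K => (p.1, ζ)) (continuousAt_poincareParam hφ hζ.1)
        (Continuous.prodMk continuous_const continuous_id).continuousAt
    have k3 : ∀ᶠ ζ in 𝓝 p.2.proj,
        ContinuousAt (fun ζ : directionSet φ K => (c (p.1, ζ))⁻¹ • B) ζ := by
      refine Eventually.of_forall fun ζ => ?_
      exact ((hc.comp (Continuous.prodMk continuous_const continuous_id)).continuousAt.inv₀
        (hcpos _).ne').smul continuousAt_const
    have k4 : FibContDiffAt n (fun q : directionSet φ K × R2 => frameInv x B q.1.1 q.2)
        (normalTriv φ K x B p.2) :=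
      FibContDiffAt.clm_apply (c := fun ζ : directionSet φ K => frameInv x B ζ.1) k1
        (FibContDiffAt.snd n _)
    have hv : frameInv x B p.2.proj.1 (B (tangentCoord x (normalVec p.2))) =
        tangentCoord x (normalVec p.2) := frameInv_apply h7.1.2 (chartGram_normalVec h7.1.1)
    -- The map is jointly smooth in the parameters and the vector, but the parameters depend only
    -- continuously on the direction: exactly the setting of `FibContDiffAt.of_contDiffAt`.
    let H : (ℝ × R3 × R3 × ℝ) × R3 → R3 := fun a =>
      (TW (a.1.1, a.1.2.1, a.1.2.2.1, a.1.2.2.2, a.2)).2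
    have hH : ContDiffAt ℝ n H (poincareParam φ x p.1 p.2.proj.1, tangentCoord x (normalVec p.2)) := by
      refine ContDiffAt.snd (ContDiffAt.comp (g := TW) (f := fun a : (ℝ × R3 × R3 × ℝ) × R3 =>
        (a.1.1, a.1.2.1, a.1.2.2.1, a.1.2.2.2, a.2)) _ h4 ?_)
      exact ContDiff.contDiffAt (by fun_prop)
    have k5 : FibContDiffAt n
        (fun q : directionSet φ K × R2 => H (poincareParam φ x p.1 q.1.1, frameInv x B q.1.1 q.2))
        (normalTriv φ K x B p.2) := by
      refine FibContDiffAt.comp (φ := id) (f := fun q : directionSet φ K × R2 =>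
        frameInv x B q.1.1 q.2) (g := fun q : directionSet φ K × R3 =>
          H (poincareParam φ x p.1 q.1.1, q.2)) ?_
          (Eventually.of_forall fun _ => continuousAt_id) k4
      refine FibContDiffAt.of_contDiffAt (c := fun ζ : directionSet φ K =>
        poincareParam φ x p.1 ζ.1) ?_ k2
      have : frameInv x B (normalTriv φ K x B p.2).1.1 (normalTriv φ K x B p.2).2 =
        tangentCoord x (normalVec p.2) := hv
      simp only [this]
      exact hH
    refine (FibContDiffAt.clm_apply (c := fun ζ : directionSet φ K => (c (p.1, ζ))⁻¹ • B) k3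
      k5).congr ?_
    have hl : Tendsto (fun q => (p.1, trivPoint (normalTriv φ K x B) q))
        (𝓝 (normalTriv φ K x B p.2)) (𝓝 p) :=
      tendsto_const_nhds.prodMk_nhds (tendsto_trivPoint h7.1)
    filter_upwards [hl.eventually h3,
      eventually_fst_mem_baseSet (e := normalTriv φ K x B) (z := p.2) hFo h7.1 h7.1] with q hq hqF
    have h8 : trivPoint (normalTriv φ K x B) q = normalOf x q.1 (frameInv x B q.1.1 q.2) :=
      normalTriv_symm_apply hqF q.2
    have h9 : tangentCoord x (normalVec (trivPoint (normalTriv φ K x B) q)) =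
        frameInv x B q.1.1 q.2 := by
      rw [h8, tangentCoord_normalOf hqF.1 (frameInv_spec hqF.2 _).2]
    change B (tangentCoord x (normalVec (Q (p.1, trivPoint (normalTriv φ K x B) q)))) =
      (c (p.1, q.1))⁻¹ • B (TW (poincareArg φ x p.1 q.1.1 (frameInv x B q.1.1 q.2))).2
    rw [hq, ← h9, ← map_smul]
    rfl
  · let a : ((ℝ × NormalTotal φ K) × ℝ) × NormalTotal φ K → R3 := fun p =>
      cz p.1.1 • tangentCoord x (normalVec p.2)
    set p₀ : ((ℝ × NormalTotal φ K) × ℝ) × NormalTotal φ K := (((0, z₀), 0), z₀) with hp₀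
    have l0 : Tendsto (fun p : ((ℝ × NormalTotal φ K) × ℝ) × NormalTotal φ K => p.1.1)
        (𝓝 p₀) (𝓝 (0, z₀)) := (continuous_fst.comp continuous_fst).tendsto' _ _ rfl
    have lτ : Tendsto (fun p : ((ℝ × NormalTotal φ K) × ℝ) × NormalTotal φ K => p.1.2)
        (𝓝 p₀) (𝓝 0) := (continuous_snd.comp continuous_fst).tendsto' _ _ rfl
    have lv : Tendsto (fun z : NormalTotal φ K => tangentCoord x (normalVec z)) (𝓝 z₀) (𝓝 0) := by
      have h1 : ContinuousAt (fun z : NormalTotal φ K => tangentCoord x (normalVec z)) z₀ :=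
        ContinuousAt.comp (g := tangentCoord x) (f := fun z : NormalTotal φ K => normalVec z)
          (continuousAt_tangentCoord hxS) continuous_normalVec.continuousAt
      have h2 := h1.tendsto
      rwa [normalVec_zero, tangentCoord_zero hxS] at h2
    have la : Tendsto a (𝓝 p₀) (𝓝 0) := by
      have h1 := ((hcz.tendsto (0, z₀)).comp l0).smul
        (lv.comp (continuous_snd.tendsto' p₀ z₀ rfl))
      rwa [smul_zero] at h1
    have lρ : Tendsto (fun p : ((ℝ × NormalTotal φ K) × ℝ) × NormalTotal φ K =>
        speed φ p.1.1.2.proj.1.proj) (𝓝 p₀) (𝓝 (speed φ x)) :=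
      (((continuous_speed hr hφ).comp hbase).tendsto (0, z₀)).comp l0
    have lz : Tendsto (fun p : ((ℝ × NormalTotal φ K) × ℝ) × NormalTotal φ K =>
        tangentCoord x (normalVec p.1.1.2)) (𝓝 p₀) (𝓝 0) :=
      lv.comp ((continuous_snd.comp (continuous_fst.comp continuous_fst)).tendsto' p₀ z₀ rfl)
    have ly : Tendsto (fun p : ((ℝ × NormalTotal φ K) × ℝ) × NormalTotal φ K =>
        extChartAt (𝓡 3) x p.1.1.2.proj.1.proj) (𝓝 p₀) (𝓝 y) :=
      (continuousAt_extChartAt x).tendsto.comp ((hbase.tendsto (0, z₀)).comp l0)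
    have lyt : Tendsto (fun p : ((ℝ × NormalTotal φ K) × ℝ) × NormalTotal φ K =>
        extChartAt (𝓡 3) x (φ p.1.1.1 p.1.1.2.proj.1.proj)) (𝓝 p₀) (𝓝 y) :=
      (continuousAt_extChartAt x).tendsto.comp
        ((hbaset.tendsto' (0, z₀) x (φ.map_zero_apply x)).comp l0)
    have l1 : Tendsto (fun p : ((ℝ × NormalTotal φ K) × ℝ) × NormalTotal φ K =>
        (extChartAt (𝓡 3) x (φ p.1.1.1 p.1.1.2.proj.1.proj), speed φ p.1.1.2.proj.1.proj • a p))
        (𝓝 p₀) (𝓝 (y, 0)) := by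
      have h1 := lρ.smul la
      rw [smul_zero] at h1
      exact lyt.prodMk_nhds h1
    have l2 : Tendsto (fun p : ((ℝ × NormalTotal φ K) × ℝ) × NormalTotal φ K =>
        (extChartAt (𝓡 3) x p.1.1.2.proj.1.proj,
          speed φ p.1.1.2.proj.1.proj • tangentCoord x (normalVec p.1.1.2)))
        (𝓝 p₀) (𝓝 (y, 0)) := by
      have h1 := lρ.smul lz
      rw [smul_zero] at h1
      exact ly.prodMk_nhds h1
    have l3 : Tendsto (fun p : ((ℝ × NormalTotal φ K) × ℝ) × NormalTotal φ K =>
        (p.1.2, E (extChartAt (𝓡 3) x p.1.1.2.proj.1.proj,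
          speed φ p.1.1.2.proj.1.proj • tangentCoord x (normalVec p.1.1.2))))
        (𝓝 p₀) (𝓝 (0, y)) := by
      have h1 := hE.continuousAt.tendsto
      rw [hE0.self_of_nhds] at h1
      exact lτ.prodMk_nhds (h1.comp l2)
    have l4 : Tendsto (fun p => (u p.1.1, (p.1.2, a p))) (𝓝 p₀)
        (𝓝 ((0, y, e, speed φ x, 0), (0, 0))) :=
      (hul.comp l0).prodMk_nhds (lτ.prodMk_nhds la)
    filter_upwards [l0.eventually ev1, l0.eventually ev3, l1.eventually hexp, l2.eventually hexp,
      l3.eventually (eventually_flow_symm_mem x), l4.eventually hTWu] with p h1 h3 hx1 hx2 h5 h6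
    intro hreg hproj
    obtain ⟨⟨⟨t, z₁⟩, τ⟩, z'⟩ := p
    simp only at h1 h3 hx1 hx2 h5 h6 hreg hproj ⊢
    have hbz : z'.proj.1.proj = φ t z₁.proj.1.proj :=
      congrArg (fun ζ : directionSet φ K => ζ.1.proj) hproj
    have hzS : z'.proj.1.proj ∈ S := by rw [hbz]; exact h1.2
    -- The final speed is the initial speed times the stretch, and the stretch is absorbed in `a`.
    -- The equation thus takes the form solved in `exists_poincare_chart`, with one factor `ρ` on
    -- both sides.
    have e1 : rescaledExp z' = (extChartAt (𝓡 3) x).symm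
        (E (extChartAt (𝓡 3) x (φ t z₁.proj.1.proj), speed φ z₁.proj.1.proj •
          a (((t, z₁), τ), z'))) := by
      rw [← hx1.2, extChartAt_symm_extChartAt h1.2, rescaledExp, tangentSmul_normalVec _ hzS, hbz,
        speed_flow hφ, mul_smul]
    have e2 : rescaledExp z₁ = (extChartAt (𝓡 3) x).symm
        (E (extChartAt (𝓡 3) x z₁.proj.1.proj, speed φ z₁.proj.1.proj •
          tangentCoord x (normalVec z₁))) := by
      rw [← hx2.2, extChartAt_symm_extChartAt h1.1, rescaledExp, tangentSmul_normalVec _ h1.1]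
    have e3 : φ τ (rescaledExp z₁) = (extChartAt (𝓡 3) x).symm
        (flowChart φ x (τ, E (extChartAt (𝓡 3) x z₁.proj.1.proj, speed φ z₁.proj.1.proj •
          tangentCoord x (normalVec z₁)))) := by
      rw [flowChart, extChartAt_symm_extChartAt h5, e2]
    have e4 : flowChart φ x (t, extChartAt (𝓡 3) x z₁.proj.1.proj) =
      extChartAt (𝓡 3) x (φ t z₁.proj.1.proj) := flowChart_extChartAt h1.1 t
    have e5 : rescaledExp z' = φ τ (rescaledExp z₁) ↔
        E (flowChart φ x (t, extChartAt (𝓡 3) x z₁.proj.1.proj), speed φ z₁.proj.1.proj •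
          a (((t, z₁), τ), z')) = flowChart φ x (τ, E (extChartAt (𝓡 3) x z₁.proj.1.proj,
            speed φ z₁.proj.1.proj • tangentCoord x (normalVec z₁))) := by
      rw [e1, e3, e4]
      exact (extChartAt (𝓡 3) x).symm.injOn.eq_iff hx1.1 (extChartAt_mem_target h5)
    have e6 := tangentCoord_directionFlow hφ hK h1.1 h1.2
    have hcp : 0 < cz (t, z₁) := hcpos _
    have e7 : chartGram x (flowChart φ x (t, extChartAt (𝓡 3) x z₁.proj.1.proj))
        (a (((t, z₁), τ), z')) (fderiv ℝ (flowChart φ x) (t, extChartAt (𝓡 3) x z₁.proj.1.proj)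
          (0, tangentCoord x z₁.proj.1)) = 0 := by
      have h7 := chartGram_normalVec hzS
      rw [hbz, hproj, e6, map_smul, smul_apply, smul_eq_zero] at h7
      rw [e4, chartGram_symm, map_smul, h7.resolve_left (inv_ne_zero hcp.ne'), smul_zero]
    have e8 : fderiv ℝ (flowChart φ x) (0, extChartAt (𝓡 3) x z₁.proj.1.proj) (1, 0) =
        speed φ z₁.proj.1.proj • tangentCoord x z₁.proj.1 := by
      rw [← tangentCoord_fieldVec hr hφ h1.1, fieldVec_proj_of_mem_directionSet hr hφ z₁.proj.2,
        tangentCoord_tangentSmul h1.1]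
    have e9 := h6 e8 (speed_ne_zero_iff.2 hreg)
    have e10 : rescaledExp z' = φ τ (rescaledExp z₁) ↔
        (τ, a (((t, z₁), τ), z')) = TW (u (t, z₁)) := by
      rw [← e9, e5]
      exact (and_iff_left e7).symm
    rw [e10, Prod.ext_iff]
    refine and_congr_right fun _ => ?_
    have e11 : a (((t, z₁), τ), z') = cz (t, z₁) • tangentCoord x (normalVec z') := rfl
    have e12 : W (t, z₁) = (cz (t, z₁))⁻¹ • (TW (u (t, z₁))).2 := rfl
    constructor
    · intro h
      have h8 : tangentCoord x (normalVec z') = W (t, z₁) := by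
        rw [e12, ← h, e11, inv_smul_smul₀ hcp.ne']
      refine normalTotal_ext hproj ?_
      refine tangentBundle_ext (x := x) hzS hbz (h8.trans h3.symm)
    · intro h
      change a (((t, z₁), τ), z') = (TW (u (t, z₁))).2
      rw [e11, h, h3, e12, smul_inv_smul₀ hcp.ne']

end PoincareGerm

/-! ### The cocycle relation, by density of the regular fibres. -/

noncomputable section PoincareCocycle

set_option linter.unusedSectionVars false
set_option synthInstance.maxHeartbeats 400000
set_option maxHeartbeats 1000000

/-- Limits along `D` are unique in a Hausdorff space. This carries the identities forced by
uniqueness over regular points to the fibres over singularities. -/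
lemma eventually_eq_of_dense {Y Z : Type*} [TopologicalSpace Y] [TopologicalSpace Z] [T2Space Z]
    {D : Set Y} (hD : Dense D) {f g : Y → Z} {y : Y} (hf : ∀ᶠ y' in 𝓝 y, ContinuousAt f y')
    (hg : ∀ᶠ y' in 𝓝 y, ContinuousAt g y') (h : ∀ᶠ y' in 𝓝 y, y' ∈ D → f y' = g y') :
    ∀ᶠ y' in 𝓝 y, f y' = g y' := by
  filter_upwards [hf, hg, h.eventually_nhds] with y' h1 h2 h3
  have : NeBot (𝓝[D] y') := mem_closure_iff_nhdsWithin_neBot.1 (hD y')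
  refine tendsto_nhds_unique_of_eventuallyEq (l := 𝓝[D] y') (h1.mono_left nhdsWithin_le_nhds)
    (h2.mono_left nhdsWithin_le_nhds) ?_
  filter_upwards [nhdsWithin_le_nhds h3, self_mem_nhdsWithin] with w hw hwD
  exact hw hwD

variable {M : Type u} [TopologicalSpace M] [ChartedSpace R3 M] [IsManifold (𝓡 3) ∞ M]
  [RiemannianBundle (fun x : M => TangentSpace (𝓡 3) x)]
  [IsContMDiffRiemannianBundle (𝓡 3) ∞ R3 (fun x : M => TangentSpace (𝓡 3) x)]
  {φ : Flow ℝ M} {K : Set M} {n : ℕ}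

lemma riemannianExp_zero [T2Space M] (x : M) :
    riemannianExp (⟨x, 0⟩ : TangentBundle (𝓡 3) M) = x := by
  obtain ⟨E, -, hE0, -, hexp⟩ := exists_riemannianExp_chart x 1
  have hs : x ∈ (chartAt R3 x).source := mem_chart_source R3 x
  have h := hexp.self_of_nhds.2
  rw [hE0.self_of_nhds] at h
  simp only [extChartAt_symm_extChartAt hs] at h
  rw [← tangentCoord_zero hs] at h
  have h2 := ofTangentCoord_tangentCoord (ζ := (⟨x, 0⟩ : TangentBundle (𝓡 3) M)) hs
  rwa [h2] at h

lemma rescaledExp_zero [T2Space M] (ξ : directionSet φ K) :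
    rescaledExp (⟨ξ, 0⟩ : NormalTotal φ K) = ξ.1.proj := by
  have h : tangentSmul (speed φ ξ.1.proj) (normalVec (⟨ξ, 0⟩ : NormalTotal φ K)) =
      ⟨ξ.1.proj, 0⟩ :=
    congrArg (TotalSpace.mk ξ.1.proj) (smul_zero (A := TangentSpace (𝓡 3) ξ.1.proj) _)
  exact (congrArg riemannianExp h).trans (riemannianExp_zero _)

lemma dense_regular_normal :
    Dense {z : NormalTotal φ K | φ.vectorField z.proj.1.proj ≠ 0} := by
  have h := Dense.preimage dense_regular_directions
    (FiberBundle.isOpenMap_proj R2 (NormalFiber φ K))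
  exact h.mono fun z hz => hz.1

lemma continuous_normalZero :
    Continuous fun ξ : directionSet φ K => (⟨ξ, 0⟩ : NormalTotal φ K) := by
  refine isInducing_normalTotal.continuous_iff.2 (continuous_id.prodMk ?_)
  exact continuous_tangentZero.comp (continuous_tangentProj.comp continuous_subtype_val)

lemma dense_prod_regular {Y : Type*} [TopologicalSpace Y] {D : Set Y} (hD : Dense D) :
    Dense {p : ℝ × Y | p.2 ∈ D} :=
  hD.preimage isOpenMap_snd

variable [T2Space M]
  {hφ : ContMDiff (𝓘(ℝ, ℝ).prod (𝓡 3)) (𝓡 3) (n + 1 : ℕ) (fun q : ℝ × M => φ q.1 q.2)}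
  {hK : IsInvariant φ K}

namespace IsPoincareGerm

section

variable {z : NormalTotal φ K} {Q : ℝ × NormalTotal φ K → NormalTotal φ K}
  {T : ℝ × NormalTotal φ K → ℝ}

/-- At time zero the vector itself, with hitting time zero, solves the holonomy equation. Uniqueness
gives the claim over regular points, and density everywhere. -/
lemma eventually_zero
    (H : IsPoincareGerm (directionFlow (Nat.succ_ne_zero n) hφ hK) n z Q T) : ∀ᶠ z' in 𝓝 z, Q (0, z') = z' ∧ T (0, z') = 0 := by
  have l1 : Tendsto (fun z' : NormalTotal φ K => ((0 : ℝ), z')) (𝓝 z) (𝓝 ((0 : ℝ), z)) :=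
    (Continuous.prodMk continuous_const continuous_id).tendsto' _ _ rfl
  have l2 : Tendsto (fun z' : NormalTotal φ K => ((((0 : ℝ), z'), (0 : ℝ)), z')) (𝓝 z)
      (𝓝 ((((0 : ℝ), z), (0 : ℝ)), z)) :=
    (Continuous.prodMk (Continuous.prodMk (Continuous.prodMk continuous_const continuous_id)
      continuous_const) continuous_id).tendsto' _ _ rfl
  have h := eventually_eq_of_dense dense_regular_normal (y := z)
    (f := fun z' => (Q (0, z'), T (0, z'))) (g := fun z' => (z', (0 : ℝ))) ?_ ?_ ?_
  · exact h.mono fun z' hz' => Prod.ext_iff.1 hz'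
  · filter_upwards [l1.eventually H.continuousAt] with z' hz'
    have hc : ContinuousAt (fun z' : NormalTotal φ K => ((0 : ℝ), z')) z' :=
      (Continuous.prodMk continuous_const continuous_id).continuousAt
    exact (ContinuousAt.comp (g := Q) (f := fun z' : NormalTotal φ K => ((0 : ℝ), z')) hz'.1
      hc).prodMk (ContinuousAt.comp (g := T) (f := fun z' : NormalTotal φ K => ((0 : ℝ), z'))
        hz'.2 hc)
  · exact Eventually.of_forall fun _ => continuousAt_id.prodMk continuousAt_const
  · filter_upwards [l2.eventually H.unique] with z' hz' hreg
    have h1 := (hz' hreg (Flow.map_zero_apply _ _).symm).1 (φ.map_zero_apply _).symm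
    exact Prod.ext h1.2.symm h1.1.symm

lemma tendsto_unique_arg
    (H : IsPoincareGerm (directionFlow (Nat.succ_ne_zero n) hφ hK) n z Q T) :
    Tendsto (fun p : ℝ × NormalTotal φ K => ((p, T p), Q p)) (𝓝 (0, z))
      (𝓝 ((((0 : ℝ), z), (0 : ℝ)), z)) := by
  obtain ⟨h1, h2⟩ := H.eventually_zero.self_of_nhds
  have hT := H.continuousAt.self_of_nhds.2.tendsto
  have hQ := H.continuousAt.self_of_nhds.1.tendsto
  rw [h1] at hQ
  rw [h2] at hT
  exact (tendsto_id.prodMk_nhds hT).prodMk_nhds hQ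

lemma eventually_rescaledExp
    (H : IsPoincareGerm (directionFlow (Nat.succ_ne_zero n) hφ hK) n z Q T) : ∀ᶠ p in 𝓝 ((0 : ℝ), z), φ.vectorField p.2.proj.1.proj ≠ 0 →
    rescaledExp (Q p) = φ (T p) (rescaledExp p.2) := by
  filter_upwards [H.tendsto_unique_arg.eventually H.unique] with p hp hreg
  exact (hp hreg (H.proj_eq p)).2 ⟨rfl, rfl⟩

/-- Over a regular point, `Q(s + h, w)` is joined to `Q(s, w)` by the hitting time `T(s + h, w) -
T(s, w)`, which is small with `h`. Uniqueness for the germ at the new point identifies it with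
`Q'(h, Q(s, w))`. Density concludes; in particular arbitrary choices of germs are compatible. -/
lemma eventually_cocycle
    (H : IsPoincareGerm (directionFlow (Nat.succ_ne_zero n) hφ hK) n z Q T) : ∀ᶠ p in 𝓝 ((0 : ℝ), z), ∀ Q' T',
    IsPoincareGerm (directionFlow (Nat.succ_ne_zero n) hφ hK) n (Q p) Q' T' →
    ∀ᶠ h in 𝓝 (0 : ℝ), Q (p.1 + h, p.2) = Q' (h, Q p) ∧
      T (p.1 + h, p.2) = T p + T' (h, Q p) := by
  filter_upwards [H.eventually_rescaledExp.eventually_nhds, H.continuousAt.eventually_nhds]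
    with p hp hc Q' T' H'
  obtain ⟨s, w⟩ := p
  have hcp := hc.self_of_nhds
  have cm : Continuous fun p : ℝ × NormalTotal φ K => (s + p.1, p.2) :=
    (continuous_const.add continuous_fst).prodMk continuous_snd
  have cs : Continuous fun p : ℝ × NormalTotal φ K => (s, p.2) :=
    continuous_const.prodMk continuous_snd
  have lm : Tendsto (fun p : ℝ × NormalTotal φ K => (s + p.1, p.2)) (𝓝 (0, w)) (𝓝 (s, w)) :=
    cm.tendsto' _ _ (by simp)
  have ls : Tendsto (fun p : ℝ × NormalTotal φ K => (s, p.2)) (𝓝 (0, w)) (𝓝 (s, w)) :=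
    cs.tendsto' _ _ rfl
  have lf : Tendsto (fun p : ℝ × NormalTotal φ K => p.1) (𝓝 (0, w)) (𝓝 0) :=
    continuous_fst.tendsto' _ _ rfl
  have lQs := hcp.1.tendsto.comp ls
  have lQm := hcp.1.tendsto.comp lm
  have lTs := hcp.2.tendsto.comp ls
  have lTm := hcp.2.tendsto.comp lm
  have l1 : Tendsto (fun p : ℝ × NormalTotal φ K => (p.1, Q (s, p.2))) (𝓝 (0, w))
      (𝓝 (0, Q (s, w))) := lf.prodMk_nhds lQs
  have l2 : Tendsto (fun p : ℝ × NormalTotal φ K =>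
      (((p.1, Q (s, p.2)), T (s + p.1, p.2) - T (s, p.2)), Q (s + p.1, p.2))) (𝓝 (0, w))
      (𝓝 (((0, Q (s, w)), 0), Q (s, w))) := by
    have := lTm.sub lTs
    rw [sub_self] at this
    exact (l1.prodMk_nhds this).prodMk_nhds lQm
  have h := eventually_eq_of_dense (dense_prod_regular (dense_regular_normal (φ := φ) (K := K)))
    (y := ((0 : ℝ), w)) (f := fun p => (Q (s + p.1, p.2), T (s + p.1, p.2)))
    (g := fun p => (Q' (p.1, Q (s, p.2)), T (s, p.2) + T' (p.1, Q (s, p.2)))) ?_ ?_ ?_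
  · have lw : Tendsto (fun h : ℝ => (h, w)) (𝓝 0) (𝓝 (0, w)) :=
      (Continuous.prodMk continuous_id continuous_const).tendsto' _ _ rfl
    exact (lw.eventually h).mono fun _ hh => Prod.ext_iff.1 hh
  · filter_upwards [lm.eventually hc] with p hpc
    exact (ContinuousAt.comp (g := Q) (f := fun p : ℝ × NormalTotal φ K => (s + p.1, p.2)) hpc.1
      cm.continuousAt).prodMk (ContinuousAt.comp (g := T)
        (f := fun p : ℝ × NormalTotal φ K => (s + p.1, p.2)) hpc.2 cm.continuousAt)
  · filter_upwards [ls.eventually hc, l1.eventually H'.continuousAt] with p hpc hpc'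
    have k1 : ContinuousAt (fun p : ℝ × NormalTotal φ K => Q (s, p.2)) p :=
      ContinuousAt.comp (g := Q) (f := fun p : ℝ × NormalTotal φ K => (s, p.2)) hpc.1
        cs.continuousAt
    have k2 : ContinuousAt (fun p : ℝ × NormalTotal φ K => T (s, p.2)) p :=
      ContinuousAt.comp (g := T) (f := fun p : ℝ × NormalTotal φ K => (s, p.2)) hpc.2
        cs.continuousAt
    have k3 : ContinuousAt (fun p : ℝ × NormalTotal φ K => (p.1, Q (s, p.2))) p :=
      continuousAt_fst.prodMk k1
    exact (ContinuousAt.comp (g := Q') (f := fun p : ℝ × NormalTotal φ K => (p.1, Q (s, p.2)))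
      hpc'.1 k3).prodMk (k2.add (ContinuousAt.comp (g := T')
        (f := fun p : ℝ × NormalTotal φ K => (p.1, Q (s, p.2))) hpc'.2 k3))
  · filter_upwards [lm.eventually hp, ls.eventually hp, l2.eventually H'.unique] with p h1 h2 h3
    intro hreg
    have hreg' : φ.vectorField (Q (s, p.2)).proj.1.proj ≠ 0 := by
      rw [H.proj_eq]
      exact directionFlow_regular _ hφ hK s hreg
    have hpr : (Q (s + p.1, p.2)).proj =
        directionFlow (Nat.succ_ne_zero n) hφ hK p.1 (Q (s, p.2)).proj := by
      rw [H.proj_eq, H.proj_eq, ← Flow.map_add, add_comm]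
    have hex : rescaledExp (Q (s + p.1, p.2)) =
        φ (T (s + p.1, p.2) - T (s, p.2)) (rescaledExp (Q (s, p.2))) := by
      rw [h1 hreg, h2 hreg, ← φ.map_add, sub_add_cancel]
    obtain ⟨k1, k2⟩ := (h3 hreg' hpr).1 hex
    refine Prod.ext k2 ?_
    change T (s + p.1, p.2) = T (s, p.2) + T' (p.1, Q (s, p.2))
    rw [← k1]
    ring

end

/-- The exponential of a zero vector is its base point, which moves with the flow itself. The zero
vector thus solves the equation with hitting time `t`. -/
lemma eventually_zero_section {ξ : directionSet φ K}
    {Q : ℝ × NormalTotal φ K → NormalTotal φ K} {T : ℝ × NormalTotal φ K → ℝ}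
    (H : IsPoincareGerm (directionFlow (Nat.succ_ne_zero n) hφ hK) n ⟨ξ, 0⟩ Q T) :
    ∀ᶠ t in 𝓝 (0 : ℝ),
      Q (t, ⟨ξ, 0⟩) = ⟨directionFlow (Nat.succ_ne_zero n) hφ hK t ξ, 0⟩ ∧ T (t, ⟨ξ, 0⟩) = t := by
  set φh := directionFlow (Nat.succ_ne_zero n) hφ hK
  have cz : Continuous fun p : ℝ × directionSet φ K => (p.1, (⟨p.2, 0⟩ : NormalTotal φ K)) :=
    continuous_fst.prodMk (continuous_normalZero.comp continuous_snd)
  have cf : Continuous fun p : ℝ × directionSet φ K => (⟨φh p.1 p.2, 0⟩ : NormalTotal φ K) :=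
    continuous_normalZero.comp φh.cont'
  have e0 : (⟨φh 0 ξ, 0⟩ : NormalTotal φ K) = ⟨ξ, 0⟩ :=
    congrArg (fun ζ => (⟨ζ, 0⟩ : NormalTotal φ K)) (φh.map_zero_apply ξ)
  have l1 : Tendsto (fun p : ℝ × directionSet φ K => (p.1, (⟨p.2, 0⟩ : NormalTotal φ K)))
      (𝓝 (0, ξ)) (𝓝 (0, ⟨ξ, 0⟩)) := cz.tendsto' _ _ rfl
  have l2 : Tendsto (fun p : ℝ × directionSet φ K =>
      (((p.1, (⟨p.2, 0⟩ : NormalTotal φ K)), p.1), (⟨φh p.1 p.2, 0⟩ : NormalTotal φ K)))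
      (𝓝 (0, ξ)) (𝓝 (((0, ⟨ξ, 0⟩), 0), ⟨ξ, 0⟩)) :=
    (l1.prodMk_nhds (continuous_fst.tendsto' _ _ rfl)).prodMk_nhds (cf.tendsto' _ _ e0)
  have h := eventually_eq_of_dense
    (dense_prod_regular (dense_regular_directions (φ := φ) (K := K))) (y := ((0 : ℝ), ξ))
    (f := fun p => (Q (p.1, ⟨p.2, 0⟩), T (p.1, ⟨p.2, 0⟩)))
    (g := fun p => ((⟨φh p.1 p.2, 0⟩ : NormalTotal φ K), p.1)) ?_ ?_ ?_
  · have lw : Tendsto (fun h : ℝ => (h, ξ)) (𝓝 0) (𝓝 (0, ξ)) :=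
      (Continuous.prodMk continuous_id continuous_const).tendsto' _ _ rfl
    exact (lw.eventually h).mono fun _ hh => Prod.ext_iff.1 hh
  · filter_upwards [l1.eventually H.continuousAt] with p hp
    exact (ContinuousAt.comp (g := Q)
      (f := fun p : ℝ × directionSet φ K => (p.1, (⟨p.2, 0⟩ : NormalTotal φ K))) hp.1
      cz.continuousAt).prodMk (ContinuousAt.comp (g := T)
        (f := fun p : ℝ × directionSet φ K => (p.1, (⟨p.2, 0⟩ : NormalTotal φ K))) hp.2
        cz.continuousAt)
  · exact Eventually.of_forall fun _ => cf.continuousAt.prodMk continuousAt_fst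
  · filter_upwards [l2.eventually H.unique] with p hp hreg
    have h1 := (hp hreg.1 rfl).1 (by rw [rescaledExp_zero, rescaledExp_zero]; rfl)
    exact Prod.ext h1.2.symm h1.1.symm

end IsPoincareGerm

/-- Neighbourhoods of the zero section contain a tube. -/
lemma exists_tube_subset [CompactSpace M] {O : Set (NormalTotal φ K)} (hO : IsOpen O)
    (h0 : ∀ ξ : directionSet φ K, (⟨ξ, 0⟩ : NormalTotal φ K) ∈ O) :
    ∃ β > 0, ∀ z : NormalTotal φ K, tangentNorm (normalVec z) < β → z ∈ O := by
  have : CompactSpace (directionSet φ K) := isCompact_iff_compactSpace.1 isCompact_directionSet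
  have key : ∃ β > 0, ∀ z : NormalTotal φ K, z.proj ∈ (univ : Set (directionSet φ K)) →
      tangentNorm (normalVec z) < β → z ∈ O := by
    refine isCompact_univ.induction_on (p := fun s => ∃ β > 0, ∀ z : NormalTotal φ K, z.proj ∈ s →
      tangentNorm (normalVec z) < β → z ∈ O) ?_ ?_ ?_ ?_
    · exact ⟨1, one_pos, fun _ h => h.elim⟩
    · rintro s t hst ⟨β, hβ, h⟩
      exact ⟨β, hβ, fun z hz => h z (hst hz)⟩
    · rintro s t ⟨β, hβ, h⟩ ⟨β', hβ', h'⟩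
      refine ⟨min β β', lt_min hβ hβ', fun z hz hn => ?_⟩
      rcases hz with hz | hz
      · exact h z hz (hn.trans_le (min_le_left _ _))
      · exact h' z hz (hn.trans_le (min_le_right _ _))
    · intro ξ _
      set x := ξ.1.proj with hx
      obtain ⟨B, hB⟩ := exists_mem_frameBase ξ
      obtain ⟨C, hC, hCe⟩ := exists_norm_tangentCoord_le (M := M) x
      have hz : trivPoint (normalTriv φ K x B) (ξ, 0) = ⟨ξ, 0⟩ := by
        have h1 := trivPoint_apply (e := normalTriv φ K x B) (z := (⟨ξ, 0⟩ : NormalTotal φ K)) hB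
        have h2 : normalTriv φ K x B (⟨ξ, 0⟩ : NormalTotal φ K) = (ξ, 0) := by
          rw [normalTriv_apply, normalVec_zero]
          refine Prod.ext rfl ?_
          change B (tangentCoord x _) = 0
          rw [tangentCoord_zero hB.1, map_zero]
        rwa [h2] at h1
      have hc : ContinuousAt (trivPoint (normalTriv φ K x B)) (ξ, 0) :=
        continuousAt_trivPoint (e := normalTriv φ K x B) hB
      have hev : ∀ᶠ q in 𝓝 (ξ, (0 : R2)), trivPoint (normalTriv φ K x B) q ∈ O :=
        hc.eventually (hO.mem_nhds (by rw [hz]; exact h0 ξ))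
      rw [nhds_prod_eq, eventually_prod_iff] at hev
      obtain ⟨P, hP, P', hP', hPP⟩ := hev
      obtain ⟨ε, hε, hball⟩ := Metric.eventually_nhds_iff.1 hP'
      have hb : Tendsto (fun ζ : directionSet φ K => ζ.1.proj) (𝓝 ξ) (𝓝 x) :=
        (continuous_tangentProj.comp continuous_subtype_val).tendsto' _ _ rfl
      -- The fibre coordinates are bounded by `‖B‖ * C` times the length of the vector; the added
      -- `1` keeps the divisor positive.
      have hpos : 0 < ‖B‖ * C + 1 := by positivity
      refine ⟨_, mem_nhdsWithin_of_mem_nhds ((hP.and (hb.eventually hCe)).and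
        ((isOpen_frameBase (φ := φ) (K := K) x B).mem_nhds hB)), ε / (‖B‖ * C + 1),
        div_pos hε hpos, ?_⟩
      rintro z ⟨⟨h1, h2⟩, h3⟩ hn
      have h4 := trivPoint_apply (e := normalTriv φ K x B) (z := z) h3
      rw [← h4]
      refine hPP h1 (hball ?_)
      rw [dist_zero_right]
      have h5 : ‖tangentCoord x (normalVec z)‖ ≤ C * tangentNorm (normalVec z) :=
        h2 (normalVec z) rfl
      have hn0 : 0 ≤ tangentNorm (normalVec z) := norm_nonneg _
      calc ‖B (tangentCoord x (normalVec z))‖ ≤ ‖B‖ * ‖tangentCoord x (normalVec z)‖ :=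
            B.le_opNorm _
        _ ≤ ‖B‖ * (C * tangentNorm (normalVec z)) := by gcongr
        _ ≤ (‖B‖ * C + 1) * tangentNorm (normalVec z) := by nlinarith
        _ < ε := by
          rw [lt_div_iff₀ hpos] at hn
          linarith
  obtain ⟨β, hβ, h⟩ := key
  exact ⟨β, hβ, fun z => h z (mem_univ _)⟩

section Germs

variable {U : Set (NormalTotal φ K)}
  {Q : NormalTotal φ K → ℝ × NormalTotal φ K → NormalTotal φ K}
  {T : NormalTotal φ K → ℝ × NormalTotal φ K → ℝ}

lemma eventually_germ_cocycle (hU : IsOpen U)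
    (H : ∀ z ∈ U, IsPoincareGerm (directionFlow (Nat.succ_ne_zero n) hφ hK) n z (Q z) (T z))
    {z : NormalTotal φ K} (hz : z ∈ U) :
    ∀ᶠ p in 𝓝 ((0 : ℝ), z), ∀ᶠ h in 𝓝 (0 : ℝ),
      Q z (p.1 + h, p.2) = Q (Q z p) (h, Q z p) ∧
      T z (p.1 + h, p.2) = T z p + T (Q z p) (h, Q z p) := by
  have h1 : ∀ᶠ p in 𝓝 ((0 : ℝ), z), Q z p ∈ U := by
    refine (H z hz).continuousAt.self_of_nhds.1.eventually ?_
    rw [(H z hz).eventually_zero.self_of_nhds.1]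
    exact hU.mem_nhds hz
  filter_upwards [(H z hz).eventually_cocycle, h1] with p hp hp'
  exact hp _ _ (H _ hp')

lemma isFlowGerm_poincare (hU : IsOpen U)
    (H : ∀ z ∈ U, IsPoincareGerm (directionFlow (Nat.succ_ne_zero n) hφ hK) n z (Q z) (T z)) :
    IsFlowGerm U (fun z h => Q z (h, z)) where
  isOpen := hU
  exists_flow z hz := ⟨Q z, (H z hz).continuousAt.mono fun _ h => h.1,
    (H z hz).eventually_zero.mono fun _ h => h.1,
    (eventually_germ_cocycle hU H hz).mono fun _ h => h.mono fun _ h => h.1⟩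

/-- The cocycle relation makes the hitting time additive, so it can be carried along as a real
coordinate. The maximal flow of the pair then provides a continuous total hitting time along whole
orbits. -/
lemma poincare_time_flow (hU : IsOpen U)
    (H : ∀ z ∈ U, IsPoincareGerm (directionFlow (Nat.succ_ne_zero n) hφ hK) n z (Q z) (T z))
    {z : NormalTotal φ K × ℝ} (hz : z.1 ∈ U) {Q' : ℝ × NormalTotal φ K × ℝ → NormalTotal φ K × ℝ}
    (hQ' : ∀ p, Q' p = (Q z.1 (p.1, p.2.1), p.2.2 + T z.1 (p.1, p.2.1))) :
    (∀ᶠ p in 𝓝 ((0 : ℝ), z), ContinuousAt Q' p) ∧ (∀ᶠ z' in 𝓝 z, Q' (0, z') = z') ∧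
      ∀ᶠ p in 𝓝 ((0 : ℝ), z), ∀ᶠ h in 𝓝 (0 : ℝ), Q' (p.1 + h, p.2) =
        (Q (Q' p).1 (h, (Q' p).1), (Q' p).2 + T (Q' p).1 (h, (Q' p).1)) := by
  obtain ⟨z, a⟩ := z
  obtain rfl : Q' = fun p => (Q z (p.1, p.2.1), p.2.2 + T z (p.1, p.2.1)) := funext hQ'
  have c1 : Continuous fun p : ℝ × NormalTotal φ K × ℝ => (p.1, p.2.1) :=
    continuous_fst.prodMk (continuous_fst.comp continuous_snd)
  have l1 : Tendsto (fun p : ℝ × NormalTotal φ K × ℝ => (p.1, p.2.1)) (𝓝 (0, (z, a)))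
      (𝓝 (0, z)) := c1.tendsto' _ _ rfl
  refine ⟨?_, ?_, ?_⟩
  · filter_upwards [l1.eventually (H z hz).continuousAt] with p hp
    exact (ContinuousAt.comp (g := Q z) (f := fun p : ℝ × NormalTotal φ K × ℝ => (p.1, p.2.1))
      hp.1 c1.continuousAt).prodMk ((continuous_snd.comp continuous_snd).continuousAt.add
        (ContinuousAt.comp (g := T z) (f := fun p : ℝ × NormalTotal φ K × ℝ => (p.1, p.2.1))
          hp.2 c1.continuousAt))
  · filter_upwards [continuousAt_fst.eventually (H z hz).eventually_zero] with p hp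
    refine Prod.ext hp.1 ?_
    change p.2 + T z (0, p.1) = p.2
    rw [hp.2, add_zero]
  · filter_upwards [l1.eventually (eventually_germ_cocycle hU H hz)] with p hp
    filter_upwards [hp] with h hh
    refine Prod.ext hh.1 ?_
    change p.2.2 + T z (p.1 + h, p.2.1) = p.2.2 + T z (p.1, p.2.1) + _
    rw [hh.2, add_assoc]

/-- The Poincaré flow together with the hitting time. -/
lemma isFlowGerm_poincare_time (hU : IsOpen U)
    (H : ∀ z ∈ U, IsPoincareGerm (directionFlow (Nat.succ_ne_zero n) hφ hK) n z (Q z) (T z)) :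
    IsFlowGerm (U ×ˢ (univ : Set ℝ)) (fun z h => (Q z.1 (h, z.1), z.2 + T z.1 (h, z.1))) where
  isOpen := hU.prod isOpen_univ
  exists_flow _ hz := ⟨_, poincare_time_flow hU H hz.1 fun _ => rfl⟩

lemma isFiberedGerm_poincare (hU : IsOpen U)
    (H : ∀ z ∈ U, IsPoincareGerm (directionFlow (Nat.succ_ne_zero n) hφ hK) n z (Q z) (T z))
    (h0 : ∀ ξ : directionSet φ K, (⟨ξ, 0⟩ : NormalTotal φ K) ∈ U) :
    IsFiberedGerm (directionFlow (Nat.succ_ne_zero n) hφ hK) n U (fun z h => Q z (h, z)) := by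
  have hG := isFlowGerm_poincare hU H
  have hev : ∀ z ∈ U, ∀ᶠ p in 𝓝 ((0 : ℝ), z),
      germFlow U (fun z h => Q z (h, z)) p.1 p.2 = Q z p := fun z hz =>
    (hG.eventually_germFlow_eq hz ((H z hz).continuousAt.mono fun _ h => h.1)
      ((H z hz).eventually_zero.mono fun _ h => h.1)
      ((eventually_germ_cocycle hU H hz).mono fun _ h => h.mono fun _ h => h.1)).mono
      fun _ h => h.2
  refine { hG with
    zero_mem := h0
    zero_eq := fun ξ => (H _ (h0 ξ)).eventually_zero_section.mono fun _ h => h.1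
    proj_eq := fun z hz => ?_
    smooth := fun z hz => ?_ }
  · filter_upwards [hev z hz] with p hp
    rw [hp, (H z hz).proj_eq]
  · filter_upwards [(hev z hz).eventually_nhds, (H z hz).smooth] with p hp hs
    refine hs.congr ?_
    have l : Tendsto (fun z' : NormalTotal φ K => (p.1, z')) (𝓝 p.2) (𝓝 p) :=
      (Continuous.prodMk continuous_const continuous_id).tendsto' _ _ rfl
    exact l.eventually hp

end Germs

end PoincareCocycle

/-! ### Conjugacy with the sectional Poincaré flow, and the theorem. -/

noncomputable section Compactification

set_option linter.unusedSectionVars false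
set_option synthInstance.maxHeartbeats 400000
set_option maxHeartbeats 1000000

variable {M : Type u} [TopologicalSpace M] [ChartedSpace R3 M] [IsManifold (𝓡 3) ∞ M]
  [RiemannianBundle (fun x : M => TangentSpace (𝓡 3) x)]
  [IsContMDiffRiemannianBundle (𝓡 3) ∞ R3 (fun x : M => TangentSpace (𝓡 3) x)]
  {φ : Flow ℝ M} {K : Set M} {n : ℕ}

lemma tangentSmul_mem_normalBundle {A : Set M} {ζ : TangentBundle (𝓡 3) M}
    (h : ζ ∈ φ.normalBundle A) (c : ℝ) : tangentSmul c ζ ∈ φ.normalBundle A := by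
  refine ⟨h.1, h.2.1, ?_⟩
  change inner ℝ (φ.vectorField ζ.proj) (c • ζ.snd) = 0
  rw [inner_smul_right, h.2.2, mul_zero]

/-- The inclusion of the normal bundle over the regular points of `K`. -/
def regularNormal (v : φ.normalBundle K) : NormalTotal φ K :=
  ⟨⟨tangentNormalize (fieldVec φ v.1.proj), tangentNormalize_fieldVec_mem v.2.1 v.2.2.1⟩,
    show normalSubmodule (tangentNormalize (fieldVec φ v.1.proj)) from ⟨v.1.snd, by
      change inner ℝ ((tangentNorm (fieldVec φ v.1.proj))⁻¹ • φ.vectorField v.1.proj) v.1.snd = 0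
      rw [real_inner_smul_left, v.2.2.2, mul_zero]⟩⟩

lemma regularNormal_injective : Function.Injective (regularNormal (φ := φ) (K := K)) :=
  fun _ _ h => Subtype.ext (congrArg normalVec h)

lemma proj_regularNormal_eq {v w : φ.normalBundle K} (h : v.1.proj = w.1.proj) :
    (regularNormal v).proj = (regularNormal w).proj :=
  Subtype.ext (congrArg (fun x => tangentNormalize (fieldVec φ x)) h)

lemma regularNormal_zero {v : φ.normalBundle K} (h : v.1.snd = 0) : (regularNormal v).snd = 0 :=
  Subtype.ext h

variable [T2Space M]

lemma continuous_regularNormal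
    (hφ : ContMDiff (𝓘(ℝ, ℝ).prod (𝓡 3)) (𝓡 3) (n + 1 : ℕ) (fun q : ℝ × M => φ q.1 q.2)) : Continuous (regularNormal (φ := φ) (K := K)) := by
  refine isInducing_normalTotal.continuous_iff.2 (Continuous.prodMk ?_ continuous_subtype_val)
  refine Continuous.subtype_mk ?_ _
  rw [continuous_iff_continuousAt]
  intro v
  exact ContinuousAt.comp (g := tangentNormalize)
    (f := fun v : φ.normalBundle K => fieldVec φ v.1.proj)
    (continuousAt_tangentNormalize (fieldVec_norm_pos v.2.2.1).ne')
    ((continuous_fieldVec (Nat.succ_ne_zero n) hφ).comp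
      (continuous_tangentProj.comp continuous_subtype_val)).continuousAt

lemma normalVec_mem_normalBundle
    (hφ : ContMDiff (𝓘(ℝ, ℝ).prod (𝓡 3)) (𝓡 3) (n + 1 : ℕ) (fun q : ℝ × M => φ q.1 q.2))
    {A : Set M} {z : NormalTotal φ K} (hA : z.proj.1.proj ∈ A)
    (hz : φ.vectorField z.proj.1.proj ≠ 0) : normalVec z ∈ φ.normalBundle A := by
  refine ⟨hA, hz, ?_⟩
  have h1 := fieldVec_proj_of_mem_directionSet (Nat.succ_ne_zero n) hφ z.proj.2
  have h2 : φ.vectorField z.proj.1.proj = speed φ z.proj.1.proj • z.proj.1.snd :=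
    TotalSpace.mk_injective _ h1
  change inner ℝ (φ.vectorField z.proj.1.proj) (show TangentSpace (𝓡 3) z.proj.1.proj from
    (normalVec z).snd) = 0
  rw [h2, real_inner_smul_left, inner_normalVec, mul_zero]

lemma directionFlow_proj_regularNormal
    (hφ : ContMDiff (𝓘(ℝ, ℝ).prod (𝓡 3)) (𝓡 3) (n + 1 : ℕ) (fun q : ℝ × M => φ q.1 q.2)) (hK : IsInvariant φ K)
    {t : ℝ} {v w : φ.normalBundle K}
    (h : w.1.proj = φ t v.1.proj) :
    (regularNormal w).proj = directionFlow (Nat.succ_ne_zero n) hφ hK t (regularNormal v).proj := by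
  refine Subtype.ext ?_
  have h1 := eq_tangentNormalize_fieldVec (Nat.succ_ne_zero n) hφ
    (directionFlow (Nat.succ_ne_zero n) hφ hK t (regularNormal v).proj).2
    (directionFlow_regular (Nat.succ_ne_zero n) hφ hK t v.2.2.1)
  exact (congrArg (fun x => tangentNormalize (fieldVec φ x)) h).trans h1.symm

variable {β : ℝ} {Q : NormalTotal φ K → ℝ × NormalTotal φ K → NormalTotal φ K}
  {T : NormalTotal φ K → ℝ × NormalTotal φ K → ℝ}

variable (φ K) in
/-- The tube of radius `β` around the zero section. -/
def normalTube (β : ℝ) : Set (NormalTotal φ K) := {z | tangentNorm (normalVec z) < β}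

lemma isOpen_normalTube (β : ℝ) : IsOpen (normalTube φ K β) :=
  isOpen_lt (continuous_tangentNorm.comp continuous_normalVec) continuous_const

lemma zero_mem_normalTube (hβ : 0 < β) (ξ : directionSet φ K) :
    (⟨ξ, 0⟩ : NormalTotal φ K) ∈ normalTube φ K β := by
  change ‖(0 : TangentSpace (𝓡 3) ξ.1.proj)‖ < β
  rwa [norm_zero]

/-- The rescaled sectional Poincaré flow is a restriction of the flow of the germs. -/
lemma germFlow_regularNormal
    (hφ : ContMDiff (𝓘(ℝ, ℝ).prod (𝓡 3)) (𝓡 3) (n + 1 : ℕ) (fun q : ℝ × M => φ q.1 q.2)) (hK : IsInvariant φ K)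
    (H : ∀ z ∈ normalTube φ K β,
      IsPoincareGerm (directionFlow (Nat.succ_ne_zero n) hφ hK) n z (Q z) (T z))
    {t : ℝ} {v w : φ.normalBundle K} (h : φ.RescaledSectionalPoincare β t v w) :
    (t, regularNormal v) ∈ germDomain (normalTube φ K β) (fun z h => Q z (h, z)) ∧
      germFlow (normalTube φ K β) (fun z h => Q z (h, z)) t (regularNormal v) =
        regularNormal w := by
  classical
  obtain ⟨u, ⟨γ, τ, hγc, hτc, hγ0, hγt, hτ0, hγ⟩, hw⟩ := h
  set φh := directionFlow (Nat.succ_ne_zero n) hφ hK with hφh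
  let a : ℝ → TangentBundle (𝓡 3) M := fun s => tangentSmul (speed φ (γ s).proj)⁻¹ (γ s)
  have hmem : ∀ s ∈ uIcc 0 t, a s ∈ φ.normalBundle K := fun s hs => by
    obtain ⟨h1, h2, -, -⟩ := hγ s hs
    refine tangentSmul_mem_normalBundle ⟨?_, h1.2.1, h1.2.2⟩ _
    rw [h2]
    exact hK s v.2.1
  -- The default value can only occur outside the interval between `0` and `t`, where `z` is not
  -- used.
  let z : ℝ → NormalTotal φ K := fun s =>
    if h : a s ∈ φ.normalBundle K then regularNormal ⟨a s, h⟩ else regularNormal v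
  have hz : ∀ s (hs : s ∈ uIcc 0 t), z s = regularNormal ⟨a s, hmem s hs⟩ :=
    fun s hs => dif_pos (hmem s hs)
  have hzv : ∀ s ∈ uIcc 0 t, normalVec (z s) = a s := fun s hs => by rw [hz s hs]; rfl
  have hzp : ∀ s ∈ uIcc 0 t, (z s).proj = φh s (regularNormal v).proj := fun s hs => by
    rw [hz s hs]
    exact directionFlow_proj_regularNormal hφ hK (hγ s hs).2.1
  have hpos : ∀ s ∈ uIcc 0 t, 0 < speed φ (γ s).proj := fun s hs =>
    norm_pos_iff.2 (hγ s hs).1.2.1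
  have hzb : ∀ s ∈ uIcc 0 t, (z s).proj.1.proj = (γ s).proj := fun s hs => by
    rw [hz s hs]; rfl
  have hexp : ∀ s ∈ uIcc 0 t, rescaledExp (z s) = riemannianExp (γ s) := fun s hs => by
    rw [rescaledExp, hzv s hs, hzb s hs]
    change riemannianExp (tangentSmul _ (tangentSmul _ (γ s))) = _
    rw [tangentSmul_tangentSmul, mul_inv_cancel₀ (hpos s hs).ne', tangentSmul_one]
  have hz0 : z 0 = regularNormal v := by
    rw [hz 0 left_mem_uIcc]
    congr 1
    refine Subtype.ext ?_
    have h1 := hpos 0 left_mem_uIcc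
    have h2 : γ 0 = tangentSmul (speed φ v.1.proj) v.1 := hγ0
    change tangentSmul (speed φ (γ 0).proj)⁻¹ (γ 0) = v.1
    have h3 : (γ 0).proj = v.1.proj := by rw [h2]; rfl
    rw [h3] at h1 ⊢
    rw [h2, tangentSmul_tangentSmul, inv_mul_cancel₀ h1.ne', tangentSmul_one]
  have hzt : z t = regularNormal w := by
    rw [hz t right_mem_uIcc]
    congr 1
    refine Subtype.ext ?_
    rw [hw, ← hγt]
    rfl
  have hac : ContinuousOn a (uIcc 0 t) := by
    refine continuous_tangentSmul.comp_continuousOn (ContinuousOn.prodMk ?_ hγc)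
    refine ContinuousOn.inv₀ ?_ fun s hs => (hpos s hs).ne'
    exact ((continuous_speed (Nat.succ_ne_zero n) hφ).comp
      continuous_tangentProj).comp_continuousOn hγc
  have hzc : ContinuousOn z (uIcc 0 t) := by
    refine isInducing_normalTotal.continuousOn_iff.2 (ContinuousOn.prodMk ?_ ?_)
    · have : Continuous fun s : ℝ => φh s (regularNormal v).proj :=
        φh.continuous continuous_id continuous_const
      exact this.continuousOn.congr hzp
    · exact hac.congr hzv
  have key := (isFlowGerm_poincare (isOpen_normalTube β) H).germFlow_eq_of_uIcc (γ := z) (t := t) ?_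
  · rwa [hz0, hzt] at key
  · intro s hs
    have hU : z s ∈ normalTube φ K β := by
      change tangentNorm (normalVec (z s)) < β
      rw [hzv s hs]
      change tangentNorm (tangentSmul _ _) < β
      rw [tangentNorm_tangentSmul, abs_of_pos (inv_pos.2 (hpos s hs)),
        inv_mul_lt_iff₀ (hpos s hs), mul_comm]
      exact (hγ s hs).2.2.1
    refine ⟨hU, ?_⟩
    have l1 : Tendsto (fun s' : ℝ => s' - s) (𝓝[uIcc 0 t] s) (𝓝 0) :=
      ((show Continuous fun s' : ℝ => s' - s by fun_prop).tendsto' s 0 (by simp)).mono_left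
        nhdsWithin_le_nhds
    have l2 : Tendsto (fun s' => τ s' - τ s) (𝓝[uIcc 0 t] s) (𝓝 0) := by
      have := (hτc s hs).tendsto.sub_const (τ s)
      rwa [sub_self] at this
    have l3 : Tendsto (fun s' => (((s' - s, z s), τ s' - τ s), z s')) (𝓝[uIcc 0 t] s)
        (𝓝 (((0, z s), 0), z s)) :=
      ((l1.prodMk_nhds tendsto_const_nhds).prodMk_nhds l2).prodMk_nhds (hzc s hs)
    -- The hitting time from `z s` to `z s'` is `τ s' - τ s`. Continuity of `τ` and of the curve
    -- brings it into the range where the germ is the only solution, which excludes later returns of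
    -- the orbit to the section.
    filter_upwards [l3.eventually (H (z s) hU).unique, self_mem_nhdsWithin] with s' h1 hs'
    refine ((h1 ?_ ?_).1 ?_).2
    · rw [hzb s hs]
      exact (hγ s hs).1.2.1
    · rw [hzp s' hs', hzp s hs, ← φh.map_add, sub_add_cancel]
    · rw [hexp s' hs', hexp s hs, (hγ s' hs').2.2.2, (hγ s hs).2.2.2, ← φ.map_add, sub_add_cancel]

/-- The flow of the germs together with the hitting time is the holonomy along the flow lines. -/
lemma germFlow_time_spec
    (hφ : ContMDiff (𝓘(ℝ, ℝ).prod (𝓡 3)) (𝓡 3) (n + 1 : ℕ) (fun q : ℝ × M => φ q.1 q.2)) (hK : IsInvariant φ K)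
    (H : ∀ z ∈ normalTube φ K β,
      IsPoincareGerm (directionFlow (Nat.succ_ne_zero n) hφ hK) n z (Q z) (T z))
    {t : ℝ} {z : NormalTotal φ K × ℝ}
    (h : (t, z) ∈ germDomain (normalTube φ K β ×ˢ (univ : Set ℝ))
      (fun z h => (Q z.1 (h, z.1), z.2 + T z.1 (h, z.1))))
    (hreg : φ.vectorField z.1.proj.1.proj ≠ 0) :
    let w := germFlow (normalTube φ K β ×ˢ (univ : Set ℝ))
      (fun z h => (Q z.1 (h, z.1), z.2 + T z.1 (h, z.1))) t z
    w.1.proj = directionFlow (Nat.succ_ne_zero n) hφ hK t z.1.proj ∧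
      rescaledExp w.1 = φ (w.2 - z.2) (rescaledExp z.1) := by
  have hG := isFlowGerm_poincare_time (isOpen_normalTube β) H
  refine hG.germFlow_induction (S := fun t z => φ.vectorField z.1.proj.1.proj ≠ 0 →
    let w := germFlow (normalTube φ K β ×ˢ (univ : Set ℝ))
      (fun z h => (Q z.1 (h, z.1), z.2 + T z.1 (h, z.1))) t z
    w.1.proj = directionFlow (Nat.succ_ne_zero n) hφ hK t z.1.proj ∧
      rescaledExp w.1 = φ (w.2 - z.2) (rescaledExp z.1)) ?_ ?_ h hreg
  · rintro ⟨z, a⟩ ⟨hz, -⟩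
    obtain ⟨h1, h2, h3⟩ := poincare_time_flow (isOpen_normalTube β) H (z := (z, a)) hz
      fun _ => rfl
    have c1 : Continuous fun p : ℝ × NormalTotal φ K × ℝ => (p.1, p.2.1) :=
      continuous_fst.prodMk (continuous_fst.comp continuous_snd)
    have l1 : Tendsto (fun p : ℝ × NormalTotal φ K × ℝ => (p.1, p.2.1)) (𝓝 (0, (z, a)))
        (𝓝 (0, z)) := c1.tendsto' _ _ rfl
    filter_upwards [hG.eventually_germFlow_eq ⟨hz, mem_univ _⟩ h1 h2 h3,
      l1.eventually (H z hz).eventually_rescaledExp] with p hp hp' hreg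
    simp only [hp.2]
    refine ⟨(H z hz).proj_eq _, ?_⟩
    rw [add_sub_cancel_left]
    exact hp' hreg
  · intro s t z hs hst h1 h2 hreg
    obtain ⟨k1, k2⟩ := h1 hreg
    have hreg' := directionFlow_regular (Nat.succ_ne_zero n) hφ hK s hreg
    rw [← k1] at hreg'
    obtain ⟨k3, k4⟩ := h2 hreg'
    simp only
    rw [hG.germFlow_add hs hst, k3, k4, k1, k2, ← φ.map_add, ← Flow.map_add, add_comm t s,
      sub_add_sub_cancel]
    exact ⟨rfl, rfl⟩

/-- Converse of `germFlow_regularNormal`. Along the orbit of `(regularNormal v, 0)` in the augmented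
flow, the vector times the speed is the curve `γ` and the second coordinate is `τ`. Staying in the
tube is the required bound of `‖γ‖` by `β` times the speed. -/
lemma exists_rescaledSectionalPoincare
    (hφ : ContMDiff (𝓘(ℝ, ℝ).prod (𝓡 3)) (𝓡 3) (n + 1 : ℕ) (fun q : ℝ × M => φ q.1 q.2)) (hK : IsInvariant φ K)
    (H : ∀ z ∈ normalTube φ K β,
      IsPoincareGerm (directionFlow (Nat.succ_ne_zero n) hφ hK) n z (Q z) (T z))
    {t : ℝ} {v : φ.normalBundle K}
    (h : (t, (regularNormal v, (0 : ℝ))) ∈ germDomain (normalTube φ K β ×ˢ (univ : Set ℝ))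
      (fun z h => (Q z.1 (h, z.1), z.2 + T z.1 (h, z.1)))) :
    ∃ w : φ.normalBundle K, φ.RescaledSectionalPoincare β t v w := by
  have hG := isFlowGerm_poincare_time (isOpen_normalTube β) H
  set q : NormalTotal φ K × ℝ → ℝ → NormalTotal φ K × ℝ :=
    fun z h => (Q z.1 (h, z.1), z.2 + T z.1 (h, z.1)) with hq
  set U := normalTube φ K β ×ˢ (univ : Set ℝ) with hU
  have hd0 := (IsFlowGerm.mem_of_mem_germDomain h).2
  have hd : ∀ s ∈ uIcc 0 t, (s, (regularNormal v, (0 : ℝ))) ∈ germDomain U q := fun s hs =>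
    (hG.ordConnected_germDomain _).uIcc_subset hd0 h hs
  let F : ℝ → NormalTotal φ K × ℝ := fun s => germFlow U q s (regularNormal v, 0)
  have hF0 : F 0 = (regularNormal v, 0) := hG.germFlow_zero hd0
  have hFc : ∀ s ∈ uIcc 0 t, ContinuousAt F s := fun s hs =>
    ContinuousAt.comp (g := fun p : ℝ × NormalTotal φ K × ℝ => germFlow U q p.1 p.2)
      (f := fun s : ℝ => (s, (regularNormal v, (0 : ℝ)))) (hG.continuousAt_germFlow (hd s hs))
      (Continuous.prodMk continuous_id continuous_const).continuousAt
  have hspec : ∀ s ∈ uIcc 0 t, (F s).1.proj = directionFlow (Nat.succ_ne_zero n) hφ hK s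
      (regularNormal v).proj ∧ rescaledExp (F s).1 = φ (F s).2 (rescaledExp (regularNormal v)) := by
    intro s hs
    have := germFlow_time_spec hφ hK H (hd s hs) v.2.2.1
    simpa only [sub_zero] using this
  have hFb : ∀ s ∈ uIcc 0 t, (F s).1.proj.1.proj = φ s v.1.proj := fun s hs =>
    congrArg (fun ξ : directionSet φ K => ξ.1.proj) (hspec s hs).1
  have hreg : ∀ s ∈ uIcc 0 t, φ.vectorField (F s).1.proj.1.proj ≠ 0 := fun s hs => by
    rw [hFb s hs]
    exact speed_flow_pos (Nat.succ_ne_zero n) hφ s v.2.2.1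
  let γ : ℝ → TangentBundle (𝓡 3) M := fun s =>
    tangentSmul (speed φ (F s).1.proj.1.proj) (normalVec (F s).1)
  have hmem : normalVec (F t).1 ∈ φ.normalBundle K := by
    refine normalVec_mem_normalBundle hφ ?_ (hreg t right_mem_uIcc)
    rw [hFb t right_mem_uIcc]
    exact hK t v.2.1
  refine ⟨⟨normalVec (F t).1, hmem⟩, γ t, ⟨γ, fun s => (F s).2, ?_, ?_, ?_, rfl, ?_, ?_⟩, ?_⟩
  · intro s hs
    refine ContinuousAt.continuousWithinAt ?_
    have h1 : ContinuousAt (fun s => (F s).1) s := (hFc s hs).fst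
    refine ContinuousAt.comp (g := fun q : ℝ × TangentBundle (𝓡 3) M => tangentSmul q.1 q.2)
      (f := fun s => (speed φ (F s).1.proj.1.proj, normalVec (F s).1))
      continuous_tangentSmul.continuousAt (ContinuousAt.prodMk ?_ ?_)
    · exact ContinuousAt.comp (g := fun z : NormalTotal φ K => speed φ z.proj.1.proj)
        (f := fun s => (F s).1) ((continuous_speed (Nat.succ_ne_zero n) hφ).comp
          continuous_normalBase).continuousAt h1
    · exact ContinuousAt.comp (g := fun z : NormalTotal φ K => normalVec z)
        (f := fun s => (F s).1) continuous_normalVec.continuousAt h1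
  · exact fun s hs => (hFc s hs).snd.continuousWithinAt
  · change tangentSmul (speed φ (F 0).1.proj.1.proj) (normalVec (F 0).1) = _
    rw [hF0]
    rfl
  · change (F 0).2 = 0
    rw [hF0]
  · intro s hs
    have hpos : 0 < speed φ (F s).1.proj.1.proj := norm_pos_iff.2 (hreg s hs)
    refine ⟨tangentSmul_mem_normalBundle (normalVec_mem_normalBundle hφ (mem_univ _) (hreg s hs)) _,
      hFb s hs, ?_, ?_⟩
    · change tangentNorm (γ s) < β * speed φ (F s).1.proj.1.proj
      rw [tangentNorm_tangentSmul, abs_of_pos hpos, mul_comm]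
      exact mul_lt_mul_of_pos_right (hG.germFlow_mem (hd s hs)).1 hpos
    · exact (hspec s hs).2
  · have hpos : 0 < speed φ (F t).1.proj.1.proj := norm_pos_iff.2 (hreg t right_mem_uIcc)
    change normalVec (F t).1 = tangentSmul (speed φ (F t).1.proj.1.proj)⁻¹
      (tangentSmul (speed φ (F t).1.proj.1.proj) (normalVec (F t).1))
    rw [tangentSmul_tangentSmul, inv_mul_cancel₀ hpos.ne', tangentSmul_one]

/-- The zero vector over the orbit of `ξ`, with hitting time `s` at time `s`, follows the germs for
all times. Openness of the domain then provides a neighbourhood of the zero section. -/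
lemma zero_section_mem_germDomain_time
    (hφ : ContMDiff (𝓘(ℝ, ℝ).prod (𝓡 3)) (𝓡 3) (n + 1 : ℕ) (fun q : ℝ × M => φ q.1 q.2)) (hK : IsInvariant φ K)
    (hβ : 0 < β)
    (H : ∀ z ∈ normalTube φ K β,
      IsPoincareGerm (directionFlow (Nat.succ_ne_zero n) hφ hK) n z (Q z) (T z))
    (t : ℝ) (ξ : directionSet φ K) :
    (t, ((⟨ξ, 0⟩ : NormalTotal φ K), (0 : ℝ))) ∈
      germDomain (normalTube φ K β ×ˢ (univ : Set ℝ))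
        (fun z h => (Q z.1 (h, z.1), z.2 + T z.1 (h, z.1))) := by
  set φh := directionFlow (Nat.succ_ne_zero n) hφ hK with hφh
  have key := (isFlowGerm_poincare_time (isOpen_normalTube β) H).germFlow_eq_of_uIcc (t := t)
    (γ := fun s => ((⟨φh s ξ, 0⟩ : NormalTotal φ K), s)) ?_
  · have e0 : (⟨φh 0 ξ, 0⟩ : NormalTotal φ K) = ⟨ξ, 0⟩ :=
      congrArg (fun ζ => (⟨ζ, 0⟩ : NormalTotal φ K)) (φh.map_zero_apply ξ)
    beta_reduce at key
    rw [e0] at key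
    exact key.1
  · intro s _
    have hU := zero_mem_normalTube hβ (φh s ξ)
    refine ⟨⟨hU, mem_univ _⟩, Filter.Eventually.filter_mono nhdsWithin_le_nhds ?_⟩
    have hl : Tendsto (fun s' : ℝ => s' - s) (𝓝 s) (𝓝 0) :=
      (show Continuous fun s' : ℝ => s' - s by fun_prop).tendsto' _ _ (by simp)
    filter_upwards [hl.eventually (H _ hU).eventually_zero_section] with s' hs'
    refine Prod.ext ?_ ?_
    · refine Eq.trans ?_ hs'.1.symm
      exact congrArg (fun ζ => (⟨ζ, 0⟩ : NormalTotal φ K))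
        (by rw [← hφh, ← φh.map_add, sub_add_cancel])
    · change s' = s + _
      rw [hs'.2]
      ring

end Compactification

theorem mainTheorem5 {M : Type u} [TopologicalSpace M] [T2Space M] [CompactSpace M]
    [ChartedSpace R3 M] [IsManifold (𝓡 3) ∞ M]
    [RiemannianBundle (fun x : M => TangentSpace (𝓡 3) x)]
    [IsContMDiffRiemannianBundle (𝓡 3) ∞ R3 (fun x : M => TangentSpace (𝓡 3) x)]
    (r : ℕ) (hr : 2 ≤ r) (φ : Flow ℝ M)
    (hφ : ContMDiff (𝓘(ℝ, ℝ).prod (𝓡 3)) (𝓡 3) r (fun q : ℝ × M => φ q.1 q.2))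
    (K : Set M) (hK : IsCompact K) (hKφ : IsInvariant φ K)
    (hsing : ∀ σ ∈ K, φ.vectorField σ = 0 → φ.IsHyperbolicSingularity σ) :
    ∃ (Khat : Type u) (_ : MetricSpace Khat) (_ : CompactSpace Khat) (φhat : Flow ℝ Khat)
      (Nhat : Khat → Type)
      (_ : ∀ x, AddCommGroup (Nhat x)) (_ : ∀ x, Module ℝ (Nhat x))
      (_ : TopologicalSpace (TotalSpace (EuclideanSpace ℝ (Fin 2)) Nhat))
      (_ : ∀ x, TopologicalSpace (Nhat x))
      (_ : FiberBundle (EuclideanSpace ℝ (Fin 2)) Nhat)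
      (_ : VectorBundle ℝ (EuclideanSpace ℝ (Fin 2)) Nhat)
      (Phat : LocalFiberedFlow (EuclideanSpace ℝ (Fin 2)) Nhat φhat)
      (p : φ.normalBundle K → TotalSpace (EuclideanSpace ℝ (Fin 2)) Nhat) (β : ℝ),
      -- `p` is an injective continuous map which preserves fibers and zero sections
      Continuous p ∧ Function.Injective p ∧
      (∀ v w : φ.normalBundle K, v.1.proj = w.1.proj → (p v).proj = (p w).proj) ∧
      (∀ v : φ.normalBundle K, v.1.snd = 0 → (p v).snd = 0) ∧
      -- `p` conjugates the local flows `P*` and `P̂*` on the `β`-neighbourhood of the zero section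
      0 < β ∧
      (∀ (t : ℝ) (v : φ.normalBundle K), v.1.snd = 0 →
        {q : ℝ × φ.normalBundle K |
          ∃ w : φ.normalBundle K, φ.RescaledSectionalPoincare β q.1 q.2 w} ∈ 𝓝 (t, v)) ∧
      (∀ (t : ℝ) (v w : φ.normalBundle K), φ.RescaledSectionalPoincare β t v w →
        (t, p v) ∈ Phat.domain ∧ Phat.toFun t (p v) = p w) ∧
      -- `P̂*` is `C^{r-1}` along the fibers
      Phat.IsContDiffAlongFibers (r - 1) := by
  -- `n = r - 1` is the order left after the division by the speed; it is at least `1`, as the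
  -- implicit function theorem requires.
  obtain ⟨n, rfl⟩ : ∃ n, r = n + 1 := ⟨r - 1, by omega⟩
  have hn : n ≠ 0 := by omega
  have hN : n + 1 ≠ 0 := Nat.succ_ne_zero n
  have hc : CompactSpace (directionSet φ K) := isCompact_iff_compactSpace.1 isCompact_directionSet
  have hsc : SecondCountableTopology (TangentBundle (𝓡 3) M) :=
    secondCountableTopology_tangentBundle
  let hm : MetricSpace (directionSet φ K) := TopologicalSpace.metrizableSpaceMetric _
  -- Germs exist at the zero section and on an open set. Compactness turns this set into a tube,
  -- whose radius `β` is also the one used to define `P*`.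
  have hO : IsOpen {z : NormalTotal φ K |
      ∃ Q T, IsPoincareGerm (directionFlow hN hφ hKφ) n z Q T} := by
    rw [isOpen_iff_mem_nhds]
    rintro z ⟨Q, T, hQT⟩
    exact hQT.eventually.mono fun z' hz' => ⟨Q, T, hz'⟩
  obtain ⟨β, hβ, hgerm⟩ := exists_tube_subset hO (exists_isPoincareGerm_zero hφ hKφ hn)
  have hall : ∀ z : NormalTotal φ K, ∃ Q T, z ∈ normalTube φ K β →
      IsPoincareGerm (directionFlow hN hφ hKφ) n z Q T := by
    intro z
    by_cases hz : z ∈ normalTube φ K β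
    · obtain ⟨Q, T, hQT⟩ := hgerm z hz
      exact ⟨Q, T, fun _ => hQT⟩
    · exact ⟨Prod.snd, fun _ => 0, fun h => absurd h hz⟩
  choose Q T H using hall
  have hF := isFiberedGerm_poincare (isOpen_normalTube β) H (zero_mem_normalTube hβ)
  refine ⟨directionSet φ K, hm, hc, directionFlow hN hφ hKφ, NormalFiber φ K, inferInstance,
    inferInstance, inferInstance, inferInstance, inferInstance, inferInstance,
    hF.localFiberedFlow, regularNormal, β, continuous_regularNormal hφ, regularNormal_injective,
    fun v w h => proj_regularNormal_eq h, fun v h => regularNormal_zero h, hβ, ?_,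
    fun t v w h => germFlow_regularNormal hφ hKφ H h, hF.isContDiffAlongFibers⟩
  intro t v hv
  have hz : regularNormal v = ⟨(regularNormal v).proj, 0⟩ :=
    congrArg (TotalSpace.mk _) (regularNormal_zero hv)
  -- The augmented flow is needed here, since its domain is where both the holonomy curve and its
  -- hitting time are available.
  have hopen := (isFlowGerm_poincare_time (isOpen_normalTube β) H).isOpen_germDomain
  have hmem := zero_section_mem_germDomain_time hφ hKφ hβ H t (regularNormal v).proj
  rw [← hz] at hmem
  have hcont : Continuous fun q : ℝ × φ.normalBundle K => (q.1, (regularNormal q.2, (0 : ℝ))) :=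
    continuous_fst.prodMk (((continuous_regularNormal hφ).comp continuous_snd).prodMk
      continuous_const)
  filter_upwards [hcont.continuousAt.eventually (hopen.mem_nhds hmem)] with q hq
  exact exists_rescaledSectionalPoincare hφ hKφ H hq
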